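/- **Setting.** Let $p:Z\to Y$ be a principal circle bundle with connection form $\alpha$ (equal to $1$ on the generator $R$ of the $2\pi$-periodic action) such that $d\alpha=p^*\omega$ for a symplectic form $\omega$ on $Y$; let $J_Y$ be an almost complex structure on $Y$ tamed by $\omega$, and let $J$ be the cylindrical almost complex structure on $\mathbb R\times Z$: $J\partial_s=R$, $J$ preserves $\ker\alpha$, and $\mathbb R\times Z\to Y$ is almost complex. The scalar $e^{r}c$ ($r\in\mathbb R$, $|c|=1$) acts on $\mathbb R\times Z$ by $(s,z)\mapsto(s+r,c\,z)$. Let $\Lambda\subset Z$ be a compact Legendrian whose projection $\Pi=p(\Lambda)$ is the image of an immersion $\phi:P\to Y$ such that $p|_\Lambda=\phi\circ q$ with $q:\Lambda\to P$ smooth and onto (hence a finite covering). A Reeb chord of angle $\theta>0$ from $a\in\Lambda$ to $b\in\Lambda$ is the path $t\mapsto e^{it\theta}a$, $0\le t\le 1$, with $e^{i\theta}a=b$. Suppose that, for some integer $k>0$, all Reeb chords of $\Lambda$ have angles that are multiples of $2\pi/k$. Let $\bar S$ be the closed unit disk, $(z_e)_{e\in\mathcal E}$ a finite collection of distinct boundary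 points, each marked incoming or outgoing, and $S=\bar S\setminus\{z_e\}$. A *lift* of $u_Y:\bar S\to Y$ is a map $u:S\to\mathbb R\times Z$ with $p\circ u=u_Y$ on $S$, continuous on $S$, smooth and $J$-holomorphic in the interior, mapping $\partial S$ to $\mathbb R\times\Lambda$, and asymptotic at each $z_e$ to a Reeb chord of $\Lambda$ of some angle $\theta_e(u)>0$ (the $\mathbb R$-coordinate tends to $+\infty$ if $e$ is incoming and to $-\infty$ if $e$ is outgoing). Two lifts are equivalent if they differ by a constant scalar $e^rc$ with $c\Lambda=\Lambda$. A collection $(\theta_e)$ of positive numbers satisfies the *angle-change formula* if $$\sum_{e\ \mathrm{incoming}}\theta_e-\sum_{e\ \mathrm{outgoing}}\theta_e=\int_{\bar S}u_Y^*\omega .$$ **Theorem.** 1. (Embedded case.) Suppose that $\phi$ is injective, so that $\Pi$ is embedded, and that each fiber of $Z$ over a point of $\Pi$ meets $\Lambda$ in exactly $k$ points. Let $u_Y:\bar S\to Y$ be a $J_Y$-holomorphic disk, smooth up to the boundary, with $u_Y(\partial\bar S)\subset\Pi$. Then $u\mapsto(\theta_e(u))_{e\in\mathcal E}$ is a bijection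 from the equivalence classes of lifts of $u_Y$ to the collections $(\theta_e)_{e\in\mathcal E}$ of positive integer multiples of $2\pi/k$ that satisfy the angle-change formula. 2. (Immersed case.) Suppose that any rotation taking a point of $\Lambda$ to a point of $\Lambda$ over the same point of $P$ takes every point of $\Lambda$ to a point of $\Lambda$ over the same point of $P$ (this is automatic if $\Lambda$ is connected). Let $u_Y:\bar S\to Y$ be continuous, smooth on $S$, $J_Y$-holomorphic in the interior and exponentially convergent at the punctures (in charts, $|du_Y|\le C|z-z_e|^{\delta-1}$ near $z_e$ for some $\delta>0$), together with a continuous $\beta:\partial S\to P$ with $\phi\circ\beta=u_Y$ on $\partial S$. Then $u\mapsto(\theta_e(u))_{e\in\mathcal E}$ is a bijection from the equivalence classes of lifts $u$ of $u_Y$ whose boundary values at $z\in\partial S$ lie in $\mathbb R\times q^{-1}(\beta(z))$, to the collections $(\theta_e)_{e\in\mathcal E}$ that satisfy the angle-change formula and for which, at each $e$, $\theta_e$ is the angle of a Reeb chord joining points of $\Lambda$ over the two one-sided limits of $\beta$ at $z_e$ (from the limit just before $z_e$ to the limit just after $z_e$ in counterclockwise order if $e$ is incoming, in the opposite direction if $e$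 is outgoing). -/

import Mathlib

open Set Filter Topology Manifold Bundle MeasureTheory
open scoped ContDiff Pointwise

noncomputable section

namespace CircleLift

/-! ### Forms, circle-fibered contact manifolds, cylindrical almost complex structures -/

section Contact

variable {EY Y EZ Z : Type*}
  [NormedAddCommGroup EY] [NormedSpace ℝ EY] [FiniteDimensional ℝ EY]
  [TopologicalSpace Y] [ChartedSpace EY Y]
  [NormedAddCommGroup EZ] [NormedSpace ℝ EZ] [FiniteDimensional ℝ EZ]
  [TopologicalSpace Z] [ChartedSpace EZ Z]

/-- The expression of a one-form `α` on the manifold `Z` in the preferred chart at `z`, as a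
one-form on the model vector space. -/
def chartForm (α : ∀ z : Z, TangentSpace 𝓘(ℝ, EZ) z →L[ℝ] ℝ) (z : Z) (x : EZ) : EZ →L[ℝ] ℝ :=
  (α ((extChartAt 𝓘(ℝ, EZ) z).symm x)).comp
    (mfderiv 𝓘(ℝ, EZ) 𝓘(ℝ, EZ) (extChartAt 𝓘(ℝ, EZ) z).symm x)

/-- The exterior derivative `dα` of a one-form at the point `z`, computed in the chart at `z` by
`dα(v, w) = (D_v α)(w) - (D_w α)(v)`. -/
def extDerivOne (α : ∀ z : Z, TangentSpace 𝓘(ℝ, EZ) z →L[ℝ] ℝ) (z : Z)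
    (v w : TangentSpace 𝓘(ℝ, EZ) z) : ℝ :=
  let χ := mfderiv 𝓘(ℝ, EZ) 𝓘(ℝ, EZ) (extChartAt 𝓘(ℝ, EZ) z) z
  let D := fderiv ℝ (chartForm α z) (extChartAt 𝓘(ℝ, EZ) z z)
  D (χ v) (χ w) - D (χ w) (χ v)

/-- The generating vector field of a circle action, `R(z) = d/dt|₀ (e^{it} • z)`. -/
def generator [MulAction Circle Z] (z : Z) : TangentSpace 𝓘(ℝ, EZ) z :=
  (mfderiv 𝓘(ℝ, ℝ) 𝓘(ℝ, EZ) (fun t : ℝ => Circle.exp t • z) 0 (1 : ℝ) : EZ)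

variable (EY Y EZ Z) in
/-- A circle-fibered contact manifold: a principal circle bundle `p : Z → Y` with a connection form
`α` (normalized to be `1` on the `2π`-periodic generator) such that `dα = p^* ω` for a symplectic
form `ω` on the base (so `ω` is minus the curvature, closed and alternating because `dα` is and `p`
is a submersion, and `α` is a contact form whose Reeb field is the generator), together with an
almost complex structure `JY` on the base tamed by `ω`. -/
structure CircleFibered [IsManifold 𝓘(ℝ, EY) ∞ Y] [IsManifold 𝓘(ℝ, EZ) ∞ Z]
    [MulAction Circle Z] where
  p : Z → Y
  alpha : ∀ z : Z, TangentSpace 𝓘(ℝ, EZ) z →L[ℝ] ℝ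
  omega : ∀ y : Y, TangentSpace 𝓘(ℝ, EY) y →L[ℝ] TangentSpace 𝓘(ℝ, EY) y →L[ℝ] ℝ
  JY : ∀ y : Y, TangentSpace 𝓘(ℝ, EY) y →L[ℝ] TangentSpace 𝓘(ℝ, EY) y
  action_smooth : ContMDiff (𝓘(ℝ, ℝ).prod 𝓘(ℝ, EZ)) 𝓘(ℝ, EZ) ∞
    (fun x : ℝ × Z => Circle.exp x.1 • x.2)
  action_free : ∀ (c : Circle) (z : Z), c • z = z → c = 1
  p_smooth : ContMDiff 𝓘(ℝ, EZ) 𝓘(ℝ, EY) ∞ p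
  p_surjective : Function.Surjective p
  p_submersion : ∀ z : Z, Function.Surjective (mfderiv 𝓘(ℝ, EZ) 𝓘(ℝ, EY) p z)
  p_fiber : ∀ z z' : Z, p z = p z' ↔ ∃ c : Circle, c • z = z'
  alpha_smooth : ContMDiff 𝓘(ℝ, EZ) (𝓘(ℝ, EZ).prod 𝓘(ℝ, EZ →L[ℝ] ℝ)) ∞
    (fun z => TotalSpace.mk' (EZ →L[ℝ] ℝ)
      (E := fun z : Z => TangentSpace 𝓘(ℝ, EZ) z →L[ℝ] ℝ) z (alpha z))
  alpha_generator : ∀ z : Z, alpha z (generator z) = 1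
  alpha_invariant : ∀ (c : Circle) (z : Z) (v : TangentSpace 𝓘(ℝ, EZ) z),
    alpha (c • z) (mfderiv 𝓘(ℝ, EZ) 𝓘(ℝ, EZ) (fun w : Z => c • w) z v) = alpha z v
  omega_smooth : ContMDiff 𝓘(ℝ, EY) (𝓘(ℝ, EY).prod 𝓘(ℝ, EY →L[ℝ] EY →L[ℝ] ℝ)) ∞
    (fun y => TotalSpace.mk' (EY →L[ℝ] EY →L[ℝ] ℝ)
      (E := fun y : Y => TangentSpace 𝓘(ℝ, EY) y →L[ℝ] TangentSpace 𝓘(ℝ, EY) y →L[ℝ] ℝ)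
      y (omega y))
  omega_nondegenerate : ∀ (y : Y) (v : TangentSpace 𝓘(ℝ, EY) y),
    (∀ w : TangentSpace 𝓘(ℝ, EY) y, omega y v w = 0) → v = 0
  curvature : ∀ (z : Z) (v w : TangentSpace 𝓘(ℝ, EZ) z),
    extDerivOne alpha z v w = omega (p z) (mfderiv 𝓘(ℝ, EZ) 𝓘(ℝ, EY) p z v)
      (mfderiv 𝓘(ℝ, EZ) 𝓘(ℝ, EY) p z w)
  JY_smooth : ContMDiff 𝓘(ℝ, EY) (𝓘(ℝ, EY).prod 𝓘(ℝ, EY →L[ℝ] EY)) ∞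
    (fun y => TotalSpace.mk' (EY →L[ℝ] EY)
      (E := fun y : Y => TangentSpace 𝓘(ℝ, EY) y →L[ℝ] TangentSpace 𝓘(ℝ, EY) y) y (JY y))
  JY_sq : ∀ (y : Y) (v : TangentSpace 𝓘(ℝ, EY) y), JY y (JY y v) = -v
  JY_tamed : ∀ (y : Y) (v : TangentSpace 𝓘(ℝ, EY) y), v ≠ 0 → 0 < omega y v (JY y v)

variable [IsManifold 𝓘(ℝ, EY) ∞ Y] [IsManifold 𝓘(ℝ, EZ) ∞ Z] [MulAction Circle Z]

/-- `J` is the cylindrical almost complex structure on `ℝ × Z` over `JY`: it sends `∂_s` to the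
Reeb field, preserves the contact planes `ker α`, and makes the projection to `Y` almost complex.
These conditions determine `J` uniquely. -/
structure CircleFibered.IsCylindrical (F : CircleFibered EY Y EZ Z)
    (J : ∀ x : ℝ × Z, TangentSpace (𝓘(ℝ, ℝ).prod 𝓘(ℝ, EZ)) x →L[ℝ]
      TangentSpace (𝓘(ℝ, ℝ).prod 𝓘(ℝ, EZ)) x) : Prop where
  sq : ∀ (x : ℝ × Z) (v : ℝ × EZ), J x (J x v) = -v
  map_ds : ∀ x : ℝ × Z, J x ((1, 0) : ℝ × EZ) = ((0, generator x.2) : ℝ × EZ)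
  map_plane : ∀ (x : ℝ × Z) (v : EZ), F.alpha x.2 v = 0 →
    (J x ((0, v) : ℝ × EZ) : ℝ × EZ).1 = 0 ∧
      F.alpha x.2 (J x ((0, v) : ℝ × EZ) : ℝ × EZ).2 = 0
  proj : ∀ (x : ℝ × Z) (v : ℝ × EZ),
    mfderiv 𝓘(ℝ, EZ) 𝓘(ℝ, EY) F.p x.2 (J x v : ℝ × EZ).2 =
      F.JY (F.p x.2) (mfderiv 𝓘(ℝ, EZ) 𝓘(ℝ, EY) F.p x.2 v.2)

end Contact

/-! ### Legendrians with immersed projection, Reeb chords -/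

section Legendrian

variable {EY Y EZ Z : Type*}
  [NormedAddCommGroup EY] [NormedSpace ℝ EY] [FiniteDimensional ℝ EY]
  [TopologicalSpace Y] [ChartedSpace EY Y] [IsManifold 𝓘(ℝ, EY) ∞ Y]
  [NormedAddCommGroup EZ] [NormedSpace ℝ EZ] [FiniteDimensional ℝ EZ]
  [TopologicalSpace Z] [ChartedSpace EZ Z] [IsManifold 𝓘(ℝ, EZ) ∞ Z] [MulAction Circle Z]
  (EL L P : Type*)
  [NormedAddCommGroup EL] [NormedSpace ℝ EL] [FiniteDimensional ℝ EL]
  [TopologicalSpace L] [ChartedSpace EL L]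
  [TopologicalSpace P] [ChartedSpace EL P]

/-- A compact Legendrian `Λ = j(L)` in `Z` together with its immersed projection: the map `p ∘ j`
is a covering `q : L → P` followed by an immersion `φ : P → Y`. The projection `Π = p(Λ) = φ(P)` is
embedded when `φ` is injective. -/
structure LegendrianOver (F : CircleFibered EY Y EZ Z) where
  j : L → Z
  q : L → P
  φ : P → Y
  j_embedding : IsSmoothEmbedding 𝓘(ℝ, EL) 𝓘(ℝ, EZ) ∞ j
  dim_eq : 2 * Module.finrank ℝ EL + 1 = Module.finrank ℝ EZ
  legendrian : ∀ (a : L) (v : TangentSpace 𝓘(ℝ, EL) a),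
    F.alpha (j a) (mfderiv 𝓘(ℝ, EL) 𝓘(ℝ, EZ) j a v) = 0
  q_smooth : ContMDiff 𝓘(ℝ, EL) 𝓘(ℝ, EL) ∞ q
  q_surjective : Function.Surjective q
  φ_immersion : IsImmersion 𝓘(ℝ, EL) 𝓘(ℝ, EY) ∞ φ
  proj_eq : ∀ a : L, φ (q a) = F.p (j a)

variable {EL L P}
variable {F : CircleFibered EY Y EZ Z} (Λ : LegendrianOver EL L P F)

/-- There is a Reeb chord of angle `θ > 0` from `j a` to `j b`, namely `t ↦ e^{itθ} • j a`,
`0 ≤ t ≤ 1`. -/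
def LegendrianOver.IsReebChord (a b : L) (θ : ℝ) : Prop :=
  0 < θ ∧ Circle.exp θ • Λ.j a = Λ.j b

/-- Rotations that take one point of `Λ` to a point of `Λ` over the same point of `P` take every
point of `Λ` to a point of `Λ` over the same point of `P`. -/
def LegendrianOver.IsHomogeneous : Prop :=
  ∀ (c : Circle) (a a' : L), Λ.q a = Λ.q a' → c • Λ.j a = Λ.j a' →
    ∀ b : L, ∃ b' : L, Λ.q b = Λ.q b' ∧ c • Λ.j b = Λ.j b'

end Legendrian

/-! ### Punctured disks -/

/-- Distinct punctures on the boundary of the unit disk, each declared incoming (the end of the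
disk goes to `+∞` in `ℝ × Z`) or outgoing (it goes to `-∞`). -/
structure Punctures (E : Type*) where
  pt : E → ℂ
  mem_sphere : ∀ e : E, pt e ∈ Metric.sphere (0 : ℂ) 1
  injective : Function.Injective pt
  inc : E → Bool

section Disks

variable {E : Type*}

/-- The punctured closed disk `S`. -/
def Punctures.surface (D : Punctures E) : Set ℂ := Metric.closedBall 0 1 \ range D.pt

/-- The boundary of the punctured disk `S`. -/
def Punctures.bdry (D : Punctures E) : Set ℂ := Metric.sphere 0 1 \ range D.pt

/-- `1` at an incoming puncture and `-1` at an outgoing one. -/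
def Punctures.sign (D : Punctures E) (e : E) : ℝ := if D.inc e then 1 else -1

/-- The strip-like end at the puncture `e`: the holomorphic map of `τ + i t`, for `0 ≤ t ≤ 1`, which
tends to the puncture as `τ → ∞`. The side `t = 0` lies on the boundary arc just before the puncture
in the counterclockwise order, and `t = 1` on the arc just after it. -/
def Punctures.stripEnd (D : Punctures E) (e : E) (x : ℝ × ℝ) : ℂ :=
  let w : ℂ := Complex.exp (Real.pi * (x.1 + Complex.I * x.2))
  D.pt e * ((w - Complex.I) / (w + Complex.I))

variable {EY Y EZ Z : Type*}
  [NormedAddCommGroup EY] [NormedSpace ℝ EY] [FiniteDimensional ℝ EY]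
  [TopologicalSpace Y] [ChartedSpace EY Y] [IsManifold 𝓘(ℝ, EY) ∞ Y]
  [NormedAddCommGroup EZ] [NormedSpace ℝ EZ] [FiniteDimensional ℝ EZ]
  [TopologicalSpace Z] [ChartedSpace EZ Z] [IsManifold 𝓘(ℝ, EZ) ∞ Z] [MulAction Circle Z]
  {EL L P : Type*}
  [NormedAddCommGroup EL] [NormedSpace ℝ EL] [FiniteDimensional ℝ EL]
  [TopologicalSpace L] [ChartedSpace EL L]
  [TopologicalSpace P] [ChartedSpace EL P]
  {F : CircleFibered EY Y EZ Z}

/-- The map `uY` is `JY`-holomorphic on the open unit disk. -/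
def CircleFibered.IsBaseHolomorphic (F : CircleFibered EY Y EZ Z) (uY : ℂ → Y) : Prop :=
  ∀ z ∈ Metric.ball (0 : ℂ) 1, ∀ v : ℂ,
    mfderiv 𝓘(ℝ, ℂ) 𝓘(ℝ, EY) uY z (Complex.I * v : ℂ) =
      F.JY (uY z) (mfderiv 𝓘(ℝ, ℂ) 𝓘(ℝ, EY) uY z v)

/-- The symplectic area `∫ uY^* ω` over the unit disk. -/
def CircleFibered.area (F : CircleFibered EY Y EZ Z) (uY : ℂ → Y) : ℝ :=
  ∫ z in Metric.ball (0 : ℂ) 1,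
    F.omega (uY z) (mfderiv 𝓘(ℝ, ℂ) 𝓘(ℝ, EY) uY z (1 : ℂ))
      (mfderiv 𝓘(ℝ, ℂ) 𝓘(ℝ, EY) uY z Complex.I)

/-- A holomorphic disk in `Y` bounding `Π = φ(P)`, smooth up to the boundary. -/
structure LegendrianOver.IsDisk (Λ : LegendrianOver EL L P F) (uY : ℂ → Y) : Prop where
  smooth : ContMDiffOn 𝓘(ℝ, ℂ) 𝓘(ℝ, EY) ∞ uY (Metric.closedBall 0 1)
  holomorphic : F.IsBaseHolomorphic uY
  boundary : ∀ z ∈ Metric.sphere (0 : ℂ) 1, uY z ∈ range Λ.φ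

/-- A holomorphic disk in `Y` bounding the immersed Lagrangian `φ : P → Y`, possibly with corners
at the punctures: it is continuous on the closed disk, smooth away from the punctures, its boundary
is lifted continuously to `P` by `β` away from the punctures, and it converges exponentially at the
punctures (in the strip coordinate `τ`, where `|z - z_e|` decays like `e^{-πτ}`). -/
structure LegendrianOver.IsCornerDisk (Λ : LegendrianOver EL L P F) (D : Punctures E)
    (uY : ℂ → Y) (β : ℂ → P) : Prop where
  continuous : ContinuousOn uY (Metric.closedBall 0 1)
  smooth : ContMDiffOn 𝓘(ℝ, ℂ) 𝓘(ℝ, EY) ∞ uY D.surface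
  holomorphic : F.IsBaseHolomorphic uY
  boundary_continuous : ContinuousOn β D.bdry
  boundary : ∀ z ∈ D.bdry, Λ.φ (β z) = uY z
  decay : ∀ e : E, ∃ C δ r : ℝ, 0 < δ ∧ 0 < r ∧ ∀ z ∈ Metric.ball (0 : ℂ) 1,
    ‖z - D.pt e‖ < r →
      ‖fderiv ℝ (fun w : ℂ => extChartAt 𝓘(ℝ, EY) (uY (D.pt e)) (uY w)) z‖
        ≤ C * ‖z - D.pt e‖ ^ (δ - 1)

/-- The map `u` to `ℝ × Z` is asymptotic at the puncture `e` to a Reeb chord of `Λ` of angle `θ`: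
the `ℝ`-coordinate tends to `+∞` (incoming) or `-∞` (outgoing), and the `Z`-coordinate tends
uniformly to the chord, which is run through in the direction of increasing `t` at an incoming
puncture and of decreasing `t` at an outgoing one. -/
def LegendrianOver.HasAngle (Λ : LegendrianOver EL L P F) (D : Punctures E) (u : ℂ → ℝ × Z)
    (e : E) (θ : ℝ) : Prop :=
  Tendsto (fun x : ℝ × ℝ => D.sign e * (u (D.stripEnd e x)).1)
      (atTop ×ˢ 𝓟 (Icc (0 : ℝ) 1)) atTop ∧
    ∃ a b : L, Λ.IsReebChord a b θ ∧ ∀ t ∈ Icc (0 : ℝ) 1,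
      Tendsto (fun x : ℝ × ℝ => (u (D.stripEnd e x)).2) (atTop ×ˢ 𝓝[Icc (0 : ℝ) 1] t)
        (𝓝 (Circle.exp (θ * (if D.inc e then t else 1 - t)) • Λ.j a))

/-- A lift of `uY` to a punctured `J`-holomorphic disk `u : S → ℝ × Z`, whose value at a boundary
point `z` lies in `ℝ × B z`, and which is asymptotic to Reeb chords at the punctures. -/
structure LegendrianOver.IsLift (Λ : LegendrianOver EL L P F) (D : Punctures E)
    (J : ∀ x : ℝ × Z, TangentSpace (𝓘(ℝ, ℝ).prod 𝓘(ℝ, EZ)) x →L[ℝ]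
      TangentSpace (𝓘(ℝ, ℝ).prod 𝓘(ℝ, EZ)) x)
    (uY : ℂ → Y) (B : ℂ → Set Z) (u : ℂ → ℝ × Z) : Prop where
  continuous : ContinuousOn u D.surface
  smooth : ContMDiffOn 𝓘(ℝ, ℂ) (𝓘(ℝ, ℝ).prod 𝓘(ℝ, EZ)) ∞ u (Metric.ball 0 1)
  holomorphic : ∀ z ∈ Metric.ball (0 : ℂ) 1, ∀ v : ℂ,
    mfderiv 𝓘(ℝ, ℂ) (𝓘(ℝ, ℝ).prod 𝓘(ℝ, EZ)) u z (Complex.I * v : ℂ) =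
      J (u z) (mfderiv 𝓘(ℝ, ℂ) (𝓘(ℝ, ℝ).prod 𝓘(ℝ, EZ)) u z v)
  lifts : ∀ z ∈ D.surface, F.p (u z).2 = uY z
  boundary : ∀ z ∈ D.bdry, (u z).2 ∈ B z
  asymptotic : ∀ e : E, ∃ θ : ℝ, Λ.HasAngle D u e θ

/-- The type of lifts of `uY` with boundary condition `B`. -/
def LegendrianOver.Lifts (Λ : LegendrianOver EL L P F) (D : Punctures E)
    (J : ∀ x : ℝ × Z, TangentSpace (𝓘(ℝ, ℝ).prod 𝓘(ℝ, EZ)) x →L[ℝ]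
      TangentSpace (𝓘(ℝ, ℝ).prod 𝓘(ℝ, EZ)) x)
    (uY : ℂ → Y) (B : ℂ → Set Z) : Type _ :=
  {u : ℂ → ℝ × Z // Λ.IsLift D J uY B u}

/-- Two lifts are equivalent if on `S` they differ by a constant scalar `e^r c`, with `r` real and
`c` a unit complex number such that `c • Λ = Λ`; the scalar acts by `(s, z) ↦ (s + r, c • z)`. -/
def LegendrianOver.liftSetoid (Λ : LegendrianOver EL L P F) (D : Punctures E)
    (J : ∀ x : ℝ × Z, TangentSpace (𝓘(ℝ, ℝ).prod 𝓘(ℝ, EZ)) x →L[ℝ]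
      TangentSpace (𝓘(ℝ, ℝ).prod 𝓘(ℝ, EZ)) x)
    (uY : ℂ → Y) (B : ℂ → Set Z) : Setoid (Λ.Lifts D J uY B) where
  r u v := ∃ r : ℝ, ∃ c : Circle, c • range Λ.j = range Λ.j ∧
    ∀ z ∈ D.surface, v.1 z = ((u.1 z).1 + r, c • (u.1 z).2)
  iseqv :=
    { refl := fun u => ⟨0, 1, one_smul _ _, fun z _ => by simp⟩
      symm := by
        rintro u v ⟨r, c, hc, h⟩
        refine ⟨-r, c⁻¹, ?_, fun z hz => ?_⟩
        · rw [inv_smul_eq_iff, hc]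
        · rw [h z hz]; simp
      trans := by
        rintro u v w ⟨r, c, hc, h⟩ ⟨r', c', hc', h'⟩
        refine ⟨r + r', c' * c, ?_, fun z hz => ?_⟩
        · rw [mul_smul, hc, hc']
        · rw [h' z hz, h z hz]; simp [mul_smul, add_assoc] }

/-- The angle-change formula: the sum of the angles at the incoming punctures minus the sum of the
angles at the outgoing punctures is the area of the disk in the base. -/
def CircleFibered.AngleChange [Fintype E] (F : CircleFibered EY Y EZ Z) (D : Punctures E)
    (uY : ℂ → Y) (θ : E → ℝ) : Prop :=
  ∑ e : E, D.sign e * θ e = F.area uY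

/-- Angles `θ e` of Reeb chords of `Λ` which join the branches of the boundary lift `β` on the two
sides of the puncture `e`: at an incoming puncture the chord starts over the branch just before the
puncture and ends over the branch just after it, at an outgoing puncture the other way round. -/
def LegendrianOver.JoinsBranches (Λ : LegendrianOver EL L P F) (D : Punctures E)
    (β : ℂ → P) (θ : E → ℝ) : Prop :=
  ∀ e : E, ∃ a b : L, Λ.IsReebChord a b (θ e) ∧
    Tendsto (fun τ : ℝ => β (D.stripEnd e (τ, if D.inc e then 0 else 1))) atTop (𝓝 (Λ.q a)) ∧
    Tendsto (fun τ : ℝ => β (D.stripEnd e (τ, if D.inc e then 1 else 0))) atTop (𝓝 (Λ.q b))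

/-- The angle map is well defined on equivalence classes of lifts of `uY` with boundary condition
`B`, and it is a bijection onto the set `A` of collections of angles. -/
def LegendrianOver.AngleMapBijective (Λ : LegendrianOver EL L P F) (D : Punctures E)
    (J : ∀ x : ℝ × Z, TangentSpace (𝓘(ℝ, ℝ).prod 𝓘(ℝ, EZ)) x →L[ℝ]
      TangentSpace (𝓘(ℝ, ℝ).prod 𝓘(ℝ, EZ)) x)
    (uY : ℂ → Y) (B : ℂ → Set Z) (A : Set (E → ℝ)) : Prop :=
  ∃ angle : Quotient (Λ.liftSetoid D J uY B) → (E → ℝ),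
    (∀ (u : Λ.Lifts D J uY B) (e : E) (θ : ℝ),
      Λ.HasAngle D u.1 e θ ↔ angle (Quotient.mk _ u) e = θ) ∧
    BijOn angle univ A

end Disks

end CircleLift

end

noncomputable section

namespace CircleLift

set_option linter.unusedSectionVars false

section

/-! ### The circle action -/

section Action

variable {EY Y EZ Z : Type*}
  [NormedAddCommGroup EY] [NormedSpace ℝ EY] [FiniteDimensional ℝ EY]
  [TopologicalSpace Y] [ChartedSpace EY Y] [IsManifold 𝓘(ℝ, EY) ∞ Y]
  [NormedAddCommGroup EZ] [NormedSpace ℝ EZ] [FiniteDimensional ℝ EZ]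
  [TopologicalSpace Z] [ChartedSpace EZ Z] [IsManifold 𝓘(ℝ, EZ) ∞ Z] [MulAction Circle Z]
  (F : CircleFibered EY Y EZ Z)

namespace CircleFibered

include F

lemma contMDiff_smul (c : Circle) :
    ContMDiff 𝓘(ℝ, EZ) 𝓘(ℝ, EZ) ∞ (fun z : Z => c • z) := by
  obtain ⟨t, rfl⟩ := Circle.exp_surjective c
  exact F.action_smooth.comp (contMDiff_const.prodMk contMDiff_id)

lemma continuous_exp_smul : Continuous (fun x : ℝ × Z => Circle.exp x.1 • x.2) :=
  F.action_smooth.continuous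

lemma continuous_const_smul (c : Circle) : Continuous (fun z : Z => c • z) :=
  (F.contMDiff_smul c).continuous

lemma p_smul (c : Circle) (z : Z) : F.p (c • z) = F.p z :=
  ((F.p_fiber z (c • z)).2 ⟨c, rfl⟩).symm

lemma smul_left_injective {c d : Circle} {z : Z} (h : c • z = d • z) : c = d := by
  have := F.action_free (d⁻¹ * c) z (by rw [mul_smul, h, inv_smul_smul])
  exact (inv_mul_eq_one.1 this).symm

lemma exists_exp_smul_of_p_eq {z w : Z} (h : F.p z = F.p w) :
    ∃ t ∈ Icc (-Real.pi) Real.pi, Circle.exp t • z = w := by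
  obtain ⟨c, hc⟩ := (F.p_fiber z w).1 h
  refine ⟨Complex.arg c, ⟨(Complex.neg_pi_lt_arg _).le, Complex.arg_le_pi _⟩, ?_⟩
  rw [Circle.exp_arg, hc]

lemma contMDiff_exp_smul (z : Z) :
    ContMDiff 𝓘(ℝ, ℝ) 𝓘(ℝ, EZ) ∞ (fun t : ℝ => Circle.exp t • z) :=
  F.action_smooth.comp (contMDiff_id.prodMk contMDiff_const)

lemma eventually_abs_lt_of_exp_smul_eq [T2Space Z] (z₀ : Z) {ε : ℝ} (hε : 0 < ε) :
    ∀ᶠ x : Z × Z in 𝓝 (z₀, z₀), ∀ t ∈ Icc (-Real.pi) Real.pi,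
      Circle.exp t • x.1 = x.2 → |t| < ε := by
  have hK : IsCompact (Icc (-Real.pi) Real.pi ∩ {t | ε ≤ |t|}) :=
    isCompact_Icc.inter_right (isClosed_le continuous_const continuous_abs)
  have := hK.eventually_forall_of_forall_eventually (x₀ := (z₀, z₀))
    (P := fun (x : Z × Z) t => Circle.exp t • x.1 ≠ x.2) (by
      rintro t ⟨⟨h1, h2⟩, ht⟩
      have hne : Circle.exp t • z₀ ≠ z₀ := by
        intro h
        have h' := F.action_free _ _ h
        rw [Circle.exp_eq_one] at h'
        obtain ⟨n, hn⟩ := h'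
        have hpi := Real.pi_pos
        have : n = 0 := by
          have a1 : (n : ℝ) < 1 := by nlinarith
          have a2 : (-1 : ℝ) < n := by nlinarith
          have a1' : n < 1 := by exact_mod_cast a1
          have a2' : -1 < n := by exact_mod_cast a2
          omega
        subst this
        simp only [Int.cast_zero, zero_mul] at hn
        subst hn
        simp only [mem_ofPred_eq, abs_zero] at ht
        linarith
      have hc1 : Continuous (fun y : (Z × Z) × ℝ => Circle.exp y.2 • y.1.1) :=
        F.continuous_exp_smul.comp (continuous_snd.prodMk (continuous_fst.comp continuous_fst))
      have hc2 : Continuous (fun y : (Z × Z) × ℝ => y.1.2) := continuous_snd.comp continuous_fst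
      exact (isClosed_eq hc1 hc2).isOpen_compl.mem_nhds hne)
  filter_upwards [this] with x hx t ht htx
  by_contra hlt
  exact hx t ⟨ht, not_lt.1 hlt⟩ htx

end CircleFibered

end Action

end

section

/-! ### Local trivializations of the circle bundle -/

section InverseFunction

lemma ker_eq_bot_of_injOn_nhds {E G : Type*} [NormedAddCommGroup E] [NormedSpace ℝ E]
    [CompleteSpace E] [NormedAddCommGroup G] [NormedSpace ℝ G] [FiniteDimensional ℝ G]
    {f : E → G} {f' : E →L[ℝ] G} {a : E} (hf : HasStrictFDerivAt f f' a)
    (hsurj : (f' : E →ₗ[ℝ] G).range = ⊤) {U : Set E} (hU : U ∈ 𝓝 a) (hinj : InjOn f U) :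
    (f' : E →ₗ[ℝ] G).ker = ⊥ := by
  have : CompleteSpace G := FiniteDimensional.complete ℝ G
  rw [Submodule.eq_bot_iff]
  intro k hk
  set e := hf.implicitToOpenPartialHomeomorph f f' hsurj with he
  have hea : e a = (f a, 0) := hf.implicitToOpenPartialHomeomorph_self hsurj
  have has : a ∈ e.source := hf.mem_implicitToOpenPartialHomeomorph_source hsurj
  have hcurve : Tendsto (fun s : ℝ => ((f a, s • (⟨k, hk⟩ : (f' : E →ₗ[ℝ] G).ker)) :
      G × (f' : E →ₗ[ℝ] G).ker)) (𝓝 0) (𝓝 (e a)) := by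
    rw [hea]
    have : Continuous (fun s : ℝ => ((f a, s • (⟨k, hk⟩ : (f' : E →ₗ[ℝ] G).ker)) :
      G × (f' : E →ₗ[ℝ] G).ker)) := by fun_prop
    convert this.tendsto 0 using 2
    simp
  have htgt : e.target ∈ 𝓝 (e a) := e.open_target.mem_nhds (e.map_source has)
  have hsymm : Tendsto e.symm (𝓝 (e a)) (𝓝 a) := by
    have := e.continuousAt_symm (e.map_source has)
    rwa [ContinuousAt, e.left_inv has] at this
  have hev : ∀ᶠ s : ℝ in 𝓝 0, s • k = 0 := by
    filter_upwards [hcurve htgt, (hsymm.comp hcurve) hU] with s hs1 hs2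
    have h1 : f (e.symm (f a, s • (⟨k, hk⟩ : (f' : E →ₗ[ℝ] G).ker))) = f a := by
      rw [← hf.implicitToOpenPartialHomeomorph_fst hsurj, ← he, e.right_inv hs1]
    have h2 := hinj hs2 (mem_of_mem_nhds hU) h1
    have h3 := e.right_inv hs1
    simp only [Function.comp_apply] at h2
    rw [h2, hea, Prod.mk.injEq] at h3
    have := congrArg (Subtype.val) h3.2
    simpa using this.symm
  obtain ⟨s, hs, hs0⟩ := ((hev.filter_mono nhdsWithin_le_nhds).and
    (self_mem_nhdsWithin : {0}ᶜ ∈ 𝓝[≠] (0 : ℝ))).exists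
  exact (smul_eq_zero.1 hs).resolve_left hs0

/-- The isomorphism `(t, n) ↦ t R + n` for a functional `a` with `a R = 1` and `n ∈ ker a`. -/
def kerSplitting {E : Type*} [NormedAddCommGroup E] [NormedSpace ℝ E] (a : E →L[ℝ] ℝ) (R : E)
    (hR : a R = 1) : (ℝ × (a : E →ₗ[ℝ] ℝ).ker) ≃L[ℝ] E :=
  ContinuousLinearEquiv.equivOfInverse
    ((ContinuousLinearMap.toSpanSingleton ℝ R).coprod (a : E →ₗ[ℝ] ℝ).ker.subtypeL)
    (a.prod ((ContinuousLinearMap.id ℝ E - (ContinuousLinearMap.toSpanSingleton ℝ R).comp a).codRestrict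
      (a : E →ₗ[ℝ] ℝ).ker (fun v => by simp [hR])))
    (by
      rintro ⟨t, n, hn⟩
      have hn' : a n = 0 := hn
      refine Prod.ext (by simp [hR, hn']) (Subtype.ext ?_)
      simp [hR, hn'])
    (by intro v; simp)

lemma kerSplitting_apply {E : Type*} [NormedAddCommGroup E] [NormedSpace ℝ E] (a : E →L[ℝ] ℝ)
    (R : E) (hR : a R = 1) (t : ℝ) (n : (a : E →ₗ[ℝ] ℝ).ker) :
    kerSplitting a R hR (t, n) = t • R + n := by
  simp [kerSplitting]

end InverseFunction

section ChartDerivative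

variable {E' E M : Type*} [NormedAddCommGroup E'] [NormedSpace ℝ E'] [NormedAddCommGroup E]
  [NormedSpace ℝ E] [TopologicalSpace M] [ChartedSpace E M]

lemma hasMFDerivWithinAt_iff_extChartAt_comp {f : E' → M} {s : Set E'} {x : E'} {D : E' →L[ℝ] E} :
    HasMFDerivWithinAt 𝓘(ℝ, E') 𝓘(ℝ, E) f s x D ↔ ContinuousWithinAt f s x ∧
      HasFDerivWithinAt (fun y => extChartAt 𝓘(ℝ, E) (f x) (f y)) D s x := by
  refine and_congr Iff.rfl ?_
  change HasFDerivWithinAt (F := E) (fun y : E' => extChartAt 𝓘(ℝ, E) (f x) (f y)) D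
    (id ⁻¹' s ∩ range id) x ↔ _
  simp

lemma hasFDerivWithinAt_extChartAt_comp {f : E' → M} {s : Set E'} {x : E'} {D : E' →L[ℝ] E} {z : M}
    (h : HasMFDerivWithinAt 𝓘(ℝ, E') 𝓘(ℝ, E) f s x D) (hz : f x = z) :
    HasFDerivWithinAt (fun y => extChartAt 𝓘(ℝ, E) z (f y)) D s x := by
  subst hz
  exact (hasMFDerivWithinAt_iff_extChartAt_comp.1 h).2

lemma hasFDerivAt_extChartAt_comp {f : E' → M} {x : E'} {D : E' →L[ℝ] E} {z : M}
    (h : HasMFDerivAt 𝓘(ℝ, E') 𝓘(ℝ, E) f x D) (hz : f x = z) :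
    HasFDerivAt (fun y => extChartAt 𝓘(ℝ, E) z (f y)) D x := by
  rw [← hasFDerivWithinAt_univ]
  exact hasFDerivWithinAt_extChartAt_comp (hasMFDerivWithinAt_univ.2 h) hz

lemma hasMFDerivAt_of_extChartAt_comp {f : E' → M} {x : E'} {D : E' →L[ℝ] E}
    (hc : ContinuousAt f x)
    (h : HasFDerivAt (fun y => extChartAt 𝓘(ℝ, E) (f x) (f y)) D x) :
    HasMFDerivAt 𝓘(ℝ, E') 𝓘(ℝ, E) f x D :=
  hasMFDerivWithinAt_univ.1
    (hasMFDerivWithinAt_iff_extChartAt_comp.2 ⟨hc.continuousWithinAt, h.hasFDerivWithinAt⟩)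

end ChartDerivative

section Trivialization

variable {EY Y EZ Z : Type*}
  [NormedAddCommGroup EY] [NormedSpace ℝ EY] [FiniteDimensional ℝ EY]
  [TopologicalSpace Y] [ChartedSpace EY Y] [IsManifold 𝓘(ℝ, EY) ∞ Y]
  [NormedAddCommGroup EZ] [NormedSpace ℝ EZ] [FiniteDimensional ℝ EZ]
  [TopologicalSpace Z] [ChartedSpace EZ Z] [IsManifold 𝓘(ℝ, EZ) ∞ Z] [MulAction Circle Z]
  (F : CircleFibered EY Y EZ Z)

namespace CircleFibered

/-- The connection form as a functional on the model space. -/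
def a (z : Z) : EZ →L[ℝ] ℝ := F.alpha z

/-- The differential of the projection as a map of model spaces. -/
def dp (z : Z) : EZ →L[ℝ] EY := mfderiv 𝓘(ℝ, EZ) 𝓘(ℝ, EY) F.p z

/-- The generator of the circle action as a vector of the model space. -/
def gen (_F : CircleFibered EY Y EZ Z) (z : Z) : EZ := (generator z : TangentSpace 𝓘(ℝ, EZ) z)

lemma a_gen (z : Z) : F.a z (F.gen z) = 1 := F.alpha_generator z

lemma dp_surjective (z : Z) : Function.Surjective (F.dp z) := F.p_submersion z

lemma hasMFDerivAt_p (z : Z) : HasMFDerivAt 𝓘(ℝ, EZ) 𝓘(ℝ, EY) F.p z (F.dp z) :=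
  (F.p_smooth.mdifferentiable (by simp) z).hasMFDerivAt

lemma hasMFDerivAt_exp_smul (z : Z) :
    HasMFDerivAt 𝓘(ℝ, ℝ) 𝓘(ℝ, EZ) (fun t : ℝ => Circle.exp t • z) 0
      (ContinuousLinearMap.toSpanSingleton ℝ (F.gen z)) := by
  have h := ((F.contMDiff_exp_smul z).mdifferentiable (by simp) 0).hasMFDerivAt
  have key : ∀ D : ℝ →L[ℝ] EZ, D 1 = F.gen z →
      D = ContinuousLinearMap.toSpanSingleton ℝ (F.gen z) := fun D hD => by
    apply ContinuousLinearMap.ext_ring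
    simp [hD]
  exact (key (mfderiv 𝓘(ℝ, ℝ) 𝓘(ℝ, EZ) (fun t : ℝ => Circle.exp t • z) 0) rfl) ▸ h

lemma dp_gen (z : Z) : F.dp z (F.gen z) = 0 := by
  have h1 := F.hasMFDerivAt_p (Circle.exp 0 • z)
  have h2 := h1.comp (0 : ℝ) (F.hasMFDerivAt_exp_smul z)
  have h3 : (F.p ∘ fun t : ℝ => Circle.exp t • z) = fun _ => F.p z := by
    funext t; exact F.p_smul _ _
  rw [h3] at h2
  have h4 := hasMFDerivAt_unique h2 (hasMFDerivAt_const (F.p z) (0 : ℝ))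
  have h5 := DFunLike.congr_fun h4 (1 : ℝ)
  have h6 : F.dp (Circle.exp 0 • z) ((1 : ℝ) • F.gen z) = 0 := h5
  rwa [one_smul, Circle.exp_zero, one_smul] at h6

lemma range_dp_comp_subtypeL (z : Z) :
    ((F.dp z).comp (F.a z : EZ →ₗ[ℝ] ℝ).ker.subtypeL).toLinearMap.range = ⊤ := by
  rw [LinearMap.range_eq_top]
  intro y
  obtain ⟨v, hv⟩ := F.dp_surjective z y
  refine ⟨⟨v - F.a z v • F.gen z, by simp [F.a_gen]⟩, ?_⟩
  simp [F.dp_gen, hv]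

/-- Around every point there is a smooth local section of the bundle together with the
corresponding phase function, and vertical vectors are multiples of the generator. -/
theorem exists_trivialization_aux [T2Space Z] (z₀ : Z) :
    (∃ (Θ : Z → ℝ) (σ : Y → Z), ContMDiffAt 𝓘(ℝ, EZ) 𝓘(ℝ, ℝ) ∞ Θ z₀ ∧
      ContMDiffAt 𝓘(ℝ, EY) 𝓘(ℝ, EZ) ∞ σ (F.p z₀) ∧ Θ z₀ = 0 ∧ σ (F.p z₀) = z₀ ∧
      (∀ᶠ y in 𝓝 (F.p z₀), F.p (σ y) = y) ∧
      (∀ᶠ z in 𝓝 z₀, Circle.exp (Θ z) • σ (F.p z) = z)) ∧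
    ∀ v : EZ, F.dp z₀ v = 0 → F.a z₀ v = 0 → v = 0 := by
  classical
  set χ := extChartAt 𝓘(ℝ, EZ) z₀ with hχ
  set N := (F.a z₀ : EZ →ₗ[ℝ] ℝ).ker with hN
  have : CompleteSpace EY := FiniteDimensional.complete ℝ EY
  have : CompleteSpace EZ := FiniteDimensional.complete ℝ EZ
  have : CompleteSpace N := FiniteDimensional.complete ℝ N
  -- the slice
  set sl : N → Z := fun n => χ.symm (χ z₀ + n) with hsl
  have hsl0 : sl 0 = z₀ := by simp [hsl, hχ]
  have htgt : χ.target ∈ 𝓝 (χ z₀) := extChartAt_target_mem_nhds z₀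
  have hslS : ContMDiffAt 𝓘(ℝ, N) 𝓘(ℝ, EZ) ∞ sl 0 := by
    have h1 : ContMDiffAt 𝓘(ℝ, EZ) 𝓘(ℝ, EZ) ∞ χ.symm (χ z₀ + ((0 : N) : EZ)) := by
      rw [Submodule.coe_zero, add_zero]
      exact (contMDiffOn_extChartAt_symm (I := 𝓘(ℝ, EZ)) (n := ∞) z₀).contMDiffAt htgt
    have h2 : ContMDiffAt 𝓘(ℝ, N) 𝓘(ℝ, EZ) ∞ (fun n : N => χ z₀ + (n : EZ)) 0 :=
      ContDiff.contMDiff (contDiff_const.add N.subtypeL.contDiff) 0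
    exact ContMDiffAt.comp (0 : N) h1 h2
  have hχsl : ∀ᶠ n : N in 𝓝 0, χ (sl n) = χ z₀ + n := by
    have : Tendsto (fun n : N => χ z₀ + (n : EZ)) (𝓝 0) (𝓝 (χ z₀)) := by
      have h : Continuous (fun n : N => χ z₀ + (n : EZ)) := by fun_prop
      simpa using h.tendsto 0
    filter_upwards [this htgt] with n hn
    exact χ.right_inv hn
  -- the flow-box map
  set Ψ : ℝ × N → EZ := fun x => χ (Circle.exp x.1 • sl x.2) with hΨ
  have hΨ0 : Ψ (0, 0) = χ z₀ := by simp [hΨ, hsl0]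
  have hχS : ContMDiffAt 𝓘(ℝ, EZ) 𝓘(ℝ, EZ) ∞ χ z₀ := contMDiffAt_extChartAt
  have hflow : ContMDiffAt (𝓘(ℝ, ℝ).prod 𝓘(ℝ, N)) 𝓘(ℝ, EZ) ∞
      (fun x : ℝ × N => Circle.exp x.1 • sl x.2) ((0 : ℝ), (0 : N)) := by
    have h3 : ContMDiffAt (𝓘(ℝ, ℝ).prod 𝓘(ℝ, N)) 𝓘(ℝ, EZ) ∞
        (fun x : ℝ × N => sl x.2) ((0 : ℝ), (0 : N)) :=
      ContMDiffAt.comp (I' := 𝓘(ℝ, N)) (g := sl) (f := Prod.snd) (((0 : ℝ), (0 : N)) : ℝ × N)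
        hslS contMDiffAt_snd
    exact ContMDiffAt.comp (((0 : ℝ), (0 : N)) : ℝ × N) (F.action_smooth _)
      (contMDiffAt_fst.prodMk h3)
  have hΨM : ContMDiffAt (𝓘(ℝ, ℝ).prod 𝓘(ℝ, N)) 𝓘(ℝ, EZ) ∞ Ψ ((0 : ℝ), (0 : N)) := by
    refine ContMDiffAt.comp (I' := 𝓘(ℝ, EZ)) (g := χ) (((0 : ℝ), (0 : N)) : ℝ × N) ?_ hflow
    simpa [hsl0] using hχS
  have hΨS : ContDiffAt ℝ ∞ Ψ (0, 0) := by
    rw [← modelWithCornersSelf_prod, chartedSpaceSelf_prod] at hΨM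
    exact contMDiffAt_iff_contDiffAt.1 hΨM
  have hΨd : HasFDerivAt Ψ ((kerSplitting (F.a z₀) (F.gen z₀) (F.a_gen z₀) :
      (ℝ × N) ≃L[ℝ] EZ) : (ℝ × N) →L[ℝ] EZ) (0, 0) := by
    have h0 : HasFDerivAt Ψ (fderiv ℝ Ψ (0, 0)) (0, 0) :=
      (hΨS.differentiableAt (by simp)).hasFDerivAt
    have e1 : HasFDerivAt (fun t : ℝ => Ψ (t, 0))
        ((fderiv ℝ Ψ (0, 0)).comp (ContinuousLinearMap.inl ℝ ℝ N)) 0 :=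
      HasFDerivAt.comp (0 : ℝ) (g := Ψ) (f := fun t : ℝ => ((t, 0) : ℝ × N)) h0
        (hasFDerivAt_prodMk_left (0 : ℝ) (0 : N))
    have e1' : HasFDerivAt (fun t : ℝ => Ψ (t, 0))
        (ContinuousLinearMap.toSpanSingleton ℝ (F.gen z₀)) 0 := by
      have h := hasFDerivAt_extChartAt_comp (F.hasMFDerivAt_exp_smul z₀)
        (z := z₀) (by rw [Circle.exp_zero, one_smul])
      have e : (fun t : ℝ => Ψ (t, 0)) = fun t => χ (Circle.exp t • z₀) := by
        funext t
        simp only [hΨ, hsl0]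
      rw [e]
      exact h
    have e2 : HasFDerivAt (fun n : N => Ψ (0, n))
        ((fderiv ℝ Ψ (0, 0)).comp (ContinuousLinearMap.inr ℝ ℝ N)) 0 :=
      HasFDerivAt.comp (0 : N) (g := Ψ) (f := fun n : N => ((0, n) : ℝ × N)) h0
        (hasFDerivAt_prodMk_right (0 : ℝ) (0 : N))
    have e2' : HasFDerivAt (fun n : N => Ψ (0, n)) N.subtypeL 0 := by
      have : (fun n : N => Ψ (0, n)) =ᶠ[𝓝 0] fun n => χ z₀ + n := by
        filter_upwards [hχsl] with n hn
        simp [hΨ, hn]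
      exact ((N.subtypeL.hasFDerivAt).const_add _).congr_of_eventuallyEq this
    have u1 := e1.unique e1'
    have u2 := e2.unique e2'
    have : fderiv ℝ Ψ (0, 0) = ((kerSplitting (F.a z₀) (F.gen z₀) (F.a_gen z₀) :
      (ℝ × N) ≃L[ℝ] EZ) : (ℝ × N) →L[ℝ] EZ) := by
      refine ContinuousLinearMap.ext fun x => ?_
      obtain ⟨t, n⟩ := x
      have h1 := DFunLike.congr_fun u1 t
      have h2 := DFunLike.congr_fun u2 n
      simp only [ContinuousLinearMap.comp_apply, ContinuousLinearMap.inl_apply,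
        ContinuousLinearMap.inr_apply] at h1 h2
      have : ((t, n) : ℝ × N) = (t, 0) + (0, n) := by simp
      rw [this, map_add, h1, h2, ← this]
      rw [ContinuousLinearEquiv.coe_coe, kerSplitting_apply]
      simp
    rwa [this] at h0
  have hst := hΨS.hasStrictFDerivAt' hΨd (by simp)
  set inv := hΨS.localInverse hΨd (by simp) with hinv
  have hinvS : ContDiffAt ℝ ∞ inv (χ z₀) := by
    rw [← hΨ0]; exact hΨS.to_localInverse hΨd (by simp)
  have hinv0 : inv (χ z₀) = (0, 0) := by
    rw [← hΨ0]; exact hΨS.localInverse_apply_image hΨd (by simp)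
  have hleft : ∀ᶠ x in 𝓝 ((0, 0) : ℝ × N), inv (Ψ x) = x := hst.eventually_left_inverse
  have hright : ∀ᶠ v in 𝓝 (χ z₀), Ψ (inv v) = v := by
    rw [← hΨ0]; exact hst.eventually_right_inverse
  have hχc : ContinuousAt χ z₀ := hχS.continuousAt
  have hinvχS : ContMDiffAt 𝓘(ℝ, EZ) 𝓘(ℝ, ℝ × N) ∞ (fun z => inv (χ z)) z₀ :=
    ContMDiffAt.comp (I' := 𝓘(ℝ, EZ)) (g := inv) z₀ hinvS.contMDiffAt hχS
  have hsrc : χ.source ∈ 𝓝 z₀ := extChartAt_source_mem_nhds z₀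
  have hbox : ∀ᶠ z in 𝓝 z₀, Circle.exp (inv (χ z)).1 • sl (inv (χ z)).2 = z := by
    have hcont : Tendsto (fun z => Circle.exp (inv (χ z)).1 • sl (inv (χ z)).2) (𝓝 z₀) (𝓝 z₀) := by
      have h1 : Tendsto (fun z => inv (χ z)) (𝓝 z₀) (𝓝 (0, 0)) := by
        simpa [ContinuousAt, hinv0] using hinvχS.continuousAt
      have h2 := hflow.continuousAt.tendsto.comp h1
      simp only [Circle.exp_zero, hsl0, one_smul] at h2
      exact h2
    filter_upwards [hcont hsrc, hsrc, hχc hright] with z h1 h2 h3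
    exact χ.injOn h1 h2 h3
  -- the slice is a section up to a diffeomorphism of the base
  set χY := extChartAt 𝓘(ℝ, EY) (F.p z₀) with hχY
  set f : N → EY := fun n => χY (F.p (sl n)) with hf
  have hpsl : ContMDiffAt 𝓘(ℝ, N) 𝓘(ℝ, EY) ∞ (fun n => F.p (sl n)) 0 :=
    ContMDiffAt.comp (I' := 𝓘(ℝ, EZ)) (g := F.p) (0 : N) (F.p_smooth _) hslS
  have hfS : ContDiffAt ℝ ∞ f 0 := by
    rw [← contMDiffAt_iff_contDiffAt]
    refine ContMDiffAt.comp (I' := 𝓘(ℝ, EY)) (g := χY) (0 : N) ?_ hpsl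
    rw [hsl0]
    exact contMDiffAt_extChartAt
  have hsld : HasMFDerivAt 𝓘(ℝ, N) 𝓘(ℝ, EZ) sl 0 N.subtypeL := by
    refine hasMFDerivAt_of_extChartAt_comp hslS.continuousAt ?_
    rw [hsl0]
    exact ((N.subtypeL.hasFDerivAt).const_add _).congr_of_eventuallyEq hχsl
  have hfd : HasFDerivAt f ((F.dp z₀).comp N.subtypeL) 0 := by
    have h := HasMFDerivAt.comp (0 : N) (F.hasMFDerivAt_p (sl 0)) hsld
    have h' := hasFDerivAt_extChartAt_comp h (z := F.p z₀) (by simp [hsl0])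
    rw [hsl0] at h'
    exact h'
  have hfst := hfS.hasStrictFDerivAt' hfd (by simp)
  obtain ⟨U, hU, hUinj⟩ : ∃ U ∈ 𝓝 (0 : N), InjOn f U := by
    rw [nhds_prod_eq, eventually_prod_iff] at hleft
    obtain ⟨pa, hpa, pb, hpb, hab⟩ := hleft
    obtain ⟨ε, hε, hpa⟩ := Metric.eventually_nhds_iff.1 hpa
    have hsm := F.eventually_abs_lt_of_exp_smul_eq z₀ hε
    rw [nhds_prod_eq] at hsm
    have hslT : Tendsto sl (𝓝 0) (𝓝 z₀) := by simpa [ContinuousAt, hsl0] using hslS.continuousAt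
    obtain ⟨W, hW, hWW⟩ := (eventually_prod_self_iff (r := fun x y : Z =>
      ∀ t ∈ Icc (-Real.pi) Real.pi, Circle.exp t • x = y → |t| < ε)).1 hsm
    have hpslT : Tendsto (fun n => F.p (sl n)) (𝓝 0) (𝓝 (F.p z₀)) := by
      simpa [ContinuousAt, hsl0] using hpsl.continuousAt
    have hU1 : {n | F.p (sl n) ∈ χY.source} ∈ 𝓝 (0 : N) := hpslT (extChartAt_source_mem_nhds _)
    refine ⟨_, inter_mem (inter_mem (hslT hW) hpb) hU1, ?_⟩
    rintro n ⟨⟨h1, h2⟩, h3⟩ n' ⟨⟨h1', h2'⟩, h3'⟩ hnn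
    have hp : F.p (sl n) = F.p (sl n') := χY.injOn h3 h3' hnn
    obtain ⟨t, ht, hts⟩ := F.exists_exp_smul_of_p_eq hp
    have htε := hWW _ h1 _ h1' t ht hts
    have e1 := hab (hpa (y := t) (by simpa using htε)) h2
    have e2 := hab (hpa (y := 0) (by simpa using hε)) h2'
    have e3 : Ψ (t, n) = Ψ (0, n') := by simp [hΨ, hts]
    rw [e3, e2] at e1
    exact (Prod.ext_iff.1 e1).2.symm
  have hker := ker_eq_bot_of_injOn_nhds hfst (F.range_dp_comp_subtypeL z₀) hU hUinj
  refine ⟨?_, ?_⟩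
  · set fe : N ≃L[ℝ] EY := ContinuousLinearEquiv.ofBijective ((F.dp z₀).comp N.subtypeL) hker
      (F.range_dp_comp_subtypeL z₀) with hfe
    have hfd' : HasFDerivAt f (fe : N →L[ℝ] EY) 0 := by
      rw [hfe, ContinuousLinearEquiv.coe_ofBijective]; exact hfd
    have hfst' := hfS.hasStrictFDerivAt' hfd' (by simp)
    set finv := hfS.localInverse hfd' (by simp) with hfinv
    have hf0 : f 0 = χY (F.p z₀) := by simp [hf, hsl0]
    have hfinvS : ContDiffAt ℝ ∞ finv (χY (F.p z₀)) := by
      rw [← hf0]; exact hfS.to_localInverse hfd' (by simp)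
    have hfinv0 : finv (χY (F.p z₀)) = 0 := by
      rw [← hf0]; exact hfS.localInverse_apply_image hfd' (by simp)
    have hfleft : ∀ᶠ n in 𝓝 (0 : N), finv (f n) = n := hfst'.eventually_left_inverse
    have hfright : ∀ᶠ v in 𝓝 (χY (F.p z₀)), f (finv v) = v := by
      rw [← hf0]; exact hfst'.eventually_right_inverse
    have hYS : ContMDiffAt 𝓘(ℝ, EY) 𝓘(ℝ, EY) ∞ χY (F.p z₀) := contMDiffAt_extChartAt
    have hfχ : ContMDiffAt 𝓘(ℝ, EY) 𝓘(ℝ, N) ∞ (fun y => finv (χY y)) (F.p z₀) :=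
      ContMDiffAt.comp (I' := 𝓘(ℝ, EY)) (g := finv) _ hfinvS.contMDiffAt hYS
    have hσS : ContMDiffAt 𝓘(ℝ, EY) 𝓘(ℝ, EZ) ∞ (fun y => sl (finv (χY y))) (F.p z₀) := by
      refine ContMDiffAt.comp (I' := 𝓘(ℝ, N)) (g := sl) _ ?_ hfχ
      rwa [hfinv0]
    refine ⟨fun z => (inv (χ z)).1, fun y => sl (finv (χY y)), ?_, hσS, ?_, ?_, ?_, ?_⟩
    · exact ContMDiffAt.comp (I' := 𝓘(ℝ, ℝ × N)) (g := Prod.fst) z₀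
        (contDiff_fst.contMDiff _) hinvχS
    · simp [hinv0]
    · simp [hfinv0, hsl0]
    · have h1 : Tendsto (fun y => F.p (sl (finv (χY y)))) (𝓝 (F.p z₀)) (𝓝 (F.p z₀)) := by
        have := (F.p_smooth.continuous.tendsto _).comp hσS.continuousAt.tendsto
        simp only [hfinv0, hsl0] at this
        exact this
      filter_upwards [h1 (extChartAt_source_mem_nhds (I := 𝓘(ℝ, EY)) (F.p z₀)),
        extChartAt_source_mem_nhds (I := 𝓘(ℝ, EY)) (F.p z₀), hYS.continuousAt hfright]
        with y h1 h2 h3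
      exact χY.injOn h1 h2 h3
    · have h1 : Tendsto (fun z => (inv (χ z)).2) (𝓝 z₀) (𝓝 0) := by
        have : Tendsto (fun z => inv (χ z)) (𝓝 z₀) (𝓝 (0, 0)) := by
          simpa [ContinuousAt, hinv0] using hinvχS.continuousAt
        exact (continuous_snd.tendsto _).comp this
      filter_upwards [hbox, h1 hfleft] with z h2 h3
      have h4 : F.p z = F.p (sl (inv (χ z)).2) := by
        conv_lhs => rw [← h2]
        exact F.p_smul _ _
      have h5 : finv (χY (F.p z)) = (inv (χ z)).2 := by rw [h4]; exact h3
      rw [h5]; exact h2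
  · intro v hv hav
    have hvN : v ∈ N := hav
    have : (⟨v, hvN⟩ : N) ∈ ((F.dp z₀).comp N.subtypeL).toLinearMap.ker := hv
    rw [hker] at this
    exact congrArg Subtype.val ((Submodule.mem_bot ℝ).1 this)

lemma eq_smul_gen_of_dp_eq_zero [T2Space Z] {z : Z} {v : EZ} (hv : F.dp z v = 0) :
    v = F.a z v • F.gen z := by
  have := (F.exists_trivialization_aux z).2 (v - F.a z v • F.gen z) (by simp [hv, F.dp_gen])
    (by simp [F.a_gen])
  exact sub_eq_zero.1 this

theorem exists_trivialization [T2Space Z] (z₀ : Z) :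
    ∃ (Θ : Z → ℝ) (σ : Y → Z), ContMDiffAt 𝓘(ℝ, EZ) 𝓘(ℝ, ℝ) ∞ Θ z₀ ∧
      ContMDiffAt 𝓘(ℝ, EY) 𝓘(ℝ, EZ) ∞ σ (F.p z₀) ∧ Θ z₀ = 0 ∧ σ (F.p z₀) = z₀ ∧
      (∀ᶠ y in 𝓝 (F.p z₀), F.p (σ y) = y) ∧
      (∀ᶠ z in 𝓝 z₀, Circle.exp (Θ z) • σ (F.p z) = z) :=
  (F.exists_trivialization_aux z₀).1

end CircleFibered

end Trivialization

end

section

/-! ### The connection form along a map, and the ratio of two lifts -/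

section Form

variable {EY Y EZ Z : Type*}
  [NormedAddCommGroup EY] [NormedSpace ℝ EY] [FiniteDimensional ℝ EY]
  [TopologicalSpace Y] [ChartedSpace EY Y] [IsManifold 𝓘(ℝ, EY) ∞ Y]
  [NormedAddCommGroup EZ] [NormedSpace ℝ EZ] [FiniteDimensional ℝ EZ]
  [TopologicalSpace Z] [ChartedSpace EZ Z] [IsManifold 𝓘(ℝ, EZ) ∞ Z] [MulAction Circle Z]
  (F : CircleFibered EY Y EZ Z)

namespace CircleFibered

variable {E' : Type*} [NormedAddCommGroup E'] [NormedSpace ℝ E']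

/-- The map `ζ` is differentiable at `x` within `s`, and the pull-back of the connection form
is `μ` there. -/
def HasForm (s : Set E') (ζ : E' → Z) (x : E') (μ : E' →L[ℝ] ℝ) : Prop :=
  ∃ D : E' →L[ℝ] EZ, HasMFDerivWithinAt 𝓘(ℝ, E') 𝓘(ℝ, EZ) ζ s x D ∧ (F.a (ζ x)).comp D = μ

variable {F} in
lemma HasForm.mono {s t : Set E'} {ζ : E' → Z} {x : E'} {μ : E' →L[ℝ] ℝ}
    (h : F.HasForm s ζ x μ) (hst : t ⊆ s) : F.HasForm t ζ x μ := by
  obtain ⟨D, hD, rfl⟩ := h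
  exact ⟨D, hD.mono hst, rfl⟩

variable {F} in
lemma HasForm.continuousWithinAt {s : Set E'} {ζ : E' → Z} {x : E'} {μ : E' →L[ℝ] ℝ}
    (h : F.HasForm s ζ x μ) : ContinuousWithinAt ζ s x := by
  obtain ⟨D, hD, -⟩ := h
  exact hD.1

variable {F} in
lemma HasForm.congr_of_eventuallyEq {s : Set E'} {ζ ζ' : E' → Z} {x : E'} {μ : E' →L[ℝ] ℝ}
    (h : F.HasForm s ζ x μ) (he : ζ' =ᶠ[𝓝[s] x] ζ) (hx : ζ' x = ζ x) : F.HasForm s ζ' x μ := by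
  obtain ⟨D, hD, rfl⟩ := h
  exact ⟨D, hD.congr_of_eventuallyEq he hx, by rw [hx]⟩

variable {F} in
lemma HasForm.mono_of_mem {s t : Set E'} {ζ : E' → Z} {x : E'} {μ : E' →L[ℝ] ℝ}
    (h : F.HasForm s ζ x μ) (hst : s ∈ 𝓝[t] x) : F.HasForm t ζ x μ := by
  obtain ⟨D, hD, rfl⟩ := h
  exact ⟨D, hD.mono_of_mem_nhdsWithin hst, rfl⟩

lemma a_smul_comp (c : Circle) (z : Z) {D : EZ →L[ℝ] EZ}
    (hD : HasMFDerivAt 𝓘(ℝ, EZ) 𝓘(ℝ, EZ) (fun w : Z => c • w) z D) (v : EZ) :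
    F.a (c • z) (D v) = F.a z v := by
  have h := F.alpha_invariant c z v
  rw [hD.mfderiv] at h
  exact h

variable {F} in
lemma HasForm.const_smul {s : Set E'} {ζ : E' → Z} {x : E'} {μ : E' →L[ℝ] ℝ}
    (h : F.HasForm s ζ x μ) (c : Circle) : F.HasForm s (fun y => c • ζ y) x μ := by
  obtain ⟨D, hD, rfl⟩ := h
  have h1 : HasMFDerivAt 𝓘(ℝ, EZ) 𝓘(ℝ, EZ) (fun w : Z => c • w) (ζ x) _ :=
    ((F.contMDiff_smul c).mdifferentiable (by simp) (ζ x)).hasMFDerivAt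
  exact ⟨_, h1.comp_hasMFDerivWithinAt x hD, ContinuousLinearMap.ext fun v =>
    F.a_smul_comp c (ζ x) h1 (D v)⟩

variable {F} in
lemma HasForm.exp_smul {s : Set E'} {ζ : E' → Z} {x : E'} {μ ψ' : E' →L[ℝ] ℝ} {ψ : E' → ℝ}
    (h : F.HasForm s ζ x μ) (hψ : HasFDerivWithinAt ψ ψ' s x) :
    F.HasForm s (fun y => Circle.exp (ψ y) • ζ y) x (μ + ψ') := by
  obtain ⟨D, hD, rfl⟩ := h
  obtain ⟨L, hL⟩ : ∃ L : ℝ × EZ →L[ℝ] EZ, HasMFDerivAt (𝓘(ℝ, ℝ).prod 𝓘(ℝ, EZ)) 𝓘(ℝ, EZ)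
      (fun y : ℝ × Z => Circle.exp y.1 • y.2) (ψ x, ζ x) L :=
    ⟨_, (F.action_smooth.mdifferentiable (by simp) (ψ x, ζ x)).hasMFDerivAt⟩
  have hψ' : HasMFDerivWithinAt 𝓘(ℝ, E') 𝓘(ℝ, ℝ) ψ s x ψ' := hψ.hasMFDerivWithinAt
  have hpair := hψ'.prodMk hD
  have hcomp := hL.comp_hasMFDerivWithinAt x hpair
  refine ⟨L.comp (ψ'.prod D), hcomp, ?_⟩
  have h1 : ∀ t : ℝ, L (t, 0) = t • F.gen (Circle.exp (ψ x) • ζ x) := by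
    have k1 : HasMFDerivAt 𝓘(ℝ, ℝ) (𝓘(ℝ, ℝ).prod 𝓘(ℝ, EZ))
        (fun t : ℝ => ((ψ x + t, ζ x) : ℝ × Z)) 0 (ContinuousLinearMap.inl ℝ ℝ EZ) := by
      have e1 : HasMFDerivAt 𝓘(ℝ, ℝ) 𝓘(ℝ, ℝ) (fun t : ℝ => ψ x + t) 0
          (ContinuousLinearMap.id ℝ ℝ) := ((hasFDerivAt_id (0 : ℝ)).const_add _).hasMFDerivAt
      exact e1.prodMk (hasMFDerivAt_const (ζ x) (0 : ℝ))
    have hL' : HasMFDerivAt (𝓘(ℝ, ℝ).prod 𝓘(ℝ, EZ)) 𝓘(ℝ, EZ)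
      (fun y : ℝ × Z => Circle.exp y.1 • y.2) (ψ x + 0, ζ x) L := by rw [add_zero]; exact hL
    have k2 := HasMFDerivAt.comp (0 : ℝ) hL' k1
    have k3 := F.hasMFDerivAt_exp_smul (Circle.exp (ψ x) • ζ x)
    have k4 : (fun t : ℝ => Circle.exp t • Circle.exp (ψ x) • ζ x) =
        (fun y : ℝ × Z => Circle.exp y.1 • y.2) ∘ fun t : ℝ => ((ψ x + t, ζ x) : ℝ × Z) := by
      funext t
      simp [smul_smul, Circle.exp_add, mul_comm]
    rw [k4] at k3
    have k5 := hasMFDerivAt_unique k2 k3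
    intro t
    have := DFunLike.congr_fun k5 t
    simpa using! this
  have h2 : ∀ v : EZ, F.a (Circle.exp (ψ x) • ζ x) (L (0, v)) = F.a (ζ x) v := by
    have k1 : HasMFDerivAt 𝓘(ℝ, EZ) (𝓘(ℝ, ℝ).prod 𝓘(ℝ, EZ))
        (fun z : Z => ((ψ x, z) : ℝ × Z)) (ζ x) (ContinuousLinearMap.inr ℝ ℝ EZ) :=
      (hasMFDerivAt_const (ψ x) (ζ x)).prodMk (hasMFDerivAt_id (ζ x))
    have k2 : HasMFDerivAt 𝓘(ℝ, EZ) 𝓘(ℝ, EZ) (fun z : Z => Circle.exp (ψ x) • z) (ζ x)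
        (L.comp (ContinuousLinearMap.inr ℝ ℝ EZ)) :=
      HasMFDerivAt.comp (g := fun y : ℝ × Z => Circle.exp y.1 • y.2) (ζ x) hL k1
    exact fun v => F.a_smul_comp _ _ k2 v
  refine ContinuousLinearMap.ext fun v => ?_
  have e : ((ψ' v, D v) : ℝ × EZ) = (ψ' v, 0) + (0, D v) := by simp
  change F.a (Circle.exp (ψ x) • ζ x) (L (ψ' v, D v)) = F.a (ζ x) (D v) + ψ' v
  rw [e, map_add, map_add, h1, h2, map_smul, F.a_gen]
  simp [add_comm]

include F in
theorem exists_phase [T2Space Z] (z₀ : Z) : ∃ Θ : Z → ℝ, ContMDiffAt 𝓘(ℝ, EZ) 𝓘(ℝ, ℝ) ∞ Θ z₀ ∧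
    ∀ᶠ x : Z × Z in 𝓝 (z₀, z₀), ∀ c : Circle, x.1 = c • x.2 → c = Circle.exp (Θ x.1 - Θ x.2) := by
  obtain ⟨Θ, σ, hΘ, -, -, -, -, h⟩ := F.exists_trivialization z₀
  refine ⟨Θ, hΘ, ?_⟩
  rw [nhds_prod_eq]
  filter_upwards [h.prod_mk h] with x hx c hc
  have hp : F.p x.1 = F.p x.2 := by rw [hc, F.p_smul]
  have h1 : Circle.exp (Θ x.1) • σ (F.p x.2) = (c * Circle.exp (Θ x.2)) • σ (F.p x.2) := by
    rw [mul_smul, hx.2, ← hc, ← hp, hx.1]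
  rw [Circle.exp_sub, F.smul_left_injective h1, mul_div_cancel_right]

include F in
lemma tendsto_ratio [T2Space Z] {X : Type*} {l : Filter X} {ζ₁ ζ₂ : X → Z} {c : X → Circle}
    {z₁ z₂ : Z} {c₀ : Circle} (h₁ : Tendsto ζ₁ l (𝓝 z₁)) (h₂ : Tendsto ζ₂ l (𝓝 z₂))
    (hz : z₁ = c₀ • z₂) (hc : ∀ᶠ x in l, ζ₁ x = c x • ζ₂ x) : Tendsto c l (𝓝 c₀) := by
  obtain ⟨Θ, hΘ, hph⟩ := F.exists_phase z₂
  have h₁' : Tendsto (fun x => c₀⁻¹ • ζ₁ x) l (𝓝 z₂) := by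
    have := ((F.continuous_const_smul c₀⁻¹).tendsto z₁).comp h₁
    rwa [hz, inv_smul_smul] at this
  have hT : Tendsto (fun x => c₀ * Circle.exp (Θ (c₀⁻¹ • ζ₁ x) - Θ (ζ₂ x))) l (𝓝 c₀) := by
    have a1 := hΘ.continuousAt.tendsto.comp h₁'
    have a2 := hΘ.continuousAt.tendsto.comp h₂
    have a3 := ((Circle.exp.continuous.tendsto _).comp (a1.sub a2)).const_mul c₀
    simpa using a3
  refine hT.congr' ?_
  filter_upwards [(h₁'.prodMk_nhds h₂).eventually hph, hc] with x hx hcx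
  have := hx (c₀⁻¹ * c x) (by rw [mul_smul, ← hcx])
  rw [← this, mul_inv_cancel_left]

include F in
lemma continuousWithinAt_ratio [T2Space Z] {X : Type*} [TopologicalSpace X] {s : Set X} {x : X}
    {ζ₁ ζ₂ : X → Z} {c : X → Circle} (h₁ : ContinuousWithinAt ζ₁ s x)
    (h₂ : ContinuousWithinAt ζ₂ s x) (hc : ∀ y ∈ s, ζ₁ y = c y • ζ₂ y) (hx : x ∈ s) :
    ContinuousWithinAt c s x :=
  F.tendsto_ratio h₁ h₂ (hc x hx) (eventually_of_mem self_mem_nhdsWithin hc)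

theorem exists_phase_deriv [T2Space Z] (z₀ : Z) : ∃ (Θ : Z → ℝ) (dΘ : EZ →L[ℝ] ℝ),
    HasMFDerivAt 𝓘(ℝ, EZ) 𝓘(ℝ, ℝ) Θ z₀ dΘ ∧ dΘ (F.gen z₀) = 1 ∧
    ∀ᶠ x : Z × Z in 𝓝 (z₀, z₀), ∀ c : Circle, x.1 = c • x.2 → c = Circle.exp (Θ x.1 - Θ x.2) := by
  obtain ⟨Θ, hΘ, hph⟩ := F.exists_phase z₀
  obtain ⟨dΘ, hdΘ⟩ : ∃ dΘ : EZ →L[ℝ] ℝ, HasMFDerivAt 𝓘(ℝ, EZ) 𝓘(ℝ, ℝ) Θ z₀ dΘ :=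
    ⟨_, (hΘ.mdifferentiableAt (by simp)).hasMFDerivAt⟩
  refine ⟨Θ, dΘ, hdΘ, ?_, hph⟩
  have h1 : HasMFDerivAt 𝓘(ℝ, ℝ) 𝓘(ℝ, ℝ) (fun t : ℝ => Θ (Circle.exp t • z₀)) 0
      (dΘ.comp (ContinuousLinearMap.toSpanSingleton ℝ (F.gen z₀))) := by
    have e : HasMFDerivAt 𝓘(ℝ, EZ) 𝓘(ℝ, ℝ) Θ (Circle.exp 0 • z₀) dΘ := by
      rw [Circle.exp_zero, one_smul]; exact hdΘ
    exact HasMFDerivAt.comp (0 : ℝ) e (F.hasMFDerivAt_exp_smul z₀)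
  have h1' : HasFDerivAt (fun t : ℝ => Θ (Circle.exp t • z₀))
      (dΘ.comp (ContinuousLinearMap.toSpanSingleton ℝ (F.gen z₀))) 0 := h1.hasFDerivAt
  have hc : Tendsto (fun t : ℝ => Circle.exp t • z₀) (𝓝 0) (𝓝 z₀) := by
    have := (F.contMDiff_exp_smul z₀).continuous.tendsto 0
    simpa using! this
  have h2 : (fun t : ℝ => Θ (Circle.exp t • z₀)) =ᶠ[𝓝 0] fun t => Θ z₀ + t := by
    have hlim : Tendsto (fun t : ℝ => Θ (Circle.exp t • z₀) - Θ z₀ - t) (𝓝 0) (𝓝 0) := by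
      have := ((hΘ.continuousAt.tendsto.comp hc).sub_const (Θ z₀)).sub tendsto_id
      simpa using! this
    have hsmall := hlim (Ioo_mem_nhds (neg_lt_zero.2 Real.pi_pos) Real.pi_pos)
    filter_upwards [(hc.prodMk_nhds (tendsto_const_nhds (x := z₀))).eventually hph, hsmall]
      with t ht hs
    have e1 := ht (Circle.exp t) rfl
    have e2 : Circle.exp (Θ (Circle.exp t • z₀) - Θ z₀ - t) = 1 := by
      rw [Circle.exp_sub, ← e1, div_self']
    obtain ⟨n, hn⟩ := Circle.exp_eq_one.1 e2
    simp only [mem_preimage, mem_Ioo] at hs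
    have hn0 : n = 0 := by
      have b1 : (n : ℝ) < 1 := by nlinarith [Real.pi_pos]
      have b2 : (-1 : ℝ) < n := by nlinarith [Real.pi_pos]
      have b1' : n < 1 := by exact_mod_cast b1
      have b2' : -1 < n := by exact_mod_cast b2
      omega
    rw [hn0] at hn
    simp only [Int.cast_zero, zero_mul] at hn
    linarith
  have h3 : HasFDerivAt (fun t : ℝ => Θ (Circle.exp t • z₀)) (ContinuousLinearMap.id ℝ ℝ) 0 :=
    ((hasFDerivAt_id (0 : ℝ)).const_add _).congr_of_eventuallyEq h2
  have := DFunLike.congr_fun (h1'.unique h3) (1 : ℝ)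
  simpa using this

theorem hasFDerivWithinAt_ratio [T2Space Z] {s : Set E'} {x : E'} {ζ₁ ζ₂ : E' → Z}
    {c : E' → Circle} {μ₁ μ₂ : E' →L[ℝ] ℝ} (h₁ : F.HasForm s ζ₁ x μ₁) (h₂ : F.HasForm s ζ₂ x μ₂)
    (hc : ∀ y ∈ s, ζ₁ y = c y • ζ₂ y) (hx : x ∈ s) (hs : UniqueDiffWithinAt ℝ s x) :
    HasFDerivWithinAt (fun y => (c y : ℂ)) ((μ₁ - μ₂).smulRight (Complex.I * (c x : ℂ))) s x := by
  have h₁' := h₁.const_smul (c x)⁻¹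
  have hval : (c x)⁻¹ • ζ₁ x = ζ₂ x := by rw [hc x hx, inv_smul_smul]
  obtain ⟨D₁, hD₁, rfl⟩ := h₁'
  obtain ⟨D₂, hD₂, rfl⟩ := h₂
  obtain ⟨Θ, dΘ, hdΘ, hgen, hph⟩ := F.exists_phase_deriv (ζ₂ x)
  -- the two lifts have the same differential modulo the generator
  have hv : ∀ v, D₁ v - D₂ v = F.a (ζ₂ x) (D₁ v - D₂ v) • F.gen (ζ₂ x) := by
    have hp1 : HasMFDerivAt 𝓘(ℝ, EZ) 𝓘(ℝ, EY) F.p ((c x)⁻¹ • ζ₁ x) (F.dp (ζ₂ x)) := by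
      rw [hval]; exact F.hasMFDerivAt_p _
    have e1 := hasFDerivWithinAt_extChartAt_comp (hp1.comp_hasMFDerivWithinAt x hD₁)
      (z := F.p (ζ₂ x)) (by simp [hval])
    have e2 := hasFDerivWithinAt_extChartAt_comp
      ((F.hasMFDerivAt_p (ζ₂ x)).comp_hasMFDerivWithinAt x hD₂) (z := F.p (ζ₂ x)) rfl
    have e3 := e1.congr (f₁ := fun y => extChartAt 𝓘(ℝ, EY) (F.p (ζ₂ x)) ((F.p ∘ ζ₂) y))
      (fun y hy => by simp [F.p_smul, hc y hy]) (by simp [hval])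
    have e4 : (F.dp (ζ₂ x)).comp D₁ = (F.dp (ζ₂ x)).comp D₂ := hs.eq e3 e2
    intro v
    refine F.eq_smul_gen_of_dp_eq_zero ?_
    have := DFunLike.congr_fun e4 v
    simp only [ContinuousLinearMap.comp_apply] at this
    rw [map_sub, this, sub_self]
  have hd1 : HasMFDerivAt 𝓘(ℝ, EZ) 𝓘(ℝ, ℝ) Θ ((c x)⁻¹ • ζ₁ x) dΘ := by rw [hval]; exact hdΘ
  have g1 : HasFDerivWithinAt (fun y => Θ ((c x)⁻¹ • ζ₁ y)) (dΘ.comp D₁) s x :=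
    (hd1.comp_hasMFDerivWithinAt x hD₁).hasFDerivWithinAt
  have g2 : HasFDerivWithinAt (fun y => Θ (ζ₂ y)) (dΘ.comp D₂) s x :=
    (hdΘ.comp_hasMFDerivWithinAt x hD₂).hasFDerivWithinAt
  have g3 := g1.sub g2
  have g4 : HasFDerivWithinAt (fun y => (c x : ℂ) *
      Complex.exp (((Θ ((c x)⁻¹ • ζ₁ y) - Θ (ζ₂ y) : ℝ) : ℂ) * Complex.I))
      (((F.a ((c x)⁻¹ • ζ₁ x)).comp D₁ - (F.a (ζ₂ x)).comp D₂).smulRight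
        (Complex.I * (c x : ℂ))) s x := by
    have k1 := (Complex.ofRealCLM.hasFDerivAt.comp_hasFDerivWithinAt x g3)
    have k2 := ((k1.mul_const Complex.I).cexp).const_mul (c x : ℂ)
    refine k2.congr_fderiv ?_
    refine ContinuousLinearMap.ext fun v => ?_
    have hdv : dΘ (D₁ v) - dΘ (D₂ v) = F.a (ζ₂ x) (D₁ v) - F.a (ζ₂ x) (D₂ v) := by
      rw [← map_sub, hv v, map_smul, hgen, map_sub]; simp
    have hzero : Θ ((c x)⁻¹ • ζ₁ x) - Θ (ζ₂ x) = 0 := by rw [hval, sub_self]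
    simp [hval]
    rw [← Complex.ofReal_sub, ← Complex.ofReal_sub, hdv]
    ring
  refine g4.congr_of_eventuallyEq ?_ ?_
  · have t1 : Tendsto (fun y => ((c x)⁻¹ • ζ₁ y, ζ₂ y)) (𝓝[s] x) (𝓝 (ζ₂ x, ζ₂ x)) := by
      have := hD₁.1.tendsto
      rw [hval] at this
      exact this.prodMk_nhds hD₂.1
    filter_upwards [t1.eventually hph, self_mem_nhdsWithin] with y hy hys
    have := hy ((c x)⁻¹ * c y) (by rw [mul_smul, ← hc y hys])
    have e : c y = c x * Circle.exp (Θ ((c x)⁻¹ • ζ₁ y) - Θ (ζ₂ y)) := by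
      rw [← this, mul_inv_cancel_left]
    rw [e, Circle.coe_mul, Circle.coe_exp]
  · simp [hval]

end CircleFibered

end Form

end

section

/-! ### The connection form in local coordinates -/

section PullbackCalculus

lemma two_le_infty : (2 : ℕ∞ω) ≤ ∞ := ENat.LEInfty.out

lemma fderiv_pullback_antisymm {E G : Type*} [NormedAddCommGroup E] [NormedSpace ℝ E]
    [NormedAddCommGroup G] [NormedSpace ℝ G] {A : G → G →L[ℝ] ℝ} {f : E → G} {x : E}
    (hA : DifferentiableAt ℝ A (f x)) (hf : ContDiffAt ℝ 2 f x) (v w : E) :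
    fderiv ℝ (fun y => (A (f y)).comp (fderiv ℝ f y)) x v w -
      fderiv ℝ (fun y => (A (f y)).comp (fderiv ℝ f y)) x w v =
    fderiv ℝ A (f x) (fderiv ℝ f x v) (fderiv ℝ f x w) -
      fderiv ℝ A (f x) (fderiv ℝ f x w) (fderiv ℝ f x v) := by
  have hf1 : HasFDerivAt f (fderiv ℝ f x) x := (hf.differentiableAt (by simp)).hasFDerivAt
  have hf2 : HasFDerivAt (fderiv ℝ f) (fderiv ℝ (fderiv ℝ f) x) x :=
    ((hf.fderiv_right (m := 1) (by norm_num)).differentiableAt (by simp)).hasFDerivAt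
  have hAf : HasFDerivAt (fun y => A (f y)) ((fderiv ℝ A (f x)).comp (fderiv ℝ f x)) x :=
    hA.hasFDerivAt.comp x hf1
  have h := hAf.clm_comp hf2
  have hsymm : IsSymmSndFDerivAt ℝ f x := hf.isSymmSndFDerivAt (by simp)
  rw [h.fderiv]
  have := hsymm.eq v w
  simp [this]

end PullbackCalculus

section ChartForm

variable {EY Y EZ Z : Type*}
  [NormedAddCommGroup EY] [NormedSpace ℝ EY] [FiniteDimensional ℝ EY]
  [TopologicalSpace Y] [ChartedSpace EY Y] [IsManifold 𝓘(ℝ, EY) ∞ Y]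
  [NormedAddCommGroup EZ] [NormedSpace ℝ EZ] [FiniteDimensional ℝ EZ]
  [TopologicalSpace Z] [ChartedSpace EZ Z] [IsManifold 𝓘(ℝ, EZ) ∞ Z] [MulAction Circle Z]
  (F : CircleFibered EY Y EZ Z)

namespace CircleFibered

variable {E' : Type*} [NormedAddCommGroup E'] [NormedSpace ℝ E']

/-- The connection form in the chart at `z₀`. -/
def A (z₀ : Z) : EZ → EZ →L[ℝ] ℝ := chartForm F.alpha z₀

lemma hasMFDerivAt_extChartAt_symm {z₀ : Z} {x : EZ} (hx : x ∈ (extChartAt 𝓘(ℝ, EZ) z₀).target) :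
    HasMFDerivAt 𝓘(ℝ, EZ) 𝓘(ℝ, EZ) (extChartAt 𝓘(ℝ, EZ) z₀).symm x
      (mfderiv 𝓘(ℝ, EZ) 𝓘(ℝ, EZ) (extChartAt 𝓘(ℝ, EZ) z₀).symm x) := by
  have h : ContMDiffAt 𝓘(ℝ, EZ) 𝓘(ℝ, EZ) ∞ (extChartAt 𝓘(ℝ, EZ) z₀).symm x :=
    (contMDiffOn_extChartAt_symm (I := 𝓘(ℝ, EZ)) (n := ∞) z₀).contMDiffAt
      (extChartAt_target_mem_nhds' hx)
  exact (h.mdifferentiableAt (by simp)).hasMFDerivAt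

lemma hasForm_of_chart {z₀ : Z} {s : Set E'} {ζ : E' → Z} {x : E'} {D : E' →L[ℝ] EZ}
    (hc : ContinuousWithinAt ζ s x) (hx : ζ x ∈ (extChartAt 𝓘(ℝ, EZ) z₀).source)
    (hD : HasFDerivWithinAt (fun y => extChartAt 𝓘(ℝ, EZ) z₀ (ζ y)) D s x) :
    F.HasForm s ζ x ((F.A z₀ (extChartAt 𝓘(ℝ, EZ) z₀ (ζ x))).comp D) := by
  set χ := extChartAt 𝓘(ℝ, EZ) z₀ with hχ
  have h1 := hasMFDerivAt_extChartAt_symm (z₀ := z₀) (χ.map_source hx)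
  have h2 : HasMFDerivWithinAt 𝓘(ℝ, E') 𝓘(ℝ, EZ) (fun y => χ (ζ y)) s x D := hD.hasMFDerivWithinAt
  have h3 := h1.comp_hasMFDerivWithinAt x h2
  have h4 : HasMFDerivWithinAt 𝓘(ℝ, E') 𝓘(ℝ, EZ) ζ s x
      ((mfderiv 𝓘(ℝ, EZ) 𝓘(ℝ, EZ) χ.symm (χ (ζ x)) : EZ →L[ℝ] EZ).comp D) := by
    refine h3.congr_of_eventuallyEq ?_ ?_
    · filter_upwards [hc ((isOpen_extChartAt_source z₀).mem_nhds hx)] with y hy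
      exact (χ.left_inv hy).symm
    · exact (χ.left_inv hx).symm
  refine ⟨_, h4, ?_⟩
  refine ContinuousLinearMap.ext fun v => ?_
  change F.alpha (ζ x) ((mfderiv 𝓘(ℝ, EZ) 𝓘(ℝ, EZ) χ.symm (χ (ζ x)) : EZ →L[ℝ] EZ) (D v)) =
    F.alpha (χ.symm (χ (ζ x))) ((mfderiv 𝓘(ℝ, EZ) 𝓘(ℝ, EZ) χ.symm (χ (ζ x)) : EZ →L[ℝ] EZ) (D v))
  rw [χ.left_inv hx]

variable {F} in
lemma HasForm.unique {s : Set E'} {ζ : E' → Z} {x : E'} {μ ν : E' →L[ℝ] ℝ}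
    (hs : UniqueDiffWithinAt ℝ s x) (h : F.HasForm s ζ x μ) (h' : F.HasForm s ζ x ν) : μ = ν := by
  obtain ⟨D, hD, rfl⟩ := h
  obtain ⟨D', hD', rfl⟩ := h'
  have := hs.eq (hasFDerivWithinAt_extChartAt_comp hD rfl) (hasFDerivWithinAt_extChartAt_comp hD' rfl)
  rw [this]

variable {F} in
lemma HasForm.comp {E'' : Type*} [NormedAddCommGroup E''] [NormedSpace ℝ E''] {s : Set E'}
    {t : Set E''} {ζ : E' → Z} {f : E'' → E'} {x : E''} {μ : E' →L[ℝ] ℝ} {D : E'' →L[ℝ] E'}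
    (h : F.HasForm s ζ (f x) μ) (hf : HasFDerivWithinAt f D t x) (hst : MapsTo f t s) :
    F.HasForm t (fun y => ζ (f y)) x (μ.comp D) := by
  obtain ⟨L, hL, rfl⟩ := h
  exact ⟨_, hL.comp x hf.hasMFDerivWithinAt hst, rfl⟩

lemma contDiffAt_A (z₀ : Z) : ContDiffAt ℝ ∞ (F.A z₀) (extChartAt 𝓘(ℝ, EZ) z₀ z₀) := by
  set χ := extChartAt 𝓘(ℝ, EZ) z₀ with hχ
  have h1 := (contMDiffAt_hom_bundle (IM := 𝓘(ℝ, EZ)) (IB := 𝓘(ℝ, EZ)) (n := ∞) (F₁ := EZ)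
    (E₁ := (TangentSpace 𝓘(ℝ, EZ) : Z → Type _)) (F₂ := ℝ) (E₂ := Bundle.Trivial Z ℝ)
    (fun z => TotalSpace.mk' (EZ →L[ℝ] ℝ) z (F.alpha z)) (x₀ := z₀)).1 (F.alpha_smooth z₀)
  have h2 := h1.2
  have hsymm : ContMDiffAt 𝓘(ℝ, EZ) 𝓘(ℝ, EZ) ∞ χ.symm (χ z₀) :=
    (contMDiffOn_extChartAt_symm (I := 𝓘(ℝ, EZ)) (n := ∞) z₀).contMDiffAt
      (extChartAt_target_mem_nhds z₀)
  have h0 : χ.symm (χ z₀) = z₀ := extChartAt_to_inv z₀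
  have h3 : ContMDiffAt 𝓘(ℝ, EZ) 𝓘(ℝ, EZ →L[ℝ] ℝ) ∞ (fun x => ContinuousLinearMap.inCoordinates EZ
      (TangentSpace 𝓘(ℝ, EZ) : Z → Type _) ℝ (Bundle.Trivial Z ℝ) z₀ (χ.symm x) z₀ (χ.symm x)
      (F.alpha (χ.symm x))) (χ z₀) := by
    refine ContMDiffAt.comp (I' := 𝓘(ℝ, EZ)) (g := fun z => ContinuousLinearMap.inCoordinates EZ
      (TangentSpace 𝓘(ℝ, EZ) : Z → Type _) ℝ (Bundle.Trivial Z ℝ) z₀ z z₀ z (F.alpha z))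
      (χ z₀) ?_ hsymm
    rw [h0]
    exact h2
  rw [← contMDiffAt_iff_contDiffAt]
  refine h3.congr_of_eventuallyEq ?_
  filter_upwards [extChartAt_target_mem_nhds (I := 𝓘(ℝ, EZ)) z₀] with x hx
  have hxs : χ.symm x ∈ (chartAt EZ z₀).source := by
    have := χ.map_target hx
    rwa [hχ, extChartAt_source] at this
  refine ContinuousLinearMap.ext fun v => ?_
  have h4 := TangentBundle.symmL_trivializationAt (I := 𝓘(ℝ, EZ)) hxs
  have h5 : χ (χ.symm x) = x := χ.right_inv hx
  simp only [ContinuousLinearMap.inCoordinates, Bundle.Trivial.fiberBundle_trivializationAt',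
    Bundle.Trivial.continuousLinearMapAt_trivialization]
  change F.alpha (χ.symm x) ((mfderiv 𝓘(ℝ, EZ) 𝓘(ℝ, EZ) χ.symm x : EZ →L[ℝ] EZ) v) =
    F.alpha (χ.symm x) (Trivialization.symmL ℝ (trivializationAt EZ (TangentSpace 𝓘(ℝ, EZ)) z₀)
      (χ.symm x) v)
  rw [h4, ← hχ, h5]
  simp only [modelWithCornersSelf_coe, range_id, mfderivWithin_univ]
  rfl

/-- A local gauge: a local section `τ` of the bundle in a chart of the base, in which the connection
form becomes a one-form `B` with exterior derivative `ω`. -/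
theorem exists_gauge [T2Space Z] (z₀ : Z) : ∃ (τ : EY → Z) (B : EY → EY →L[ℝ] ℝ),
    τ (extChartAt 𝓘(ℝ, EY) (F.p z₀) (F.p z₀)) = z₀ ∧
    ContMDiffAt 𝓘(ℝ, EY) 𝓘(ℝ, EZ) ∞ τ (extChartAt 𝓘(ℝ, EY) (F.p z₀) (F.p z₀)) ∧
    ContDiffAt ℝ ∞ B (extChartAt 𝓘(ℝ, EY) (F.p z₀) (F.p z₀)) ∧
    ∀ᶠ η in 𝓝 (extChartAt 𝓘(ℝ, EY) (F.p z₀) (F.p z₀)),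
      F.p (τ η) = (extChartAt 𝓘(ℝ, EY) (F.p z₀)).symm η ∧ F.HasForm univ τ η (B η) ∧
      ∀ (D : EY →L[ℝ] EY), HasMFDerivAt 𝓘(ℝ, EY) 𝓘(ℝ, EY) (extChartAt 𝓘(ℝ, EY) (F.p z₀)).symm η D →
        ∀ v w, fderiv ℝ B η v w - fderiv ℝ B η w v =
          F.omega ((extChartAt 𝓘(ℝ, EY) (F.p z₀)).symm η) (D v) (D w) := by
  obtain ⟨Θ, σ, -, hσ, -, hσ0, hpσ, -⟩ := F.exists_trivialization z₀
  set χ := extChartAt 𝓘(ℝ, EY) (F.p z₀) with hχ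
  have hsymm : ContMDiffAt 𝓘(ℝ, EY) 𝓘(ℝ, EY) ∞ χ.symm (χ (F.p z₀)) :=
    (contMDiffOn_extChartAt_symm (I := 𝓘(ℝ, EY)) (n := ∞) _).contMDiffAt
      (extChartAt_target_mem_nhds _)
  have h0 : χ.symm (χ (F.p z₀)) = F.p z₀ := extChartAt_to_inv _
  set τ : EY → Z := fun η => σ (χ.symm η) with hτ
  have hτ0 : τ (χ (F.p z₀)) = z₀ := by simp only [hτ, h0, hσ0]
  have hτS : ContMDiffAt 𝓘(ℝ, EY) 𝓘(ℝ, EZ) ∞ τ (χ (F.p z₀)) := by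
    refine ContMDiffAt.comp (I' := 𝓘(ℝ, EY)) (g := σ) _ ?_ hsymm
    rw [h0]; exact hσ
  set κ := extChartAt 𝓘(ℝ, EZ) z₀ with hκ
  have hκτS : ContDiffAt ℝ ∞ (fun η => κ (τ η)) (χ (F.p z₀)) := by
    rw [← contMDiffAt_iff_contDiffAt]
    refine ContMDiffAt.comp (I' := 𝓘(ℝ, EZ)) (g := κ) _ ?_ hτS
    rw [hτ0]; exact contMDiffAt_extChartAt
  have hκτ0 : κ (τ (χ (F.p z₀))) = κ z₀ := by rw [hτ0]
  refine ⟨τ, fun η => (F.A z₀ (κ (τ η))).comp (fderiv ℝ (fun η => κ (τ η)) η), hτ0, hτS, ?_, ?_⟩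
  · refine ContDiffAt.clm_comp ?_ (hκτS.fderiv_right (by simp))
    refine ContDiffAt.comp (g := F.A z₀) (χ (F.p z₀)) ?_ hκτS
    rw [hκτ0]; exact F.contDiffAt_A z₀
  · have hsrc : ∀ᶠ η in 𝓝 (χ (F.p z₀)), τ η ∈ κ.source := by
      have := hτS.continuousAt.tendsto
      rw [hτ0] at this
      exact this (extChartAt_source_mem_nhds _)
    have hform : ∀ᶠ η in 𝓝 (χ (F.p z₀)), ContMDiffAt 𝓘(ℝ, EY) 𝓘(ℝ, EZ) 2 τ η ∧
        F.HasForm univ τ η ((F.A z₀ (κ (τ η))).comp (fderiv ℝ (fun η => κ (τ η)) η)) := by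
      have h2 : ∀ᶠ η in 𝓝 (χ (F.p z₀)), ContMDiffAt 𝓘(ℝ, EY) 𝓘(ℝ, EZ) 2 τ η := by
        have := (contMDiffAt_iff_contMDiffAt_nhds (n := 2) (by simp)).1 (hτS.of_le two_le_infty)
        exact this
      filter_upwards [hsrc, h2, hκτS.of_le (m := 1) (by exact_mod_cast le_top) |>.eventually (by simp)] with η h1 h2 h3
      refine ⟨h2, F.hasForm_of_chart h2.continuousAt.continuousWithinAt h1 ?_⟩
      exact ((h3.differentiableAt (by simp)).hasFDerivAt).hasFDerivWithinAt
    have hpτ : ∀ᶠ η in 𝓝 (χ (F.p z₀)), F.p (τ η) = χ.symm η := by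
      have h1 := hsymm.continuousAt.tendsto
      rw [h0] at h1
      exact h1.eventually hpσ
    filter_upwards [hpτ.eventually_nhds, hform.eventually_nhds] with η h1 h2
    refine ⟨h1.self_of_nhds, h2.self_of_nhds.2, ?_⟩
    intro D hD v w
    -- compute in the chart at `τ η`
    set z := τ η with hz
    set ξ := extChartAt 𝓘(ℝ, EZ) z with hξ
    have hτη := h2.self_of_nhds.1
    have hfS : ContDiffAt ℝ 2 (fun y => ξ (τ y)) η := by
      rw [← contMDiffAt_iff_contDiffAt]
      refine ContMDiffAt.comp (I' := 𝓘(ℝ, EZ)) (g := ξ) _ ?_ hτη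
      exact contMDiffAt_extChartAt
    have hBeq : (fun η => (F.A z₀ (κ (τ η))).comp (fderiv ℝ (fun η => κ (τ η)) η)) =ᶠ[𝓝 η]
        fun y => (F.A z (ξ (τ y))).comp (fderiv ℝ (fun y => ξ (τ y)) y) := by
      filter_upwards [h2, hfS.eventually (by simp), hτη.continuousAt.eventually
        (extChartAt_source_mem_nhds (I := 𝓘(ℝ, EZ)) (τ η))] with y hy1 hy2 hy3
      refine hy1.2.unique uniqueDiffWithinAt_univ (F.hasForm_of_chart (z₀ := z)
        hy1.2.continuousWithinAt hy3 ?_)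
      exact ((hy2.differentiableAt (by simp)).hasFDerivAt).hasFDerivWithinAt
    obtain ⟨T, hT⟩ : ∃ T : EY →L[ℝ] EZ, HasMFDerivAt 𝓘(ℝ, EY) 𝓘(ℝ, EZ) τ η T :=
      ⟨_, (hτη.mdifferentiableAt (by simp)).hasMFDerivAt⟩
    have hTf : fderiv ℝ (fun y => ξ (τ y)) η = T := (hasFDerivAt_extChartAt_comp hT rfl).fderiv
    have hpT : (F.dp z).comp T = D := by
      have e1 := (F.hasMFDerivAt_p z).comp η hT
      have e2 : HasMFDerivAt 𝓘(ℝ, EY) 𝓘(ℝ, EY) (F.p ∘ τ) η D := hD.congr_of_eventuallyEq h1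
      exact hasMFDerivAt_unique e1 e2
    have hAd : DifferentiableAt ℝ (F.A z) (ξ (τ η)) := (F.contDiffAt_A z).differentiableAt (by simp)
    rw [hBeq.fderiv_eq, fderiv_pullback_antisymm (A := F.A z) (f := fun y => ξ (τ y)) hAd hfS, hTf]
    have hcurv := F.curvature z (T v) (T w)
    rw [h1.self_of_nhds] at hcurv
    have hid : mfderiv 𝓘(ℝ, EZ) 𝓘(ℝ, EZ) ξ z = ContinuousLinearMap.id ℝ EZ :=
      mfderiv_extChartAt_self
    have hL : extDerivOne F.alpha z (T v) (T w) =
        fderiv ℝ (F.A z) (ξ z) (T v) (T w) - fderiv ℝ (F.A z) (ξ z) (T w) (T v) := by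
      simp only [extDerivOne]
      rw [← hξ, hid]
      rfl
    rw [← hz, ← hL, hcurv, ← hpT]
    rfl

end CircleFibered

end ChartForm

end

section

section Gauge

lemma abs_bilin_sub_le {E G : Type*} [NormedAddCommGroup E] [NormedSpace ℝ E]
    [NormedAddCommGroup G] [NormedSpace ℝ G] {N : G →L[ℝ] G →L[ℝ] ℝ} {M : ℝ} (hN : ‖N‖ ≤ M)
    (V : E →L[ℝ] G) (a b : E) :
    |N (V a) (V b) - N (V b) (V a)| ≤ 2 * M * ‖V‖ ^ 2 * ‖a‖ * ‖b‖ := by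
  have key : ∀ a b : E, |N (V a) (V b)| ≤ M * ‖V‖ ^ 2 * ‖a‖ * ‖b‖ := by
    intro a b
    have h1 : |N (V a) (V b)| ≤ ‖N‖ * ‖V a‖ * ‖V b‖ := N.le_opNorm₂ _ _
    have h2 : ‖V a‖ ≤ ‖V‖ * ‖a‖ := V.le_opNorm a
    have h3 : ‖V b‖ ≤ ‖V‖ * ‖b‖ := V.le_opNorm b
    have hM : 0 ≤ M := (norm_nonneg N).trans hN
    calc |N (V a) (V b)| ≤ ‖N‖ * ‖V a‖ * ‖V b‖ := h1
      _ ≤ M * (‖V‖ * ‖a‖) * (‖V‖ * ‖b‖) := by gcongr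
      _ = _ := by ring
  refine (abs_sub _ _).trans ?_
  have h1 := key a b
  have h2 := key b a
  calc _ ≤ M * ‖V‖ ^ 2 * ‖a‖ * ‖b‖ + M * ‖V‖ ^ 2 * ‖b‖ * ‖a‖ := add_le_add h1 h2
    _ = _ := by ring

variable {EY Y EZ Z : Type*}
  [NormedAddCommGroup EY] [NormedSpace ℝ EY] [FiniteDimensional ℝ EY]
  [TopologicalSpace Y] [ChartedSpace EY Y] [IsManifold 𝓘(ℝ, EY) ∞ Y]
  [NormedAddCommGroup EZ] [NormedSpace ℝ EZ] [FiniteDimensional ℝ EZ]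
  [TopologicalSpace Z] [ChartedSpace EZ Z] [IsManifold 𝓘(ℝ, EZ) ∞ Z] [MulAction Circle Z]
  (F : CircleFibered EY Y EZ Z)

namespace CircleFibered

variable {E' : Type*} [NormedAddCommGroup E'] [NormedSpace ℝ E']

/-- A local gauge in the chart of the base at `y₀`, with bounds by `M`, is available at `y`. -/
structure GaugeAt (τ : EY → Z) (B : EY → EY →L[ℝ] ℝ) (M : ℝ) (y₀ y : Y) : Prop where
  mem_source : y ∈ (extChartAt 𝓘(ℝ, EY) y₀).source
  p_eq : F.p (τ (extChartAt 𝓘(ℝ, EY) y₀ y)) = y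
  form : F.HasForm univ τ (extChartAt 𝓘(ℝ, EY) y₀ y) (B (extChartAt 𝓘(ℝ, EY) y₀ y))
  contDiffAt : ContDiffAt ℝ 1 B (extChartAt 𝓘(ℝ, EY) y₀ y)
  norm_le : ‖B (extChartAt 𝓘(ℝ, EY) y₀ y)‖ ≤ M
  norm_fderiv_le : ‖fderiv ℝ B (extChartAt 𝓘(ℝ, EY) y₀ y)‖ ≤ M
  curvature : ∀ D : EY →L[ℝ] EY,
    HasMFDerivAt 𝓘(ℝ, EY) 𝓘(ℝ, EY) (extChartAt 𝓘(ℝ, EY) y₀).symm (extChartAt 𝓘(ℝ, EY) y₀ y) D →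
      ∀ v w, fderiv ℝ B (extChartAt 𝓘(ℝ, EY) y₀ y) v w -
        fderiv ℝ B (extChartAt 𝓘(ℝ, EY) y₀ y) w v = F.omega y (D v) (D w)

theorem exists_gaugeAt [T2Space Z] (y₀ : Y) : ∃ (τ : EY → Z) (B : EY → EY →L[ℝ] ℝ) (M : ℝ),
    ContMDiffAt 𝓘(ℝ, EY) 𝓘(ℝ, EZ) ∞ τ (extChartAt 𝓘(ℝ, EY) y₀ y₀) ∧
    ContDiffAt ℝ ∞ B (extChartAt 𝓘(ℝ, EY) y₀ y₀) ∧
    ∀ᶠ y in 𝓝 y₀, F.GaugeAt τ B M y₀ y := by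
  obtain ⟨z₀, rfl⟩ := F.p_surjective y₀
  obtain ⟨τ, B, -, hτ, hB, h⟩ := F.exists_gauge z₀
  set χ := extChartAt 𝓘(ℝ, EY) (F.p z₀) with hχ
  set x₀ := χ (F.p z₀) with hx₀
  refine ⟨τ, B, max (‖B x₀‖ + 1) (‖fderiv ℝ B x₀‖ + 1), hτ, hB, ?_⟩
  have hcont : ContinuousAt χ (F.p z₀) := continuousAt_extChartAt _
  have h1 : ∀ᶠ x in 𝓝 x₀, ‖B x‖ < ‖B x₀‖ + 1 :=
    hB.continuousAt.norm.eventually (gt_mem_nhds (by linarith))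
  have h2 : ∀ᶠ x in 𝓝 x₀, ‖fderiv ℝ B x‖ < ‖fderiv ℝ B x₀‖ + 1 :=
    (hB.fderiv_right (m := ∞) (by simp)).continuousAt.norm.eventually (gt_mem_nhds (by linarith))
  have h3 : ∀ᶠ x in 𝓝 x₀, ContDiffAt ℝ 1 B x :=
    (hB.of_le (m := 1) (by exact_mod_cast le_top)).eventually (by simp)
  filter_upwards [hcont.eventually h, hcont.eventually h1, hcont.eventually h2,
    hcont.eventually h3, extChartAt_source_mem_nhds (I := 𝓘(ℝ, EY)) (F.p z₀)]
    with y hy hy1 hy2 hy3 hys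
  have hinv : χ.symm (χ y) = y := χ.left_inv hys
  refine ⟨hys, hy.1.trans hinv, hy.2.1, hy3, hy1.le.trans (le_max_left _ _),
    hy2.le.trans (le_max_right _ _), fun D hD v w => ?_⟩
  have := hy.2.2 D hD v w
  rw [hinv] at this
  exact this

namespace GaugeAt

variable {F} {τ : EY → Z} {B : EY → EY →L[ℝ] ℝ} {M : ℝ} {y₀ : Y}

/-- The form of the gauge section along a map to the base. -/
lemma hasForm {u : E' → Y} {z : E'} (h : F.GaugeAt τ B M y₀ (u z)) {s : Set E'} {D : E' →L[ℝ] EY}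
    (hD : HasFDerivWithinAt (fun w => extChartAt 𝓘(ℝ, EY) y₀ (u w)) D s z) :
    F.HasForm s (fun w => τ (extChartAt 𝓘(ℝ, EY) y₀ (u w))) z
      ((B (extChartAt 𝓘(ℝ, EY) y₀ (u z))).comp D) :=
  HasForm.comp h.form hD (mapsTo_univ _ _)

lemma contDiffWithinAt_chart {u : E' → Y} {z : E'} (h : F.GaugeAt τ B M y₀ (u z)) {s : Set E'}
    {n : ℕ∞ω} (hn : n ≤ ∞) (hu : ContMDiffWithinAt 𝓘(ℝ, E') 𝓘(ℝ, EY) n u s z) :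
    ContDiffWithinAt ℝ n (fun w => extChartAt 𝓘(ℝ, EY) y₀ (u w)) s z := by
  rw [← contMDiffWithinAt_iff_contDiffWithinAt]
  have h1 : ContMDiffAt 𝓘(ℝ, EY) 𝓘(ℝ, EY) n (extChartAt 𝓘(ℝ, EY) y₀) (u z) := by
    have := h.mem_source
    rw [extChartAt_source] at this
    exact (contMDiffAt_extChartAt' (I := 𝓘(ℝ, EY)) (n := ∞) this).of_le hn
  exact h1.comp_contMDiffWithinAt z hu

lemma contDiffAt_chart {u : E' → Y} {z : E'} (h : F.GaugeAt τ B M y₀ (u z))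
    {n : ℕ∞ω} (hn : n ≤ ∞) (hu : ContMDiffAt 𝓘(ℝ, E') 𝓘(ℝ, EY) n u z) :
    ContDiffAt ℝ n (fun w => extChartAt 𝓘(ℝ, EY) y₀ (u w)) z :=
  h.contDiffWithinAt_chart hn hu

/-- The pull-back of the symplectic form in terms of the chart. -/
lemma omega_eq {u : E' → Y} {z : E'} (h : F.GaugeAt τ B M y₀ (u z))
    (hu : ContMDiffAt 𝓘(ℝ, E') 𝓘(ℝ, EY) 2 u z) (a b : E') :
    F.omega (u z) (mfderiv 𝓘(ℝ, E') 𝓘(ℝ, EY) u z a) (mfderiv 𝓘(ℝ, E') 𝓘(ℝ, EY) u z b) =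
      fderiv ℝ B (extChartAt 𝓘(ℝ, EY) y₀ (u z))
          (fderiv ℝ (fun w => extChartAt 𝓘(ℝ, EY) y₀ (u w)) z a)
          (fderiv ℝ (fun w => extChartAt 𝓘(ℝ, EY) y₀ (u w)) z b) -
        fderiv ℝ B (extChartAt 𝓘(ℝ, EY) y₀ (u z))
          (fderiv ℝ (fun w => extChartAt 𝓘(ℝ, EY) y₀ (u w)) z b)
          (fderiv ℝ (fun w => extChartAt 𝓘(ℝ, EY) y₀ (u w)) z a) := by
  set χ := extChartAt 𝓘(ℝ, EY) y₀ with hχ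
  have hsymm : ContMDiffAt 𝓘(ℝ, EY) 𝓘(ℝ, EY) ∞ χ.symm (χ (u z)) :=
    (contMDiffOn_extChartAt_symm (I := 𝓘(ℝ, EY)) (n := ∞) _).contMDiffAt
      (extChartAt_target_mem_nhds' (χ.map_source h.mem_source))
  obtain ⟨D, hD⟩ : ∃ D : EY →L[ℝ] EY, HasMFDerivAt 𝓘(ℝ, EY) 𝓘(ℝ, EY) χ.symm (χ (u z)) D :=
    ⟨_, (hsymm.mdifferentiableAt (by simp)).hasMFDerivAt⟩
  rw [h.curvature D hD]
  obtain ⟨V, hV⟩ : ∃ V : E' →L[ℝ] EY, fderiv ℝ (fun w => χ (u w)) z = V := ⟨_, rfl⟩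
  have hv : HasFDerivAt (fun w => χ (u w)) V z := by
    rw [← hV]
    exact ((h.contDiffAt_chart two_le_infty hu).differentiableAt (by simp)).hasFDerivAt
  have h1 : HasMFDerivAt 𝓘(ℝ, E') 𝓘(ℝ, EY) u z (D.comp V) := by
    have h2 := HasMFDerivAt.comp (g := χ.symm) (f := fun w => χ (u w)) z hD hv.hasMFDerivAt
    refine h2.congr_of_eventuallyEq ?_
    filter_upwards [hu.continuousAt.eventually ((isOpen_extChartAt_source (I := 𝓘(ℝ, EY)) y₀).mem_nhds
      h.mem_source)] with w hw
    exact (χ.left_inv hw).symm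
  rw [hV]
  have h3 := h1.mfderiv
  have h4 : ∀ a : E', (mfderiv 𝓘(ℝ, E') 𝓘(ℝ, EY) u z a : EY) = D (V a) := fun a => by
    have := DFunLike.congr_fun h3 a
    exact this
  have e : ∀ x x' y y' : EY, x = x' → y = y' → F.omega (u z) x y = F.omega (u z) x' y' := by
    rintro x _ y _ rfl rfl; rfl
  exact e _ _ _ _ (h4 a) (h4 b)

lemma omega_eq_fderiv {u : E' → Y} {z : E'} (h : F.GaugeAt τ B M y₀ (u z))
    (hu : ContMDiffAt 𝓘(ℝ, E') 𝓘(ℝ, EY) 2 u z) (a b : E') :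
    F.omega (u z) (mfderiv 𝓘(ℝ, E') 𝓘(ℝ, EY) u z a) (mfderiv 𝓘(ℝ, E') 𝓘(ℝ, EY) u z b) =
      fderiv ℝ (fun w => (B (extChartAt 𝓘(ℝ, EY) y₀ (u w))).comp
        (fderiv ℝ (fun w => extChartAt 𝓘(ℝ, EY) y₀ (u w)) w)) z a b -
      fderiv ℝ (fun w => (B (extChartAt 𝓘(ℝ, EY) y₀ (u w))).comp
        (fderiv ℝ (fun w => extChartAt 𝓘(ℝ, EY) y₀ (u w)) w)) z b a := by
  rw [h.omega_eq hu, fderiv_pullback_antisymm (A := B)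
    (f := fun w => extChartAt 𝓘(ℝ, EY) y₀ (u w)) (h.contDiffAt.differentiableAt (by simp))
    (h.contDiffAt_chart two_le_infty hu)]

lemma abs_omega_le {u : E' → Y} {z : E'} (h : F.GaugeAt τ B M y₀ (u z))
    (hu : ContMDiffAt 𝓘(ℝ, E') 𝓘(ℝ, EY) 2 u z) (a b : E') :
    |F.omega (u z) (mfderiv 𝓘(ℝ, E') 𝓘(ℝ, EY) u z a) (mfderiv 𝓘(ℝ, E') 𝓘(ℝ, EY) u z b)| ≤
      2 * M * ‖fderiv ℝ (fun w => extChartAt 𝓘(ℝ, EY) y₀ (u w)) z‖ ^ 2 * ‖a‖ * ‖b‖ := by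
  rw [h.omega_eq hu]
  exact abs_bilin_sub_le h.norm_fderiv_le _ a b

end GaugeAt

end CircleFibered

end Gauge

end

section

/-! ### Flat lifts -/

section Flat

variable {EY Y EZ Z : Type*}
  [NormedAddCommGroup EY] [NormedSpace ℝ EY] [FiniteDimensional ℝ EY]
  [TopologicalSpace Y] [ChartedSpace EY Y] [IsManifold 𝓘(ℝ, EY) ∞ Y]
  [NormedAddCommGroup EZ] [NormedSpace ℝ EZ] [FiniteDimensional ℝ EZ]
  [TopologicalSpace Z] [ChartedSpace EZ Z] [IsManifold 𝓘(ℝ, EZ) ∞ Z] [MulAction Circle Z]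
  (F : CircleFibered EY Y EZ Z)

namespace CircleFibered

/-- `ζ` lifts `u` over `W` and pulls the connection form back to `η`. -/
def IsFlat (u : ℂ → Y) (η : ℂ → ℂ →L[ℝ] ℝ) (W : Set ℂ) (ζ : ℂ → Z) : Prop :=
  ∀ z ∈ W, F.p (ζ z) = u z ∧ F.HasForm univ ζ z (η z)

variable {F} {u : ℂ → Y} {η : ℂ → ℂ →L[ℝ] ℝ}

lemma IsFlat.mono {W W' : Set ℂ} {ζ : ℂ → Z} (h : F.IsFlat u η W ζ) (hW : W' ⊆ W) :
    F.IsFlat u η W' ζ := fun z hz => h z (hW hz)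

lemma IsFlat.const_smul {W : Set ℂ} {ζ : ℂ → Z} (h : F.IsFlat u η W ζ) (c : Circle) :
    F.IsFlat u η W (fun z => c • ζ z) := fun z hz =>
  ⟨(F.p_smul _ _).trans (h z hz).1, (h z hz).2.const_smul c⟩

/-- Flat lifts over a connected open set are unique up to a constant rotation. -/
theorem IsFlat.exists_eq_smul [T2Space Z] {W : Set ℂ} (hW : IsOpen W) (hWc : IsPreconnected W)
    {ζ₁ ζ₂ : ℂ → Z} (h₁ : F.IsFlat u η W ζ₁) (h₂ : F.IsFlat u η W ζ₂) :
    ∃ c : Circle, ∀ z ∈ W, ζ₁ z = c • ζ₂ z := by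
  have hex : ∀ z, ∃ c : Circle, z ∈ W → ζ₁ z = c • ζ₂ z := by
    intro z
    by_cases hz : z ∈ W
    · obtain ⟨c, hc⟩ := (F.p_fiber (ζ₂ z) (ζ₁ z)).1 ((h₂ z hz).1.trans (h₁ z hz).1.symm)
      exact ⟨c, fun _ => hc.symm⟩
    · exact ⟨1, fun h => absurd h hz⟩
  choose c hc using hex
  have hd : ∀ z ∈ W, HasFDerivAt (fun y => (c y : ℂ)) (0 : ℂ →L[ℝ] ℂ) z := by
    intro z hz
    have := F.hasFDerivWithinAt_ratio ((h₁ z hz).2.mono (subset_univ W))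
      ((h₂ z hz).2.mono (subset_univ W)) (c := c) (fun y hy => hc y hy) hz
      (hW.uniqueDiffWithinAt hz)
    rw [sub_self] at this
    simpa using this.hasFDerivAt (hW.mem_nhds hz)
  obtain ⟨a, ha⟩ := hW.exists_is_const_of_fderiv_eq_zero hWc
    (fun z hz => (hd z hz).differentiableAt.differentiableWithinAt) (fun z hz => (hd z hz).fderiv)
  rcases W.eq_empty_or_nonempty with rfl | ⟨z₀, hz₀⟩
  · exact ⟨1, by simp⟩
  · refine ⟨c z₀, fun z hz => ?_⟩
    have : c z = c z₀ := Subtype.ext ((ha z hz).trans (ha z₀ hz₀).symm)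
    rw [← this]
    exact hc z hz

lemma contDiffAt_infty_of_hasFDerivAt {E G : Type*} [NormedAddCommGroup E] [NormedSpace ℝ E]
    [NormedAddCommGroup G] [NormedSpace ℝ G] {f : E → G} {f' : E → E →L[ℝ] G} {x : E}
    (hf : ∀ᶠ y in 𝓝 x, HasFDerivAt f (f' y) y) (hf' : ContDiffAt ℝ ∞ f' x) :
    ContDiffAt ℝ ∞ f x := by
  refine contDiffAt_infty.2 fun n => ?_
  have : ContDiffAt ℝ (n + 1) f x :=
    contDiffAt_succ_iff_hasFDerivAt.2 ⟨f', ⟨_, hf, fun y hy => hy⟩, contDiffAt_infty.1 hf' n⟩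
  exact this.of_le (by exact_mod_cast Nat.le_succ n)

/-- Local existence of flat lifts. -/
theorem exists_isFlat_nhds [T2Space Z] {U : Set ℂ} (hU : IsOpen U)
    (hu : ∀ z ∈ U, ContMDiffAt 𝓘(ℝ, ℂ) 𝓘(ℝ, EY) ∞ u z) (hη : ∀ z ∈ U, ContDiffAt ℝ ∞ η z)
    (hcurv : ∀ z ∈ U, ∀ a b : ℂ, fderiv ℝ η z a b - fderiv ℝ η z b a =
      F.omega (u z) (mfderiv 𝓘(ℝ, ℂ) 𝓘(ℝ, EY) u z a) (mfderiv 𝓘(ℝ, ℂ) 𝓘(ℝ, EY) u z b))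
    {z₀ : ℂ} (hz₀ : z₀ ∈ U) : ∃ r > 0, ∃ ζ : ℂ → Z, Metric.ball z₀ r ⊆ U ∧
      F.IsFlat u η (Metric.ball z₀ r) ζ ∧ ContMDiffAt 𝓘(ℝ, ℂ) 𝓘(ℝ, EZ) ∞ ζ z₀ := by
  obtain ⟨τ, B, M, hτ, hB, hg⟩ := F.exists_gaugeAt (u z₀)
  have hev : ∀ᶠ z in 𝓝 z₀, z ∈ U ∧ F.GaugeAt τ B M (u z₀) (u z) :=
    (hU.eventually_mem hz₀).and ((hu z₀ hz₀).continuousAt.eventually hg)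
  obtain ⟨r, hr, hball⟩ := Metric.eventually_nhds_iff_ball.1 hev
  set v : ℂ → EY := fun z => extChartAt 𝓘(ℝ, EY) (u z₀) (u z) with hv
  set lam : ℂ → ℂ →L[ℝ] ℝ := fun z => (B (v z)).comp (fderiv ℝ v z) with hlam
  have hvs : ∀ z ∈ Metric.ball z₀ r, ContDiffAt ℝ ∞ v z := fun z hz =>
    (hball z hz).2.contDiffAt_chart le_rfl (hu z (hball z hz).1)
  have hlamd : ∀ z ∈ Metric.ball z₀ r, DifferentiableAt ℝ lam z := by
    intro z hz
    have h1 : DifferentiableAt ℝ (fun z => B (v z)) z :=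
      ((hball z hz).2.contDiffAt.differentiableAt (by simp)).comp z
        ((hvs z hz).differentiableAt (by simp))
    have h2 : DifferentiableAt ℝ (fderiv ℝ v) z :=
      ((hvs z hz).fderiv_right (m := ∞) (by simp)).differentiableAt (by simp)
    exact h1.clm_comp h2
  have hsymm : ∀ z ∈ Metric.ball z₀ r, ∀ a b, fderiv ℝ (fun z => η z - lam z) z a b =
      fderiv ℝ (fun z => η z - lam z) z b a := by
    intro z hz a b
    have h1 := (hball z hz).2.omega_eq_fderiv ((hu z (hball z hz).1).of_le two_le_infty) a b
    rw [← hcurv z (hball z hz).1 a b] at h1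
    rw [fderiv_fun_sub ((hη z (hball z hz).1).differentiableAt (by simp)) (hlamd z hz)]
    change fderiv ℝ η z a b - fderiv ℝ lam z a b = fderiv ℝ η z b a - fderiv ℝ lam z b a
    have h2 : fderiv ℝ η z a b - fderiv ℝ η z b a = fderiv ℝ lam z a b - fderiv ℝ lam z b a := h1
    linarith
  obtain ⟨ψ, hψ⟩ := (convex_ball z₀ r).exists_forall_hasFDerivAt_of_fderiv_symmetric
    Metric.isOpen_ball (show DifferentiableOn ℝ (fun z => η z - lam z) _ from fun z hz => (((hη z (hball z hz).1).differentiableAt (by simp)).sub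
      (hlamd z hz)).differentiableWithinAt) hsymm
  refine ⟨r, hr, fun z => Circle.exp (ψ z) • τ (v z), fun z hz => (hball z hz).1, ?_, ?_⟩
  · intro z hz
    refine ⟨(F.p_smul _ _).trans (hball z hz).2.p_eq, ?_⟩
    have h1 := (hball z hz).2.hasForm (s := univ) (u := u)
      ((hvs z hz).differentiableAt (by simp)).hasFDerivAt.hasFDerivWithinAt
    have h2 := h1.exp_smul (hψ z hz).hasFDerivWithinAt
    rwa [show (B (extChartAt 𝓘(ℝ, EY) (u z₀) (u z))).comp (fderiv ℝ v z) + (η z - lam z) = η z from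
      add_sub_cancel _ _] at h2
  · have hz0 := Metric.mem_ball_self hr (x := z₀)
    have hlam0 : ContDiffAt ℝ ∞ lam z₀ := by
      refine ContDiffAt.clm_comp ?_ ((hvs z₀ hz0).fderiv_right (by simp))
      exact ContDiffAt.comp (g := B) z₀ hB (hvs z₀ hz0)
    have hψs : ContDiffAt ℝ ∞ ψ z₀ := contDiffAt_infty_of_hasFDerivAt
      (eventually_of_mem (Metric.ball_mem_nhds z₀ hr) hψ) ((hη z₀ hz₀).sub hlam0)
    have h1 : ContMDiffAt 𝓘(ℝ, ℂ) 𝓘(ℝ, EZ) ∞ (fun z => τ (v z)) z₀ :=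
      ContMDiffAt.comp (I' := 𝓘(ℝ, EY)) (g := τ) z₀ hτ (hvs z₀ hz0).contMDiffAt
    exact ContMDiffAt.comp (I' := 𝓘(ℝ, ℝ).prod 𝓘(ℝ, EZ))
      (g := fun x : ℝ × Z => Circle.exp x.1 • x.2) z₀ F.action_smooth.contMDiffAt
      (hψs.contMDiffAt.prodMk h1)

/-- Flat lifts are smooth. -/
theorem IsFlat.contMDiffAt [T2Space Z] {U : Set ℂ} (hU : IsOpen U)
    (hu : ∀ z ∈ U, ContMDiffAt 𝓘(ℝ, ℂ) 𝓘(ℝ, EY) ∞ u z) (hη : ∀ z ∈ U, ContDiffAt ℝ ∞ η z)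
    (hcurv : ∀ z ∈ U, ∀ a b : ℂ, fderiv ℝ η z a b - fderiv ℝ η z b a =
      F.omega (u z) (mfderiv 𝓘(ℝ, ℂ) 𝓘(ℝ, EY) u z a) (mfderiv 𝓘(ℝ, ℂ) 𝓘(ℝ, EY) u z b))
    {ζ : ℂ → Z} (h : F.IsFlat u η U ζ) {z₀ : ℂ} (hz₀ : z₀ ∈ U) :
    ContMDiffAt 𝓘(ℝ, ℂ) 𝓘(ℝ, EZ) ∞ ζ z₀ := by
  obtain ⟨r, hr, ζ', hsub, hflat, hs⟩ := exists_isFlat_nhds hU hu hη hcurv hz₀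
  obtain ⟨c, hc⟩ := (h.mono hsub).exists_eq_smul Metric.isOpen_ball
    (convex_ball z₀ r).isPreconnected hflat
  refine ContMDiffAt.congr_of_eventuallyEq
    (ContMDiffAt.comp (I' := 𝓘(ℝ, EZ)) (g := fun z : Z => c • z) z₀
      (F.contMDiff_smul c).contMDiffAt hs) ?_
  filter_upwards [Metric.ball_mem_nhds z₀ hr] with z hz
  exact hc z hz

/-- A flat lift exists on a convex open neighborhood of `K`. -/
def HasFlat (F : CircleFibered EY Y EZ Z) (u : ℂ → Y) (η : ℂ → ℂ →L[ℝ] ℝ) (K : Set ℂ) : Prop :=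
  ∃ W : Set ℂ, IsOpen W ∧ Convex ℝ W ∧ K ⊆ W ∧ ∃ ζ : ℂ → Z, F.IsFlat u η W ζ

lemma HasFlat.mono {K K' : Set ℂ} (h : F.HasFlat u η K) (hK : K' ⊆ K) : F.HasFlat u η K' := by
  obtain ⟨W, h1, h2, h3, h4⟩ := h
  exact ⟨W, h1, h2, hK.trans h3, h4⟩

lemma HasFlat.union [T2Space Z] {K K₁ K₂ : Set ℂ} (hK : IsCompact K) (hKc : Convex ℝ K)
    (hsub : K ⊆ K₁ ∪ K₂) (h₁ : F.HasFlat u η K₁) (h₂ : F.HasFlat u η K₂) : F.HasFlat u η K := by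
  classical
  obtain ⟨W₁, hW₁, hc₁, hs₁, ζ₁, hf₁⟩ := h₁
  obtain ⟨W₂, hW₂, hc₂, hs₂, ζ₂, hf₂⟩ := h₂
  obtain ⟨c, hc⟩ := (hf₁.mono inter_subset_left).exists_eq_smul (hW₁.inter hW₂)
    (hc₁.inter hc₂).isPreconnected (hf₂.mono inter_subset_right)
  obtain ⟨δ, hδ, hδs⟩ := hK.exists_thickening_subset_open (hW₁.union hW₂)
    (hsub.trans (union_subset_union hs₁ hs₂))
  refine ⟨Metric.thickening δ K, Metric.isOpen_thickening, hKc.thickening δ,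
    Metric.self_subset_thickening hδ K, fun z => if z ∈ W₁ then ζ₁ z else c • ζ₂ z, ?_⟩
  have e₂ : ∀ z ∈ W₂, (if z ∈ W₁ then ζ₁ z else c • ζ₂ z) = c • ζ₂ z := by
    intro z hz
    by_cases h : z ∈ W₁
    · rw [if_pos h]; exact hc z ⟨h, hz⟩
    · rw [if_neg h]
  intro z hz
  rcases hδs hz with hz | hz
  · have he : (fun z => if z ∈ W₁ then ζ₁ z else c • ζ₂ z) =ᶠ[𝓝[univ] z] ζ₁ := by
      rw [nhdsWithin_univ]
      filter_upwards [hW₁.mem_nhds hz] with w hw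
      rw [if_pos hw]
    exact ⟨by simp only [if_pos hz]; exact (hf₁ z hz).1,
      (hf₁ z hz).2.congr_of_eventuallyEq he (if_pos hz)⟩
  · have hf := hf₂.const_smul c z hz
    have he : (fun z => if z ∈ W₁ then ζ₁ z else c • ζ₂ z) =ᶠ[𝓝[univ] z] fun z => c • ζ₂ z := by
      rw [nhdsWithin_univ]
      filter_upwards [hW₂.mem_nhds hz] with w hw
      exact e₂ w hw
    exact ⟨by simp only [e₂ z hz]; exact hf.1, hf.2.congr_of_eventuallyEq he (e₂ z hz)⟩

lemma HasFlat.of_slices [T2Space Z] {K : Set ℂ} (hK : IsCompact K) (hKc : Convex ℝ K)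
    (l : ℂ →L[ℝ] ℝ) (h : ∀ t, F.HasFlat u η (K ∩ l ⁻¹' {t})) : F.HasFlat u η K := by
  obtain ⟨R, hR⟩ := (hK.image l.continuous).isBounded.subset_closedBall 0
  set b := max R 0 with hb
  have hab : -b ≤ b := by
    have : 0 ≤ b := le_max_right _ _
    linarith
  have hKb : K ⊆ l ⁻¹' Icc (-b) b := by
    intro z hz
    have h1 := hR (mem_image_of_mem l hz)
    rw [Metric.mem_closedBall, dist_zero_right, Real.norm_eq_abs] at h1
    exact abs_le.1 (h1.trans (le_max_left R 0))
  have hthick : ∀ t, ∃ ε > 0, F.HasFlat u η (K ∩ l ⁻¹' {s | |s - t| < ε}) := by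
    intro t
    obtain ⟨W, hW, hWc, hKW, hζ⟩ := h t
    have hcl : IsClosed (l '' (K \ W)) := ((hK.diff hW).image l.continuous).isClosed
    have ht : t ∉ l '' (K \ W) := by
      rintro ⟨z, ⟨hz, hzW⟩, hzt⟩
      exact hzW (hKW ⟨hz, hzt⟩)
    obtain ⟨ε, hε, hεs⟩ := Metric.isOpen_iff.1 hcl.isOpen_compl t ht
    refine ⟨ε, hε, W, hW, hWc, ?_, hζ⟩
    rintro z ⟨hz, hzt⟩
    by_contra hzW
    exact hεs (show l z ∈ Metric.ball t ε from hzt) ⟨z, ⟨hz, hzW⟩, rfl⟩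
  choose ε hε hflat using hthick
  obtain ⟨t, ht0, htm, ⟨m, hm⟩, hti⟩ := exists_monotone_Icc_subset_open_cover_Icc hab
    (c := fun i : ℝ => {s : Icc (-b) b | |(s : ℝ) - i| < ε i})
    (fun i => isOpen_lt (by fun_prop) continuous_const)
    (fun s _ => mem_iUnion.2 ⟨s, by simp [hε]⟩)
  have hind : ∀ n, F.HasFlat u η (K ∩ l ⁻¹' Icc (-b) (t n)) := by
    intro n
    induction n with
    | zero =>
      rw [ht0, Icc_self]
      exact h (-b)
    | succ n ih =>
      obtain ⟨i, hi⟩ := hti n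
      refine HasFlat.union (hK.inter_right (isClosed_Icc.preimage l.continuous))
        (hKc.inter ((convex_Icc _ _).linear_preimage (l : ℂ →ₗ[ℝ] ℝ))) ?_ ih (hflat i)
      rintro z ⟨hz, hz1⟩
      by_cases hzt : l z ≤ t n
      · exact Or.inl ⟨hz, hz1.1, hzt⟩
      · exact Or.inr ⟨hz, hi (show (⟨l z, hKb hz⟩ : Icc (-b) b) ∈ Icc (t n) (t (n + 1)) from
          ⟨(not_le.1 hzt).le, hz1.2⟩)⟩
  refine (hind m).mono fun z hz => ⟨hz, ?_⟩
  rw [hm m le_rfl]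
  exact hKb hz

/-- Flat lifts exist over the disk. -/
theorem exists_isFlat_ball [T2Space Z]
    (h : ∀ z ∈ Metric.ball (0 : ℂ) 1, F.HasFlat u η {z}) :
    ∃ ζ : ℂ → Z, F.IsFlat u η (Metric.ball 0 1) ζ := by
  have hr : ∀ r < 1, F.HasFlat u η (Metric.closedBall 0 r) := by
    intro r hr
    refine HasFlat.of_slices (isCompact_closedBall 0 r) (convex_closedBall 0 r) Complex.reCLM
      fun t => ?_
    refine HasFlat.of_slices
      ((isCompact_closedBall 0 r).inter_right (isClosed_singleton.preimage Complex.reCLM.continuous))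
      ((convex_closedBall 0 r).inter ((convex_singleton t).linear_preimage
        (Complex.reCLM : ℂ →ₗ[ℝ] ℝ))) Complex.imCLM fun t' => ?_
    rcases (Metric.closedBall (0 : ℂ) r ∩ Complex.reCLM ⁻¹' {t} ∩
      Complex.imCLM ⁻¹' {t'}).eq_empty_or_nonempty with he | ⟨z, hz⟩
    · rw [he]
      exact ⟨∅, isOpen_empty, convex_empty, subset_rfl, fun _ => (F.p_surjective (u 0)).choose,
        fun z hz => absurd hz (notMem_empty z)⟩
    · refine (h z (Metric.closedBall_subset_ball hr hz.1.1)).mono ?_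
      rintro w ⟨⟨-, hw1⟩, hw2⟩
      obtain ⟨⟨-, hz1⟩, hz2⟩ := hz
      refine Complex.ext ?_ ?_
      · exact (show w.re = t from hw1).trans (show z.re = t from hz1).symm
      · exact (show w.im = t' from hw2).trans (show z.im = t' from hz2).symm
  obtain ⟨z₁, hz₁⟩ := F.p_surjective (u 0)
  have hn : ∀ n : ℕ, ∃ ζ : ℂ → Z, F.IsFlat u η (Metric.ball 0 (1 - 1 / ((n : ℝ) + 1))) ζ ∧
      (0 < 1 - 1 / ((n : ℝ) + 1) → ζ 0 = z₁) := by
    intro n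
    have hpos : 0 < 1 / ((n : ℝ) + 1) := by positivity
    obtain ⟨W, -, -, hW, ζ, hζ⟩ := hr (1 - 1 / ((n : ℝ) + 1)) (by linarith)
    have hζ' := hζ.mono (Metric.ball_subset_closedBall.trans hW)
    by_cases h0 : 0 < 1 - 1 / ((n : ℝ) + 1)
    · obtain ⟨c, hc⟩ := (F.p_fiber (ζ 0) z₁).1
        ((hζ' 0 (Metric.mem_ball_self h0)).1.trans hz₁.symm)
      exact ⟨fun z => c • ζ z, hζ'.const_smul c, fun _ => hc⟩
    · exact ⟨ζ, hζ', fun h => absurd h h0⟩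
  choose ζ hζ hζ0 using hn
  have hagree : ∀ (n m : ℕ) (z : ℂ), z ∈ Metric.ball (0 : ℂ) (1 - 1 / ((n : ℝ) + 1)) →
      z ∈ Metric.ball (0 : ℂ) (1 - 1 / ((m : ℝ) + 1)) → ζ n z = ζ m z := by
    intro n m z hzn hzm
    set ρ := min (1 - 1 / ((n : ℝ) + 1)) (1 - 1 / ((m : ℝ) + 1)) with hρ
    obtain ⟨c, hc⟩ := ((hζ n).mono (Metric.ball_subset_ball (min_le_left _ _))).exists_eq_smul
      Metric.isOpen_ball (convex_ball (0 : ℂ) ρ).isPreconnected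
      ((hζ m).mono (Metric.ball_subset_ball (min_le_right _ _)))
    have hz : z ∈ Metric.ball (0 : ℂ) ρ := by
      rw [Metric.mem_ball] at hzn hzm ⊢
      exact lt_min hzn hzm
    have hρ0 : 0 < ρ := Metric.pos_of_mem_ball hz
    have h0 := hc 0 (Metric.mem_ball_self hρ0)
    rw [hζ0 n (hρ0.trans_le (min_le_left _ _)), hζ0 m (hρ0.trans_le (min_le_right _ _))] at h0
    rw [hc z hz, F.action_free c z₁ h0.symm, one_smul]
  have hex : ∀ z : ℂ, ∃ n : ℕ, z ∈ Metric.ball (0 : ℂ) 1 →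
      z ∈ Metric.ball (0 : ℂ) (1 - 1 / ((n : ℝ) + 1)) := by
    intro z
    by_cases hz : z ∈ Metric.ball (0 : ℂ) 1
    · have h1 : 0 < 1 - dist z 0 := sub_pos.2 (Metric.mem_ball.1 hz)
      obtain ⟨n, hn⟩ := exists_nat_one_div_lt h1
      exact ⟨n, fun _ => by rw [Metric.mem_ball]; linarith⟩
    · exact ⟨0, fun h => absurd h hz⟩
  choose N hN using hex
  refine ⟨fun z => ζ (N z) z, fun z hz => ⟨(hζ (N z) z (hN z hz)).1, ?_⟩⟩
  refine (hζ (N z) z (hN z hz)).2.congr_of_eventuallyEq ?_ rfl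
  rw [nhdsWithin_univ]
  filter_upwards [Metric.isOpen_ball.mem_nhds hz, Metric.isOpen_ball.mem_nhds (hN z hz)] with w h1 h2
  exact hagree _ _ w (hN w h1) h2

end CircleFibered

end Flat

end

section

/-! ### Immersions and Legendrians -/

section Immersion

variable {E M G N : Type*} [NormedAddCommGroup E] [NormedSpace ℝ E]
  [TopologicalSpace M] [ChartedSpace E M] [IsManifold 𝓘(ℝ, E) ∞ M]
  [NormedAddCommGroup G] [NormedSpace ℝ G]
  [TopologicalSpace N] [ChartedSpace G N] [IsManifold 𝓘(ℝ, G) ∞ N]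

/-- The derivative of an immersion is injective. -/
lemma eq_zero_of_isImmersionAt {f : M → N} {x : M} (h : IsImmersionAt 𝓘(ℝ, E) 𝓘(ℝ, G) ∞ f x)
    {D : E →L[ℝ] G} (hD : HasMFDerivAt 𝓘(ℝ, E) 𝓘(ℝ, G) f x D) {v : E} (hv : D v = 0) : v = 0 := by
  set d := h.domChart.extend 𝓘(ℝ, E) with hd
  set c := h.codChart.extend 𝓘(ℝ, G) with hc
  have hdx : d.source ∈ 𝓝 x := by
    rw [hd, OpenPartialHomeomorph.extend_source]
    exact h.domChart.open_source.mem_nhds h.mem_domChart_source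
  have hds : ContMDiffAt 𝓘(ℝ, E) 𝓘(ℝ, E) ∞ d x :=
    OpenPartialHomeomorph.contMDiffAt_extend h.domChart_mem_maximalAtlas h.mem_domChart_source
  have hcs : ContMDiffAt 𝓘(ℝ, G) 𝓘(ℝ, G) ∞ c (f x) :=
    OpenPartialHomeomorph.contMDiffAt_extend h.codChart_mem_maximalAtlas h.mem_codChart_source
  have hdsymm : ContMDiffAt 𝓘(ℝ, E) 𝓘(ℝ, E) ∞ d.symm (d x) := by
    refine (contMDiffOn_extend_symm h.domChart_mem_maximalAtlas).contMDiffAt ?_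
    have h1 : h.domChart.target ∈ 𝓝 (h.domChart x) :=
      h.domChart.open_target.mem_nhds (h.domChart.map_source h.mem_domChart_source)
    simpa [hd] using h1
  obtain ⟨Dd, hDd⟩ : ∃ T : E →L[ℝ] E, HasMFDerivAt 𝓘(ℝ, E) 𝓘(ℝ, E) d x T :=
    ⟨_, (hds.mdifferentiableAt (by simp)).hasMFDerivAt⟩
  obtain ⟨Dc, hDc⟩ : ∃ T : G →L[ℝ] G, HasMFDerivAt 𝓘(ℝ, G) 𝓘(ℝ, G) c (f x) T :=
    ⟨_, (hcs.mdifferentiableAt (by simp)).hasMFDerivAt⟩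
  obtain ⟨Ds, hDs⟩ : ∃ T : E →L[ℝ] E, HasMFDerivAt 𝓘(ℝ, E) 𝓘(ℝ, E) d.symm (d x) T :=
    ⟨_, (hdsymm.mdifferentiableAt (by simp)).hasMFDerivAt⟩
  -- `d` factors through `f` near `x`
  have hfac : (fun y => (h.equiv.symm (c (f y))).1) =ᶠ[𝓝 x] d := by
    filter_upwards [hdx] with y hy
    have h1 := h.writtenInCharts (d.map_source hy)
    simp only [Function.comp_apply] at h1
    rw [← hd, ← hc, d.left_inv hy] at h1
    rw [h1]
    simp
  have h2 : HasMFDerivAt 𝓘(ℝ, E) 𝓘(ℝ, E) d x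
      (((ContinuousLinearMap.fst ℝ E h.complement).comp
        (h.equiv.symm : G →L[ℝ] E × h.complement)).comp (Dc.comp D)) := by
    have h3 : HasMFDerivAt 𝓘(ℝ, G) 𝓘(ℝ, E) (fun w : G => (h.equiv.symm w).1) (c (f x))
        ((ContinuousLinearMap.fst ℝ E h.complement).comp
          (h.equiv.symm : G →L[ℝ] E × h.complement)) :=
      ((ContinuousLinearMap.fst ℝ E h.complement).comp
        (h.equiv.symm : G →L[ℝ] E × h.complement)).hasMFDerivAt
    have h5 := HasMFDerivAt.comp (g := fun w : G => (h.equiv.symm w).1) (f := fun y => c (f y)) x h3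
      (hDc.comp x hD)
    exact h5.congr_of_eventuallyEq hfac.symm
  have hDd0 : Dd v = 0 := by
    have e : Dd = _ := hasMFDerivAt_unique hDd h2
    rw [e]
    change (h.equiv.symm (Dc (D v))).1 = 0
    rw [hv, map_zero, map_zero]
    rfl
  have hid : Ds.comp Dd = ContinuousLinearMap.id ℝ E := by
    have h4 : HasMFDerivAt 𝓘(ℝ, E) 𝓘(ℝ, E) (fun y => y) x (Ds.comp Dd) :=
      (hDs.comp x hDd).congr_of_eventuallyEq (by
        filter_upwards [hdx] with y hy
        exact (d.left_inv hy).symm)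
    exact hasMFDerivAt_unique h4 (hasMFDerivAt_id x)
  have := DFunLike.congr_fun hid v
  simpa [hDd0] using this.symm

/-- The derivative of a smooth map in the preferred charts is its manifold derivative. -/
lemma hasStrictFDerivAt_writtenInExtChartAt {f : M → N} {x : M}
    (hf : ContMDiffAt 𝓘(ℝ, E) 𝓘(ℝ, G) ∞ f x) {D : E →L[ℝ] G}
    (hD : HasMFDerivAt 𝓘(ℝ, E) 𝓘(ℝ, G) f x D) :
    HasStrictFDerivAt (fun y => extChartAt 𝓘(ℝ, G) (f x) (f ((extChartAt 𝓘(ℝ, E) x).symm y))) D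
      (extChartAt 𝓘(ℝ, E) x x) := by
  have h1 := (contMDiffAt_iff.1 hf).2
  rw [modelWithCornersSelf_coe, range_id, contDiffWithinAt_univ] at h1
  have h2 : HasFDerivAt (fun y => extChartAt 𝓘(ℝ, G) (f x) (f ((extChartAt 𝓘(ℝ, E) x).symm y))) D
      (extChartAt 𝓘(ℝ, E) x x) := by
    rw [← hasFDerivWithinAt_univ, ← range_id]
    exact hD.2
  have h3 : HasStrictFDerivAt (fun y => extChartAt 𝓘(ℝ, G) (f x) (f ((extChartAt 𝓘(ℝ, E) x).symm y)))
      (fderiv ℝ (fun y => extChartAt 𝓘(ℝ, G) (f x) (f ((extChartAt 𝓘(ℝ, E) x).symm y)))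
        (extChartAt 𝓘(ℝ, E) x x)) (extChartAt 𝓘(ℝ, E) x x) :=
    h1.hasStrictFDerivAt (by simp)
  have h4 : fderiv ℝ (fun y => extChartAt 𝓘(ℝ, G) (f x) (f ((extChartAt 𝓘(ℝ, E) x).symm y)))
        (extChartAt 𝓘(ℝ, E) x x) = D := h2.fderiv
  rwa [h4] at h3

/-- A map that is continuous, and differentiable after composition with an immersion, is
differentiable. -/
lemma exists_hasMFDerivWithinAt_of_comp [FiniteDimensional ℝ E] [FiniteDimensional ℝ G]
    {E' : Type*} [NormedAddCommGroup E'] [NormedSpace ℝ E'] {f : M → N} {b : E' → M} {s : Set E'}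
    {x : E'} (hf : ContMDiffAt 𝓘(ℝ, E) 𝓘(ℝ, G) ∞ f (b x)) {D : E →L[ℝ] G}
    (hD : HasMFDerivAt 𝓘(ℝ, E) 𝓘(ℝ, G) f (b x) D) (hinj : ∀ v, D v = 0 → v = 0)
    (hb : ContinuousWithinAt b s x) {T : E' →L[ℝ] G}
    (hfb : HasMFDerivWithinAt 𝓘(ℝ, E') 𝓘(ℝ, G) (fun y => f (b y)) s x T) :
    ∃ S : E' →L[ℝ] E, HasMFDerivWithinAt 𝓘(ℝ, E') 𝓘(ℝ, E) b s x S := by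
  have : CompleteSpace E := FiniteDimensional.complete ℝ E
  have hstrict := hasStrictFDerivAt_writtenInExtChartAt hf hD
  set χ := extChartAt 𝓘(ℝ, E) (b x) with hχ
  set ξ := extChartAt 𝓘(ℝ, G) (f (b x)) with hξ
  obtain ⟨A, hA⟩ := (D : E →ₗ[ℝ] G).exists_leftInverse_of_injective
    (LinearMap.ker_eq_bot'.2 hinj)
  have hAc : (LinearMap.toContinuousLinearMap A).comp D =
      ((ContinuousLinearEquiv.refl ℝ E : E ≃L[ℝ] E) : E →L[ℝ] E) := by
    ext v
    exact LinearMap.congr_fun hA v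
  have hs2 := (LinearMap.toContinuousLinearMap A).hasStrictFDerivAt.comp (χ (b x)) hstrict
  rw [hAc] at hs2
  have hloc := hs2.to_localInverse
  have hleft := hs2.eventually_left_inverse
  have hχb : ContinuousWithinAt (fun y => χ (b y)) s x :=
    (continuousAt_extChartAt (I := 𝓘(ℝ, E)) (b x)).comp_continuousWithinAt hb
  have hsrc : ∀ᶠ y in 𝓝[s] x, b y ∈ χ.source := hb (extChartAt_source_mem_nhds (b x))
  have hU := (hasMFDerivWithinAt_iff_extChartAt_comp.1 hfb).2
  have hval : χ.symm (χ (b x)) = b x := extChartAt_to_inv (b x)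
  have hAU : HasFDerivWithinAt (fun y => (LinearMap.toContinuousLinearMap A) (ξ (f (b y))))
      ((LinearMap.toContinuousLinearMap A).comp T) s x :=
    (LinearMap.toContinuousLinearMap A).hasFDerivAt.comp_hasFDerivWithinAt x hU
  have hloc' : HasFDerivAt (hs2.localInverse _ _ _)
      ((ContinuousLinearEquiv.refl ℝ E).symm : E →L[ℝ] E)
      ((LinearMap.toContinuousLinearMap A) (ξ (f (b x)))) := by
    have := hloc.hasFDerivAt
    simp only [hval] at this
    exact this
  have hcomp := HasFDerivAt.comp_hasFDerivWithinAt x hloc' hAU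
  have heq : (fun y => χ (b y)) =ᶠ[𝓝[s] x]
      (hs2.localInverse _ _ _ ∘ fun y => (LinearMap.toContinuousLinearMap A) (ξ (f (b y)))) := by
    filter_upwards [hχb.eventually hleft, hsrc] with y hy hys
    rw [← hy]
    simp only [Function.comp_apply, χ.left_inv hys]
  have heqx : χ (b x) = (hs2.localInverse _ _ _ ∘
      fun y => (LinearMap.toContinuousLinearMap A) (ξ (f (b y)))) x := by
    have := hleft.self_of_nhds
    simp only [Function.comp_apply, hval] at this ⊢
    exact this.symm
  exact ⟨_, hasMFDerivWithinAt_iff_extChartAt_comp.2 ⟨hb, hcomp.congr_of_eventuallyEq heq heqx⟩⟩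

/-- A smooth map between manifolds of the same dimension with injective derivative has local
sections. -/
lemma exists_local_section [FiniteDimensional ℝ E] {N : Type*} [TopologicalSpace N]
    [ChartedSpace E N] [IsManifold 𝓘(ℝ, E) ∞ N] {q : M → N} {x : M}
    (hq : ContMDiffAt 𝓘(ℝ, E) 𝓘(ℝ, E) ∞ q x) {D : E →L[ℝ] E}
    (hD : HasMFDerivAt 𝓘(ℝ, E) 𝓘(ℝ, E) q x D) (hinj : ∀ v, D v = 0 → v = 0) :
    ∃ g : N → M, g (q x) = x ∧ ∀ᶠ y in 𝓝 (q x), q (g y) = y ∧ ContinuousAt g y := by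
  have : CompleteSpace E := FiniteDimensional.complete ℝ E
  have hstrict := hasStrictFDerivAt_writtenInExtChartAt hq hD
  set χ := extChartAt 𝓘(ℝ, E) x with hχ
  set ξ := extChartAt 𝓘(ℝ, E) (q x) with hξ
  have hinj' : Function.Injective (D : E →ₗ[ℝ] E) :=
    LinearMap.ker_eq_bot.1 (LinearMap.ker_eq_bot'.2 hinj)
  set De : E ≃L[ℝ] E := (LinearEquiv.ofInjectiveEndo (D : E →ₗ[ℝ] E) hinj').toContinuousLinearEquiv
  have hDe : (De : E →L[ℝ] E) = D := by
    ext v; rfl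
  rw [← hDe] at hstrict
  set e := hstrict.toOpenPartialHomeomorph _ with he
  have hxs : χ x ∈ e.source := hstrict.mem_toOpenPartialHomeomorph_source
  have hcoe : ∀ w, e w = ξ (q (χ.symm w)) := fun w => rfl
  have hex : e (χ x) = ξ (q x) := by rw [hcoe, extChartAt_to_inv]
  have hesymm : e.symm (ξ (q x)) = χ x := by rw [← hex, e.left_inv hxs]
  have htgt : ξ (q x) ∈ e.target := hex ▸ e.map_source hxs
  have hgx : χ.symm (e.symm (ξ (q x))) = x := by rw [hesymm]; exact extChartAt_to_inv x
  have hcξ : ContinuousAt ξ (q x) := continuousAt_extChartAt _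
  have hce : ContinuousAt (fun y => e.symm (ξ y)) (q x) :=
    ContinuousAt.comp (g := e.symm) (e.continuousAt_symm htgt) hcξ
  have hcg : ContinuousAt (fun y => χ.symm (e.symm (ξ y))) (q x) := by
    refine ContinuousAt.comp (g := χ.symm) ?_ hce
    rw [hesymm]; exact continuousAt_extChartAt_symm x
  refine ⟨fun y => χ.symm (e.symm (ξ y)), hgx, ?_⟩
  have h1 : ∀ᶠ y in 𝓝 (q x), ξ y ∈ e.target := hcξ (e.open_target.mem_nhds htgt)
  have h2 : ∀ᶠ y in 𝓝 (q x), e.symm (ξ y) ∈ χ.target := by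
    refine hce.eventually_mem ?_
    rw [hesymm]; exact extChartAt_target_mem_nhds x
  have h3 : ∀ᶠ y in 𝓝 (q x), q (χ.symm (e.symm (ξ y))) ∈ ξ.source := by
    have hqc : ContinuousAt (fun y => q (χ.symm (e.symm (ξ y)))) (q x) := by
      refine ContinuousAt.comp (g := q) ?_ hcg
      rw [hgx]; exact hq.continuousAt
    refine hqc.eventually_mem ?_
    rw [hgx]
    exact extChartAt_source_mem_nhds (q x)
  filter_upwards [h1, h2, h3, extChartAt_source_mem_nhds (I := 𝓘(ℝ, E)) (q x)] with y hy1 hy2 hy3 hy4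
  refine ⟨ξ.injOn hy3 hy4 ?_, ?_⟩
  · rw [← hcoe, e.right_inv hy1]
  · refine ContinuousAt.comp (g := χ.symm) (continuousAt_extChartAt_symm'' hy2) ?_
    exact ContinuousAt.comp (g := e.symm) (e.continuousAt_symm hy1) (continuousAt_extChartAt' hy4)

end Immersion

section LegendrianGeometry

variable {EY Y EZ Z EL L P : Type*}
  [NormedAddCommGroup EY] [NormedSpace ℝ EY] [FiniteDimensional ℝ EY]
  [TopologicalSpace Y] [ChartedSpace EY Y] [IsManifold 𝓘(ℝ, EY) ∞ Y]
  [NormedAddCommGroup EZ] [NormedSpace ℝ EZ] [FiniteDimensional ℝ EZ]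
  [TopologicalSpace Z] [ChartedSpace EZ Z] [IsManifold 𝓘(ℝ, EZ) ∞ Z] [MulAction Circle Z]
  [NormedAddCommGroup EL] [NormedSpace ℝ EL] [FiniteDimensional ℝ EL]
  [TopologicalSpace L] [ChartedSpace EL L]
  [TopologicalSpace P] [ChartedSpace EL P]
variable [IsManifold 𝓘(ℝ, EL) ∞ L] [IsManifold 𝓘(ℝ, EL) ∞ P] [T2Space Z]
  {F : CircleFibered EY Y EZ Z} (Λ : LegendrianOver EL L P F)

namespace LegendrianOver

include Λ in
lemma contMDiff_pj : ContMDiff 𝓘(ℝ, EL) 𝓘(ℝ, EY) ∞ (fun a => F.p (Λ.j a)) :=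
  F.p_smooth.comp Λ.j_embedding.contMDiff

/-- The differential of the immersed projection is injective. -/
lemma exists_hasMFDerivAt_pj (a : L) : ∃ (Dj : EL →L[ℝ] EZ) (D : EL →L[ℝ] EY),
    HasMFDerivAt 𝓘(ℝ, EL) 𝓘(ℝ, EZ) Λ.j a Dj ∧ (F.a (Λ.j a)).comp Dj = 0 ∧
    HasMFDerivAt 𝓘(ℝ, EL) 𝓘(ℝ, EY) (fun a => F.p (Λ.j a)) a D ∧ ∀ v, D v = 0 → v = 0 := by
  obtain ⟨Dj, hDj⟩ : ∃ Dj : EL →L[ℝ] EZ, HasMFDerivAt 𝓘(ℝ, EL) 𝓘(ℝ, EZ) Λ.j a Dj :=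
    ⟨_, (Λ.j_embedding.contMDiff.mdifferentiable (by simp) a).hasMFDerivAt⟩
  have hleg : ∀ v, F.a (Λ.j a) (Dj v) = 0 := by
    intro v
    have h1 := Λ.legendrian a v
    rw [hDj.mfderiv] at h1
    exact h1
  refine ⟨Dj, (F.dp (Λ.j a)).comp Dj, hDj, ContinuousLinearMap.ext hleg,
    (F.hasMFDerivAt_p (Λ.j a)).comp a hDj, fun v hv => ?_⟩
  have h1 : F.dp (Λ.j a) (Dj v) = 0 := hv
  have h2 := F.eq_smul_gen_of_dp_eq_zero h1
  rw [hleg v, zero_smul] at h2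
  exact eq_zero_of_isImmersionAt (Λ.j_embedding.isImmersion.isImmersionAt a) hDj h2

/-- Curves in the Legendrian are horizontal. -/
theorem hasForm_j_comp {E' : Type*} [NormedAddCommGroup E'] [NormedSpace ℝ E'] {s : Set E'}
    {b : E' → L} {x : E'} (hb : ContinuousWithinAt b s x) {T : E' →L[ℝ] EY}
    (hpb : HasMFDerivWithinAt 𝓘(ℝ, E') 𝓘(ℝ, EY) (fun y => F.p (Λ.j (b y))) s x T) :
    F.HasForm s (fun y => Λ.j (b y)) x 0 := by
  obtain ⟨Dj, D, hDj, hleg, hD, hinj⟩ := Λ.exists_hasMFDerivAt_pj (b x)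
  obtain ⟨S, hS⟩ := exists_hasMFDerivWithinAt_of_comp (f := fun a => F.p (Λ.j a))
    Λ.contMDiff_pj.contMDiffAt hD hinj hb hpb
  refine ⟨_, hDj.comp_hasMFDerivWithinAt x hS, ?_⟩
  refine ContinuousLinearMap.ext fun v => ?_
  exact DFunLike.congr_fun hleg (S v)

/-- Local sections of the covering `q`. -/
theorem exists_section (a : L) :
    ∃ g : P → L, g (Λ.q a) = a ∧ ∀ᶠ y in 𝓝 (Λ.q a), Λ.q (g y) = y ∧ ContinuousAt g y := by
  obtain ⟨Dj, D, hDj, hleg, hD, hinj⟩ := Λ.exists_hasMFDerivAt_pj a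
  obtain ⟨Dq, hDq⟩ : ∃ Dq : EL →L[ℝ] EL, HasMFDerivAt 𝓘(ℝ, EL) 𝓘(ℝ, EL) Λ.q a Dq :=
    ⟨_, (Λ.q_smooth.mdifferentiable (by simp) a).hasMFDerivAt⟩
  obtain ⟨Df, hDf⟩ : ∃ Df : EL →L[ℝ] EY, HasMFDerivAt 𝓘(ℝ, EL) 𝓘(ℝ, EY) Λ.φ (Λ.q a) Df :=
    ⟨_, (Λ.φ_immersion.contMDiff.mdifferentiable (by simp) _).hasMFDerivAt⟩
  refine exists_local_section Λ.q_smooth.contMDiffAt hDq fun v hv => hinj v ?_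
  have h1 := hDf.comp a hDq
  have h2 : (Λ.φ ∘ Λ.q) = fun a => F.p (Λ.j a) := funext Λ.proj_eq
  rw [h2] at h1
  have h3 : D = Df.comp Dq := hasMFDerivAt_unique hD h1
  rw [h3]
  change Df (Dq v) = 0
  rw [hv, map_zero]

end LegendrianOver

end LegendrianGeometry

section Rotations

variable {EY Y EZ Z EL L P : Type*}
  [NormedAddCommGroup EY] [NormedSpace ℝ EY] [FiniteDimensional ℝ EY]
  [TopologicalSpace Y] [ChartedSpace EY Y] [IsManifold 𝓘(ℝ, EY) ∞ Y]
  [NormedAddCommGroup EZ] [NormedSpace ℝ EZ] [FiniteDimensional ℝ EZ]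
  [TopologicalSpace Z] [ChartedSpace EZ Z] [IsManifold 𝓘(ℝ, EZ) ∞ Z] [MulAction Circle Z]
  [NormedAddCommGroup EL] [NormedSpace ℝ EL] [FiniteDimensional ℝ EL]
  [TopologicalSpace L] [ChartedSpace EL L]
  [TopologicalSpace P] [ChartedSpace EL P]
variable {F : CircleFibered EY Y EZ Z} (Λ : LegendrianOver EL L P F)

namespace LegendrianOver

/-- The rotations preserving the fibers of `Λ` over `P`. -/
def Deck (c : Circle) : Prop := ∀ b : L, ∃ b' : L, Λ.q b = Λ.q b' ∧ c • Λ.j b = Λ.j b'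

variable {Λ}

lemma IsHomogeneous.deck (h : Λ.IsHomogeneous) {c : Circle} {a a' : L} (hq : Λ.q a = Λ.q a')
    (hc : c • Λ.j a = Λ.j a') : Λ.Deck c := h c a a' hq hc

lemma IsHomogeneous.deck_inv (h : Λ.IsHomogeneous) [Nonempty L] {c : Circle} (hc : Λ.Deck c) :
    Λ.Deck c⁻¹ := by
  obtain ⟨a⟩ := ‹Nonempty L›
  obtain ⟨a', hq, ha⟩ := hc a
  exact h.deck hq.symm (by rw [← ha, inv_smul_smul])

lemma Deck.smul_range_subset {c : Circle} (hc : Λ.Deck c) : c • range Λ.j ⊆ range Λ.j := by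
  rintro _ ⟨_, ⟨b, rfl⟩, rfl⟩
  obtain ⟨b', -, hb'⟩ := hc b
  exact ⟨b', hb'.symm⟩

lemma IsHomogeneous.smul_range (h : Λ.IsHomogeneous) [Nonempty L] {c : Circle} (hc : Λ.Deck c) :
    c • range Λ.j = range Λ.j := by
  refine subset_antisymm hc.smul_range_subset ?_
  have := (h.deck_inv hc).smul_range_subset
  rwa [Set.smul_set_subset_iff_subset_inv_smul_set, inv_inv] at this

variable (Λ) in
lemma pow_eq_one_of_smul_eq {k : ℕ} (hk : 0 < k)
    (hchord : ∀ (a b : L) (θ : ℝ), Λ.IsReebChord a b θ → ∃ m : ℕ, θ = m * (2 * Real.pi / k))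
    {c : Circle} {a b : L} (h : c • Λ.j a = Λ.j b) : c ^ k = 1 := by
  have hθ : 0 < Complex.arg c + 2 * Real.pi := by
    have := Complex.neg_pi_lt_arg (c : ℂ)
    linarith [Real.pi_pos]
  have hc : Circle.exp (Complex.arg c + 2 * Real.pi) = c := by
    rw [Circle.exp_add, Circle.exp_two_pi, mul_one, Circle.exp_arg]
  obtain ⟨m, hm⟩ := hchord a b (Complex.arg c + 2 * Real.pi) ⟨hθ, by rw [hc, h]⟩
  have hk' : (k : ℝ) ≠ 0 := Nat.cast_ne_zero.2 hk.ne'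
  have h1 : (k : ℝ) * (Complex.arg c + 2 * Real.pi) = m * (2 * Real.pi) := by
    rw [hm]; field_simp
  rw [← hc, ← Circle.exp_natCast_mul, h1, Circle.exp_natCast_mul, Circle.exp_two_pi, one_pow]

end LegendrianOver

end Rotations

end

section

/-! ### The Cauchy transform on the disk -/

section CauchyKernel

open Metric

lemma integrableOn_ball_inv_norm (ρ : ℝ) : IntegrableOn (fun w : ℂ => ‖w‖⁻¹) (ball 0 ρ) := by
  have h := (integrableOn_fun_norm_addHaar (E := ℂ) volume (f := fun y : ℝ => y⁻¹) (r := ρ)).2 (by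
    have : IntegrableOn (fun _ : ℝ => (1 : ℝ)) (Ioo 0 ρ) := by simp
    refine this.congr_fun (fun y hy => ?_) measurableSet_Ioo
    simp [mul_inv_cancel₀ hy.1.ne'])
  exact h

lemma integral_ball_inv_norm {ρ : ℝ} (hρ : 0 ≤ ρ) :
    ∫ w in ball (0 : ℂ) ρ, ‖w‖⁻¹ = 2 * Real.pi * ρ := by
  have h := integral_fun_norm_addHaar (E := ℂ) volume (fun y : ℝ => (Iio ρ).indicator (fun y => y⁻¹) y)
  have e1 : (fun x : ℂ => (Iio ρ).indicator (fun y : ℝ => y⁻¹) ‖x‖) =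
      (ball (0 : ℂ) ρ).indicator (fun w => ‖w‖⁻¹) := by
    funext x
    by_cases hx : ‖x‖ < ρ
    · rw [indicator_of_mem (show ‖x‖ ∈ Iio ρ from hx), indicator_of_mem (by simpa using hx)]
    · rw [indicator_of_notMem (show ‖x‖ ∉ Iio ρ from hx), indicator_of_notMem (by simpa using hx)]
  rw [e1, integral_indicator measurableSet_ball] at h
  rw [h]
  have e2 : ∫ y in Ioi (0 : ℝ), y ^ (Module.finrank ℝ ℂ - 1) • (Iio ρ).indicator (fun y => y⁻¹) y =
      ∫ y in Ioo (0 : ℝ) ρ, (1 : ℝ) := by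
    rw [← integral_indicator measurableSet_Ioi, ← integral_indicator measurableSet_Ioo]
    congr 1
    funext y
    by_cases h0 : 0 < y
    · by_cases h1 : y < ρ
      · simp [indicator, h0, h1, mul_inv_cancel₀ h0.ne']
      · simp [indicator, h1]
    · simp [indicator, h0]
  rw [e2]
  simp [Measure.real, hρ, Complex.volume_ball]
  ring

lemma lintegral_ball_inv_sub (z : ℂ) {ρ : ℝ} (hρ : 0 ≤ ρ) :
    ∫⁻ w in ball z ρ, ‖(z - w)⁻¹‖ₑ = ENNReal.ofReal (2 * Real.pi * ρ) := by
  have h0 : ∫⁻ w in ball (0 : ℂ) ρ, ‖w⁻¹‖ₑ = ENNReal.ofReal (2 * Real.pi * ρ) := by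
    rw [← integral_ball_inv_norm hρ, ofReal_integral_eq_lintegral_ofReal
      (integrableOn_ball_inv_norm ρ) (ae_of_all _ fun w => by positivity)]
    refine lintegral_congr fun w => ?_
    rw [← norm_inv, ofReal_norm]
  rw [← h0, ← lintegral_indicator measurableSet_ball, ← lintegral_indicator measurableSet_ball,
    ← lintegral_sub_left_eq_self _ z]
  refine lintegral_congr fun w => ?_
  have : z - w ∈ ball z ρ ↔ w ∈ ball (0 : ℂ) ρ := by
    simp [dist_eq_norm]
  by_cases hw : w ∈ ball (0 : ℂ) ρ
  · rw [indicator_of_mem hw, indicator_of_mem (this.2 hw), sub_sub_cancel]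
  · rw [indicator_of_notMem hw, indicator_of_notMem (fun h => hw (this.1 h))]

lemma locallyIntegrable_inv : LocallyIntegrable (fun w : ℂ => w⁻¹) := by
  intro x
  refine ⟨ball 0 (‖x‖ + 1), isOpen_ball.mem_nhds (by simp), ?_⟩
  refine (integrableOn_ball_inv_norm (‖x‖ + 1)).mono' (measurable_inv.aestronglyMeasurable)
    (ae_of_all _ fun w => by simp)

/-- The Cauchy–Pompeiu formula for compactly supported functions. -/
theorem integral_dbar_div {f : ℂ → ℂ} (hf : ContDiff ℝ 1 f) (hc : HasCompactSupport f) :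
    ∫ w : ℂ, (fderiv ℝ f w 1 + Complex.I * fderiv ℝ f w Complex.I) * w⁻¹ =
      -(2 * Real.pi * f 0) := by
  obtain ⟨R, hR, hsupp⟩ : ∃ R : ℝ, 0 < R ∧ ∀ w : ℂ, R ≤ ‖w‖ → f w = 0 ∧ fderiv ℝ f w = 0 := by
    obtain ⟨R, hR⟩ := hc.isCompact.isBounded.subset_ball (0 : ℂ)
    refine ⟨max R 1, by positivity, fun w hw => ?_⟩
    have hw' : w ∉ tsupport f := fun h => by
      have := hR h
      simp only [mem_ball, dist_zero_right] at this
      exact absurd (le_max_left R 1) (by linarith)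
    exact ⟨image_eq_zero_of_notMem_tsupport hw',
      by_contra fun hne => hw' (support_fderiv_subset ℝ hne)⟩
  have hdc : Continuous (fderiv ℝ f) := hf.continuous_fderiv (by simp)
  have hdf : ∀ w, HasFDerivAt f (fderiv ℝ f w) w := fun w =>
    (hf.differentiable (by simp) w).hasFDerivAt
  set e : ℝ → ℂ := fun θ => Complex.exp (θ * Complex.I) with he
  have hec : Continuous e := by fun_prop
  have hen : ∀ θ, ‖e θ‖ = 1 := fun θ => Complex.norm_exp_ofReal_mul_I θ
  have hsymm : ∀ p : ℝ × ℝ, Complex.polarCoord.symm p = p.1 * e p.2 := fun p => by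
    rw [Complex.polarCoord_symm_apply, he]
    simp only [Complex.exp_mul_I, Complex.ofReal_cos, Complex.ofReal_sin]
  -- the radial and the angular part of the integrand
  set a : ℝ × ℝ → ℂ := fun p => fderiv ℝ f (p.1 * e p.2) (e p.2) with ha
  set b : ℝ × ℝ → ℂ := fun p => fderiv ℝ f (p.1 * e p.2) (Complex.I * e p.2) with hb
  have hac : Continuous a := by
    have h1 : Continuous fun p : ℝ × ℝ => (p.1 : ℂ) * e p.2 := by fun_prop
    exact (hdc.comp h1).clm_apply (hec.comp continuous_snd)
  have hbc : Continuous b := by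
    have h1 : Continuous fun p : ℝ × ℝ => (p.1 : ℂ) * e p.2 := by fun_prop
    exact (hdc.comp h1).clm_apply (continuous_const.mul (hec.comp continuous_snd))
  have hzero : ∀ p : ℝ × ℝ, p.1 ∉ Ioo 0 R → p.1 ∈ Ioi (0 : ℝ) →
      fderiv ℝ f (p.1 * e p.2) = 0 := by
    intro p hp hp0
    refine (hsupp _ ?_).2
    rw [norm_mul, hen, mul_one, Complex.norm_real, Real.norm_eq_abs]
    by_contra hlt
    exact hp ⟨hp0, lt_of_le_of_lt (le_abs_self _) (not_le.1 hlt)⟩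
  have hpol : ∀ p ∈ Ioi (0 : ℝ) ×ˢ Ioo (-Real.pi) Real.pi,
      p.1 • ((fderiv ℝ f (Complex.polarCoord.symm p) 1 +
        Complex.I * fderiv ℝ f (Complex.polarCoord.symm p) Complex.I) *
          (Complex.polarCoord.symm p)⁻¹) = a p + Complex.I * b p := by
    rintro p ⟨hp, -⟩
    have hp0 : (p.1 : ℂ) ≠ 0 := by
      have : p.1 ≠ 0 := ne_of_gt hp
      exact_mod_cast this
    have hen0 : e p.2 ≠ 0 := Complex.exp_ne_zero _
    rw [hsymm]
    set L := fderiv ℝ f (p.1 * e p.2) with hL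
    have hlin : ∀ w : ℂ, L w = w.re * L 1 + w.im * L Complex.I := by
      intro w
      conv_lhs => rw [← Complex.re_add_im w]
      have : (w.re : ℂ) + w.im * Complex.I = w.re • (1 : ℂ) + w.im • Complex.I := by simp
      rw [this, map_add, map_smul, map_smul]; simp
    have h1 : a p = (e p.2).re * L 1 + (e p.2).im * L Complex.I := hlin _
    have h2 : b p = (Complex.I * e p.2).re * L 1 + (Complex.I * e p.2).im * L Complex.I := hlin _
    have hconj : (e p.2)⁻¹ = (e p.2).re - (e p.2).im * Complex.I := by
      rw [Complex.inv_def, Complex.normSq_eq_norm_sq, hen]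
      simp only [one_pow, inv_one, Complex.ofReal_one, mul_one]
      apply Complex.ext <;> simp
    rw [h1, h2, mul_inv, hconj, Complex.real_smul]
    simp only [Complex.mul_re, Complex.I_re, zero_mul, Complex.I_im, one_mul, zero_sub,
      Complex.mul_im, zero_add, Complex.ofReal_neg]
    have hII : Complex.I * Complex.I = -1 := Complex.I_mul_I
    field_simp
    linear_combination (-(e p.2).im * L Complex.I) * Complex.I_sq
  rw [← Complex.integral_comp_polarCoord_symm, polarCoord_target,
    setIntegral_congr_fun (measurableSet_Ioi.prod measurableSet_Ioo) hpol]
  -- restrict to a bounded range of radii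
  have hrestr : ∫ p in Ioi (0 : ℝ) ×ˢ Ioo (-Real.pi) Real.pi, (a p + Complex.I * b p) =
      ∫ p in Ioo (0 : ℝ) R ×ˢ Ioo (-Real.pi) Real.pi, (a p + Complex.I * b p) := by
    have hsub : Ioo (0 : ℝ) R ×ˢ Ioo (-Real.pi) Real.pi ⊆ Ioi (0 : ℝ) ×ˢ Ioo (-Real.pi) Real.pi :=
      Set.prod_mono Ioo_subset_Ioi_self subset_rfl
    have hout : ∀ p ∈ (Ioi (0 : ℝ) ×ˢ Ioo (-Real.pi) Real.pi) \
        (Ioo (0 : ℝ) R ×ˢ Ioo (-Real.pi) Real.pi), a p + Complex.I * b p = 0 := by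
      rintro p ⟨⟨hp1, hp2⟩, hp3⟩
      have : p.1 ∉ Ioo 0 R := fun h => hp3 ⟨h, hp2⟩
      simp [ha, hb, hzero p this hp1]
    exact (setIntegral_eq_of_subset_of_forall_sdiff_eq_zero
      (measurableSet_Ioi.prod measurableSet_Ioo) hsub hout)
  rw [hrestr]
  have hint : ∀ h : ℝ × ℝ → ℂ, Continuous h →
      IntegrableOn h (Ioo (0 : ℝ) R ×ˢ Ioo (-Real.pi) Real.pi) := fun h hh =>
    (hh.continuousOn.integrableOn_compact (isCompact_Icc.prod isCompact_Icc)).mono_set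
      (prod_mono Ioo_subset_Icc_self Ioo_subset_Icc_self)
  have hderiv_r : ∀ θ r : ℝ, HasDerivAt (fun r : ℝ => f (r * e θ)) (a (r, θ)) r := by
    intro θ r
    have h1 : HasDerivAt (fun r : ℝ => (r : ℂ) * e θ) (1 * e θ) r :=
      (Complex.ofRealCLM.hasDerivAt (x := r)).mul_const _
    rw [one_mul] at h1
    exact (hdf (r * e θ)).comp_hasDerivAt r h1
  have hderiv_t : ∀ r θ : ℝ, HasDerivAt (fun θ : ℝ => f (r * e θ)) (r * b (r, θ)) θ := by
    intro r θ
    have h1 : HasDerivAt (fun θ : ℝ => (r : ℂ) * e θ) (r * (e θ * Complex.I)) θ := by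
      have h0 : HasDerivAt (fun θ : ℝ => (θ : ℂ) * Complex.I) (1 * Complex.I) θ :=
        (Complex.ofRealCLM.hasDerivAt (x := θ)).mul_const _
      rw [one_mul] at h0
      exact h0.cexp.const_mul _
    have h2 := (hdf (r * e θ)).comp_hasDerivAt θ h1
    have e1 : (r : ℂ) * (e θ * Complex.I) = r • (Complex.I * e θ) := by
      rw [Complex.real_smul]; ring
    rw [e1, map_smul, Complex.real_smul] at h2
    exact h2
  have ia : ∫ p in Ioo (0 : ℝ) R ×ˢ Ioo (-Real.pi) Real.pi, a p = -(2 * Real.pi * f 0) := by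
    rw [Measure.volume_eq_prod, ← setIntegral_prod_swap,
      setIntegral_prod _ (by
        have := (hint a hac)
        rw [Measure.volume_eq_prod] at this
        exact this.swap)]
    have inner : ∀ θ : ℝ, ∫ r in Ioo (0 : ℝ) R, a (r, θ) = -f 0 := by
      intro θ
      rw [← integral_Ioc_eq_integral_Ioo, ← intervalIntegral.integral_of_le hR.le,
        intervalIntegral.integral_eq_sub_of_hasDerivAt (fun r _ => hderiv_r θ r)
          ((hac.comp (by fun_prop : Continuous fun r : ℝ => (r, θ))).intervalIntegrable _ _)]
      have : f (R * e θ) = 0 := (hsupp _ (by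
        rw [norm_mul, hen, mul_one, Complex.norm_real, Real.norm_eq_abs]; exact le_abs_self R)).1
      simp [this]
    simp only [Prod.swap_prod_mk, inner]
    simp [Real.pi_pos.le]
    left
    ring
  have ib : ∫ p in Ioo (0 : ℝ) R ×ˢ Ioo (-Real.pi) Real.pi, b p = 0 := by
    rw [Measure.volume_eq_prod, setIntegral_prod _ (by
        have := (hint b hbc)
        rwa [Measure.volume_eq_prod] at this)]
    have inner : ∀ r ∈ Ioo (0 : ℝ) R, ∫ θ in Ioo (-Real.pi) Real.pi, b (r, θ) = 0 := by
      intro r hr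
      have h1 : ∫ θ in (-Real.pi)..Real.pi, (r * b (r, θ) : ℂ) = 0 := by
        rw [intervalIntegral.integral_eq_sub_of_hasDerivAt (fun θ _ => hderiv_t r θ)
          ((continuous_const.mul (hbc.comp
            (by fun_prop : Continuous fun θ : ℝ => (r, θ)))).intervalIntegrable _ _)]
        have : e Real.pi = e (-Real.pi) := by simp [he, Complex.exp_neg, Complex.exp_pi_mul_I]
        rw [this, sub_self]
      rw [intervalIntegral.integral_const_mul] at h1
      have hr0 : (r : ℂ) ≠ 0 := by exact_mod_cast hr.1.ne'
      have h2 := (mul_eq_zero.1 h1).resolve_left hr0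
      rwa [intervalIntegral.integral_of_le (by linarith [Real.pi_pos]),
        integral_Ioc_eq_integral_Ioo] at h2
    rw [setIntegral_congr_fun measurableSet_Ioo inner]
    simp
  have hadd := integral_add (hint a hac)
    (hint (fun p => Complex.I * b p) (continuous_const.mul hbc))
  rw [hadd, integral_const_mul, ia, ib]
  simp

end CauchyKernel

end

section

section CauchyTransform

open Metric

/-- The Cauchy transform solves the inhomogeneous Cauchy–Riemann equation. -/
theorem cauchyTransform_smooth {f : ℂ → ℂ} (hf : ContDiff ℝ ∞ f) (hc : HasCompactSupport f) :
    ContDiff ℝ ∞ (fun z => ∫ w, f w * (z - w)⁻¹) ∧ ∀ z,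
      fderiv ℝ (fun z => ∫ w, f w * (z - w)⁻¹) z 1 +
        Complex.I * fderiv ℝ (fun z => ∫ w, f w * (z - w)⁻¹) z Complex.I = 2 * Real.pi * f z := by
  set L := ContinuousLinearMap.mul ℝ ℂ with hL
  have hconv : (fun z => ∫ w, f w * (z - w)⁻¹) = convolution f (fun w : ℂ => w⁻¹) L volume := by
    funext z
    simp [convolution_def, hL]
  have hf1 : ContDiff ℝ 1 f := hf.of_le (by exact_mod_cast le_top)
  have hdc : Continuous (fderiv ℝ f) := hf1.continuous_fderiv (by simp)
  refine ⟨?_, fun z => ?_⟩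
  · rw [hconv]
    exact hc.contDiff_convolution_left L (n := ⊤) hf locallyIntegrable_inv
  · have hd := hc.hasFDerivAt_convolution_left (μ := volume) L hf1 locallyIntegrable_inv z
    have hex : ConvolutionExistsAt (fderiv ℝ f) (fun w : ℂ => w⁻¹) z (L.precompL ℂ) volume :=
      (hc.fderiv ℝ).convolutionExists_left (L.precompL ℂ) hdc locallyIntegrable_inv z
    have happ : ∀ v, fderiv ℝ (fun z => ∫ w, f w * (z - w)⁻¹) z v =
        ∫ w, fderiv ℝ f (z - w) v * w⁻¹ := by
      intro v
      rw [hconv, hd.fderiv, convolution_def, ContinuousLinearMap.integral_apply hex,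
        ← integral_sub_left_eq_self _ volume z]
      simp [hL]
    have hcont : ∀ v, Integrable (fun w => fderiv ℝ f (z - w) v * w⁻¹) := by
      intro v
      have h1 : ConvolutionExistsAt (fun w => fderiv ℝ f w v) (fun w : ℂ => w⁻¹) z L volume := by
        refine HasCompactSupport.convolutionExists_left L ?_ (hdc.clm_apply continuous_const)
          locallyIntegrable_inv z
        exact (hc.fderiv ℝ).comp_left (g := fun T : ℂ →L[ℝ] ℂ => T v) (by simp)
      have h2 := h1.integrable
      have h3 := h2.comp_sub_left z
      simpa [hL] using h3
    have hF : ContDiff ℝ 1 (fun w => f (z - w)) := hf1.comp (contDiff_const.sub contDiff_id)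
    have hFc : HasCompactSupport (fun w => f (z - w)) :=
      hc.comp_homeomorph (Homeomorph.subLeft z)
    have hFd : ∀ w v, fderiv ℝ (fun w => f (z - w)) w v = -fderiv ℝ f (z - w) v := by
      intro w v
      have h1 : HasFDerivAt (fun w : ℂ => z - w) (-ContinuousLinearMap.id ℝ ℂ) w :=
        (hasFDerivAt_id w).const_sub z
      have h2 := ((hf1.differentiable (by simp)) (z - w)).hasFDerivAt.comp w h1
      have h3 : fderiv ℝ (fun w => f (z - w)) w = _ := h2.fderiv
      rw [h3]; simp
    have key := integral_dbar_div hF hFc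
    simp only [hFd, sub_zero] at key
    rw [happ, happ, ← integral_const_mul, ← integral_add (hcont 1) ((hcont Complex.I).const_mul _)]
    rw [← neg_eq_iff_eq_neg, ← integral_neg] at key
    rw [← key]
    refine integral_congr_ae (ae_of_all _ fun w => ?_)
    ring

end CauchyTransform

end

section

section DiskTransform

open Metric ComplexConjugate

/-- The Neumann-type kernel `1/(z-w) - w̄/(1-z w̄)` of the unit disk. -/
def diskKernel (z w : ℂ) : ℂ := (z - w)⁻¹ - conj w * (1 - z * conj w)⁻¹

/-- The solution `G` of `∂G/∂z̄ = g/2` on the disk with `Re (z G)` constant on the circle. -/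
def diskTransform (g : ℂ → ℝ) (z : ℂ) : ℂ :=
  (2 * Real.pi : ℂ)⁻¹ * ∫ w in ball (0 : ℂ) 1, (g w : ℂ) * diskKernel z w

lemma one_sub_norm_le_norm_one_sub_mul_conj {z w : ℂ} (hw : ‖w‖ < 1) :
    1 - ‖z‖ ≤ ‖1 - z * conj w‖ := by
  have h1 : ‖z * conj w‖ ≤ ‖z‖ := by
    rw [norm_mul, RCLike.norm_conj]
    exact mul_le_of_le_one_right (norm_nonneg _) hw.le
  have h2 := norm_sub_norm_le (1 : ℂ) (z * conj w)
  rw [norm_one] at h2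
  linarith

lemma norm_sub_le_norm_one_sub_mul_conj {z w : ℂ} (hz : ‖z‖ ≤ 1) (hw : ‖w‖ ≤ 1) :
    ‖z - w‖ ≤ ‖1 - z * conj w‖ := by
  rw [← sq_le_sq₀ (norm_nonneg _) (norm_nonneg _), ← Complex.normSq_eq_norm_sq,
    ← Complex.normSq_eq_norm_sq]
  have hz' : z.re ^ 2 + z.im ^ 2 ≤ 1 := by
    have := Complex.normSq_eq_norm_sq z
    rw [Complex.normSq_apply] at this
    nlinarith [norm_nonneg z]
  have hw' : w.re ^ 2 + w.im ^ 2 ≤ 1 := by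
    have := Complex.normSq_eq_norm_sq w
    rw [Complex.normSq_apply] at this
    nlinarith [norm_nonneg w]
  simp only [Complex.normSq_apply, Complex.sub_re, Complex.sub_im, Complex.one_re, Complex.one_im,
    Complex.mul_re, Complex.mul_im, Complex.conj_re, Complex.conj_im]
  nlinarith [mul_nonneg (sub_nonneg.2 hz') (sub_nonneg.2 hw')]

lemma norm_diskKernel_le {z w : ℂ} (hz : ‖z‖ ≤ 1) (hw : ‖w‖ ≤ 1) (hne : z ≠ w) :
    ‖diskKernel z w‖ ≤ 2 * ‖(z - w)⁻¹‖ := by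
  have h1 : ‖conj w * (1 - z * conj w)⁻¹‖ ≤ ‖(z - w)⁻¹‖ := by
    rw [norm_mul, RCLike.norm_conj, norm_inv, norm_inv]
    have h2 : ‖1 - z * conj w‖⁻¹ ≤ ‖z - w‖⁻¹ :=
      inv_anti₀ (norm_pos_iff.2 (sub_ne_zero.2 hne)) (norm_sub_le_norm_one_sub_mul_conj hz hw)
    calc ‖w‖ * ‖1 - z * conj w‖⁻¹ ≤ 1 * ‖1 - z * conj w‖⁻¹ := by gcongr
      _ ≤ ‖z - w‖⁻¹ := by rw [one_mul]; exact h2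
  calc ‖diskKernel z w‖ ≤ ‖(z - w)⁻¹‖ + ‖conj w * (1 - z * conj w)⁻¹‖ := norm_sub_le _ _
    _ ≤ 2 * ‖(z - w)⁻¹‖ := by linarith

lemma measurable_diskKernel (z : ℂ) : Measurable (diskKernel z) := by
  unfold diskKernel
  have : Measurable (fun w : ℂ => conj w) := Complex.continuous_conj.measurable
  fun_prop

/-- The disk transform is smooth in the open disk and solves the Cauchy–Riemann equation with
right-hand side `g`. -/
theorem diskTransform_interior {g : ℂ → ℝ} (hg : IntegrableOn g (ball 0 1))
    (hs : ContDiffOn ℝ ∞ g (ball 0 1)) {z₀ : ℂ} (hz₀ : z₀ ∈ ball (0 : ℂ) 1) :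
    ContDiffAt ℝ ∞ (diskTransform g) z₀ ∧
      fderiv ℝ (diskTransform g) z₀ 1 + Complex.I * fderiv ℝ (diskTransform g) z₀ Complex.I =
        g z₀ := by
  have hz₀' : ‖z₀‖ < 1 := by simpa using hz₀
  set ρ := (1 - ‖z₀‖) / 4 with hρ
  have hρ0 : 0 < ρ := by rw [hρ]; linarith
  let χ : ContDiffBump z₀ := ⟨ρ, 2 * ρ, hρ0, by linarith⟩
  have hχ1 : ∀ w ∈ closedBall z₀ ρ, χ w = 1 := fun w hw => χ.one_of_mem_closedBall hw
  have hχle : ∀ w, χ w ≤ 1 := fun w => χ.le_one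
  have hχ0 : ∀ w, 0 ≤ χ w := fun w => χ.nonneg
  have hχsupp : closedBall z₀ (2 * ρ) ⊆ ball 0 1 := by
    intro w hw
    have h1 : ‖w - z₀‖ ≤ 2 * ρ := by simpa [dist_eq_norm] using hw
    have h2 : ‖w‖ ≤ ‖w - z₀‖ + ‖z₀‖ := by simpa using norm_add_le (w - z₀) z₀
    simp only [mem_ball, dist_zero_right]
    rw [hρ] at h1; linarith
  set f : ℂ → ℂ := fun w => ((χ w * g w : ℝ) : ℂ) with hf
  have hfsupp : ∀ w, w ∉ closedBall z₀ (2 * ρ) → f w = 0 := by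
    intro w hw
    have : χ w = 0 := χ.zero_of_le_dist (by simpa using (not_le.1 hw).le)
    simp [hf, this]
  have hfc : HasCompactSupport f :=
    HasCompactSupport.intro (isCompact_closedBall z₀ (2 * ρ)) hfsupp
  have hfs : ContDiff ℝ ∞ f := by
    rw [contDiff_iff_contDiffAt]
    intro w
    by_cases hw : w ∈ closedBall z₀ (2 * ρ)
    · have h1 : ContDiffAt ℝ ∞ g w := hs.contDiffAt (isOpen_ball.mem_nhds (hχsupp hw))
      exact Complex.ofRealCLM.contDiff.contDiffAt.comp w (χ.contDiff.contDiffAt.mul h1)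
    · have h1 : f =ᶠ[𝓝 w] fun _ => 0 := by
        filter_upwards [isClosed_closedBall.isOpen_compl.mem_nhds hw] with v hv
        exact hfsupp v hv
      exact contDiffAt_const.congr_of_eventuallyEq h1
  obtain ⟨hT1, hT1'⟩ := cauchyTransform_smooth hfs hfc
  set T1 : ℂ → ℂ := fun z => ∫ w, f w * (z - w)⁻¹ with hT1def
  -- the part of the integral away from `z₀`
  set K2 : ℂ → ℂ → ℂ := fun z w => ((1 - χ w : ℝ) : ℂ) * (z - w)⁻¹ - conj w * (1 - z * conj w)⁻¹
    with hK2
  set K2' : ℂ → ℂ → ℂ := fun z w => ((1 - χ w : ℝ) : ℂ) * (-1 / (z - w) ^ 2) -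
    conj w * (conj w / (1 - z * conj w) ^ 2) with hK2'
  have hconjm : Measurable (fun w : ℂ => conj w) := Complex.continuous_conj.measurable
  have hχm : Measurable (fun w => ((1 - χ w : ℝ) : ℂ)) := by
    have := χ.continuous
    exact (Complex.continuous_ofReal.comp (continuous_const.sub this)).measurable
  have hKm : ∀ z, Measurable (K2 z) := fun z => by simp only [hK2]; fun_prop
  have hKm' : ∀ z, Measurable (K2' z) := fun z => by simp only [hK2']; fun_prop
  have hgm : AEStronglyMeasurable (fun w => (g w : ℂ)) (volume.restrict (ball 0 1)) :=
    Complex.continuous_ofReal.comp_aestronglyMeasurable hg.aestronglyMeasurable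
  have hnear : ∀ z ∈ ball z₀ (ρ / 2), ∀ w ∈ ball (0 : ℂ) 1,
      (χ w = 1 ∨ ρ / 2 ≤ ‖z - w‖) ∧ ρ ≤ ‖1 - z * conj w‖ := by
    intro z hz w hw
    have h1 : ‖z - z₀‖ < ρ / 2 := by simpa [dist_eq_norm] using hz
    have h3 : ‖w‖ < 1 := by simpa using hw
    refine ⟨?_, ?_⟩
    · by_cases hwρ : w ∈ closedBall z₀ ρ
      · exact Or.inl (hχ1 w hwρ)
      · right
        have h2 : ρ < ‖w - z₀‖ := by simpa [dist_eq_norm] using hwρ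
        have h4 : ‖w - z₀‖ ≤ ‖z - z₀‖ + ‖z - w‖ := by
          have := norm_sub_le (z - z₀) (z - w)
          simpa using this
        linarith
    · have h2 := one_sub_norm_le_norm_one_sub_mul_conj (z := z) h3
      have h4 : ‖z‖ ≤ ‖z - z₀‖ + ‖z₀‖ := by simpa using norm_add_le (z - z₀) z₀
      rw [hρ] at h1 ⊢; linarith
  have hbd : ∀ z ∈ ball z₀ (ρ / 2), ∀ w ∈ ball (0 : ℂ) 1, ‖K2 z w‖ ≤ 2 / ρ + 1 / ρ := by
    intro z hz w hw
    obtain ⟨h1, h2⟩ := hnear z hz w hw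
    have h3 : ‖w‖ ≤ 1 := by
      have : ‖w‖ < 1 := by simpa using hw
      exact this.le
    refine (norm_sub_le _ _).trans (add_le_add ?_ ?_)
    · rcases h1 with h1 | h1
      · simp [h1]; positivity
      · rw [norm_mul, norm_inv, Complex.norm_real, Real.norm_eq_abs,
          abs_of_nonneg (sub_nonneg.2 (hχle w))]
        calc (1 - χ w) * ‖z - w‖⁻¹ ≤ 1 * (ρ / 2)⁻¹ := by
              gcongr
              linarith [hχ0 w]
          _ = 2 / ρ := by rw [one_mul, inv_div]
    · rw [norm_mul, norm_inv, RCLike.norm_conj]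
      calc ‖w‖ * ‖1 - z * conj w‖⁻¹ ≤ 1 * ρ⁻¹ := by gcongr
        _ = 1 / ρ := by rw [one_mul, one_div]
  have hbd' : ∀ z ∈ ball z₀ (ρ / 2), ∀ w ∈ ball (0 : ℂ) 1,
      ‖K2' z w‖ ≤ 1 / (ρ / 2) ^ 2 + 1 / ρ ^ 2 := by
    intro z hz w hw
    obtain ⟨h1, h2⟩ := hnear z hz w hw
    have h3 : ‖w‖ ≤ 1 := by
      have : ‖w‖ < 1 := by simpa using hw
      exact this.le
    refine (norm_sub_le _ _).trans (add_le_add ?_ ?_)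
    · rcases h1 with h1 | h1
      · simp [h1]; positivity
      · rw [norm_mul, norm_div, norm_neg, norm_one, norm_pow, Complex.norm_real, Real.norm_eq_abs,
          abs_of_nonneg (sub_nonneg.2 (hχle w))]
        calc (1 - χ w) * (1 / ‖z - w‖ ^ 2) ≤ 1 * (1 / (ρ / 2) ^ 2) := by
              gcongr
              linarith [hχ0 w]
          _ = 1 / (ρ / 2) ^ 2 := by rw [one_mul]
    · rw [norm_mul, norm_div, norm_pow, RCLike.norm_conj]
      calc ‖w‖ * (‖w‖ / ‖1 - z * conj w‖ ^ 2) ≤ 1 * (1 / ρ ^ 2) := by gcongr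
        _ = 1 / ρ ^ 2 := by rw [one_mul]
  have hderK : ∀ z ∈ ball z₀ (ρ / 2), ∀ w ∈ ball (0 : ℂ) 1,
      HasDerivAt (fun z => K2 z w) (K2' z w) z := by
    intro z hz w hw
    obtain ⟨h1, h2⟩ := hnear z hz w hw
    have hne : 1 - z * conj w ≠ 0 := norm_pos_iff.1 (hρ0.trans_le h2)
    have d1 : HasDerivAt (fun z => (1 - z * conj w)⁻¹) (conj w / (1 - z * conj w) ^ 2) z := by
      have h := (((hasDerivAt_id' z).mul_const (conj w)).const_sub 1).fun_inv hne
      refine h.congr_deriv ?_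
      ring
    have d2 : HasDerivAt (fun z => ((1 - χ w : ℝ) : ℂ) * (z - w)⁻¹)
        (((1 - χ w : ℝ) : ℂ) * (-1 / (z - w) ^ 2)) z := by
      rcases h1 with h1 | h1
      · simp only [h1, sub_self, Complex.ofReal_zero, zero_mul]
        exact hasDerivAt_const z 0
      · have hne' : z - w ≠ 0 := norm_pos_iff.1 (by linarith)
        exact (((hasDerivAt_id z).sub_const w).inv hne').const_mul _
    exact d2.sub (d1.const_mul _)
  have hFint : ∀ z ∈ ball z₀ (ρ / 2), IntegrableOn (fun w => (g w : ℂ) * K2 z w) (ball 0 1) := by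
    intro z hz
    refine Integrable.mono' (hg.norm.mul_const (2 / ρ + 1 / ρ)) (hgm.mul (hKm z).aestronglyMeasurable) ?_
    refine (ae_restrict_iff' measurableSet_ball).2 (ae_of_all _ fun w hw => ?_)
    rw [norm_mul, Complex.norm_real]
    exact mul_le_mul_of_nonneg_left (hbd z hz w hw) (norm_nonneg _)
  set T2 : ℂ → ℂ := fun z => ∫ w in ball (0 : ℂ) 1, (g w : ℂ) * K2 z w with hT2def
  have hT2 : DifferentiableOn ℂ T2 (ball z₀ (ρ / 2)) := by
    intro z hz
    have := hasDerivAt_integral_of_dominated_loc_of_deriv_le (μ := volume.restrict (ball (0 : ℂ) 1))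
      (F := fun z w => (g w : ℂ) * K2 z w) (F' := fun z w => (g w : ℂ) * K2' z w) (x₀ := z)
      (bound := fun w => ‖g w‖ * (1 / (ρ / 2) ^ 2 + 1 / ρ ^ 2)) (isOpen_ball.mem_nhds hz)
      (Eventually.of_forall fun z => hgm.mul (hKm z).aestronglyMeasurable) (hFint z hz)
      (hgm.mul (hKm' z).aestronglyMeasurable)
      ((ae_restrict_iff' measurableSet_ball).2 (ae_of_all _ fun w hw x hx => by
        rw [norm_mul, Complex.norm_real]
        exact mul_le_mul_of_nonneg_left (hbd' x hx w hw) (norm_nonneg _)))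
      (hg.norm.mul_const _)
      ((ae_restrict_iff' measurableSet_ball).2 (ae_of_all _ fun w hw x hx =>
        (hderK x hx w hw).const_mul _))
    exact this.2.differentiableAt.differentiableWithinAt
  have hsplit : ∀ z ∈ ball z₀ (ρ / 2), diskTransform g z = (2 * Real.pi : ℂ)⁻¹ * (T1 z + T2 z) := by
    intro z hz
    have hexists : Integrable (fun w => f w * (z - w)⁻¹) := by
      have h1 : ConvolutionExistsAt f (fun w : ℂ => w⁻¹) z (ContinuousLinearMap.mul ℝ ℂ) volume :=
        hfc.convolutionExists_left _ hfs.continuous locallyIntegrable_inv z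
      simpa using h1.integrable
    have h2 : T1 z = ∫ w in ball (0 : ℂ) 1, f w * (z - w)⁻¹ := by
      rw [hT1def, setIntegral_eq_integral_of_forall_compl_eq_zero]
      intro w hw
      rw [hfsupp w (fun h => hw (hχsupp h)), zero_mul]
    rw [diskTransform, h2, hT2def, ← integral_add hexists.integrableOn (hFint z hz)]
    congr 1
    refine integral_congr_ae (ae_of_all _ fun w => ?_)
    simp only [diskKernel, hf, hK2, Complex.ofReal_mul, Complex.ofReal_sub, Complex.ofReal_one]
    ring
  have hEq : diskTransform g =ᶠ[𝓝 z₀] fun z => (2 * Real.pi : ℂ)⁻¹ * (T1 z + T2 z) := by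
    filter_upwards [isOpen_ball.mem_nhds (mem_ball_self (half_pos hρ0))] with z hz
    exact hsplit z hz
  have hT2s : ContDiffAt ℝ ∞ T2 z₀ := by
    have : ContDiffAt ℂ ∞ T2 z₀ := (hT2.contDiffOn isOpen_ball).contDiffAt
      (isOpen_ball.mem_nhds (mem_ball_self (half_pos hρ0)))
    exact this.restrict_scalars ℝ
  have hT2d : DifferentiableAt ℂ T2 z₀ :=
    hT2.differentiableAt (isOpen_ball.mem_nhds (mem_ball_self (half_pos hρ0)))
  refine ⟨(contDiffAt_const.mul (hT1.contDiffAt.add hT2s)).congr_of_eventuallyEq hEq, ?_⟩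
  have hd1 : HasFDerivAt T1 (fderiv ℝ T1 z₀) z₀ :=
    (hT1.differentiable (by simp) z₀).hasFDerivAt
  have hd2 : HasFDerivAt T2 ((fderiv ℂ T2 z₀).restrictScalars ℝ) z₀ :=
    hT2d.hasFDerivAt.restrictScalars ℝ
  have hd : fderiv ℝ (diskTransform g) z₀ = (2 * Real.pi : ℂ)⁻¹ •
      (fderiv ℝ T1 z₀ + (fderiv ℂ T2 z₀).restrictScalars ℝ) := by
    rw [hEq.fderiv_eq]
    exact ((hd1.add hd2).const_mul _).fderiv
  have hI : fderiv ℂ T2 z₀ Complex.I = Complex.I * fderiv ℂ T2 z₀ 1 := by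
    simp
  have hpi : (2 * Real.pi : ℂ) ≠ 0 := by simp [Real.pi_ne_zero]
  have hfz : f z₀ = g z₀ := by simp [hf, hχ1 z₀ (mem_closedBall_self hρ0.le)]
  have h1 := hT1' z₀
  rw [hfz] at h1
  rw [hd]
  simp only [FunLike.coe_smul, FunLike.coe_add, Pi.smul_apply, Pi.add_apply, smul_eq_mul,
    ContinuousLinearMap.coe_restrictScalars', hI]
  rw [show (2 * Real.pi : ℂ)⁻¹ * (fderiv ℝ T1 z₀ 1 + fderiv ℂ T2 z₀ 1) + Complex.I *
    ((2 * Real.pi : ℂ)⁻¹ * (fderiv ℝ T1 z₀ Complex.I + Complex.I * fderiv ℂ T2 z₀ 1)) =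
    (2 * Real.pi : ℂ)⁻¹ * ((fderiv ℝ T1 z₀ 1 + Complex.I * fderiv ℝ T1 z₀ Complex.I) +
      (1 + Complex.I * Complex.I) * fderiv ℂ T2 z₀ 1) by ring, h1, Complex.I_mul_I]
  field_simp
  ring

end DiskTransform

end

section

section DiskTransformBoundary

open Metric ComplexConjugate

/-- Near the pole, the kernel contributes little. -/
lemma integral_diskKernel_near {g : ℂ → ℝ} (hg : IntegrableOn g (ball 0 1)) {z : ℂ} (hz : ‖z‖ ≤ 1)
    {s M : ℝ} (hs : 0 ≤ s) (hM : ∀ w ∈ ball (0 : ℂ) 1 ∩ ball z s, |g w| ≤ M) :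
    IntegrableOn (fun w => (g w : ℂ) * diskKernel z w) (ball 0 1 ∩ ball z s) ∧
      ‖∫ w in ball (0 : ℂ) 1 ∩ ball z s, (g w : ℂ) * diskKernel z w‖ ≤
        4 * Real.pi * |M| * s := by
  have hms : MeasurableSet (ball (0 : ℂ) 1 ∩ ball z s) := measurableSet_ball.inter measurableSet_ball
  have hgm : AEStronglyMeasurable (fun w => (g w : ℂ) * diskKernel z w)
      (volume.restrict (ball 0 1 ∩ ball z s)) :=
    ((Complex.continuous_ofReal.comp_aestronglyMeasurable hg.aestronglyMeasurable).mono_measure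
      (Measure.restrict_mono inter_subset_left le_rfl)).mul
        (measurable_diskKernel z).aestronglyMeasurable
  have hb : ∫⁻ w in ball (0 : ℂ) 1 ∩ ball z s, ‖(g w : ℂ) * diskKernel z w‖ₑ ≤
      ENNReal.ofReal (4 * Real.pi * |M| * s) := by
    calc ∫⁻ w in ball (0 : ℂ) 1 ∩ ball z s, ‖(g w : ℂ) * diskKernel z w‖ₑ
        ≤ ∫⁻ w in ball (0 : ℂ) 1 ∩ ball z s, ENNReal.ofReal (2 * |M|) * ‖(z - w)⁻¹‖ₑ := by
          refine lintegral_mono_ae ((ae_restrict_iff' hms).2 ?_)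
          filter_upwards [Measure.ae_ne volume z] with w hwz hw
          rw [← ofReal_norm, ← ofReal_norm, ← ENNReal.ofReal_mul (by positivity)]
          refine ENNReal.ofReal_le_ofReal ?_
          have h1 : ‖w‖ ≤ 1 := by
            have : ‖w‖ < 1 := by simpa using hw.1
            exact this.le
          rw [norm_mul, Complex.norm_real, Real.norm_eq_abs]
          calc |g w| * ‖diskKernel z w‖ ≤ |M| * (2 * ‖(z - w)⁻¹‖) :=
                mul_le_mul ((hM w hw).trans (le_abs_self M)) (norm_diskKernel_le hz h1 hwz.symm)
                  (norm_nonneg _) (abs_nonneg _)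
            _ = 2 * |M| * ‖(z - w)⁻¹‖ := by ring
      _ ≤ ∫⁻ w in ball z s, ENNReal.ofReal (2 * |M|) * ‖(z - w)⁻¹‖ₑ :=
          lintegral_mono' (Measure.restrict_mono inter_subset_right le_rfl) le_rfl
      _ = ENNReal.ofReal (4 * Real.pi * |M| * s) := by
          rw [lintegral_const_mul' _ _ ENNReal.ofReal_ne_top, lintegral_ball_inv_sub z hs,
            ← ENNReal.ofReal_mul (by positivity)]
          congr 1; ring
  refine ⟨⟨hgm, hb.trans_lt ENNReal.ofReal_lt_top⟩, ?_⟩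
  have h1 := enorm_integral_le_lintegral_enorm (μ := volume.restrict (ball (0 : ℂ) 1 ∩ ball z s))
    (fun w => (g w : ℂ) * diskKernel z w)
  have h2 := h1.trans hb
  rw [← ofReal_norm] at h2
  exact (ENNReal.ofReal_le_ofReal_iff (by positivity)).1 h2

lemma norm_diskKernel_le_of_far {z w : ℂ} {s : ℝ} (hs : 0 < s) (hz : ‖z‖ ≤ 1) (hw : ‖w‖ ≤ 1)
    (h : s ≤ ‖z - w‖) : ‖diskKernel z w‖ ≤ 2 / s := by
  have hne : z ≠ w := by
    rintro rfl
    rw [sub_self, norm_zero] at h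
    linarith
  refine (norm_diskKernel_le hz hw hne).trans ?_
  rw [norm_inv, div_eq_mul_inv]
  gcongr

/-- Away from the pole, the integrand is integrable. -/
lemma integrableOn_diskKernel_far {g : ℂ → ℝ} (hg : IntegrableOn g (ball 0 1)) {z : ℂ}
    (hz : ‖z‖ ≤ 1) {s : ℝ} (hs : 0 < s) {A : Set ℂ} (hA : MeasurableSet A) (hA1 : A ⊆ ball 0 1)
    (hAz : ∀ w ∈ A, s ≤ ‖z - w‖) :
    IntegrableOn (fun w => (g w : ℂ) * diskKernel z w) A := by
  have hgA := hg.mono_set hA1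
  refine Integrable.mono' (hgA.norm.mul_const (2 / s))
    ((Complex.continuous_ofReal.comp_aestronglyMeasurable hgA.aestronglyMeasurable).mul
      (measurable_diskKernel z).aestronglyMeasurable)
    ((ae_restrict_iff' hA).2 (ae_of_all _ fun w hw => ?_))
  have h1 : ‖w‖ < 1 := by simpa using hA1 hw
  rw [norm_mul, Complex.norm_real]
  exact mul_le_mul_of_nonneg_left (norm_diskKernel_le_of_far hs hz h1.le (hAz w hw))
    (norm_nonneg _)

lemma continuousWithinAt_diskKernel {z w : ℂ} (hz : ‖z‖ ≤ 1) (hw : ‖w‖ < 1) (hne : z ≠ w) :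
    ContinuousAt (fun z => diskKernel z w) z := by
  have h1 : z - w ≠ 0 := sub_ne_zero.2 hne
  have h2 : 1 - z * conj w ≠ 0 := by
    have := norm_sub_le_norm_one_sub_mul_conj hz hw.le
    intro h
    rw [h, norm_zero] at this
    exact h1 (norm_le_zero_iff.1 this)
  unfold diskKernel
  refine ContinuousAt.sub (ContinuousAt.inv₀ (by fun_prop) h1)
    (continuousAt_const.mul (ContinuousAt.inv₀ (by fun_prop) h2))

/-- The disk transform is continuous up to boundary points near which `g` is bounded. -/
theorem continuousWithinAt_diskTransform {g : ℂ → ℝ} (hg : IntegrableOn g (ball 0 1)) {z₀ : ℂ}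
    (hz₀ : ‖z₀‖ ≤ 1) {ρ M : ℝ} (hρ : 0 < ρ) (hM : ∀ w ∈ ball (0 : ℂ) 1 ∩ ball z₀ ρ, |g w| ≤ M) :
    ContinuousWithinAt (diskTransform g) (closedBall 0 1) z₀ := by
  refine (continuousWithinAt_const (b := (2 * Real.pi : ℂ)⁻¹)).mul ?_
  refine continuousWithinAt_of_locally_uniform_approx_of_continuousWithinAt
    (by simpa using hz₀) fun u hu => ?_
  obtain ⟨ε, hε, hεu⟩ := Metric.mem_uniformity_dist.1 hu
  obtain ⟨r, hr0, hrρ, hrε⟩ : ∃ r : ℝ, 0 < r ∧ 2 * r ≤ ρ ∧ 8 * Real.pi * |M| * r < ε := by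
    refine ⟨min (ρ / 2) (ε / (8 * Real.pi * |M| + 1)), by positivity, ?_, ?_⟩
    · linarith [min_le_left (ρ / 2) (ε / (8 * Real.pi * |M| + 1))]
    · have h1 := min_le_right (ρ / 2) (ε / (8 * Real.pi * |M| + 1))
      have h2 : 0 < 8 * Real.pi * |M| + 1 := by positivity
      calc 8 * Real.pi * |M| * min (ρ / 2) (ε / (8 * Real.pi * |M| + 1))
          ≤ 8 * Real.pi * |M| * (ε / (8 * Real.pi * |M| + 1)) := by gcongr
        _ < (8 * Real.pi * |M| + 1) * (ε / (8 * Real.pi * |M| + 1)) := by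
            have : 0 < ε / (8 * Real.pi * |M| + 1) := by positivity
            gcongr; linarith
        _ = ε := by field_simp
  have hAm : MeasurableSet (ball (0 : ℂ) 1 \ ball z₀ r) := measurableSet_ball.diff measurableSet_ball
  have hfar : ∀ z, dist z z₀ < r / 2 → ∀ w ∈ ball (0 : ℂ) 1 \ ball z₀ r, r / 2 ≤ ‖z - w‖ := by
    intro z hz w hw
    have h1 : r ≤ dist w z₀ := by simpa using hw.2
    have h2 := dist_triangle w z z₀
    rw [← dist_eq_norm, dist_comm]
    linarith
  refine ⟨ball z₀ (r / 2) ∩ closedBall 0 1,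
    inter_mem (mem_nhdsWithin_of_mem_nhds (ball_mem_nhds _ (half_pos hr0))) self_mem_nhdsWithin,
    fun z => ∫ w in ball (0 : ℂ) 1 \ ball z₀ r, (g w : ℂ) * diskKernel z w, ?_, ?_⟩
  · refine continuousWithinAt_of_dominated (bound := fun w => ‖g w‖ * (2 / (r / 2))) ?_ ?_
      ((hg.mono_set sdiff_subset).norm.mul_const _) ?_
    · exact Eventually.of_forall fun z => (Complex.continuous_ofReal.comp_aestronglyMeasurable
        (hg.mono_set sdiff_subset).aestronglyMeasurable).mul
          (measurable_diskKernel z).aestronglyMeasurable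
    · filter_upwards [mem_nhdsWithin_of_mem_nhds (ball_mem_nhds z₀ (half_pos hr0)),
        self_mem_nhdsWithin] with z hz hz1
      refine (ae_restrict_iff' hAm).2 (ae_of_all _ fun w hw => ?_)
      have h1 : ‖w‖ < 1 := by simpa using hw.1
      rw [norm_mul, Complex.norm_real]
      exact mul_le_mul_of_nonneg_left (norm_diskKernel_le_of_far (half_pos hr0) (by simpa using hz1)
        h1.le (hfar z hz w hw)) (norm_nonneg _)
    · refine (ae_restrict_iff' hAm).2 (ae_of_all _ fun w hw => ?_)
      have h1 : ‖w‖ < 1 := by simpa using hw.1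
      refine continuousWithinAt_const.mul
        (continuousWithinAt_diskKernel hz₀ h1 ?_).continuousWithinAt
      rintro rfl
      exact hw.2 (mem_ball_self hr0)
  · rintro z ⟨hz, hz1⟩
    apply hεu
    have hz1' : ‖z‖ ≤ 1 := by simpa using hz1
    have hsub : ball (0 : ℂ) 1 ∩ ball z₀ r ⊆ ball 0 1 ∩ ball z (3 / 2 * r) := by
      rintro w ⟨hw1, hw2⟩
      refine ⟨hw1, ?_⟩
      have h2 := dist_triangle w z₀ z
      rw [mem_ball] at hw2 hz ⊢
      rw [dist_comm z₀ z] at h2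
      linarith
    -- cut `g` off outside the ball around `z₀`
    have hnear := integral_diskKernel_near (g := (ball z₀ r).indicator g)
      (hg.indicator measurableSet_ball) hz1' (s := 3 / 2 * r) (M := |M|) (by positivity)
      (fun w hw => by
        by_cases h : w ∈ ball z₀ r
        · rw [indicator_of_mem h]
          exact (hM w ⟨hw.1, ball_subset_ball (by linarith) h⟩).trans (le_abs_self M)
        · rw [indicator_of_notMem h, abs_zero]; exact abs_nonneg _)
    have hcongr : ∀ w ∈ ball (0 : ℂ) 1 ∩ ball z₀ r,
        (((ball z₀ r).indicator g w : ℝ) : ℂ) * diskKernel z w = (g w : ℂ) * diskKernel z w := by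
      intro w hw; rw [indicator_of_mem hw.2]
    have hms : MeasurableSet (ball (0 : ℂ) 1 ∩ ball z₀ r) := measurableSet_ball.inter measurableSet_ball
    have hi1 : IntegrableOn (fun w => (g w : ℂ) * diskKernel z w) (ball 0 1 ∩ ball z₀ r) :=
      (hnear.1.mono_set hsub).congr_fun hcongr hms
    have hi2 := integrableOn_diskKernel_far hg hz1' (half_pos hr0) hAm sdiff_subset (hfar z hz)
    have hint : ∫ w in ball (0 : ℂ) 1 ∩ ball z (3 / 2 * r),
        (((ball z₀ r).indicator g w : ℝ) : ℂ) * diskKernel z w =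
        ∫ w in ball (0 : ℂ) 1 ∩ ball z₀ r, (g w : ℂ) * diskKernel z w := by
      rw [← setIntegral_congr_fun hms hcongr]
      refine setIntegral_eq_of_subset_of_forall_sdiff_eq_zero
        (measurableSet_ball.inter measurableSet_ball) hsub fun w hw => ?_
      rw [indicator_of_notMem (fun h => hw.2 ⟨hw.1.1, h⟩)]; simp
    have hsplit : ∫ w in ball (0 : ℂ) 1, (g w : ℂ) * diskKernel z w =
        (∫ w in ball (0 : ℂ) 1 ∩ ball z₀ r, (g w : ℂ) * diskKernel z w) +
          ∫ w in ball (0 : ℂ) 1 \ ball z₀ r, (g w : ℂ) * diskKernel z w := by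
      rw [← setIntegral_union (disjoint_sdiff_right.mono_left inter_subset_right) hAm hi1 hi2]
      congr 2
      exact (inter_union_sdiff _ _).symm
    rw [dist_eq_norm, hsplit, add_sub_cancel_right, ← hint]
    refine hnear.2.trans_lt (lt_of_le_of_lt ?_ hrε)
    rw [abs_abs]
    have : 0 ≤ Real.pi * |M| * r := by positivity
    linarith

lemma integrableOn_diskKernel {g : ℂ → ℝ} (hg : IntegrableOn g (ball 0 1)) {z : ℂ}
    (hz : ‖z‖ ≤ 1) {ρ M : ℝ} (hρ : 0 < ρ) (hM : ∀ w ∈ ball (0 : ℂ) 1 ∩ ball z ρ, |g w| ≤ M) :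
    IntegrableOn (fun w => (g w : ℂ) * diskKernel z w) (ball 0 1) := by
  have h1 := (integral_diskKernel_near hg hz hρ.le hM).1
  have h2 := integrableOn_diskKernel_far hg hz hρ (measurableSet_ball.diff measurableSet_ball)
    (sdiff_subset (s := ball (0 : ℂ) 1) (t := ball z ρ)) (fun w hw => by
      have : ρ ≤ dist w z := by simpa using hw.2
      rwa [← dist_eq_norm, dist_comm])
  exact (h1.union h2).mono_set (inter_union_sdiff _ _).symm.subset

lemma re_mul_diskKernel {z w : ℂ} (hz : ‖z‖ = 1) (hne : z ≠ w) : (z * diskKernel z w).re = 1 := by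
  have hzz : z * conj z = 1 := by
    rw [Complex.mul_conj, Complex.normSq_eq_norm_sq, hz]; simp
  have hz0 : z ≠ 0 := norm_ne_zero_iff.1 (by rw [hz]; exact one_ne_zero)
  have h1 : z - w ≠ 0 := sub_ne_zero.2 hne
  have h2 : conj z - conj w ≠ 0 := by
    rw [← map_sub]; exact (map_ne_zero (starRingEnd ℂ)).2 h1
  have h3 : 1 - z * conj w = z * (conj z - conj w) := by rw [mul_sub, hzz]
  have h4 : z * diskKernel z w = z * (z - w)⁻¹ - conj w * (conj z - conj w)⁻¹ := by
    rw [diskKernel, h3, mul_inv, mul_sub]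
    congr 1
    field_simp
  have h5 : conj w * (conj z - conj w)⁻¹ = conj (z * (z - w)⁻¹) - 1 := by
    rw [map_mul, map_inv₀, map_sub]
    field_simp
    ring
  rw [h4, h5, Complex.sub_re, Complex.sub_re, Complex.conj_re, Complex.one_re]
  ring

/-- On the circle, `Re (z G z)` is constant. -/
theorem re_mul_diskTransform {g : ℂ → ℝ} (hg : IntegrableOn g (ball 0 1)) {z : ℂ}
    (hz : ‖z‖ = 1) {ρ M : ℝ} (hρ : 0 < ρ) (hM : ∀ w ∈ ball (0 : ℂ) 1 ∩ ball z ρ, |g w| ≤ M) :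
    (z * diskTransform g z).re = (2 * Real.pi)⁻¹ * ∫ w in ball (0 : ℂ) 1, g w := by
  have hi := integrableOn_diskKernel hg hz.le hρ hM
  have h1 : z * diskTransform g z = (((2 * Real.pi)⁻¹ : ℝ) : ℂ) *
      ∫ w in ball (0 : ℂ) 1, (g w : ℂ) * (z * diskKernel z w) := by
    rw [diskTransform, mul_left_comm, ← integral_const_mul]
    push_cast
    congr 2
    funext w
    ring
  have hi' : IntegrableOn (fun w => (g w : ℂ) * (z * diskKernel z w)) (ball 0 1) := by
    refine (hi.const_mul z).congr (ae_of_all _ fun w => ?_)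
    simp only; ring
  rw [h1, Complex.re_ofReal_mul]
  congr 1
  have h2 := integral_re hi'
  simp only [RCLike.re_to_complex] at h2
  rw [← h2]
  refine setIntegral_congr_fun measurableSet_ball fun w hw => ?_
  have hne : z ≠ w := by
    rintro rfl
    have : ‖z‖ < 1 := by simpa using hw
    linarith
  simp only [Complex.re_ofReal_mul, re_mul_diskKernel hz hne, mul_one]

/-- At boundary points where `g` has a mild power singularity, the disk transform is `o(1/|z-z₀|)`. -/
theorem tendsto_sub_mul_diskTransform {g : ℂ → ℝ} (hg : IntegrableOn g (ball 0 1)) {z₀ : ℂ}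
    {ρ C δ : ℝ} (hρ : 0 < ρ) (hδ : 0 < δ) (hδ1 : δ ≤ 1)
    (hC : ∀ w ∈ ball (0 : ℂ) 1 ∩ ball z₀ ρ, |g w| ≤ C * ‖w - z₀‖ ^ (2 * δ - 2)) :
    Tendsto (fun z => (z - z₀) * diskTransform g z) (𝓝[closedBall 0 1 \ {z₀}] z₀) (𝓝 0) := by
  set l := 𝓝[closedBall (0 : ℂ) 1 \ {z₀}] z₀ with hl
  have hlz : Tendsto (fun z : ℂ => ‖z - z₀‖) l (𝓝 0) := by
    have : Tendsto (fun z : ℂ => ‖z - z₀‖) (𝓝 z₀) (𝓝 ‖z₀ - z₀‖) := by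
      exact (continuous_id.sub continuous_const).norm.tendsto z₀
    rw [sub_self, norm_zero] at this
    exact this.mono_left nhdsWithin_le_nhds
  have hgm := Complex.continuous_ofReal.comp_aestronglyMeasurable hg.aestronglyMeasurable
  -- the part away from the pole
  have hfar : Tendsto (fun z => ∫ w in ball (0 : ℂ) 1, (ball z (‖z - z₀‖ / 2))ᶜ.indicator
      (fun w => (z - z₀) * ((g w : ℂ) * diskKernel z w)) w) l (𝓝 0) := by
    have h0 : ∫ w in ball (0 : ℂ) 1, (0 : ℂ) = 0 := by simp
    refine Eq.subst (motive := fun x => Tendsto _ l (𝓝 x)) h0 ?_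
    refine tendsto_integral_filter_of_dominated_convergence (fun w => 4 * ‖g w‖) ?_ ?_
      (hg.norm.const_mul 4) ?_
    · refine Eventually.of_forall fun z => AEStronglyMeasurable.indicator ?_
        measurableSet_ball.compl
      exact (hgm.mul (measurable_diskKernel z).aestronglyMeasurable).const_mul _
    · filter_upwards [self_mem_nhdsWithin] with z hz
      refine (ae_restrict_iff' measurableSet_ball).2 (ae_of_all _ fun w hw => ?_)
      have h1 : ‖w‖ < 1 := by simpa using hw
      have h2 : 0 < ‖z - z₀‖ := norm_pos_iff.2 (sub_ne_zero.2 hz.2)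
      by_cases hwz : w ∈ ball z (‖z - z₀‖ / 2)
      · rw [indicator_of_notMem (notMem_compl_iff.2 hwz), norm_zero]; positivity
      · rw [indicator_of_mem hwz]
        have h3 : ‖z - z₀‖ / 2 ≤ ‖z - w‖ := by
          have : ‖z - z₀‖ / 2 ≤ dist w z := by simpa using hwz
          rwa [← dist_eq_norm z w, dist_comm]
        rw [norm_mul, norm_mul, Complex.norm_real]
        calc ‖z - z₀‖ * (‖g w‖ * ‖diskKernel z w‖)
            ≤ ‖z - z₀‖ * (‖g w‖ * (2 / (‖z - z₀‖ / 2))) := by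
              gcongr
              exact norm_diskKernel_le_of_far (half_pos h2) (by simpa using hz.1) h1.le h3
          _ = 4 * ‖g w‖ := by field_simp; ring
    · refine (ae_restrict_iff' measurableSet_ball).2 ?_
      filter_upwards [Measure.ae_ne volume z₀] with w hwz hw
      have h1 : ‖w‖ < 1 := by simpa using hw
      have hd : 0 < ‖w - z₀‖ := norm_pos_iff.2 (sub_ne_zero.2 hwz)
      have hlim : Tendsto (fun z : ℂ => ‖z - z₀‖ * (‖g w‖ * (2 / (‖w - z₀‖ / 2)))) l (𝓝 0) := by
        simpa using hlz.mul_const (‖g w‖ * (2 / (‖w - z₀‖ / 2)))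
      refine squeeze_zero_norm' ?_ hlim
      filter_upwards [hlz.eventually (gt_mem_nhds (half_pos hd)), self_mem_nhdsWithin] with z hz hz1
      have h3 : ‖w - z₀‖ / 2 ≤ ‖z - w‖ := by
        have : ‖w - z₀‖ ≤ ‖z - w‖ + ‖z - z₀‖ := by
          have := norm_sub_le (z - z₀) (z - w)
          simp only [sub_sub_sub_cancel_left] at this
          linarith
        linarith
      refine (norm_indicator_le_norm_self _ _).trans ?_
      rw [norm_mul, norm_mul, Complex.norm_real]
      gcongr
      exact norm_diskKernel_le_of_far (half_pos hd) (by simpa using hz1.1) h1.le h3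
  -- the part near the pole
  have hpow : Tendsto (fun z : ℂ => 8 * Real.pi * |C| * (‖z - z₀‖ / 2) ^ (2 * δ)) l (𝓝 0) := by
    have h1 : Tendsto (fun z : ℂ => (‖z - z₀‖ / 2) ^ (2 * δ)) l (𝓝 ((0 / 2) ^ (2 * δ))) :=
      (hlz.div_const 2).rpow_const (Or.inr (by positivity))
    rw [zero_div, Real.zero_rpow (by positivity)] at h1
    simpa using h1.const_mul (8 * Real.pi * |C|)
  have hnear : Tendsto (fun z => (z - z₀) * ∫ w in ball (0 : ℂ) 1 ∩ ball z (‖z - z₀‖ / 2),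
      (g w : ℂ) * diskKernel z w) l (𝓝 0) ∧ ∀ᶠ z in l, IntegrableOn
        (fun w => (g w : ℂ) * diskKernel z w) (ball 0 1 ∩ ball z (‖z - z₀‖ / 2)) := by
    have key : ∀ᶠ z in l, IntegrableOn (fun w => (g w : ℂ) * diskKernel z w)
        (ball 0 1 ∩ ball z (‖z - z₀‖ / 2)) ∧ ‖∫ w in ball (0 : ℂ) 1 ∩ ball z (‖z - z₀‖ / 2),
          (g w : ℂ) * diskKernel z w‖ ≤
          4 * Real.pi * |C| * ((‖z - z₀‖ / 2) ^ (2 * δ - 2)) * (‖z - z₀‖ / 2) := by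
      filter_upwards [hlz.eventually (gt_mem_nhds (half_pos hρ)), self_mem_nhdsWithin] with z hz hz1
      have h2 : 0 < ‖z - z₀‖ := norm_pos_iff.2 (sub_ne_zero.2 hz1.2)
      have hb := integral_diskKernel_near hg (z := z) (by simpa using hz1.1)
        (s := ‖z - z₀‖ / 2) (M := |C| * (‖z - z₀‖ / 2) ^ (2 * δ - 2)) (by positivity) (by
          rintro w ⟨hw, hwz⟩
          have h3 : ‖z - w‖ < ‖z - z₀‖ / 2 := by
            rwa [mem_ball, dist_comm, dist_eq_norm] at hwz
          have h4 : ‖z - z₀‖ ≤ ‖z - w‖ + ‖w - z₀‖ := by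
            have := norm_add_le (z - w) (w - z₀)
            simpa using this
          have h5 : ‖w - z₀‖ ≤ ‖z - w‖ + ‖z - z₀‖ := by
            have := norm_sub_le (z - z₀) (z - w)
            simp only [sub_sub_sub_cancel_left] at this
            linarith
          have h6 : ‖z - z₀‖ / 2 ≤ ‖w - z₀‖ := by linarith
          refine (hC w ⟨hw, by rw [mem_ball, dist_eq_norm]; linarith⟩).trans ?_
          calc C * ‖w - z₀‖ ^ (2 * δ - 2) ≤ |C| * ‖w - z₀‖ ^ (2 * δ - 2) := by
                gcongr; exact le_abs_self C
            _ ≤ |C| * (‖z - z₀‖ / 2) ^ (2 * δ - 2) := by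
                refine mul_le_mul_of_nonneg_left ?_ (abs_nonneg _)
                exact Real.rpow_le_rpow_of_nonpos (half_pos h2) h6 (by linarith))
      refine ⟨hb.1, hb.2.trans_eq ?_⟩
      rw [abs_of_nonneg (by positivity)]
      ring
    refine ⟨squeeze_zero_norm' ?_ hpow, key.mono fun z h => h.1⟩
    filter_upwards [key, self_mem_nhdsWithin] with z hz hz1
    have h2 : 0 < ‖z - z₀‖ / 2 := half_pos (norm_pos_iff.2 (sub_ne_zero.2 hz1.2))
    rw [norm_mul]
    calc ‖z - z₀‖ * ‖∫ w in ball (0 : ℂ) 1 ∩ ball z (‖z - z₀‖ / 2), (g w : ℂ) * diskKernel z w‖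
        ≤ ‖z - z₀‖ * (4 * Real.pi * |C| * ((‖z - z₀‖ / 2) ^ (2 * δ - 2)) * (‖z - z₀‖ / 2)) := by
          gcongr; exact hz.2
      _ = 8 * Real.pi * |C| * ((‖z - z₀‖ / 2) ^ (2 * δ - 2) * (‖z - z₀‖ / 2) ^ (2 : ℝ)) := by
          rw [Real.rpow_two]; ring
      _ = 8 * Real.pi * |C| * (‖z - z₀‖ / 2) ^ (2 * δ) := by
          rw [← Real.rpow_add h2]; ring_nf
  have hsum := (hnear.1.add hfar).const_mul ((2 * Real.pi : ℂ)⁻¹)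
  rw [add_zero, mul_zero] at hsum
  refine hsum.congr' ?_
  filter_upwards [hnear.2, self_mem_nhdsWithin] with z hz hz1
  have h2 : 0 < ‖z - z₀‖ := norm_pos_iff.2 (sub_ne_zero.2 hz1.2)
  have hms : MeasurableSet (ball (0 : ℂ) 1 \ ball z (‖z - z₀‖ / 2)) :=
    measurableSet_ball.diff measurableSet_ball
  have hi2 := integrableOn_diskKernel_far hg (z := z) (by simpa using hz1.1) (half_pos h2) hms
    sdiff_subset (fun w hw => by
      have : ‖z - z₀‖ / 2 ≤ dist w z := by simpa using hw.2
      rwa [← dist_eq_norm z w, dist_comm])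
  have hsplit : ∫ w in ball (0 : ℂ) 1, (g w : ℂ) * diskKernel z w =
      (∫ w in ball (0 : ℂ) 1 ∩ ball z (‖z - z₀‖ / 2), (g w : ℂ) * diskKernel z w) +
        ∫ w in ball (0 : ℂ) 1 \ ball z (‖z - z₀‖ / 2), (g w : ℂ) * diskKernel z w := by
    rw [← setIntegral_union (disjoint_sdiff_right.mono_left inter_subset_right) hms hz hi2]
    congr 2
    exact (inter_union_sdiff _ _).symm
  rw [diskTransform, hsplit, setIntegral_indicator measurableSet_ball.compl, integral_const_mul,
    ← Set.sdiff_eq]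
  ring

end DiskTransformBoundary

end

section

/-! ### The potential of the area form -/

section Density

open Metric

namespace Punctures

variable {E : Type*} (D : Punctures E)

lemma norm_pt (e : E) : ‖D.pt e‖ = 1 := by simpa using D.mem_sphere e

lemma ball_subset_surface : ball (0 : ℂ) 1 ⊆ D.surface := by
  rintro z hz
  refine ⟨ball_subset_closedBall hz, ?_⟩
  rintro ⟨e, rfl⟩
  have h1 : ‖D.pt e‖ < 1 := by simpa using hz
  rw [D.norm_pt] at h1
  exact lt_irrefl _ h1

lemma bdry_subset_surface : D.bdry ⊆ D.surface := fun _ hz => ⟨sphere_subset_closedBall hz.1, hz.2⟩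

lemma surface_subset : D.surface ⊆ closedBall 0 1 := sdiff_subset

lemma surface_mem_nhds {z : ℂ} (hz : z ∈ ball (0 : ℂ) 1) : D.surface ∈ 𝓝 z :=
  mem_of_superset (isOpen_ball.mem_nhds hz) D.ball_subset_surface

lemma isOpen_compl_range [Finite E] : IsOpen (range D.pt)ᶜ :=
  (finite_range D.pt).isClosed.isOpen_compl

lemma uniqueDiffOn_surface [Finite E] : UniqueDiffOn ℝ D.surface :=
  (uniqueDiffOn_convex (convex_closedBall (0 : ℂ) 1) (by simp [interior_closedBall])).inter
    D.isOpen_compl_range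

lemma mem_surface_or_mem_range {z : ℂ} (hz : z ∈ closedBall (0 : ℂ) 1) :
    z ∈ D.surface ∨ ∃ e, D.pt e = z := by
  by_cases h : z ∈ range D.pt
  · exact Or.inr h
  · exact Or.inl ⟨hz, h⟩

lemma surface_mem_nhdsWithin_pt [Finite E] (e : E) :
    D.surface ∈ 𝓝[closedBall 0 1 \ {D.pt e}] (D.pt e) := by
  have hfin : (range D.pt \ {D.pt e}).Finite := (finite_range D.pt).sdiff
  have h1 : (range D.pt \ {D.pt e})ᶜ ∈ 𝓝 (D.pt e) :=
    hfin.isClosed.isOpen_compl.mem_nhds (by simp)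
  filter_upwards [self_mem_nhdsWithin, mem_nhdsWithin_of_mem_nhds h1] with z hz hz1
  exact ⟨hz.1, fun h => hz1 ⟨h, hz.2⟩⟩

end Punctures

variable {EY Y EZ Z : Type*}
  [NormedAddCommGroup EY] [NormedSpace ℝ EY] [FiniteDimensional ℝ EY]
  [TopologicalSpace Y] [ChartedSpace EY Y] [IsManifold 𝓘(ℝ, EY) ∞ Y]
  [NormedAddCommGroup EZ] [NormedSpace ℝ EZ] [FiniteDimensional ℝ EZ]
  [TopologicalSpace Z] [ChartedSpace EZ Z] [IsManifold 𝓘(ℝ, EZ) ∞ Z] [MulAction Circle Z]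
  (F : CircleFibered EY Y EZ Z)

variable {E : Type*}

namespace CircleFibered

/-- The density of the pull-back of the symplectic form. -/
def density (u : ℂ → Y) (z : ℂ) : ℝ :=
  F.omega (u z) (mfderiv 𝓘(ℝ, ℂ) 𝓘(ℝ, EY) u z (1 : ℂ)) (mfderiv 𝓘(ℝ, ℂ) 𝓘(ℝ, EY) u z Complex.I)

variable (EY) in
/-- Maps of the closed disk which are smooth away from the punctures, where they converge
exponentially. -/
structure IsCornerMap (D : Punctures E) (u : ℂ → Y) : Prop where
  continuous : ContinuousOn u (closedBall 0 1)
  smooth : ContMDiffOn 𝓘(ℝ, ℂ) 𝓘(ℝ, EY) ∞ u D.surface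
  decay : ∀ e : E, ∃ C δ r : ℝ, 0 < δ ∧ 0 < r ∧ ∀ z ∈ Metric.ball (0 : ℂ) 1,
    ‖z - D.pt e‖ < r →
      ‖fderiv ℝ (fun w : ℂ => extChartAt 𝓘(ℝ, EY) (u (D.pt e)) (u w)) z‖
        ≤ C * ‖z - D.pt e‖ ^ (δ - 1)

variable {F} {D : Punctures E} {u : ℂ → Y}

namespace IsCornerMap

lemma contMDiffAt (hu : IsCornerMap EY D u) {z : ℂ} (hz : z ∈ ball (0 : ℂ) 1) :
    ContMDiffAt 𝓘(ℝ, ℂ) 𝓘(ℝ, EY) ∞ u z :=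
  hu.smooth.contMDiffAt (D.surface_mem_nhds hz)

lemma exists_gaugeAt [T2Space Z] (F : CircleFibered EY Y EZ Z) (hu : IsCornerMap EY D u) {z₀ : ℂ}
    (hz₀ : z₀ ∈ closedBall (0 : ℂ) 1) : ∃ (τ : EY → Z) (B : EY → EY →L[ℝ] ℝ) (M : ℝ),
    ContMDiffAt 𝓘(ℝ, EY) 𝓘(ℝ, EZ) ∞ τ (extChartAt 𝓘(ℝ, EY) (u z₀) (u z₀)) ∧
    ContDiffAt ℝ ∞ B (extChartAt 𝓘(ℝ, EY) (u z₀) (u z₀)) ∧ 0 ≤ M ∧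
    ∃ ρ > 0, ∀ z ∈ closedBall (0 : ℂ) 1 ∩ ball z₀ ρ, F.GaugeAt τ B M (u z₀) (u z) := by
  obtain ⟨τ, B, M, hτ, hB, hg⟩ := F.exists_gaugeAt (u z₀)
  have h1 : ∀ᶠ z in 𝓝[closedBall 0 1] z₀, F.GaugeAt τ B M (u z₀) (u z) :=
    (hu.continuous z₀ hz₀).eventually hg
  obtain ⟨ρ, hρ, h⟩ := Metric.mem_nhdsWithin_iff.1 h1
  refine ⟨τ, B, M, hτ, hB, (norm_nonneg _).trans hg.self_of_nhds.norm_le, ρ, hρ, fun z hz => h ⟨hz.2, hz.1⟩⟩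

/-- Near a point of the surface the derivative in the chart is bounded. -/
lemma exists_norm_fderiv_le [Finite E] (hu : IsCornerMap EY D u) {z₀ : ℂ} (hz₀ : z₀ ∈ D.surface) :
    ∃ C : ℝ, ∃ ρ > 0, ∀ z ∈ ball (0 : ℂ) 1 ∩ ball z₀ ρ,
      ‖fderiv ℝ (fun w => extChartAt 𝓘(ℝ, EY) (u z₀) (u w)) z‖ ≤ C := by
  set v : ℂ → EY := fun w => extChartAt 𝓘(ℝ, EY) (u z₀) (u w) with hv
  have hvs : ContDiffWithinAt ℝ 1 v D.surface z₀ := by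
    rw [← contMDiffWithinAt_iff_contDiffWithinAt]
    exact (contMDiffAt_extChartAt (I := 𝓘(ℝ, EY)) (n := 1)).comp_contMDiffWithinAt z₀
      ((hu.smooth z₀ hz₀).of_le (by exact_mod_cast le_top))
  have h1 : ContinuousWithinAt (fderivWithin ℝ v D.surface) D.surface z₀ :=
    (hvs.fderivWithin_right D.uniqueDiffOn_surface (m := 0) (by simp) hz₀).continuousWithinAt
  have h2 : ∀ᶠ z in 𝓝[D.surface] z₀, ‖fderivWithin ℝ v D.surface z‖ <
      ‖fderivWithin ℝ v D.surface z₀‖ + 1 := h1.norm.eventually (gt_mem_nhds (by linarith))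
  obtain ⟨ρ, hρ, h⟩ := Metric.mem_nhdsWithin_iff.1 h2
  refine ⟨‖fderivWithin ℝ v D.surface z₀‖ + 1, ρ, hρ, fun z hz => ?_⟩
  have h3 := h ⟨hz.2, D.ball_subset_surface hz.1⟩
  rw [mem_ofPred_eq, fderivWithin_of_mem_nhds (D.surface_mem_nhds hz.1)] at h3
  exact h3.le

lemma exists_decay (hu : IsCornerMap EY D u) (e : E) : ∃ C δ ρ : ℝ, 0 ≤ C ∧ 0 < δ ∧ δ ≤ 1 ∧ 0 < ρ ∧
    ∀ z ∈ ball (0 : ℂ) 1 ∩ ball (D.pt e) ρ,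
      ‖fderiv ℝ (fun w => extChartAt 𝓘(ℝ, EY) (u (D.pt e)) (u w)) z‖ ≤
        C * ‖z - D.pt e‖ ^ (δ - 1) := by
  obtain ⟨C, δ, r, hδ, hr, h⟩ := hu.decay e
  refine ⟨|C|, min δ 1, min r 1, abs_nonneg C, by positivity, min_le_right _ _, by positivity,
    fun z hz => ?_⟩
  have h1 : ‖z - D.pt e‖ < min r 1 := by simpa [dist_eq_norm] using hz.2
  have h0 : 0 < ‖z - D.pt e‖ := by
    rw [norm_pos_iff, sub_ne_zero]
    rintro rfl
    have h1 : ‖D.pt e‖ < 1 := by simpa using hz.1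
    rw [D.norm_pt] at h1
    exact lt_irrefl _ h1
  refine (h z hz.1 (h1.trans_le (min_le_left _ _))).trans ?_
  calc C * ‖z - D.pt e‖ ^ (δ - 1) ≤ |C| * ‖z - D.pt e‖ ^ (δ - 1) := by
        gcongr; exact le_abs_self C
    _ ≤ |C| * ‖z - D.pt e‖ ^ (min δ 1 - 1) := by
        refine mul_le_mul_of_nonneg_left ?_ (abs_nonneg C)
        exact Real.rpow_le_rpow_of_exponent_ge h0 (h1.le.trans (min_le_right _ _))
          (by linarith [min_le_left δ 1])

variable [T2Space Z]

lemma contDiffOn_density (hu : IsCornerMap EY D u) : ContDiffOn ℝ ∞ (F.density u) (ball 0 1) := by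
  intro z₀ hz₀
  refine ContDiffAt.contDiffWithinAt ?_
  obtain ⟨τ, B, M, -, hB, -, ρ, hρ, hg⟩ :=
    hu.exists_gaugeAt F (ball_subset_closedBall hz₀)
  set v : ℂ → EY := fun w => extChartAt 𝓘(ℝ, EY) (u z₀) (u w) with hv
  have hvs : ContDiffAt ℝ ∞ v z₀ := (hg z₀ ⟨ball_subset_closedBall hz₀,
    mem_ball_self hρ⟩).contDiffAt_chart le_rfl (hu.contMDiffAt hz₀)
  have hdB : ContDiffAt ℝ ∞ (fun z => fderiv ℝ B (v z)) z₀ :=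
    ContDiffAt.comp (g := fderiv ℝ B) z₀ (hB.fderiv_right (by simp)) hvs
  have hdv : ContDiffAt ℝ ∞ (fderiv ℝ v) z₀ := hvs.fderiv_right (by simp)
  have h1 : ContDiffAt ℝ ∞ (fun z => fderiv ℝ v z 1) z₀ := hdv.clm_apply contDiffAt_const
  have h2 : ContDiffAt ℝ ∞ (fun z => fderiv ℝ v z Complex.I) z₀ := hdv.clm_apply contDiffAt_const
  refine (((hdB.clm_apply h1).clm_apply h2).sub ((hdB.clm_apply h2).clm_apply h1)).congr_of_eventuallyEq ?_
  filter_upwards [isOpen_ball.mem_nhds hz₀, ball_mem_nhds z₀ hρ] with z hz hz1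
  exact (hg z ⟨ball_subset_closedBall hz, hz1⟩).omega_eq ((hu.contMDiffAt hz).of_le two_le_infty)
    1 Complex.I

lemma abs_density_le_of_norm_fderiv_le (hu : IsCornerMap EY D u) {τ : EY → Z} {B : EY → EY →L[ℝ] ℝ}
    {M C : ℝ} {y₀ : Y} {z : ℂ} (hz : z ∈ ball (0 : ℂ) 1) (hM : 0 ≤ M)
    (h : F.GaugeAt τ B M y₀ (u z))
    (hC : ‖fderiv ℝ (fun w => extChartAt 𝓘(ℝ, EY) y₀ (u w)) z‖ ≤ C) :
    |F.density u z| ≤ 2 * M * C ^ 2 := by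
  have h1 := h.abs_omega_le ((hu.contMDiffAt hz).of_le two_le_infty) 1 Complex.I
  rw [norm_one, Complex.norm_I, mul_one, mul_one] at h1
  refine h1.trans ?_
  gcongr

lemma exists_abs_density_le [Finite E] (hu : IsCornerMap EY D u) {z₀ : ℂ} (hz₀ : z₀ ∈ D.surface) :
    ∃ M : ℝ, ∃ ρ > 0, ∀ z ∈ ball (0 : ℂ) 1 ∩ ball z₀ ρ, |F.density u z| ≤ M := by
  obtain ⟨τ, B, M, -, -, hM, ρ, hρ, hg⟩ := hu.exists_gaugeAt F (D.surface_subset hz₀)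
  obtain ⟨C, ρ', hρ', hC⟩ := hu.exists_norm_fderiv_le hz₀
  refine ⟨2 * M * C ^ 2, min ρ ρ', by positivity, fun z hz => ?_⟩
  exact hu.abs_density_le_of_norm_fderiv_le hz.1 hM
    (hg z ⟨ball_subset_closedBall hz.1, ball_subset_ball (min_le_left _ _) hz.2⟩)
    (hC z ⟨hz.1, ball_subset_ball (min_le_right _ _) hz.2⟩)

lemma exists_abs_density_le_pt (hu : IsCornerMap EY D u) (e : E) :
    ∃ C δ ρ : ℝ, 0 < ρ ∧ 0 < δ ∧ δ ≤ 1 ∧ ∀ z ∈ ball (0 : ℂ) 1 ∩ ball (D.pt e) ρ,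
      |F.density u z| ≤ C * ‖z - D.pt e‖ ^ (2 * δ - 2) := by
  obtain ⟨τ, B, M, -, -, hM, ρ, hρ, hg⟩ :=
    hu.exists_gaugeAt F (sphere_subset_closedBall (D.mem_sphere e))
  obtain ⟨C, δ, ρ', hC0, hδ, hδ1, hρ', hC⟩ := hu.exists_decay e
  refine ⟨2 * M * C ^ 2, δ, min ρ ρ', by positivity, hδ, hδ1, fun z hz => ?_⟩
  refine (hu.abs_density_le_of_norm_fderiv_le hz.1 hM
    (hg z ⟨ball_subset_closedBall hz.1, ball_subset_ball (min_le_left _ _) hz.2⟩)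
    (hC z ⟨hz.1, ball_subset_ball (min_le_right _ _) hz.2⟩)).trans_eq ?_
  have : (‖z - D.pt e‖ ^ (δ - 1)) ^ 2 = ‖z - D.pt e‖ ^ (2 * δ - 2) := by
    rw [← Real.rpow_natCast, ← Real.rpow_mul (norm_nonneg _)]
    congr 1; push_cast; ring
  rw [mul_pow, this]
  ring

lemma integrableOn_ball_norm_rpow {s : ℝ} (hs : -2 < s) (z₀ : ℂ) (ρ : ℝ) :
    IntegrableOn (fun w : ℂ => ‖w - z₀‖ ^ s) (ball z₀ ρ) := by
  have h := (integrableOn_fun_norm_addHaar (E := ℂ) volume (f := fun y : ℝ => y ^ s) (r := ρ)).2 (by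
    rcases le_or_gt ρ 0 with hρ | hρ
    · rw [Ioo_eq_empty (not_lt.2 hρ)]; exact integrableOn_empty
    have h1 : IntegrableOn (fun y : ℝ => y ^ (s + 1)) (Ioo 0 ρ) :=
      (intervalIntegral.integrableOn_Ioo_rpow_iff hρ).2 (by linarith)
    refine h1.congr_fun (fun y hy => ?_) measurableSet_Ioo
    simp [Real.rpow_add_one hy.1.ne', mul_comm])
  have h2 := (measurePreserving_sub_right (volume : Measure ℂ) z₀).integrableOn_comp_preimage
    (Homeomorph.subRight z₀).measurableEmbedding (s := ball 0 ρ) (f := fun w : ℂ => ‖w‖ ^ s)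
  have h3 : (fun x : ℂ => x - z₀) ⁻¹' ball 0 ρ = ball z₀ ρ := by
    ext x; simp [dist_eq_norm]
  rw [h3] at h2
  exact h2.2 h

lemma integrableOn_density [Finite E] (hu : IsCornerMap EY D u) :
    IntegrableOn (F.density u) (ball 0 1) := by
  have hm : AEStronglyMeasurable (F.density u) (volume.restrict (ball 0 1)) :=
    (hu.contDiffOn_density (F := F)).continuousOn.aestronglyMeasurable measurableSet_ball
  have hloc : ∀ z ∈ closedBall (0 : ℂ) 1, ∃ ρ > 0, IntegrableOn (F.density u) (ball 0 1 ∩ ball z ρ) := by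
    intro z hz
    rcases D.mem_surface_or_mem_range hz with hz | ⟨e, rfl⟩
    · obtain ⟨M, ρ, hρ, h⟩ := hu.exists_abs_density_le (F := F) hz
      refine ⟨ρ, hρ, IntegrableOn.of_bound ?_
        (hm.mono_measure (Measure.restrict_mono inter_subset_left le_rfl)) M ?_⟩
      · exact (measure_mono inter_subset_right).trans_lt measure_ball_lt_top
      · exact (ae_restrict_iff' (measurableSet_ball.inter measurableSet_ball)).2
          (ae_of_all _ fun w hw => h w hw)
    · obtain ⟨C, δ, ρ, hρ, hδ, -, h⟩ := hu.exists_abs_density_le_pt (F := F) e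
      refine ⟨ρ, hρ, Integrable.mono' (g := fun w => C * ‖w - D.pt e‖ ^ (2 * δ - 2))
        (((integrableOn_ball_norm_rpow (by linarith) _ ρ).mono_set inter_subset_right).const_mul C)
        (hm.mono_measure (Measure.restrict_mono inter_subset_left le_rfl)) ?_⟩
      exact (ae_restrict_iff' (measurableSet_ball.inter measurableSet_ball)).2
        (ae_of_all _ fun w hw => h w hw)
  have key : IntegrableOn (F.density u) (ball 0 1 ∩ closedBall 0 1) volume := by
    refine (isCompact_closedBall (0 : ℂ) 1).induction_on
      (p := fun s => IntegrableOn (F.density u) (ball 0 1 ∩ s) volume) (by simp)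
      (fun s t hst h => h.mono_set (inter_subset_inter_right _ hst))
      (fun s t hs ht => by rw [inter_union_distrib_left]; exact hs.union ht) ?_
    intro z hz
    obtain ⟨ρ, hρ, h⟩ := hloc z hz
    exact ⟨ball z ρ, mem_nhdsWithin_of_mem_nhds (ball_mem_nhds z hρ), h⟩
  exact key.mono_set (subset_inter subset_rfl ball_subset_closedBall)

/-- The potential of the area density. -/
theorem exists_potential [Finite E] (hu : IsCornerMap EY D u) : ∃ G : ℂ → ℂ,
    (∀ z ∈ ball (0 : ℂ) 1, ContDiffAt ℝ ∞ G z ∧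
      fderiv ℝ G z 1 + Complex.I * fderiv ℝ G z Complex.I = F.density u z) ∧
    ContinuousOn G D.surface ∧
    (∀ e, Tendsto (fun z => (z - D.pt e) * G z) (𝓝[closedBall 0 1 \ {D.pt e}] (D.pt e)) (𝓝 0)) ∧
    ∀ z ∈ D.bdry, (z * G z).re = (2 * Real.pi)⁻¹ * F.area u := by
  have hi := hu.integrableOn_density (F := F)
  refine ⟨diskTransform (F.density u), fun z hz => diskTransform_interior hi hu.contDiffOn_density hz,
    fun z hz => ?_, fun e => ?_, fun z hz => ?_⟩
  · obtain ⟨M, ρ, hρ, h⟩ := hu.exists_abs_density_le (F := F) hz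
    exact (continuousWithinAt_diskTransform hi (by simpa using hz.1) hρ h).mono D.surface_subset
  · obtain ⟨C, δ, ρ, hρ, hδ, hδ1, h⟩ := hu.exists_abs_density_le_pt (F := F) e
    exact tendsto_sub_mul_diskTransform hi hρ hδ hδ1 h
  · obtain ⟨M, ρ, hρ, h⟩ := hu.exists_abs_density_le (F := F) (D.bdry_subset_surface hz)
    exact re_mul_diskTransform hi (by simpa using hz.1) hρ h

end IsCornerMap

end CircleFibered

end Density

end

section

/-! ### The model lift -/

section Forms

/-- The real one-form `h ↦ Im (c h)` on the plane. -/
def imForm : ℂ →L[ℝ] ℂ →L[ℝ] ℝ :=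
  (ContinuousLinearMap.compL ℝ ℂ ℂ ℝ Complex.imCLM).comp (ContinuousLinearMap.mul ℝ ℂ)

/-- The real one-form `h ↦ Re (c h)` on the plane. -/
def reForm : ℂ →L[ℝ] ℂ →L[ℝ] ℝ :=
  (ContinuousLinearMap.compL ℝ ℂ ℂ ℝ Complex.reCLM).comp (ContinuousLinearMap.mul ℝ ℂ)

@[simp] lemma imForm_apply (c h : ℂ) : imForm c h = (c * h).im := rfl

@[simp] lemma reForm_apply (c h : ℂ) : reForm c h = (c * h).re := rfl

lemma bilin_antisymm_eq (N : ℂ →L[ℝ] ℂ →L[ℝ] ℝ) (a b : ℂ) :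
    N a b - N b a = (a.re * b.im - a.im * b.re) * (N 1 Complex.I - N Complex.I 1) := by
  have h : ∀ w : ℂ, w = w.re • (1 : ℂ) + w.im • Complex.I := fun w => by
    simp [Complex.re_add_im]
  have key : ∀ a b : ℂ, N a b = a.re * b.re * N 1 1 + a.re * b.im * N 1 Complex.I +
      a.im * b.re * N Complex.I 1 + a.im * b.im * N Complex.I Complex.I := by
    intro a b
    conv_lhs => rw [h a, h b]
    simp only [map_add, map_smul, FunLike.coe_add, FunLike.coe_smul, Pi.add_apply, Pi.smul_apply,
      smul_eq_mul]
    ring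
  rw [key a b, key b a]
  ring

lemma exists_tendsto_of_norm_fderiv_le {V : Type*} [NormedAddCommGroup V] [NormedSpace ℝ V]
    [CompleteSpace V] {f : ℂ → V} {f' : ℂ → ℂ →L[ℝ] V} {A : Set ℂ} (hA : Convex ℝ A) {C : ℝ}
    (hf : ∀ z ∈ A, HasFDerivAt f (f' z) z) (hC : ∀ z ∈ A, ‖f' z‖ ≤ C) {z₀ : ℂ}
    (hz₀ : z₀ ∈ closure A) : ∃ l, Tendsto f (𝓝[A] z₀) (𝓝 l) := by
  have : (𝓝[A] z₀).NeBot := mem_closure_iff_nhdsWithin_neBot.1 hz₀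
  have hlip : ∀ x ∈ A, ∀ y ∈ A, ‖f y - f x‖ ≤ C * ‖y - x‖ := fun x hx y hy =>
    hA.norm_image_sub_le_of_norm_hasFDerivWithin_le (fun z hz => (hf z hz).hasFDerivWithinAt) hC hx hy
  have hcau : Cauchy (map f (𝓝[A] z₀)) := by
    refine Metric.cauchy_iff.2 ⟨inferInstance, fun ε hε => ?_⟩
    have hK : 0 < 2 * (|C| + 1) := by positivity
    refine ⟨f '' (A ∩ Metric.ball z₀ (ε / (2 * (|C| + 1)))), image_mem_map
      (inter_mem self_mem_nhdsWithin (mem_nhdsWithin_of_mem_nhds (Metric.ball_mem_nhds _ (by positivity)))), ?_⟩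
    rintro _ ⟨x, ⟨hx, hx'⟩, rfl⟩ _ ⟨y, ⟨hy, hy'⟩, rfl⟩
    rw [dist_comm, dist_eq_norm]
    have h1 : ‖y - x‖ < 2 * (ε / (2 * (|C| + 1))) := by
      have := dist_triangle_right y x z₀
      rw [Metric.mem_ball] at hx' hy'
      rw [← dist_eq_norm]
      linarith
    calc ‖f y - f x‖ ≤ C * ‖y - x‖ := hlip x hx y hy
      _ ≤ (|C| + 1) * ‖y - x‖ := by gcongr; linarith [le_abs_self C]
      _ < (|C| + 1) * (2 * (ε / (2 * (|C| + 1)))) := by gcongr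
      _ = ε := by field_simp
  exact CompleteSpace.complete hcau

end Forms

section CircleValued

lemma Circle.exp_arg_div_mul (c d : Circle) : Circle.exp (Complex.arg (c / d : Circle)) * d = c := by
  rw [Circle.exp_arg, div_mul_cancel]

variable {EY Y EZ Z : Type*}
  [NormedAddCommGroup EY] [NormedSpace ℝ EY] [FiniteDimensional ℝ EY]
  [TopologicalSpace Y] [ChartedSpace EY Y] [IsManifold 𝓘(ℝ, EY) ∞ Y]
  [NormedAddCommGroup EZ] [NormedSpace ℝ EZ] [FiniteDimensional ℝ EZ]
  [TopologicalSpace Z] [ChartedSpace EZ Z] [IsManifold 𝓘(ℝ, EZ) ∞ Z] [MulAction Circle Z]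
  (F : CircleFibered EY Y EZ Z)

namespace CircleFibered

include F in
lemma tendsto_smul {X : Type*} {l : Filter X} {c : X → Circle} {ζ : X → Z} {c₀ : Circle} {z₀ : Z}
    (hc : Tendsto c l (𝓝 c₀)) (hζ : Tendsto ζ l (𝓝 z₀)) :
    Tendsto (fun x => c x • ζ x) l (𝓝 (c₀ • z₀)) := by
  have h1 : Tendsto (fun x => Complex.arg (c x / c₀ : Circle)) l (𝓝 0) := by
    have h2 : Tendsto (fun x => ((c x / c₀ : Circle) : ℂ)) l (𝓝 1) := by
      have h3 : Tendsto (fun x => c x / c₀) l (𝓝 (c₀ / c₀)) := hc.div_const' c₀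
      rw [div_self'] at h3
      exact (continuous_subtype_val.tendsto (1 : Circle)).comp h3
    have h4 := (Complex.continuousAt_arg (x := 1) (by simp)).tendsto.comp h2
    rwa [Complex.arg_one] at h4
  have h5 : Tendsto (fun x => Circle.exp (Complex.arg (c x / c₀ : Circle)) • (c₀ • ζ x)) l
      (𝓝 (Circle.exp 0 • (c₀ • z₀))) :=
    (F.continuous_exp_smul.tendsto (0, c₀ • z₀)).comp
      (h1.prodMk_nhds (((F.continuous_const_smul c₀).tendsto z₀).comp hζ))
  rw [Circle.exp_zero, one_smul] at h5
  refine h5.congr fun x => ?_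
  rw [smul_smul, Circle.exp_arg_div_mul]

variable {F} in
/-- The form of a lift rotated by a circle-valued function. -/
lemma HasForm.smul {E' : Type*} [NormedAddCommGroup E'] [NormedSpace ℝ E'] {s : Set E'}
    {ζ : E' → Z} {x : E'} {μ ν : E' →L[ℝ] ℝ} {c : E' → Circle} (h : F.HasForm s ζ x μ)
    (hc : HasFDerivWithinAt (fun y => (c y : ℂ)) (ν.smulRight (Complex.I * (c x : ℂ))) s x) :
    F.HasForm s (fun y => c y • ζ y) x (μ + ν) := by
  have h1 : HasFDerivWithinAt (fun y => (c y : ℂ) * ((c x : ℂ))⁻¹)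
      (ν.smulRight Complex.I) s x := by
    refine (hc.mul_const' ((c x : ℂ))⁻¹).congr_fderiv ?_
    ext v
    simp [mul_assoc]
  have hne : (c x : ℂ) ≠ 0 := Circle.coe_ne_zero _
  have hslit : (c x : ℂ) * ((c x : ℂ))⁻¹ ∈ Complex.slitPlane := by
    rw [mul_inv_cancel₀ hne]; simp
  have h2 := HasFDerivAt.comp_hasFDerivWithinAt x
    (Complex.hasStrictFDerivAt_log_real hslit).hasFDerivAt h1
  rw [mul_inv_cancel₀ hne, inv_one, one_smul] at h2
  have h3 : HasFDerivWithinAt (fun y => Complex.arg (c y / c x : Circle)) ν s x := by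
    have h4 := Complex.imCLM.hasFDerivAt.comp_hasFDerivWithinAt x h2
    refine (h4.congr_fderiv ?_).congr (fun y _ => ?_) ?_
    · ext v; simp
    · simp [Complex.log_im, div_eq_mul_inv]
    · simp [Complex.log_im]
  refine ((h.const_smul (c x)).exp_smul h3).congr_of_eventuallyEq ?_ ?_
  · refine Eventually.of_forall fun y => ?_
    simp only [smul_smul, Circle.exp_arg_div_mul]
  · simp only [smul_smul, Circle.exp_arg_div_mul]

end CircleFibered

end CircleValued

end

section

section Model

open Metric

variable {EY Y EZ Z : Type*}
  [NormedAddCommGroup EY] [NormedSpace ℝ EY] [FiniteDimensional ℝ EY]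
  [TopologicalSpace Y] [ChartedSpace EY Y] [IsManifold 𝓘(ℝ, EY) ∞ Y]
  [NormedAddCommGroup EZ] [NormedSpace ℝ EZ] [FiniteDimensional ℝ EZ]
  [TopologicalSpace Z] [ChartedSpace EZ Z] [IsManifold 𝓘(ℝ, EZ) ∞ Z] [MulAction Circle Z]
  (F : CircleFibered EY Y EZ Z)

variable {E : Type*}

namespace CircleFibered

/-- A lift of `u` to `ℝ × Z` over the punctured disk such that `ds + i ζ^*α = G dz` for a potential
`G` of the area form. -/
structure IsModel (D : Punctures E) (u : ℂ → Y) (G : ℂ → ℂ) (s : ℂ → ℝ) (ζ : ℂ → Z) : Prop where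
  continuousOn_G : ContinuousOn G D.surface
  tendsto_G : ∀ e, Tendsto (fun z => (z - D.pt e) * G z) (𝓝[closedBall 0 1 \ {D.pt e}] (D.pt e)) (𝓝 0)
  re_mul_G : ∀ z ∈ D.bdry, (z * G z).re = (2 * Real.pi)⁻¹ * F.area u
  continuousOn_s : ContinuousOn s D.surface
  contDiffAt_s : ∀ z ∈ ball (0 : ℂ) 1, ContDiffAt ℝ ∞ s z
  hasFDerivAt_s : ∀ z ∈ ball (0 : ℂ) 1, HasFDerivAt s (reForm (G z)) z
  continuousOn_ζ : ContinuousOn ζ D.surface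
  contMDiffAt_ζ : ∀ z ∈ ball (0 : ℂ) 1, ContMDiffAt 𝓘(ℝ, ℂ) 𝓘(ℝ, EZ) ∞ ζ z
  p_ζ : ∀ z ∈ D.surface, F.p (ζ z) = u z
  hasForm : ∀ z ∈ D.surface, F.HasForm D.surface ζ z (imForm (G z))

namespace IsCornerMap

variable {F} {D : Punctures E} {u : ℂ → Y} [T2Space Z]

lemma omega_antisymm_eq (hu : IsCornerMap EY D u) {z : ℂ} (hz : z ∈ ball (0 : ℂ) 1) (a b : ℂ) :
    F.omega (u z) (mfderiv 𝓘(ℝ, ℂ) 𝓘(ℝ, EY) u z a) (mfderiv 𝓘(ℝ, ℂ) 𝓘(ℝ, EY) u z b) =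
      (a.re * b.im - a.im * b.re) * F.density u z := by
  obtain ⟨τ, B, M, -, -, -, ρ, hρ, hg⟩ := hu.exists_gaugeAt F (ball_subset_closedBall hz)
  have h := hg z ⟨ball_subset_closedBall hz, mem_ball_self hρ⟩
  have hs := (hu.contMDiffAt hz).of_le two_le_infty
  have h1 := h.omega_eq_fderiv hs a b
  have h2 := h.omega_eq_fderiv hs 1 Complex.I
  rw [bilin_antisymm_eq] at h1
  rw [h1]
  congr 1
  exact h2.symm

lemma curvature_imForm (hu : IsCornerMap EY D u) {G : ℂ → ℂ} {z : ℂ} (hz : z ∈ ball (0 : ℂ) 1)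
    (hG : ContDiffAt ℝ ∞ G z)
    (hG' : fderiv ℝ G z 1 + Complex.I * fderiv ℝ G z Complex.I = F.density u z) (a b : ℂ) :
    fderiv ℝ (fun z => imForm (G z)) z a b - fderiv ℝ (fun z => imForm (G z)) z b a =
      F.omega (u z) (mfderiv 𝓘(ℝ, ℂ) 𝓘(ℝ, EY) u z a) (mfderiv 𝓘(ℝ, ℂ) 𝓘(ℝ, EY) u z b) := by
  rw [hu.omega_antisymm_eq hz, bilin_antisymm_eq]
  congr 1
  have hd : fderiv ℝ (fun z => imForm (G z)) z = imForm.comp (fderiv ℝ G z) :=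
    (imForm.hasFDerivAt.comp z (hG.differentiableAt (by simp)).hasFDerivAt).fderiv
  have h2 := congrArg Complex.re hG'
  simp only [hd, ContinuousLinearMap.comp_apply, imForm_apply, Complex.mul_im, Complex.add_re,
    Complex.mul_re, Complex.I_re, Complex.I_im, Complex.ofReal_re, Complex.one_re,
    Complex.one_im] at h2 ⊢
  linarith

lemma symmetric_reForm {G : ℂ → ℂ} {z : ℂ} {g : ℝ} (hG : ContDiffAt ℝ ∞ G z)
    (hG' : fderiv ℝ G z 1 + Complex.I * fderiv ℝ G z Complex.I = g) (a b : ℂ) :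
    fderiv ℝ (fun z => reForm (G z)) z a b = fderiv ℝ (fun z => reForm (G z)) z b a := by
  rw [← sub_eq_zero, bilin_antisymm_eq]
  have hd : fderiv ℝ (fun z => reForm (G z)) z = reForm.comp (fderiv ℝ G z) :=
    (reForm.hasFDerivAt.comp z (hG.differentiableAt (by simp)).hasFDerivAt).fderiv
  have h2 := congrArg Complex.im hG'
  simp only [hd, ContinuousLinearMap.comp_apply, reForm_apply, Complex.add_im, Complex.mul_im,
    Complex.mul_re, Complex.I_re, Complex.I_im, Complex.ofReal_im, Complex.one_re,
    Complex.one_im] at h2 ⊢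
  rw [show (fderiv ℝ G z 1).re * 0 - (fderiv ℝ G z 1).im * 1 -
    ((fderiv ℝ G z Complex.I).re * 1 - (fderiv ℝ G z Complex.I).im * 0) = 0 by linarith, mul_zero]

/-- A gauge along the disk near a point of the surface, with its connection form. -/
lemma exists_gauge_surface [Finite E] (F : CircleFibered EY Y EZ Z) (hu : IsCornerMap EY D u) {z₀ : ℂ}
    (hz₀ : z₀ ∈ D.surface) : ∃ (σ : ℂ → Z) (lam : ℂ → ℂ →L[ℝ] ℝ) (C : ℝ), ∃ ρ > 0,
      closedBall (0 : ℂ) 1 ∩ ball z₀ ρ ⊆ D.surface ∧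
      (∀ z ∈ closedBall (0 : ℂ) 1 ∩ ball z₀ ρ, F.p (σ z) = u z ∧ F.HasForm D.surface σ z (lam z)) ∧
      (∀ z ∈ ball (0 : ℂ) 1 ∩ ball z₀ ρ, ‖lam z‖ ≤ C) ∧
      ContinuousWithinAt lam D.surface z₀ := by
  obtain ⟨τ, B, M, -, hB, hM, ρ₁, hρ₁, hg⟩ := hu.exists_gaugeAt F (D.surface_subset hz₀)
  obtain ⟨C, ρ₂, hρ₂, hC⟩ := hu.exists_norm_fderiv_le hz₀
  obtain ⟨ρ₃, hρ₃, hS⟩ := Metric.isOpen_iff.1 D.isOpen_compl_range z₀ hz₀.2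
  set v : ℂ → EY := fun w => extChartAt 𝓘(ℝ, EY) (u z₀) (u w) with hv
  have hsub : closedBall (0 : ℂ) 1 ∩ ball z₀ (min ρ₁ (min ρ₂ ρ₃)) ⊆ D.surface := fun z hz =>
    ⟨hz.1, hS (ball_subset_ball ((min_le_right _ _).trans (min_le_right _ _)) hz.2)⟩
  have hgz : ∀ z ∈ closedBall (0 : ℂ) 1 ∩ ball z₀ (min ρ₁ (min ρ₂ ρ₃)),
      F.GaugeAt τ B M (u z₀) (u z) := fun z hz =>
    hg z ⟨hz.1, ball_subset_ball (min_le_left _ _) hz.2⟩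
  have hz₀' : z₀ ∈ closedBall (0 : ℂ) 1 ∩ ball z₀ (min ρ₁ (min ρ₂ ρ₃)) :=
    ⟨D.surface_subset hz₀, mem_ball_self (by positivity)⟩
  have hvs : ∀ z ∈ closedBall (0 : ℂ) 1 ∩ ball z₀ (min ρ₁ (min ρ₂ ρ₃)),
      ContDiffWithinAt ℝ ∞ v D.surface z := fun z hz =>
    (hgz z hz).contDiffWithinAt_chart le_rfl (hu.smooth z (hsub hz))
  refine ⟨fun z => τ (v z), fun z => (B (v z)).comp (fderivWithin ℝ v D.surface z), M * C,
    min ρ₁ (min ρ₂ ρ₃), by positivity, hsub, fun z hz => ⟨(hgz z hz).p_eq, ?_⟩, fun z hz => ?_, ?_⟩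
  · exact (hgz z hz).hasForm (u := u)
      ((hvs z hz).differentiableWithinAt (by simp)).hasFDerivWithinAt
  · have h1 := hC z ⟨hz.1, ball_subset_ball ((min_le_right _ _).trans (min_le_left _ _)) hz.2⟩
    have h2 := (hgz z ⟨ball_subset_closedBall hz.1, hz.2⟩).norm_le
    beta_reduce
    rw [fderivWithin_of_mem_nhds (D.surface_mem_nhds hz.1)]
    exact (ContinuousLinearMap.opNorm_comp_le _ _).trans (mul_le_mul h2 h1 (norm_nonneg _) hM)
  · have h1 : ContinuousWithinAt (fun z => B (v z)) D.surface z₀ :=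
      ContinuousAt.comp_continuousWithinAt (g := B) hB.continuousAt (hvs z₀ hz₀').continuousWithinAt
    exact h1.clm_comp ((hvs z₀ hz₀').fderivWithin_right D.uniqueDiffOn_surface (m := 0) (by simp)
      hz₀).continuousWithinAt

lemma mem_closure_ball_inter {z₀ : ℂ} {ρ : ℝ} {z : ℂ} (hz : z ∈ closedBall (0 : ℂ) 1 ∩ ball z₀ ρ) :
    z ∈ closure (ball (0 : ℂ) 1 ∩ ball z₀ ρ) := by
  rw [inter_comm]
  refine isOpen_ball.inter_closure ⟨hz.2, ?_⟩
  rw [closure_ball _ one_ne_zero]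
  exact hz.1

/-- Flat lifts over the open disk have limits at the points of the punctured circle. -/
lemma exists_tendsto_of_isFlat [Finite E] (hu : IsCornerMap EY D u) {G : ℂ → ℂ}
    (hG : ContinuousOn G D.surface) {ζ : ℂ → Z}
    (hζ : F.IsFlat u (fun z => imForm (G z)) (ball 0 1) ζ) {z₀ : ℂ} (hz₀ : z₀ ∈ D.surface) :
    ∃ w, Tendsto ζ (𝓝[ball 0 1] z₀) (𝓝 w) := by
  obtain ⟨σ, lam, C, ρ, hρ, hsub, hσ, hC, hlam⟩ := hu.exists_gauge_surface F hz₀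
  have hη : ContinuousWithinAt (fun z => imForm (G z)) D.surface z₀ :=
    imForm.continuous.continuousAt.comp_continuousWithinAt (hG z₀ hz₀)
  obtain ⟨ρ', hρ', hη'⟩ := Metric.mem_nhdsWithin_iff.1
    (hη.norm.eventually (gt_mem_nhds (show ‖imForm (G z₀)‖ < ‖imForm (G z₀)‖ + 1 by linarith)))
  set A := ball (0 : ℂ) 1 ∩ ball z₀ (min ρ ρ') with hA
  have hAo : IsOpen A := isOpen_ball.inter isOpen_ball
  have hAρ : ∀ z ∈ A, z ∈ ball (0 : ℂ) 1 ∩ ball z₀ ρ := fun z hz =>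
    ⟨hz.1, ball_subset_ball (min_le_left _ _) hz.2⟩
  have hAK : ∀ z ∈ A, z ∈ closedBall (0 : ℂ) 1 ∩ ball z₀ ρ := fun z hz =>
    ⟨ball_subset_closedBall hz.1, (hAρ z hz).2⟩
  have hex : ∀ z, ∃ c : Circle, z ∈ A → ζ z = c • σ z := by
    intro z
    by_cases hz : z ∈ A
    · obtain ⟨c, hc⟩ := (F.p_fiber (σ z) (ζ z)).1 ((hσ z (hAK z hz)).1.trans (hζ z hz.1).1.symm)
      exact ⟨c, fun _ => hc.symm⟩
    · exact ⟨1, fun h => absurd h hz⟩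
  choose c hc using hex
  have hd : ∀ z ∈ A, HasFDerivAt (fun y => (c y : ℂ))
      ((imForm (G z) - lam z).smulRight (Complex.I * (c z : ℂ))) z := fun z hz =>
    (F.hasFDerivWithinAt_ratio ((hζ z hz.1).2.mono (subset_univ A))
      ((hσ z (hAK z hz)).2.mono (fun w hw => D.ball_subset_surface hw.1)) (fun y hy => hc y hy) hz
      (hAo.uniqueDiffWithinAt hz)).hasFDerivAt (hAo.mem_nhds hz)
  have hb : ∀ z ∈ A, ‖(imForm (G z) - lam z).smulRight (Complex.I * (c z : ℂ))‖ ≤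
      ‖imForm (G z₀)‖ + 1 + C := by
    intro z hz
    rw [ContinuousLinearMap.norm_smulRight_apply, norm_mul, Complex.norm_I, Circle.norm_coe,
      mul_one, mul_one]
    have h1 := hη' ⟨ball_subset_ball (min_le_right _ _) hz.2, D.ball_subset_surface hz.1⟩
    rw [mem_ofPred_eq] at h1
    have h2 := hC z (hAρ z hz)
    have h3 := norm_sub_le (imForm (G z)) (lam z)
    linarith
  have hz₀A : z₀ ∈ closure A := mem_closure_ball_inter
    ⟨D.surface_subset hz₀, mem_ball_self (by positivity)⟩
  obtain ⟨l, hl⟩ := exists_tendsto_of_norm_fderiv_le ((convex_ball (0 : ℂ) 1).inter (convex_ball z₀ _))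
    hd hb hz₀A
  have hne : (𝓝[A] z₀).NeBot := mem_closure_iff_nhdsWithin_neBot.1 hz₀A
  have hl1 : ‖l‖ = 1 := by
    refine tendsto_nhds_unique hl.norm ?_
    simp only [Circle.norm_coe]
    exact tendsto_const_nhds
  have hlc : Tendsto c (𝓝[A] z₀) (𝓝 (⟨l, mem_sphere_zero_iff_norm.2 hl1⟩ : Circle)) :=
    tendsto_subtype_rng.2 hl
  have hσc : Tendsto σ (𝓝[A] z₀) (𝓝 (σ z₀)) :=
    ((hσ z₀ ⟨D.surface_subset hz₀, mem_ball_self hρ⟩).2.continuousWithinAt).mono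
      (fun w hw => D.ball_subset_surface hw.1)
  refine ⟨_, (((F.tendsto_smul hlc hσc).congr' ?_).mono_left (le_of_eq ?_))⟩
  · filter_upwards [self_mem_nhdsWithin] with z hz
    exact (hc z hz).symm
  · rw [hA]
    exact (nhdsWithin_inter_of_mem' (mem_nhdsWithin_of_mem_nhds (ball_mem_nhds _ (by positivity)))).symm

/-- Continuous extensions of flat lifts to the punctured circle have the expected form there. -/
lemma hasForm_of_isFlat [Finite E] (hu : IsCornerMap EY D u) {G : ℂ → ℂ}
    (hG : ContinuousOn G D.surface) {ζ : ℂ → Z} (hζc : ContinuousOn ζ D.surface)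
    (hζp : ∀ z ∈ D.surface, F.p (ζ z) = u z)
    (hζ : F.IsFlat u (fun z => imForm (G z)) (ball 0 1) ζ) {z₀ : ℂ} (hz₀ : z₀ ∈ D.surface) :
    F.HasForm D.surface ζ z₀ (imForm (G z₀)) := by
  obtain ⟨σ, lam, C, ρ, hρ, hsub, hσ, hC, hlam⟩ := hu.exists_gauge_surface F hz₀
  have hη : ContinuousWithinAt (fun z => imForm (G z)) D.surface z₀ :=
    imForm.continuous.continuousAt.comp_continuousWithinAt (hG z₀ hz₀)
  set K := closedBall (0 : ℂ) 1 ∩ ball z₀ ρ with hK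
  set A := ball (0 : ℂ) 1 ∩ ball z₀ (ρ / 2) with hA
  have hAo : IsOpen A := isOpen_ball.inter isOpen_ball
  have hAK : A ⊆ K := fun z hz =>
    ⟨ball_subset_closedBall hz.1, ball_subset_ball (by linarith) hz.2⟩
  have hclK : closure A ⊆ K := by
    refine (closure_inter_subset_inter_closure _ _).trans (inter_subset_inter ?_ ?_)
    · exact closure_ball_subset_closedBall
    · exact closure_ball_subset_closedBall.trans (closedBall_subset_ball (by linarith))
  have hex : ∀ z, ∃ c : Circle, z ∈ K → ζ z = c • σ z := by
    intro z
    by_cases hz : z ∈ K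
    · obtain ⟨c, hc⟩ := (F.p_fiber (σ z) (ζ z)).1 ((hσ z hz).1.trans (hζp z (hsub hz)).symm)
      exact ⟨c, fun _ => hc.symm⟩
    · exact ⟨1, fun h => absurd h hz⟩
  choose c hc using hex
  have hcc : ContinuousOn c K := fun z hz =>
    F.continuousWithinAt_ratio ((hζc z (hsub hz)).mono hsub)
      ((hσ z hz).2.continuousWithinAt.mono hsub) hc hz
  have hd : ∀ z ∈ A, HasFDerivAt (fun y => (c y : ℂ))
      ((imForm (G z) - lam z).smulRight (Complex.I * (c z : ℂ))) z := fun z hz =>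
    (F.hasFDerivWithinAt_ratio ((hζ z hz.1).2.mono (subset_univ A))
      ((hσ z (hAK hz)).2.mono (fun w hw => D.ball_subset_surface hw.1))
      (fun y hy => hc y (hAK hy)) hz (hAo.uniqueDiffWithinAt hz)).hasFDerivAt (hAo.mem_nhds hz)
  have hz₀K : z₀ ∈ K := ⟨D.surface_subset hz₀, mem_ball_self hρ⟩
  have hAS : A ⊆ D.surface := fun z hz => D.ball_subset_surface hz.1
  have hlim : Tendsto (fun z => fderiv ℝ (fun y => (c y : ℂ)) z) (𝓝[A] z₀)
      (𝓝 ((imForm (G z₀) - lam z₀).smulRight (Complex.I * (c z₀ : ℂ)))) := by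
    have h1 : Tendsto (fun z => imForm (G z) - lam z) (𝓝[A] z₀) (𝓝 (imForm (G z₀) - lam z₀)) :=
      (hη.sub hlam).mono hAS
    have h2 : Tendsto (fun z => Complex.I * (c z : ℂ)) (𝓝[A] z₀) (𝓝 (Complex.I * (c z₀ : ℂ))) :=
      (continuous_subtype_val.continuousAt.comp_continuousWithinAt
        ((hcc z₀ hz₀K).mono hAK)).const_mul _
    have h3 := ((ContinuousLinearMap.smulRightL ℝ ℂ ℂ).continuous₂.tendsto
      (imForm (G z₀) - lam z₀, Complex.I * (c z₀ : ℂ))).comp (h1.prodMk_nhds h2)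
    refine h3.congr' ?_
    filter_upwards [self_mem_nhdsWithin] with z hz
    exact (hd z hz).fderiv.symm
  have hder := hasFDerivWithinAt_closure_of_tendsto_fderiv
    (fun z hz => (hd z hz).differentiableAt.differentiableWithinAt)
    ((convex_ball (0 : ℂ) 1).inter (convex_ball z₀ (ρ / 2))) hAo
    (fun y hy => continuous_subtype_val.continuousAt.comp_continuousWithinAt
      ((hcc y (hclK hy)).mono hAK)) hlim
  have h4 := ((hσ z₀ hz₀K).2.mono (hclK.trans hsub)).smul hder
  rw [add_sub_cancel] at h4
  have hz₀A : z₀ ∈ closure A := mem_closure_ball_inter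
    ⟨D.surface_subset hz₀, mem_ball_self (by positivity)⟩
  have h5 := h4.congr_of_eventuallyEq (ζ' := ζ)
    (eventually_of_mem self_mem_nhdsWithin fun z hz => hc z (hclK hz)) (hc z₀ hz₀K)
  refine h5.mono_of_mem ?_
  filter_upwards [self_mem_nhdsWithin, mem_nhdsWithin_of_mem_nhds (ball_mem_nhds z₀ (half_pos hρ))]
    with z hz hz1
  exact mem_closure_ball_inter ⟨D.surface_subset hz, hz1⟩

/-- The model lift exists. -/
theorem exists_isModel [Finite E] [T2Space Y] (F : CircleFibered EY Y EZ Z)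
    (hu : IsCornerMap EY D u) : ∃ G s ζ, F.IsModel D u G s ζ := by
  have : LocallyCompactSpace Z := ChartedSpace.locallyCompactSpace EZ Z
  obtain ⟨G, hG, hGc, hGp, hGb⟩ := hu.exists_potential (F := F)
  have hη : ∀ z ∈ ball (0 : ℂ) 1, ContDiffAt ℝ ∞ (fun z => imForm (G z)) z := fun z hz =>
    imForm.contDiff.contDiffAt.comp z (hG z hz).1
  have hcurv := fun z hz => hu.curvature_imForm (F := F) hz (hG z hz).1 (hG z hz).2
  obtain ⟨ζ₀, hζ₀⟩ := exists_isFlat_ball (F := F) (u := u) (η := fun z => imForm (G z)) (by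
    intro z hz
    obtain ⟨r, hr, ζ, -, hζ, -⟩ := exists_isFlat_nhds isOpen_ball (fun z hz => hu.contMDiffAt hz)
      hη hcurv hz
    exact ⟨ball z r, isOpen_ball, convex_ball _ _, singleton_subset_iff.2 (mem_ball_self hr), ζ, hζ⟩)
  have hρ : ∀ z ∈ ball (0 : ℂ) 1, ContDiffAt ℝ ∞ (fun z => reForm (G z)) z := fun z hz =>
    reForm.contDiff.contDiffAt.comp z (hG z hz).1
  obtain ⟨s₀, hs₀⟩ := (convex_ball (0 : ℂ) 1).exists_forall_hasFDerivAt_of_fderiv_symmetric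
    isOpen_ball (show DifferentiableOn ℝ (fun z => reForm (G z)) _ from fun z hz =>
      ((hρ z hz).differentiableAt (by simp)).differentiableWithinAt)
    (fun z hz => symmetric_reForm (hG z hz).1 (hG z hz).2)
  have hcl : D.surface ⊆ closure (ball (0 : ℂ) 1) := by
    rw [closure_ball _ one_ne_zero]; exact D.surface_subset
  have hζlim : ∀ z ∈ D.surface, ∃ w, Tendsto ζ₀ (𝓝[ball 0 1] z) (𝓝 w) := fun z hz =>
    hu.exists_tendsto_of_isFlat hGc hζ₀ hz
  have hslim : ∀ z ∈ D.surface, ∃ w, Tendsto s₀ (𝓝[ball 0 1] z) (𝓝 w) := by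
    intro z₀ hz₀
    have hη : ContinuousWithinAt (fun z => reForm (G z)) D.surface z₀ :=
      reForm.continuous.continuousAt.comp_continuousWithinAt (hGc z₀ hz₀)
    obtain ⟨ρ, hρ, hη'⟩ := Metric.mem_nhdsWithin_iff.1
      (hη.norm.eventually (gt_mem_nhds (show ‖reForm (G z₀)‖ < ‖reForm (G z₀)‖ + 1 by linarith)))
    obtain ⟨l, hl⟩ := exists_tendsto_of_norm_fderiv_le
      ((convex_ball (0 : ℂ) 1).inter (convex_ball z₀ ρ)) (C := ‖reForm (G z₀)‖ + 1)
      (fun z hz => hs₀ z hz.1) (fun z hz => (hη' ⟨hz.2, D.ball_subset_surface hz.1⟩).le)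
      (mem_closure_ball_inter ⟨D.surface_subset hz₀, mem_ball_self hρ⟩)
    refine ⟨l, hl.mono_left (le_of_eq ?_)⟩
    exact (nhdsWithin_inter_of_mem' (mem_nhdsWithin_of_mem_nhds (ball_mem_nhds _ hρ))).symm
  have hζ₀c : ContinuousOn ζ₀ (ball 0 1) := fun z hz =>
    (hζ₀ z hz).2.continuousWithinAt.mono (subset_univ _)
  have hs₀c : ContinuousOn s₀ (ball 0 1) := fun z hz =>
    (hs₀ z hz).continuousAt.continuousWithinAt
  set ζ := extendFrom (ball (0 : ℂ) 1) ζ₀ with hζdef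
  set s := extendFrom (ball (0 : ℂ) 1) s₀ with hsdef
  have hζeq : ∀ z ∈ ball (0 : ℂ) 1, ζ z = ζ₀ z := extendFrom_extends hζ₀c
  have hseq : ∀ z ∈ ball (0 : ℂ) 1, s z = s₀ z := extendFrom_extends hs₀c
  have hζc : ContinuousOn ζ D.surface := continuousOn_extendFrom hcl hζlim
  have hsc : ContinuousOn s D.surface := continuousOn_extendFrom hcl hslim
  have hζev : ∀ z ∈ ball (0 : ℂ) 1, ζ =ᶠ[𝓝 z] ζ₀ := fun z hz =>
    eventually_of_mem (isOpen_ball.mem_nhds hz) hζeq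
  have hsev : ∀ z ∈ ball (0 : ℂ) 1, s =ᶠ[𝓝 z] s₀ := fun z hz =>
    eventually_of_mem (isOpen_ball.mem_nhds hz) hseq
  have hflat : F.IsFlat u (fun z => imForm (G z)) (ball 0 1) ζ := fun z hz => by
    refine ⟨by rw [hζeq z hz]; exact (hζ₀ z hz).1, (hζ₀ z hz).2.congr_of_eventuallyEq ?_ (hζeq z hz)⟩
    rw [nhdsWithin_univ]
    exact hζev z hz
  have hp : ∀ z ∈ D.surface, F.p (ζ z) = u z := by
    intro z hz
    have hne : (𝓝[ball 0 1] z).NeBot := mem_closure_iff_nhdsWithin_neBot.1 (hcl hz)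
    have h1 : Tendsto (fun w => F.p (ζ w)) (𝓝[ball 0 1] z) (𝓝 (F.p (ζ z))) :=
      (F.p_smooth.continuous.tendsto _).comp ((hζc z hz).mono D.ball_subset_surface)
    have h2 : Tendsto u (𝓝[ball 0 1] z) (𝓝 (u z)) :=
      (hu.continuous z (D.surface_subset hz)).mono ball_subset_closedBall
    refine tendsto_nhds_unique h1 (h2.congr' ?_)
    filter_upwards [self_mem_nhdsWithin] with w hw
    exact (hflat w hw).1.symm
  refine ⟨G, s, ζ, hGc, hGp, hGb, hsc, fun z hz => ?_, fun z hz => ?_, hζc, fun z hz => ?_, hp,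
    fun z hz => hu.hasForm_of_isFlat hGc hζc hp hflat hz⟩
  · exact (contDiffAt_infty_of_hasFDerivAt (eventually_of_mem (isOpen_ball.mem_nhds hz) hs₀)
      (hρ z hz)).congr_of_eventuallyEq (hsev z hz)
  · exact (hs₀ z hz).congr_of_eventuallyEq (hsev z hz)
  · exact hflat.contMDiffAt isOpen_ball (fun z hz => hu.contMDiffAt hz) hη hcurv hz

end IsCornerMap

end CircleFibered

end Model

end

section

/-! ### Strip-like ends -/

section Strip

open Metric

namespace Punctures

variable {E : Type*} (D : Punctures E)

/-- The upper half-plane coordinate of the strip. -/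
def stripExp (x : ℝ × ℝ) : ℂ := Complex.exp (Real.pi * (x.1 + Complex.I * x.2))

lemma stripExp_ne_zero (x : ℝ × ℝ) : stripExp x ≠ 0 := Complex.exp_ne_zero _

lemma norm_stripExp (x : ℝ × ℝ) : ‖stripExp x‖ = Real.exp (Real.pi * x.1) := by
  simp [stripExp, Complex.norm_exp]

lemma stripExp_eq (x : ℝ × ℝ) : stripExp x =
    (Real.exp (Real.pi * x.1) : ℝ) * Complex.exp ((Real.pi * x.2 : ℝ) * Complex.I) := by
  rw [stripExp, Complex.ofReal_exp, ← Complex.exp_add]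
  congr 1
  push_cast
  ring

lemma stripExp_im (x : ℝ × ℝ) :
    (stripExp x).im = Real.exp (Real.pi * x.1) * Real.sin (Real.pi * x.2) := by
  rw [stripExp_eq, Complex.im_ofReal_mul, Complex.exp_ofReal_mul_I_im]

lemma stripExp_im_nonneg {x : ℝ × ℝ} (hx : x.2 ∈ Icc (0 : ℝ) 1) : 0 ≤ (stripExp x).im := by
  rw [stripExp_im]
  refine mul_nonneg (Real.exp_pos _).le (Real.sin_nonneg_of_mem_Icc ⟨?_, ?_⟩)
  · exact mul_nonneg Real.pi_pos.le hx.1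
  · nlinarith [Real.pi_pos, hx.2]

lemma stripExp_im_pos {x : ℝ × ℝ} (hx : x.2 ∈ Ioo (0 : ℝ) 1) : 0 < (stripExp x).im := by
  rw [stripExp_im]
  refine mul_pos (Real.exp_pos _) (Real.sin_pos_of_mem_Ioo ⟨?_, ?_⟩)
  · exact mul_pos Real.pi_pos hx.1
  · nlinarith [Real.pi_pos, hx.2]

lemma stripExp_im_eq_zero {x : ℝ × ℝ} (hx : x.2 = 0 ∨ x.2 = 1) : (stripExp x).im = 0 := by
  rw [stripExp_im]
  rcases hx with hx | hx <;> simp [hx]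

lemma norm_add_I_pos {w : ℂ} (hw : 0 ≤ w.im) : 0 < ‖w + Complex.I‖ := by
  rw [norm_pos_iff]
  intro h
  have := congrArg Complex.im h
  simp at this
  linarith

lemma norm_sq_add_I (w : ℂ) : ‖w + Complex.I‖ ^ 2 = ‖w‖ ^ 2 + 2 * w.im + 1 := by
  rw [← Complex.normSq_eq_norm_sq, ← Complex.normSq_eq_norm_sq, Complex.normSq_apply,
    Complex.normSq_apply]
  simp
  ring

lemma norm_sq_sub_I (w : ℂ) : ‖w - Complex.I‖ ^ 2 = ‖w‖ ^ 2 - 2 * w.im + 1 := by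
  rw [← Complex.normSq_eq_norm_sq, ← Complex.normSq_eq_norm_sq, Complex.normSq_apply,
    Complex.normSq_apply]
  simp
  ring

lemma norm_le_norm_add_I {w : ℂ} (hw : 0 ≤ w.im) : ‖w‖ ≤ ‖w + Complex.I‖ := by
  refine (sq_le_sq₀ (norm_nonneg _) (norm_nonneg _)).1 ?_
  rw [norm_sq_add_I]
  linarith

lemma stripEnd_eq (e : E) (x : ℝ × ℝ) :
    D.stripEnd e x = D.pt e * ((stripExp x - Complex.I) / (stripExp x + Complex.I)) := rfl

lemma stripExp_add_I_ne_zero {x : ℝ × ℝ} (hx : x.2 ∈ Icc (0 : ℝ) 1) : stripExp x + Complex.I ≠ 0 :=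
  norm_pos_iff.1 (norm_add_I_pos (stripExp_im_nonneg hx))

lemma stripEnd_sub_pt (e : E) {x : ℝ × ℝ} (hx : x.2 ∈ Icc (0 : ℝ) 1) :
    D.stripEnd e x - D.pt e = -(2 * Complex.I * D.pt e) / (stripExp x + Complex.I) := by
  rw [stripEnd_eq]
  have := stripExp_add_I_ne_zero hx
  field_simp
  ring

lemma norm_stripEnd_sub_pt (e : E) {x : ℝ × ℝ} (hx : x.2 ∈ Icc (0 : ℝ) 1) :
    ‖D.stripEnd e x - D.pt e‖ = 2 / ‖stripExp x + Complex.I‖ := by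
  rw [D.stripEnd_sub_pt e hx, norm_div, norm_neg, norm_mul, norm_mul, D.norm_pt]
  simp

lemma norm_stripEnd_sub_pt_le (e : E) {x : ℝ × ℝ} (hx : x.2 ∈ Icc (0 : ℝ) 1) :
    ‖D.stripEnd e x - D.pt e‖ ≤ 2 * Real.exp (-(Real.pi * x.1)) := by
  rw [D.norm_stripEnd_sub_pt e hx, Real.exp_neg, ← div_eq_mul_inv]
  refine div_le_div_of_nonneg_left (by norm_num) (Real.exp_pos _) ?_
  rw [← norm_stripExp]
  exact norm_le_norm_add_I (stripExp_im_nonneg hx)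

lemma stripEnd_ne_pt (e : E) {x : ℝ × ℝ} (hx : x.2 ∈ Icc (0 : ℝ) 1) :
    D.stripEnd e x ≠ D.pt e := by
  rw [← sub_ne_zero, ← norm_pos_iff, D.norm_stripEnd_sub_pt e hx]
  exact div_pos two_pos (norm_add_I_pos (stripExp_im_nonneg hx))

lemma norm_stripEnd (e : E) (x : ℝ × ℝ) :
    ‖D.stripEnd e x‖ = ‖stripExp x - Complex.I‖ / ‖stripExp x + Complex.I‖ := by
  rw [stripEnd_eq, norm_mul, norm_div, D.norm_pt, one_mul]

lemma norm_stripEnd_le (e : E) {x : ℝ × ℝ} (hx : x.2 ∈ Icc (0 : ℝ) 1) : ‖D.stripEnd e x‖ ≤ 1 := by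
  rw [norm_stripEnd, div_le_one (norm_add_I_pos (stripExp_im_nonneg hx))]
  refine (sq_le_sq₀ (norm_nonneg _) (norm_nonneg _)).1 ?_
  rw [norm_sq_add_I, norm_sq_sub_I]
  linarith [stripExp_im_nonneg hx]

lemma norm_stripEnd_lt (e : E) {x : ℝ × ℝ} (hx : x.2 ∈ Ioo (0 : ℝ) 1) : ‖D.stripEnd e x‖ < 1 := by
  have h := stripExp_im_pos hx
  rw [norm_stripEnd, div_lt_one (norm_add_I_pos h.le)]
  refine (sq_lt_sq₀ (norm_nonneg _) (norm_nonneg _)).1 ?_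
  rw [norm_sq_add_I, norm_sq_sub_I]
  linarith

lemma norm_stripEnd_eq (e : E) {x : ℝ × ℝ} (hx : x.2 = 0 ∨ x.2 = 1) : ‖D.stripEnd e x‖ = 1 := by
  have h := stripExp_im_eq_zero hx
  rw [norm_stripEnd, div_eq_one_iff_eq (norm_add_I_pos h.ge).ne']
  refine (sq_eq_sq₀ (norm_nonneg _) (norm_nonneg _)).1 ?_
  rw [norm_sq_add_I, norm_sq_sub_I, h]
  ring

lemma tendsto_stripEnd_nhds (e : E) :
    Tendsto (D.stripEnd e) (atTop ×ˢ 𝓟 (Icc (0 : ℝ) 1)) (𝓝 (D.pt e)) := by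
  rw [tendsto_iff_norm_sub_tendsto_zero]
  have h1 : Tendsto (fun x : ℝ × ℝ => 2 * Real.exp (-(Real.pi * x.1)))
      (atTop ×ˢ 𝓟 (Icc (0 : ℝ) 1)) (𝓝 0) := by
    have h2 : Tendsto (fun τ : ℝ => 2 * Real.exp (-(Real.pi * τ))) atTop (𝓝 (2 * 0)) :=
      ((Real.tendsto_exp_neg_atTop_nhds_zero.comp
        (tendsto_id.const_mul_atTop Real.pi_pos))).const_mul 2
    rw [mul_zero] at h2
    exact h2.comp tendsto_fst
  refine squeeze_zero' (Eventually.of_forall fun _ => norm_nonneg _) ?_ h1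
  have h3 : ∀ᶠ x : ℝ × ℝ in atTop ×ˢ 𝓟 (Icc (0 : ℝ) 1), x.2 ∈ Icc (0 : ℝ) 1 :=
    tendsto_snd.eventually (eventually_mem_principal _)
  filter_upwards [h3] with x hx
  exact D.norm_stripEnd_sub_pt_le e hx

lemma eventually_snd_mem : ∀ᶠ x : ℝ × ℝ in atTop ×ˢ 𝓟 (Icc (0 : ℝ) 1), x.2 ∈ Icc (0 : ℝ) 1 :=
  tendsto_snd.eventually (eventually_mem_principal _)

lemma tendsto_stripEnd (e : E) : Tendsto (D.stripEnd e) (atTop ×ˢ 𝓟 (Icc (0 : ℝ) 1))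
    (𝓝[closedBall 0 1 \ {D.pt e}] (D.pt e)) := by
  refine tendsto_nhdsWithin_iff.2 ⟨D.tendsto_stripEnd_nhds e, ?_⟩
  filter_upwards [eventually_snd_mem] with x hx
  exact ⟨mem_closedBall_zero_iff.2 (D.norm_stripEnd_le e hx), D.stripEnd_ne_pt e hx⟩

/-- The strip-like end covers a punctured neighborhood of the puncture in the closed disk. -/
lemma nhdsWithin_pt_le_map_stripEnd (e : E) : 𝓝[closedBall 0 1 \ {D.pt e}] (D.pt e) ≤
    map (D.stripEnd e) (atTop ×ˢ 𝓟 (Icc (0 : ℝ) 1)) := by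
  have hp : D.pt e ≠ 0 := norm_pos_iff.1 (by rw [D.norm_pt]; exact one_pos)
  set W : ℂ → ℂ := fun z => Complex.I * (D.pt e + z) / (D.pt e - z) with hW
  set inv : ℂ → ℝ × ℝ := fun z => (Real.log ‖W z‖ / Real.pi, Complex.arg (W z) / Real.pi) with hinv
  have hmem : ∀ᶠ z in 𝓝[closedBall 0 1 \ {D.pt e}] (D.pt e),
      z ∈ closedBall (0 : ℂ) 1 \ {D.pt e} := self_mem_nhdsWithin
  have hWim : ∀ z ∈ closedBall (0 : ℂ) 1 \ {D.pt e}, 0 ≤ (W z).im := by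
    intro z hz
    have h1 : ‖z‖ ≤ 1 := by simpa using hz.1
    have h2 : D.pt e - z ≠ 0 := sub_ne_zero.2 (Ne.symm hz.2)
    have h3 : W z = Complex.I * ((D.pt e + z) * (starRingEnd ℂ) (D.pt e - z)) *
        ((Complex.normSq (D.pt e - z))⁻¹ : ℝ) := by
      rw [hW]
      simp only [div_eq_mul_inv]
      rw [Complex.inv_def]
      ring
    rw [h3, Complex.im_mul_ofReal]
    refine mul_nonneg ?_ (inv_nonneg.2 (Complex.normSq_nonneg _))
    have h4 : (D.pt e).re ^ 2 + (D.pt e).im ^ 2 = 1 := by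
      have := D.norm_pt e
      have h5 := Complex.normSq_eq_norm_sq (D.pt e)
      rw [this, Complex.normSq_apply] at h5
      nlinarith
    have h5 : z.re ^ 2 + z.im ^ 2 ≤ 1 := by
      have h5 := Complex.normSq_eq_norm_sq z
      rw [Complex.normSq_apply] at h5
      nlinarith [norm_nonneg z]
    simp
    nlinarith
  have hnorm : Tendsto (fun z => ‖W z‖) (𝓝[closedBall 0 1 \ {D.pt e}] (D.pt e)) atTop := by
    have h1 : Tendsto (fun z => ‖D.pt e - z‖⁻¹) (𝓝[closedBall 0 1 \ {D.pt e}] (D.pt e)) atTop := by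
      refine tendsto_inv_nhdsGT_zero.comp (tendsto_nhdsWithin_iff.2 ⟨?_, ?_⟩)
      · have h2 : Tendsto (fun z => ‖D.pt e - z‖) (𝓝 (D.pt e)) (𝓝 ‖D.pt e - D.pt e‖) :=
          ((continuous_const.sub continuous_id).norm).tendsto _
        rw [sub_self, norm_zero] at h2
        exact h2.mono_left nhdsWithin_le_nhds
      · filter_upwards [hmem] with z hz
        exact norm_pos_iff.2 (sub_ne_zero.2 (Ne.symm hz.2))
    have h2 : Tendsto (fun z => ‖D.pt e + z‖) (𝓝[closedBall 0 1 \ {D.pt e}] (D.pt e))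
        (𝓝 ‖D.pt e + D.pt e‖) :=
      (((continuous_const.add continuous_id).norm).tendsto _).mono_left nhdsWithin_le_nhds
    have h3 : 0 < ‖D.pt e + D.pt e‖ := by
      rw [← two_mul, norm_pos_iff]
      exact mul_ne_zero two_ne_zero hp
    refine (h2.pos_mul_atTop h3 h1).congr fun z => ?_
    rw [hW]
    simp [div_eq_mul_inv]
  have htend : Tendsto inv (𝓝[closedBall 0 1 \ {D.pt e}] (D.pt e)) (atTop ×ˢ 𝓟 (Icc (0 : ℝ) 1)) := by
    refine Tendsto.prodMk ((Real.tendsto_log_atTop.comp hnorm).atTop_div_const Real.pi_pos) ?_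
    refine tendsto_principal.2 ?_
    filter_upwards [hmem] with z hz
    refine ⟨div_nonneg (Complex.arg_nonneg_iff.2 (hWim z hz)) Real.pi_pos.le, ?_⟩
    exact (div_le_one Real.pi_pos).2 (Complex.arg_le_pi _)
  have hright : ∀ᶠ z in 𝓝[closedBall 0 1 \ {D.pt e}] (D.pt e), D.stripEnd e (inv z) = z := by
    filter_upwards [hmem, hnorm.eventually_gt_atTop 0] with z hz hWz
    have hW0 : W z ≠ 0 := norm_pos_iff.1 hWz
    have h2 : D.pt e - z ≠ 0 := sub_ne_zero.2 (Ne.symm hz.2)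
    have h3 : stripExp (inv z) = W z := by
      rw [stripExp_eq, hinv]
      simp only
      rw [mul_div_cancel₀ _ Real.pi_ne_zero, mul_div_cancel₀ _ Real.pi_ne_zero, Real.exp_log hWz]
      exact Complex.norm_mul_exp_arg_mul_I _
    have h4 : W z + Complex.I ≠ 0 := norm_pos_iff.1 (norm_add_I_pos (hWim z hz))
    rw [stripEnd_eq, h3, ← mul_div_assoc, div_eq_iff h4, hW]
    field_simp
    ring
  calc 𝓝[closedBall 0 1 \ {D.pt e}] (D.pt e)
      = map (D.stripEnd e ∘ inv) (𝓝[closedBall 0 1 \ {D.pt e}] (D.pt e)) := by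
        rw [Filter.map_congr (m₁ := D.stripEnd e ∘ inv) (m₂ := id) hright, map_id]
    _ = map (D.stripEnd e) (map inv (𝓝[closedBall 0 1 \ {D.pt e}] (D.pt e))) := (map_map ..).symm
    _ ≤ map (D.stripEnd e) (atTop ×ˢ 𝓟 (Icc (0 : ℝ) 1)) := map_mono htend

lemma map_stripEnd (e : E) : map (D.stripEnd e) (atTop ×ˢ 𝓟 (Icc (0 : ℝ) 1)) =
    𝓝[closedBall 0 1 \ {D.pt e}] (D.pt e) :=
  le_antisymm (D.tendsto_stripEnd e) (D.nhdsWithin_pt_le_map_stripEnd e)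

lemma eventually_stripEnd_mem_surface [Finite E] (e : E) :
    ∀ᶠ x in atTop ×ˢ 𝓟 (Icc (0 : ℝ) 1), D.stripEnd e x ∈ D.surface :=
  (D.tendsto_stripEnd e).eventually (D.surface_mem_nhdsWithin_pt e)

lemma tendsto_prodMk_const {t : ℝ} (ht : t ∈ Icc (0 : ℝ) 1) :
    Tendsto (fun τ : ℝ => (τ, t)) atTop (atTop ×ˢ 𝓟 (Icc (0 : ℝ) 1)) :=
  tendsto_id.prodMk (tendsto_principal.2 (Eventually.of_forall fun _ => ht))

lemma eventually_stripEnd_mem_bdry [Finite E] (e : E) {t : ℝ} (ht : t = 0 ∨ t = 1) :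
    ∀ᶠ τ : ℝ in atTop, D.stripEnd e (τ, t) ∈ D.bdry := by
  have ht' : t ∈ Icc (0 : ℝ) 1 := by rcases ht with rfl | rfl <;> simp
  filter_upwards [(tendsto_prodMk_const ht').eventually (D.eventually_stripEnd_mem_surface e)]
    with τ hτ
  exact ⟨by simpa using D.norm_stripEnd_eq e (x := (τ, t)) ht, hτ.2⟩

/-- The punctured circle near a puncture is covered by the two sides of the strip-like end. -/
lemma eventually_bdry_of_stripEnd (e : E) {p : ℂ → Prop}
    (h0 : ∀ᶠ τ : ℝ in atTop, p (D.stripEnd e (τ, 0)))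
    (h1 : ∀ᶠ τ : ℝ in atTop, p (D.stripEnd e (τ, 1))) :
    ∀ᶠ z in 𝓝[D.bdry] (D.pt e), p z := by
  have h2 : ∀ᶠ z in 𝓝[closedBall 0 1 \ {D.pt e}] (D.pt e), ‖z‖ = 1 → p z := by
    rw [← D.map_stripEnd, eventually_map]
    have h0' := h0.prod_inl (𝓟 (Icc (0 : ℝ) 1))
    have h1' := h1.prod_inl (𝓟 (Icc (0 : ℝ) 1))
    filter_upwards [h0', h1', eventually_snd_mem] with x hx0 hx1 hx hn
    rcases hx.1.eq_or_lt with h | h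
    · rwa [h] at hx0
    rcases hx.2.eq_or_lt with h' | h'
    · rwa [← h'] at hx1
    · exact absurd hn (D.norm_stripEnd_lt e (x := x) ⟨h, h'⟩).ne
  have h3 : 𝓝[D.bdry] (D.pt e) ≤ 𝓝[closedBall 0 1 \ {D.pt e}] (D.pt e) := by
    refine nhdsWithin_mono _ fun z hz => ⟨sphere_subset_closedBall hz.1, fun h => hz.2 ?_⟩
    rw [mem_singleton_iff] at h
    exact ⟨e, h.symm⟩
  filter_upwards [h3 h2, self_mem_nhdsWithin] with z hz hz1
  exact hz (by simpa using hz1.1)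

lemma hasDerivAt_stripEnd_of_hasDerivAt (e : E) {f : ℝ → ℝ × ℝ} {f' : ℂ} {x : ℝ}
    (hf : (f x).2 ∈ Icc (0 : ℝ) 1)
    (h : HasDerivAt (fun y => ((f y).1 + Complex.I * (f y).2 : ℂ)) f' x) :
    HasDerivAt (fun y => D.stripEnd e (f y)) (D.pt e * (2 * Complex.I * Real.pi * f' *
      stripExp (f x) / (stripExp (f x) + Complex.I) ^ 2)) x := by
  have h1 : HasDerivAt (fun y => stripExp (f y)) (stripExp (f x) * (Real.pi * f')) x :=
    (h.const_mul (Real.pi : ℂ)).cexp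
  have h2 := ((h1.sub_const Complex.I).div (h1.add_const Complex.I)
    (stripExp_add_I_ne_zero hf)).const_mul (D.pt e)
  refine h2.congr_deriv ?_
  congr 2
  ring

lemma hasDerivAt_stripEnd_snd (e : E) {τ t : ℝ} (ht : t ∈ Icc (0 : ℝ) 1) :
    HasDerivAt (fun t => D.stripEnd e (τ, t)) (D.pt e * (2 * Complex.I * Real.pi * Complex.I *
      stripExp (τ, t) / (stripExp (τ, t) + Complex.I) ^ 2)) t := by
  refine D.hasDerivAt_stripEnd_of_hasDerivAt e (f := fun t => (τ, t)) ht ?_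
  simpa using ((hasDerivAt_id t).ofReal_comp.const_mul Complex.I).const_add (τ : ℂ)

lemma hasDerivAt_stripEnd_fst (e : E) {τ t : ℝ} (ht : t ∈ Icc (0 : ℝ) 1) :
    HasDerivAt (fun τ => D.stripEnd e (τ, t)) (D.pt e * (2 * Complex.I * Real.pi * 1 *
      stripExp (τ, t) / (stripExp (τ, t) + Complex.I) ^ 2)) τ := by
  refine D.hasDerivAt_stripEnd_of_hasDerivAt e (f := fun τ => (τ, t)) ht ?_
  simpa using ((hasDerivAt_id τ).ofReal_comp.add_const (Complex.I * (t : ℂ)))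

lemma norm_deriv_stripEnd_le (e : E) {x : ℝ × ℝ} (hx : x.2 ∈ Icc (0 : ℝ) 1) {a : ℂ} (ha : ‖a‖ = 1) :
    ‖D.pt e * (2 * Complex.I * Real.pi * a * stripExp x / (stripExp x + Complex.I) ^ 2)‖ ≤
      Real.pi * ‖D.stripEnd e x - D.pt e‖ := by
  have h1 := norm_add_I_pos (stripExp_im_nonneg hx)
  have h2 := norm_le_norm_add_I (stripExp_im_nonneg hx)
  rw [D.norm_stripEnd_sub_pt e hx, norm_mul, norm_div, D.norm_pt, norm_pow]
  simp only [norm_mul, ha, Complex.norm_I, Complex.norm_real, Complex.norm_ofNat, one_mul, mul_one,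
    Real.norm_eq_abs, abs_of_pos Real.pi_pos]
  rw [div_le_iff₀ (by positivity)]
  calc 2 * Real.pi * ‖stripExp x‖ ≤ 2 * Real.pi * ‖stripExp x + Complex.I‖ := by gcongr
    _ = Real.pi * (2 / ‖stripExp x + Complex.I‖) * ‖stripExp x + Complex.I‖ ^ 2 := by
        field_simp

/-- The sides of the strip run along the unit circle. -/
lemma exists_hasDerivAt_stripEnd (e : E) {t : ℝ} (ht : t = 0 ∨ t = 1) (τ : ℝ) :
    ∃ r : ℝ, HasDerivAt (fun τ => D.stripEnd e (τ, t)) (r * (Complex.I * D.stripEnd e (τ, t))) τ := by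
  have ht' : t ∈ Icc (0 : ℝ) 1 := by rcases ht with rfl | rfl <;> simp
  have him := stripExp_im_eq_zero (x := (τ, t)) ht
  obtain ⟨y, hy⟩ : ∃ y : ℝ, stripExp (τ, t) = y := ⟨_, (Complex.ext rfl (by simpa using him))⟩
  have h1 : (y : ℂ) + Complex.I ≠ 0 := by rw [← hy]; exact stripExp_add_I_ne_zero (x := (τ, t)) ht'
  have h2 : (y : ℂ) - Complex.I ≠ 0 := by
    intro h
    have := congrArg Complex.im h
    simp at this
  refine ⟨2 * Real.pi * y / (y ^ 2 + 1), (D.hasDerivAt_stripEnd_fst e ht').congr_deriv ?_⟩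
  have h3 : ((y : ℂ) ^ 2 + 1) = (y + Complex.I) * (y - Complex.I) := by
    linear_combination Complex.I_sq
  rw [stripEnd_eq, hy]
  push_cast
  rw [h3]
  field_simp

end Punctures

end Strip

end

section

/-! ### Logarithms with poles at the punctures -/

section CornerLog

open Metric

namespace Punctures

variable {E : Type*} (D : Punctures E)

/-- The branch of `log (1 - z / z_e)` on the closed disk punctured at `z_e`. -/
def cornerLog (e : E) (z : ℂ) : ℂ := Complex.log (1 - z * (starRingEnd ℂ) (D.pt e))

lemma pt_mul_conj (e : E) : D.pt e * (starRingEnd ℂ) (D.pt e) = 1 := by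
  rw [Complex.mul_conj, Complex.normSq_eq_norm_sq, D.norm_pt]
  simp

lemma conj_ne_zero (e : E) : (starRingEnd ℂ) (D.pt e) ≠ 0 :=
  right_ne_zero_of_mul_eq_one (D.pt_mul_conj e)

lemma one_sub_re_pos (e : E) {z : ℂ} (hz : z ∈ closedBall (0 : ℂ) 1 \ {D.pt e}) :
    0 < (1 - z * (starRingEnd ℂ) (D.pt e)).re := by
  set v := z * (starRingEnd ℂ) (D.pt e) with hv
  have h1 : ‖v‖ ≤ 1 := by
    rw [hv, norm_mul, RCLike.norm_conj, D.norm_pt, mul_one]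
    simpa using hz.1
  have h2 : v ≠ 1 := by
    intro h
    refine hz.2 (mul_right_cancel₀ (D.conj_ne_zero e) ?_)
    rw [D.pt_mul_conj, ← h]
  have h3 : v.re ≤ 1 := (Complex.re_le_norm v).trans h1
  rw [Complex.sub_re, Complex.one_re, sub_pos]
  refine h3.lt_of_ne fun h => h2 (Complex.ext h ?_)
  have h4 := Complex.normSq_eq_norm_sq v
  rw [Complex.normSq_apply, h] at h4
  have h5 : v.im * v.im ≤ 0 := by nlinarith [norm_nonneg v]
  simpa using le_antisymm h5 (mul_self_nonneg _)

lemma one_sub_mem_slitPlane (e : E) {z : ℂ} (hz : z ∈ closedBall (0 : ℂ) 1 \ {D.pt e}) :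
    1 - z * (starRingEnd ℂ) (D.pt e) ∈ Complex.slitPlane := Or.inl (D.one_sub_re_pos e hz)

lemma hasDerivAt_cornerLog (e : E) {z : ℂ} (hz : z ∈ closedBall (0 : ℂ) 1 \ {D.pt e}) :
    HasDerivAt (D.cornerLog e)
      (-(starRingEnd ℂ) (D.pt e) / (1 - z * (starRingEnd ℂ) (D.pt e))) z := by
  have h1 : HasDerivAt (fun z : ℂ => 1 - z * (starRingEnd ℂ) (D.pt e))
      (-(1 * (starRingEnd ℂ) (D.pt e))) z :=
    ((hasDerivAt_id z).mul_const _).const_sub 1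
  rw [one_mul] at h1
  exact h1.clog (D.one_sub_mem_slitPlane e hz)

lemma re_mul_deriv_cornerLog (e : E) {z : ℂ} (hz : z ∈ sphere (0 : ℂ) 1) (hz' : z ≠ D.pt e) :
    (z * (-(starRingEnd ℂ) (D.pt e) / (1 - z * (starRingEnd ℂ) (D.pt e)))).re = 1 / 2 := by
  set v := z * (starRingEnd ℂ) (D.pt e) with hv
  have h1 : ‖v‖ = 1 := by
    rw [hv, norm_mul, RCLike.norm_conj, D.norm_pt, mul_one]
    simpa using hz
  have h2 := D.one_sub_re_pos e (z := z) ⟨sphere_subset_closedBall hz, hz'⟩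
  rw [← hv, Complex.sub_re, Complex.one_re] at h2
  have h3 : z * (-(starRingEnd ℂ) (D.pt e) / (1 - v)) = -v / (1 - v) := by
    rw [hv]; ring
  have h4 := Complex.normSq_eq_norm_sq v
  rw [Complex.normSq_apply, h1] at h4
  have h5 : Complex.normSq (1 - v) = 2 * (1 - v.re) := by
    rw [Complex.normSq_apply]
    simp
    nlinarith
  rw [h3, Complex.div_re, h5]
  have h6 : (1 - v.re) ≠ 0 := h2.ne'
  simp
  field_simp
  nlinarith

lemma one_sub_stripEnd (e : E) {x : ℝ × ℝ} (hx : x.2 ∈ Icc (0 : ℝ) 1) :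
    1 - D.stripEnd e x * (starRingEnd ℂ) (D.pt e) = 2 * Complex.I / (stripExp x + Complex.I) := by
  have h1 := D.stripEnd_sub_pt e hx
  have h2 := D.pt_mul_conj e
  have h3 := stripExp_add_I_ne_zero hx
  have h4 : 1 - D.stripEnd e x * (starRingEnd ℂ) (D.pt e) =
      -(D.stripEnd e x - D.pt e) * (starRingEnd ℂ) (D.pt e) := by
    linear_combination -h2
  rw [h4, h1]
  field_simp
  linear_combination h2

lemma cornerLog_stripEnd_re_le (e : E) {x : ℝ × ℝ} (hx : x.2 ∈ Icc (0 : ℝ) 1) :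
    (D.cornerLog e (D.stripEnd e x)).re ≤ Real.log 2 - Real.pi * x.1 := by
  have h3 := norm_add_I_pos (stripExp_im_nonneg hx)
  rw [cornerLog, Complex.log_re, D.one_sub_stripEnd e hx, norm_div, Real.log_div (by simp) h3.ne']
  have h4 : ‖(2 : ℂ) * Complex.I‖ = 2 := by simp
  rw [h4]
  have h5 : Real.pi * x.1 ≤ Real.log ‖stripExp x + Complex.I‖ := by
    rw [Real.le_log_iff_exp_le h3, ← norm_stripExp]
    exact norm_le_norm_add_I (stripExp_im_nonneg hx)
  linarith

lemma tendsto_cornerLog_stripEnd_im (e : E) {t : ℝ} (ht : t ∈ Icc (0 : ℝ) 1) :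
    Tendsto (fun x => (D.cornerLog e (D.stripEnd e x)).im) (atTop ×ˢ 𝓝[Icc (0 : ℝ) 1] t)
      (𝓝 (Real.pi / 2 - Real.pi * t)) := by
  have hπ := Real.pi_pos
  set c : ℂ := Complex.exp ((Real.pi / 2 - Real.pi * t : ℝ) * Complex.I) with hc
  have harg : Complex.arg c = Real.pi / 2 - Real.pi * t := by
    rw [hc, ← Complex.log_im, Complex.log_exp] <;> simp <;> nlinarith [ht.1, ht.2]
  have hslit : c ∈ Complex.slitPlane := by
    rw [Complex.mem_slitPlane_iff_arg, harg]
    exact ⟨by nlinarith [ht.1, ht.2], Complex.exp_ne_zero _⟩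
  have hmem : ∀ᶠ x : ℝ × ℝ in atTop ×ˢ 𝓝[Icc (0 : ℝ) 1] t, x.2 ∈ Icc (0 : ℝ) 1 :=
    tendsto_snd.eventually self_mem_nhdsWithin
  have hinv : Tendsto (fun x : ℝ × ℝ => 1 + Complex.I / stripExp x) (atTop ×ˢ 𝓝[Icc (0 : ℝ) 1] t)
      (𝓝 1) := by
    have h1 : Tendsto (fun x : ℝ × ℝ => Complex.I / stripExp x) (atTop ×ˢ 𝓝[Icc (0 : ℝ) 1] t)
        (𝓝 0) := by
      rw [tendsto_zero_iff_norm_tendsto_zero]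
      have h2 : Tendsto (fun τ : ℝ => Real.exp (-(Real.pi * τ))) atTop (𝓝 0) :=
        Real.tendsto_exp_neg_atTop_nhds_zero.comp (tendsto_id.const_mul_atTop Real.pi_pos)
      refine (h2.comp tendsto_fst).congr fun x => ?_
      rw [norm_div, Complex.norm_I, norm_stripExp, one_div, ← Real.exp_neg]
      rfl
    simpa using h1.const_add 1
  have hexp : Tendsto (fun x : ℝ × ℝ => Complex.exp ((Real.pi / 2 - Real.pi * x.2 : ℝ) * Complex.I))
      (atTop ×ˢ 𝓝[Icc (0 : ℝ) 1] t) (𝓝 c) := by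
    have h1 : Continuous fun s : ℝ => Complex.exp ((Real.pi / 2 - Real.pi * s : ℝ) * Complex.I) := by
      fun_prop
    exact ((h1.tendsto t).mono_left nhdsWithin_le_nhds).comp tendsto_snd
  have h1 := hexp.div hinv one_ne_zero
  rw [div_one] at h1
  have h2 := (Complex.continuousAt_arg hslit).tendsto.comp h1
  rw [harg] at h2
  refine h2.congr' ?_
  filter_upwards [hmem] with x hx
  have h3 := stripExp_add_I_ne_zero hx
  have h4 : 2 * Complex.I / (stripExp x + Complex.I) =
      ((2 * Real.exp (-(Real.pi * x.1)) : ℝ) : ℂ) *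
      (Complex.exp ((Real.pi / 2 - Real.pi * x.2 : ℝ) * Complex.I) /
        (1 + Complex.I / stripExp x)) := by
    have h5 : 1 + Complex.I / stripExp x = (stripExp x + Complex.I) / stripExp x := by
      field_simp [stripExp_ne_zero x]
    have h6 : ((Real.exp (-(Real.pi * x.1)) : ℝ) : ℂ) *
        Complex.exp ((Real.pi / 2 - Real.pi * x.2 : ℝ) * Complex.I) * stripExp x = Complex.I := by
      rw [stripExp, Complex.ofReal_exp, ← Complex.exp_add, ← Complex.exp_add]
      refine Eq.trans ?_ Complex.exp_pi_div_two_mul_I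
      congr 1
      push_cast
      ring
    rw [h5, div_div_eq_mul_div]
    push_cast at h6 ⊢
    rw [← mul_div_assoc]
    congr 1
    linear_combination -2 * h6
  rw [cornerLog, Complex.log_im, D.one_sub_stripEnd e hx, h4,
    Complex.arg_real_mul _ (by positivity)]
  rfl

lemma mem_sdiff_of_mem_surface {z : ℂ} (hz : z ∈ D.surface) (e : E) :
    z ∈ closedBall (0 : ℂ) 1 \ {D.pt e} := by
  refine ⟨hz.1, fun h => hz.2 ?_⟩
  rw [mem_singleton_iff] at h
  exact ⟨e, h.symm⟩

variable [Fintype E]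

/-- A function on the punctured disk whose imaginary part increases by `sign e * θ e` across the
strip-like end `e`. -/
def cornerSum (θ : E → ℝ) (z : ℂ) : ℂ :=
  ∑ e, -((D.sign e * θ e / Real.pi : ℝ) : ℂ) * D.cornerLog e z

/-- The derivative of `cornerSum`. -/
def cornerSumDeriv (θ : E → ℝ) (z : ℂ) : ℂ :=
  ∑ e, -((D.sign e * θ e / Real.pi : ℝ) : ℂ) *
    (-(starRingEnd ℂ) (D.pt e) / (1 - z * (starRingEnd ℂ) (D.pt e)))

lemma hasDerivAt_cornerSum (θ : E → ℝ) {z : ℂ} (hz : z ∈ D.surface) :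
    HasDerivAt (D.cornerSum θ) (D.cornerSumDeriv θ z) z :=
  HasDerivAt.fun_sum fun e _ =>
    (D.hasDerivAt_cornerLog e (D.mem_sdiff_of_mem_surface hz e)).const_mul _

lemma re_mul_cornerSumDeriv (θ : E → ℝ) {z : ℂ} (hz : z ∈ D.bdry) :
    (z * D.cornerSumDeriv θ z).re = -((2 * Real.pi)⁻¹ * ∑ e, D.sign e * θ e) := by
  rw [cornerSumDeriv, Finset.mul_sum, Complex.re_sum, Finset.mul_sum, ← Finset.sum_neg_distrib]
  refine Finset.sum_congr rfl fun e _ => ?_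
  have h1 := D.re_mul_deriv_cornerLog e hz.1 (D.mem_sdiff_of_mem_surface (D.bdry_subset_surface hz) e).2
  rw [mul_left_comm, ← Complex.ofReal_neg, Complex.re_ofReal_mul, h1]
  field_simp

lemma sign_mul_sign (e : E) : D.sign e * D.sign e = 1 := by
  unfold sign
  split_ifs <;> simp

/-- The terms of `cornerSum` at the other punctures are continuous at `z_e`. -/
lemma exists_tendsto_cornerSum (θ : E → ℝ) (e : E) : ∃ K : ℂ,
    Tendsto (fun z => D.cornerSum θ z + ((D.sign e * θ e / Real.pi : ℝ) : ℂ) * D.cornerLog e z)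
      (𝓝 (D.pt e)) (𝓝 K) := by
  classical
  refine ⟨∑ i ∈ Finset.univ.erase e, -((D.sign i * θ i / Real.pi : ℝ) : ℂ) *
    D.cornerLog i (D.pt e), ?_⟩
  have h1 : ∀ z, D.cornerSum θ z + ((D.sign e * θ e / Real.pi : ℝ) : ℂ) * D.cornerLog e z =
      ∑ i ∈ Finset.univ.erase e, -((D.sign i * θ i / Real.pi : ℝ) : ℂ) * D.cornerLog i z := by
    intro z
    rw [cornerSum, ← Finset.add_sum_erase _ _ (Finset.mem_univ e)]
    ring
  simp only [h1]
  refine tendsto_finsetSum _ fun i hi => ?_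
  have h2 : D.pt e ≠ D.pt i := fun h => (Finset.ne_of_mem_erase hi) (D.injective h).symm
  exact ((D.hasDerivAt_cornerLog i ⟨sphere_subset_closedBall (D.mem_sphere e), h2⟩).continuousAt.tendsto).const_mul _

lemma exists_tendsto_cornerSum_im (θ : E → ℝ) (e : E) : ∃ κ : ℝ, ∀ t ∈ Icc (0 : ℝ) 1,
    Tendsto (fun x => (D.cornerSum θ (D.stripEnd e x)).im) (atTop ×ˢ 𝓝[Icc (0 : ℝ) 1] t)
      (𝓝 (κ + D.sign e * θ e * t)) := by
  obtain ⟨K, hK⟩ := D.exists_tendsto_cornerSum θ e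
  refine ⟨K.im - D.sign e * θ e / 2, fun t ht => ?_⟩
  have h1 := (Complex.continuous_im.tendsto _).comp (hK.comp ((D.tendsto_stripEnd_nhds e).mono_left
    (prod_mono_right atTop (inf_le_right : 𝓝[Icc (0 : ℝ) 1] t ≤ 𝓟 (Icc (0 : ℝ) 1)))))
  have h2 := (D.tendsto_cornerLog_stripEnd_im e ht).const_mul (D.sign e * θ e / Real.pi)
  have h3 := h1.sub h2
  have h4 : K.im - D.sign e * θ e / Real.pi * (Real.pi / 2 - Real.pi * t) =
      K.im - D.sign e * θ e / 2 + D.sign e * θ e * t := by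
    field_simp
    ring
  rw [h4] at h3
  refine h3.congr fun x => ?_
  simp [-Complex.ofReal_div, -Complex.ofReal_mul]

lemma exists_le_cornerSum_re {θ : E → ℝ} {e : E} (hθ : 0 ≤ θ e) : ∃ C : ℝ,
    ∀ᶠ x in atTop ×ˢ 𝓟 (Icc (0 : ℝ) 1),
      θ e * x.1 - C ≤ D.sign e * (D.cornerSum θ (D.stripEnd e x)).re := by
  obtain ⟨K, hK⟩ := D.exists_tendsto_cornerSum θ e
  have h1 := (hK.comp (D.tendsto_stripEnd_nhds e)).norm.eventually
    (gt_mem_nhds (show ‖K‖ < ‖K‖ + 1 by linarith))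
  refine ⟨‖K‖ + 1 + θ e / Real.pi * Real.log 2, ?_⟩
  filter_upwards [h1, eventually_snd_mem] with x hx ht
  set S := D.cornerSum θ (D.stripEnd e x)
  set ℓ := D.cornerLog e (D.stripEnd e x) with hℓ
  have h2 : |S.re + D.sign e * θ e / Real.pi * ℓ.re| ≤ ‖K‖ + 1 := by
    have h3 := (Complex.abs_re_le_norm _).trans hx.le
    simp only [Function.comp_apply, Complex.add_re, Complex.re_ofReal_mul] at h3
    exact h3
  have h4 : |D.sign e| = 1 := by unfold sign; split_ifs <;> simp
  have h5 : |D.sign e * (S.re + D.sign e * θ e / Real.pi * ℓ.re)| ≤ ‖K‖ + 1 := by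
    rwa [abs_mul, h4, one_mul]
  have h6 : D.sign e * (S.re + D.sign e * θ e / Real.pi * ℓ.re) =
      D.sign e * S.re + θ e / Real.pi * ℓ.re := by
    linear_combination (θ e / Real.pi * ℓ.re) * D.sign_mul_sign e
  rw [h6] at h5
  have h7 := (abs_le.1 h5).1
  have h8 : θ e / Real.pi * ℓ.re ≤ θ e / Real.pi * (Real.log 2 - Real.pi * x.1) :=
    mul_le_mul_of_nonneg_left (D.cornerLog_stripEnd_re_le e ht) (by positivity)
  have h9 : θ e / Real.pi * (Real.log 2 - Real.pi * x.1) = θ e / Real.pi * Real.log 2 - θ e * x.1 := by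
    field_simp
  linarith

end Punctures

/-- Uniform convergence on a compact set from convergence near each of its points. -/
lemma tendsto_prod_principal_of_forall {ι X Y' : Type*} [TopologicalSpace X] {l : Filter ι} {K : Set X}
    (hK : IsCompact K) {f : ι × X → Y'} {m : Filter Y'}
    (h : ∀ t ∈ K, Tendsto f (l ×ˢ 𝓝[K] t) m) : Tendsto f (l ×ˢ 𝓟 K) m := by
  intro U hU
  refine hK.induction_on (p := fun s => f ⁻¹' U ∈ l ×ˢ 𝓟 s) ?_ ?_ ?_ ?_
  · simp
  · intro s t hst ht
    exact prod_mono_right l (principal_mono.2 hst) ht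
  · intro s t hs ht
    rw [← sup_principal, prod_sup]
    exact ⟨hs, ht⟩
  · intro t ht
    obtain ⟨A, hA, B, hB, hAB⟩ := mem_prod_iff.1 (h t ht hU)
    exact ⟨B, hB, mem_of_superset (prod_mem_prod hA (mem_principal_self B)) hAB⟩

end CornerLog

end

section

/-! ### Holomorphic functions with constant boundary phase -/

section Phase

open Metric

lemma exists_exp_eq_of_differentiableOn_ball {H : ℂ → ℂ} (hH : DifferentiableOn ℂ H (ball 0 1))
    (h0 : ∀ z ∈ ball (0 : ℂ) 1, H z ≠ 0) :
    ∃ h : ℂ → ℂ, DifferentiableOn ℂ h (ball 0 1) ∧ ∀ z ∈ ball (0 : ℂ) 1, H z = Complex.exp (h z) := by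
  have hd : DifferentiableOn ℂ (fun z => deriv H z / H z) (ball 0 1) :=
    (hH.deriv isOpen_ball).div hH h0
  obtain ⟨h, hh⟩ := hd.isExactOn_ball
  have hder : ∀ z ∈ ball (0 : ℂ) 1, HasDerivAt (fun z => H z * Complex.exp (-h z)) 0 z := by
    intro z hz
    have h1 := ((hH.differentiableAt (isOpen_ball.mem_nhds hz)).hasDerivAt).mul (hh z hz).neg.cexp
    refine h1.congr_deriv ?_
    have := h0 z hz
    field_simp
    ring
  obtain ⟨c, hc⟩ : ∃ c, ∀ z ∈ ball (0 : ℂ) 1, H z * Complex.exp (-h z) = c := by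
    refine isOpen_ball.exists_is_const_of_deriv_eq_zero (convex_ball (0 : ℂ) 1).isPreconnected
      (fun z hz => (hder z hz).differentiableAt.differentiableWithinAt) fun z hz => (hder z hz).deriv
  have hc0 : c ≠ 0 := by
    rw [← hc 0 (mem_ball_self one_pos)]
    exact mul_ne_zero (h0 0 (mem_ball_self one_pos)) (Complex.exp_ne_zero _)
  refine ⟨fun z => h z + Complex.log c, fun z hz =>
    ((hh z hz).differentiableAt.add_const _).differentiableWithinAt, fun z hz => ?_⟩
  rw [Complex.exp_add, Complex.exp_log hc0, ← hc z hz, Complex.exp_neg]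
  field_simp [Complex.exp_ne_zero]

lemma le_of_eq_im_of_eq_on_sphere {g : ℂ → ℂ} (hg : DifferentiableOn ℂ g (ball 0 1)) {f : ℂ → ℝ}
    (hf : ContinuousOn f (closedBall 0 1)) (hfg : ∀ z ∈ ball (0 : ℂ) 1, f z = (g z).im) {a : ℝ}
    (ha : ∀ z ∈ sphere (0 : ℂ) 1, f z = a) : ∀ z ∈ closedBall (0 : ℂ) 1, f z ≤ a := by
  obtain ⟨m, hm, hmax⟩ := (isCompact_closedBall (0 : ℂ) 1).exists_isMaxOn ⟨0, by simp⟩ hf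
  suffices h : f m = a from fun z hz => h ▸ hmax hz
  rcases (show ‖m‖ ≤ 1 by simpa using hm).lt_or_eq with h | h
  swap
  · exact ha m (by simpa using h)
  have hmb : m ∈ ball (0 : ℂ) 1 := by simpa using h
  have hnorm : ∀ z ∈ ball (0 : ℂ) 1, ‖Complex.exp (-Complex.I * g z)‖ = Real.exp (f z) := by
    intro z hz
    rw [Complex.norm_exp, hfg z hz]
    simp
  have hmax' : IsMaxOn (norm ∘ fun z => Complex.exp (-Complex.I * g z)) (ball 0 1) m := by
    intro z hz
    simp only [Function.comp_apply, mem_ofPred_eq]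
    rw [hnorm z hz, hnorm m hmb]
    exact Real.exp_le_exp.2 (hmax (ball_subset_closedBall hz))
  have hconst := Complex.norm_eqOn_of_isPreconnected_of_isMaxOn (convex_ball (0 : ℂ) 1).isPreconnected
    isOpen_ball ((hg.const_mul (-Complex.I)).cexp) hmb hmax'
  have hconst' : ∀ z ∈ ball (0 : ℂ) 1, f z = f m := by
    intro z hz
    have h1 := hconst hz
    simp only [Function.comp_apply, Function.const_apply] at h1
    rw [hnorm z hz, hnorm m hmb] at h1
    exact Real.exp_injective h1
  have h1 : (1 : ℂ) ∈ sphere (0 : ℂ) 1 := by simp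
  have hcl : (1 : ℂ) ∈ closure (ball (0 : ℂ) 1) := by
    rw [closure_ball _ one_ne_zero]; exact sphere_subset_closedBall h1
  have hne : (𝓝[ball 0 1] (1 : ℂ)).NeBot := mem_closure_iff_nhdsWithin_neBot.1 hcl
  have h2 : Tendsto f (𝓝[ball 0 1] (1 : ℂ)) (𝓝 (f 1)) :=
    (hf 1 (sphere_subset_closedBall h1)).mono ball_subset_closedBall
  rw [← ha 1 h1]
  refine tendsto_nhds_unique (tendsto_const_nhds.congr' ?_) h2
  filter_upwards [self_mem_nhdsWithin] with z hz
  exact (hconst' z hz).symm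

lemma eq_of_hasDerivAt_zero_off_countable {p : ℝ → ℂ} (hp : Continuous p) {s : Set ℝ}
    (hs : s.Countable) (h : ∀ x ∉ s, HasDerivAt p 0 x) (x y : ℝ) : p x = p y := by
  have h1 := MeasureTheory.integral_eq_of_hasDerivAt_off_countable p (fun _ => 0) (a := y) (b := x) hs
    hp.continuousOn (fun z hz => h z hz.2) intervalIntegrable_const
  rw [intervalIntegral.integral_zero] at h1
  exact sub_eq_zero.1 h1.symm

/-- A holomorphic function on the disk whose phase extends continuously to the closed disk, with
constant angular speed on the boundary, is constant. -/
theorem exists_const_of_phase {g : ℂ → ℂ} (hg : DifferentiableOn ℂ g (ball 0 1)) {c : ℂ → Circle}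
    (hc : ContinuousOn c (closedBall 0 1))
    (hcg : ∀ z ∈ ball (0 : ℂ) 1, c z = Circle.exp (g z).im) {κ : ℝ} {s : Set ℝ} (hs : s.Countable)
    (hder : ∀ x ∉ s, HasDerivAt (fun x : ℝ => (c (Circle.exp x : ℂ) : ℂ))
      (κ * (Complex.I * (c (Circle.exp x : ℂ) : ℂ))) x) :
    κ = 0 ∧ ∃ a : ℂ, ∀ z ∈ ball (0 : ℂ) 1, g z = a := by
  have h0 : (0 : ℂ) ∈ closedBall (0 : ℂ) 1 := by simp
  have : ContractibleSpace (closedBall (0 : ℂ) 1) := (convex_closedBall 0 1).contractibleSpace ⟨0, h0⟩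
  have : LocallyPathConnectedSpace (closedBall (0 : ℂ) 1) :=
    (convex_closedBall (0 : ℂ) 1).locallyPathConnectedSpace
  obtain ⟨f', ⟨hf'0, hf'c⟩, -⟩ := Circle.isCoveringMap_exp.existsUnique_continuousMap_lifts
    ⟨_, hc.domRestrict⟩ (⟨0, h0⟩ : closedBall (0 : ℂ) 1) (g 0).im (by
      simpa using (hcg 0 (mem_ball_self one_pos)).symm)
  obtain ⟨f, hf, hf0, hfc⟩ : ∃ f : ℂ → ℝ, ContinuousOn f (closedBall 0 1) ∧ f 0 = (g 0).im ∧
      ∀ z ∈ closedBall (0 : ℂ) 1, Circle.exp (f z) = c z := by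
    classical
    refine ⟨fun z => if hz : z ∈ closedBall (0 : ℂ) 1 then f' ⟨z, hz⟩ else 0, ?_, ?_, ?_⟩
    · rw [continuousOn_iff_continuous_domRestrict]
      exact f'.continuous.congr fun z => by
        have hz := z.2
        rw [domRestrict_apply]
        split_ifs
        rfl
    · exact (dif_pos h0).trans hf'0
    · intro z hz
      exact (congrArg Circle.exp (dif_pos hz)).trans (congrFun hf'c ⟨z, hz⟩)
  have hfg : ∀ z ∈ ball (0 : ℂ) 1, f z = (g z).im := by
    refine Circle.isCoveringMap_exp.eqOn_of_comp_eqOn (convex_ball (0 : ℂ) 1).isPreconnected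
      (hf.mono ball_subset_closedBall) (Complex.continuous_im.comp_continuousOn hg.continuousOn)
      (fun z hz => ?_) (mem_ball_self one_pos) hf0
    exact (hfc z (ball_subset_closedBall hz)).trans (hcg z hz)
  have hexp : ∀ x : ℝ, (Circle.exp x : ℂ) ∈ closedBall (0 : ℂ) 1 := fun x => by simp
  have hfe : Continuous fun x : ℝ => f (Circle.exp x : ℂ) :=
    hf.comp_continuous (continuous_subtype_val.comp Circle.exp.continuous) hexp
  have hfκ : Continuous fun x : ℝ => f (Circle.exp x : ℂ) - κ * x :=
    hfe.sub (continuous_const.mul continuous_id)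
  have hsub : ∀ a b : ℝ, ((Circle.exp (a - b) : Circle) : ℂ) =
      (Circle.exp a : ℂ) * Complex.exp (-(b : ℝ) * Complex.I) := by
    intro a b
    rw [Circle.coe_exp, Circle.coe_exp, ← Complex.exp_add]
    congr 1
    push_cast
    ring
  have hp : ∀ x y : ℝ, ((Circle.exp (f (Circle.exp x : ℂ) - κ * x) : Circle) : ℂ) =
      (Circle.exp (f (Circle.exp y : ℂ) - κ * y) : Circle) := by
    refine eq_of_hasDerivAt_zero_off_countable (continuous_subtype_val.comp
      (Circle.exp.continuous.comp hfκ)) hs fun x hx => ?_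
    have h1 : HasDerivAt (fun x : ℝ => Complex.exp (-(κ * x : ℝ) * Complex.I))
        (Complex.exp (-(κ * x : ℝ) * Complex.I) * (-(κ : ℂ) * Complex.I)) x := by
      refine HasDerivAt.cexp ?_
      have h2 : HasDerivAt (fun x : ℝ => ((κ * x : ℝ) : ℂ)) (κ : ℂ) x := by
        simpa using ((hasDerivAt_id x).const_mul κ).ofReal_comp
      exact (h2.neg).mul_const _
    have h3 := (hder x hx).mul h1
    refine (h3.congr_deriv (by ring)).congr_of_eventuallyEq (Eventually.of_forall fun y => ?_)
    simp only [Pi.mul_apply]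
    rw [← hfc _ (hexp y)]
    exact hsub _ _
  have hconst : ∀ x y : ℝ, f (Circle.exp x : ℂ) - κ * x = f (Circle.exp y : ℂ) - κ * y :=
    Circle.isCoveringMap_exp.const_of_comp hfκ fun x y => Circle.coe_injective (hp x y)
  have hκ : κ = 0 := by
    have h1 := hconst (2 * Real.pi) 0
    rw [Circle.exp_two_pi, Circle.exp_zero] at h1
    have h2 : κ * (2 * Real.pi) = 0 := by linarith
    simpa [Real.pi_ne_zero] using h2
  have hsph : ∀ z ∈ sphere (0 : ℂ) 1, f z = f 1 := by
    intro z hz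
    have h1 := hconst (Complex.arg z) 0
    rw [hκ, Circle.exp_zero] at h1
    have h2 : ((Circle.exp (Complex.arg z) : Circle) : ℂ) = z := by
      have := Complex.norm_mul_exp_arg_mul_I z
      rwa [mem_sphere_zero_iff_norm.1 hz, Complex.ofReal_one, one_mul] at this
    rw [h2] at h1
    simpa using h1
  have hle := le_of_eq_im_of_eq_on_sphere hg hf hfg hsph
  have hge := le_of_eq_im_of_eq_on_sphere (f := fun z => -f z) hg.neg hf.neg
    (fun z hz => by rw [hfg z hz]; rfl) (fun z hz => by rw [hsph z hz])
  have him : ∀ z ∈ ball (0 : ℂ) 1, (g z).im = f 1 := fun z hz => by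
    rw [← hfg z hz]
    exact le_antisymm (hle z (ball_subset_closedBall hz))
      (neg_le_neg_iff.1 (hge z (ball_subset_closedBall hz)))
  refine ⟨hκ, isOpen_ball.exists_is_const_of_deriv_eq_zero (convex_ball (0 : ℂ) 1).isPreconnected hg
    fun z hz => ?_⟩
  have hmax' : IsMaxOn (norm ∘ fun z => Complex.exp (-Complex.I * g z)) (ball 0 1) z := by
    intro w hw
    simp [Complex.norm_exp, him w hw, him z hz]
  have hE := Complex.eqOn_of_isPreconnected_of_isMaxOn_norm (convex_ball (0 : ℂ) 1).isPreconnected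
    isOpen_ball ((hg.const_mul (-Complex.I)).cexp) hz hmax'
  have h1 := ((hg.differentiableAt (isOpen_ball.mem_nhds hz)).hasDerivAt.const_mul
    (-Complex.I)).cexp
  have h2 := h1.unique ((hasDerivAt_const z _).congr_of_eventuallyEq
    (eventually_of_mem (isOpen_ball.mem_nhds hz) hE))
  simpa [Complex.exp_ne_zero] using h2

end Phase

end

section

/-! ### Lifts along the boundary and at the punctures -/

section BoundaryLifts

open Metric

lemma norm_imForm_le (c : ℂ) : ‖imForm c‖ ≤ ‖c‖ := by
  refine ContinuousLinearMap.opNorm_le_bound _ (norm_nonneg _) fun h => ?_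
  rw [imForm_apply, Real.norm_eq_abs, ← norm_mul]
  exact Complex.abs_im_le_norm _

lemma norm_sub_le_of_hasDerivAt_Ioo {V : Type*} [NormedAddCommGroup V] [NormedSpace ℝ V] {f f' : ℝ → V}
    {C : ℝ} (hf : ContinuousOn f (Icc 0 1)) (hd : ∀ t ∈ Ioo (0 : ℝ) 1, HasDerivAt f (f' t) t)
    (hC : ∀ t ∈ Ioo (0 : ℝ) 1, ‖f' t‖ ≤ C) {t : ℝ} (ht : t ∈ Icc (0 : ℝ) 1) : ‖f t - f 0‖ ≤ C := by
  have hC0 : 0 ≤ C := (norm_nonneg _).trans (hC (1 / 2) (by norm_num))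
  have h1 : LipschitzOnWith C.toNNReal f (Ioo 0 1) :=
    (convex_Ioo 0 1).lipschitzOnWith_of_nnnorm_hasDerivWithin_le
      (fun t ht => (hd t ht).hasDerivWithinAt) fun t ht => by
        rw [← NNReal.coe_le_coe, coe_nnnorm, Real.coe_toNNReal _ hC0]
        exact hC t ht
  have hcl : closure (Ioo (0 : ℝ) 1) = Icc 0 1 := closure_Ioo zero_ne_one
  have h2 := (h1.closure (by rwa [hcl])).dist_le_mul t (by rwa [hcl]) 0 (by rw [hcl]; simp)
  rw [dist_eq_norm, Real.coe_toNNReal _ hC0, Real.dist_eq, sub_zero, abs_of_nonneg ht.1] at h2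
  nlinarith [ht.2]

variable {EY Y EZ Z : Type*}
  [NormedAddCommGroup EY] [NormedSpace ℝ EY] [FiniteDimensional ℝ EY]
  [TopologicalSpace Y] [ChartedSpace EY Y] [IsManifold 𝓘(ℝ, EY) ∞ Y]
  [NormedAddCommGroup EZ] [NormedSpace ℝ EZ] [FiniteDimensional ℝ EZ]
  [TopologicalSpace Z] [ChartedSpace EZ Z] [IsManifold 𝓘(ℝ, EZ) ∞ Z] [MulAction Circle Z]
  (F : CircleFibered EY Y EZ Z)

variable {E : Type*} {D : Punctures E} {u : ℂ → Y}

namespace CircleFibered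

/-- Lifts along an interval with the same form differ by a constant rotation. -/
theorem exists_eq_smul_of_hasForm [T2Space Z] {I : Set ℝ} (hI : IsOpen I) (hIc : IsPreconnected I)
    {γ₁ γ₂ : ℝ → Z} {μ : ℝ → ℝ →L[ℝ] ℝ} (hp : ∀ x ∈ I, F.p (γ₁ x) = F.p (γ₂ x))
    (h₁ : ∀ x ∈ I, F.HasForm I γ₁ x (μ x)) (h₂ : ∀ x ∈ I, F.HasForm I γ₂ x (μ x)) :
    ∃ c : Circle, ∀ x ∈ I, γ₁ x = c • γ₂ x := by
  have hex : ∀ x, ∃ c : Circle, x ∈ I → γ₁ x = c • γ₂ x := by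
    intro x
    by_cases hx : x ∈ I
    · obtain ⟨c, hc⟩ := (F.p_fiber (γ₂ x) (γ₁ x)).1 (hp x hx).symm
      exact ⟨c, fun _ => hc.symm⟩
    · exact ⟨1, fun h => absurd h hx⟩
  choose c hc using hex
  have hd : ∀ x ∈ I, HasFDerivAt (fun y => (c y : ℂ)) (0 : ℝ →L[ℝ] ℂ) x := by
    intro x hx
    have := F.hasFDerivWithinAt_ratio (h₁ x hx) (h₂ x hx) (c := c) (fun y hy => hc y hy) hx
      (hI.uniqueDiffWithinAt hx)
    refine (this.hasFDerivAt (hI.mem_nhds hx)).congr_fderiv ?_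
    ext
    simp
  obtain ⟨a, ha⟩ := hI.exists_is_const_of_fderiv_eq_zero (𝕜 := ℝ) hIc
    (fun x hx => (hd x hx).differentiableAt.differentiableWithinAt) fun x hx => (hd x hx).fderiv
  rcases I.eq_empty_or_nonempty with rfl | ⟨x₀, hx₀⟩
  · exact ⟨1, fun x hx => absurd hx (notMem_empty x)⟩
  refine ⟨c x₀, fun x hx => ?_⟩
  rw [hc x hx]
  congr 1
  exact Circle.coe_injective ((ha x hx).trans (ha x₀ hx₀).symm)

/-- `ζ` lifts `u` over the punctured disk, with connection form `Im (K dz)`. -/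
structure IsTwisted (D : Punctures E) (u : ℂ → Y) (K : ℂ → ℂ) (ζ : ℂ → Z) : Prop where
  p_eq : ∀ z ∈ D.surface, F.p (ζ z) = u z
  hasForm : ∀ z ∈ D.surface, F.HasForm D.surface ζ z (imForm (K z))

variable {F}

lemma IsModel.isTwisted {G : ℂ → ℂ} {s : ℂ → ℝ} {ζ : ℂ → Z} (h : F.IsModel D u G s ζ) :
    F.IsTwisted D u G ζ := ⟨h.p_ζ, h.hasForm⟩

namespace IsTwisted

variable {K : ℂ → ℂ} {ζ : ℂ → Z}

lemma continuousOn (h : F.IsTwisted D u K ζ) : ContinuousOn ζ D.surface := fun z hz =>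
  (h.hasForm z hz).continuousWithinAt

lemma const_smul (h : F.IsTwisted D u K ζ) (c : Circle) : F.IsTwisted D u K (fun z => c • ζ z) :=
  ⟨fun z hz => (F.p_smul _ _).trans (h.p_eq z hz), fun z hz => (h.hasForm z hz).const_smul c⟩

lemma exp_smul (h : F.IsTwisted D u K ζ) {g g' : ℂ → ℂ} (hg : ∀ z ∈ D.surface, HasDerivAt g (g' z) z) :
    F.IsTwisted D u (fun z => K z + g' z) (fun z => Circle.exp (g z).im • ζ z) := by
  refine ⟨fun z hz => (F.p_smul _ _).trans (h.p_eq z hz), fun z hz => ?_⟩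
  have h1 : HasFDerivWithinAt (fun z => (g z).im) (imForm (g' z)) D.surface z := by
    have h2 := Complex.imCLM.hasFDerivAt.comp z (hg z hz).complexToReal_fderiv
    refine (h2.congr_fderiv ?_).hasFDerivWithinAt
    ext v
    simp
  have h3 := (h.hasForm z hz).exp_smul h1
  rwa [← map_add] at h3

lemma hasForm_curve (h : F.IsTwisted D u K ζ) {I : Set ℝ} {b : ℝ → ℂ} {x a : ℝ} (hx : x ∈ I)
    (hb : ∀ y ∈ I, b y ∈ D.surface) (hd : HasDerivAt b (a * (Complex.I * b x)) x) :
    F.HasForm I (fun y => ζ (b y)) x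
      (ContinuousLinearMap.toSpanSingleton ℝ (a * (b x * K (b x)).re)) := by
  have h1 := HasForm.comp (h.hasForm _ (hb x hx)) hd.hasFDerivAt.hasFDerivWithinAt
    (fun y hy => hb y hy)
  convert h1 using 1
  ext
  simp
  ring

end IsTwisted

namespace IsModel

variable {G : ℂ → ℂ} {s : ℂ → ℝ} {ζ : ℂ → Z} [T2Space Y] [T2Space Z]

/-- The model lift does not oscillate across the strip-like ends. -/
theorem tendsto_pt_of_tendsto [Finite E] (h : F.IsModel D u G s ζ) (hu : IsCornerMap EY D u) (e : E)
    {w : Z} (hw : Tendsto (fun τ : ℝ => ζ (D.stripEnd e (τ, 0))) atTop (𝓝 w)) :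
    Tendsto ζ (𝓝[closedBall 0 1 \ {D.pt e}] (D.pt e)) (𝓝 w) := by
  have hpt : D.pt e ∈ closedBall (0 : ℂ) 1 := sphere_subset_closedBall (D.mem_sphere e)
  obtain ⟨τg, B, M, hτg, -, hM, ρ₁, hρ₁, hg⟩ := hu.exists_gaugeAt F hpt
  obtain ⟨C, δ, ρ₂, hC0, hδ, -, hρ₂, hC⟩ := hu.exists_decay e
  set v : ℂ → EY := fun w => extChartAt 𝓘(ℝ, EY) (u (D.pt e)) (u w) with hv
  set ρ := min ρ₁ ρ₂ with hρ
  have hρ0 : 0 < ρ := lt_min hρ₁ hρ₂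
  set W := D.surface ∩ ball (D.pt e) ρ with hWdef
  have hgW : ∀ z ∈ W, F.GaugeAt τg B M (u (D.pt e)) (u z) := fun z hz =>
    hg z ⟨D.surface_subset hz.1, ball_subset_ball (min_le_left _ _) hz.2⟩
  have hgpt := hg (D.pt e) ⟨hpt, mem_ball_self hρ₁⟩
  set N := 𝓝[closedBall 0 1 \ {D.pt e}] (D.pt e) with hN
  have hWN : W ∈ N := inter_mem (D.surface_mem_nhdsWithin_pt e)
    (mem_nhdsWithin_of_mem_nhds (ball_mem_nhds _ hρ0))
  have hex : ∀ z, ∃ c : Circle, z ∈ W → ζ z = c • τg (v z) := by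
    intro z
    by_cases hz : z ∈ W
    · obtain ⟨c, hc⟩ := (F.p_fiber (τg (v z)) (ζ z)).1 ((hgW z hz).p_eq.trans (h.p_ζ z hz.1).symm)
      exact ⟨c, fun _ => hc.symm⟩
    · exact ⟨1, fun h => absurd h hz⟩
  choose c hc using hex
  have huN : Tendsto u N (𝓝 (u (D.pt e))) := (hu.continuous _ hpt).mono sdiff_subset
  have hσN : Tendsto (fun z => τg (v z)) N (𝓝 (τg (v (D.pt e)))) :=
    hτg.continuousAt.tendsto.comp ((continuousAt_extChartAt _).tendsto.comp huN)
  have hstrip := D.tendsto_stripEnd e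
  have h0N : Tendsto (fun τ : ℝ => D.stripEnd e (τ, 0)) atTop N :=
    hstrip.comp (Punctures.tendsto_prodMk_const (by simp))
  have hpw : F.p w = u (D.pt e) := by
    refine tendsto_nhds_unique ((F.p_smooth.continuous.tendsto w).comp hw)
      ((huN.comp h0N).congr' ?_)
    filter_upwards [h0N hWN] with τ hτ
    exact (h.p_ζ _ hτ.1).symm
  obtain ⟨c₀, hc₀⟩ := (F.p_fiber (τg (v (D.pt e))) w).1 (hgpt.p_eq.trans hpw.symm)
  have hc0 : Tendsto (fun τ : ℝ => c (D.stripEnd e (τ, 0))) atTop (𝓝 c₀) :=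
    F.tendsto_ratio hw (hσN.comp h0N) hc₀.symm
      ((h0N.eventually hWN).mono fun τ hτ => hc _ hτ)
  set err : ℂ → ℝ := fun z =>
    (‖G z‖ + M * (C * ‖z - D.pt e‖ ^ (δ - 1))) * (Real.pi * ‖z - D.pt e‖) with herr
  have herrN : Tendsto err N (𝓝 0) := by
    have h1 : Tendsto (fun z => Real.pi * ‖(z - D.pt e) * G z‖ +
        Real.pi * M * C * ‖z - D.pt e‖ ^ δ) N (𝓝 (Real.pi * 0 + Real.pi * M * C * 0)) := by
      refine Tendsto.add (((tendsto_zero_iff_norm_tendsto_zero.1 (h.tendsto_G e)).const_mul _))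
        (Tendsto.const_mul _ ?_)
      have h2 : Tendsto (fun z => ‖z - D.pt e‖) N (𝓝 0) := by
        have h3 : Tendsto (fun z => ‖z - D.pt e‖) (𝓝 (D.pt e)) (𝓝 ‖D.pt e - D.pt e‖) :=
          (continuous_id.sub continuous_const).norm.tendsto _
        rw [sub_self, norm_zero] at h3
        exact h3.mono_left nhdsWithin_le_nhds
      have h4 := h2.rpow_const (p := δ) (Or.inr hδ.le)
      rwa [Real.zero_rpow hδ.ne'] at h4
    rw [mul_zero, mul_zero, add_zero] at h1
    refine h1.congr' ?_
    filter_upwards [self_mem_nhdsWithin] with z hz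
    have hz0 : 0 < ‖z - D.pt e‖ := norm_pos_iff.2 (sub_ne_zero.2 hz.2)
    rw [herr]
    simp only
    rw [norm_mul, Real.rpow_sub_one hz0.ne']
    field_simp
  have hosc : Tendsto (fun x : ℝ × ℝ => ‖(c (D.stripEnd e x) : ℂ) - c (D.stripEnd e (x.1, 0))‖)
      (atTop ×ˢ 𝓟 (Icc (0 : ℝ) 1)) (𝓝 0) := by
    rw [Metric.tendsto_nhds]
    intro ε hε
    have h1 := (hstrip.eventually hWN).and
      ((herrN.comp hstrip).eventually (gt_mem_nhds (half_pos hε)))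
    rw [eventually_prod_principal_iff] at h1 ⊢
    filter_upwards [h1] with τ hτ t ht
    rw [Real.dist_eq, sub_zero, abs_of_nonneg (norm_nonneg _)]
    refine (norm_sub_le_of_hasDerivAt_Ioo (f := fun t => (c (D.stripEnd e (τ, t)) : ℂ))
      (C := ε / 2) (f' := fun t => deriv (fun t => (c (D.stripEnd e (τ, t)) : ℂ)) t)
      (fun t ht => ?_) (fun t ht => ?_) (fun t ht => ?_) ht).trans_lt (by linarith)
    · have hmem := (hτ t ht).1
      have h2 : ContinuousWithinAt c W (D.stripEnd e (τ, t)) := by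
        refine F.continuousWithinAt_ratio ((h.continuousOn_ζ _ hmem.1).mono inter_subset_left)
          ((hgW _ hmem).hasForm (u := u) (s := W) (HasFDerivWithinAt.mono
            (DifferentiableWithinAt.hasFDerivWithinAt (s := D.surface) ?_)
              inter_subset_left)).continuousWithinAt hc hmem
        exact ((hgW _ hmem).contDiffWithinAt_chart (n := 1) (by simp)
          ((hu.smooth _ hmem.1).of_le (by simp))).differentiableWithinAt (by simp)
      have h3 : ContinuousWithinAt (fun t => D.stripEnd e (τ, t)) (Icc 0 1) t :=
        (D.hasDerivAt_stripEnd_snd e ht).continuousAt.continuousWithinAt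
      exact continuous_subtype_val.continuousAt.comp_continuousWithinAt
        (ContinuousWithinAt.comp (t := W) h2 h3 fun t ht => (hτ t ht).1)
    all_goals
      have hmem := (hτ t (Ioo_subset_Icc_self ht)).1
      have hb : D.stripEnd e (τ, t) ∈ ball (0 : ℂ) 1 := by
        simpa using D.norm_stripEnd_lt e (x := (τ, t)) ht
      have hWnhds : W ∈ 𝓝 (D.stripEnd e (τ, t)) :=
        inter_mem (D.surface_mem_nhds hb) (isOpen_ball.mem_nhds hmem.2)
      have hvd : HasFDerivAt v (fderiv ℝ v (D.stripEnd e (τ, t))) (D.stripEnd e (τ, t)) :=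
        (((hgW _ hmem).contDiffAt_chart (n := 1) (by simp)
          ((hu.contMDiffAt hb).of_le (by simp))).differentiableAt (by simp)).hasFDerivAt
      have hform := (hgW _ hmem).hasForm (u := u) (s := W) hvd.hasFDerivWithinAt
      have hcd := (F.hasFDerivWithinAt_ratio ((h.hasForm _ hmem.1).mono inter_subset_left) hform hc
        hmem (mem_interior_iff_mem_nhds.2 hWnhds |> fun h =>
          (uniqueDiffWithinAt_of_mem_nhds (mem_interior_iff_mem_nhds.1 h)))).hasFDerivAt hWnhds
      have hder := hcd.comp_hasDerivAt t (D.hasDerivAt_stripEnd_snd e (Ioo_subset_Icc_self ht))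
    · exact hder.differentiableAt.hasDerivAt
    · refine (le_of_eq (congrArg norm hder.deriv)).trans ?_
      refine (ContinuousLinearMap.le_opNorm _ _).trans (le_trans ?_ (hτ t (Ioo_subset_Icc_self ht)).2.le)
      refine mul_le_mul ?_ (D.norm_deriv_stripEnd_le e (x := (τ, t)) (Ioo_subset_Icc_self ht)
        Complex.norm_I) (norm_nonneg _) ?_
      · rw [ContinuousLinearMap.norm_smulRight_apply, norm_mul, Complex.norm_I, Circle.norm_coe,
          mul_one, mul_one]
        refine (norm_sub_le _ _).trans (add_le_add (norm_imForm_le _) ?_)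
        refine (ContinuousLinearMap.opNorm_comp_le _ _).trans
          (mul_le_mul (hgW _ hmem).norm_le ?_ (norm_nonneg _) hM)
        exact hC _ ⟨hb, ball_subset_ball (min_le_right _ _) hmem.2⟩
      · positivity
  have hcN : Tendsto c N (𝓝 c₀) := by
    have h1 : Tendsto (fun x => (c (D.stripEnd e x) : ℂ)) (atTop ×ˢ 𝓟 (Icc (0 : ℝ) 1)) (𝓝 (c₀ : ℂ)) := by
      have h2 : Tendsto (fun x : ℝ × ℝ => (c (D.stripEnd e (x.1, 0)) : ℂ))
          (atTop ×ˢ 𝓟 (Icc (0 : ℝ) 1)) (𝓝 (c₀ : ℂ)) :=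
        ((continuous_subtype_val.tendsto c₀).comp hc0).comp tendsto_fst
      have h3 := (tendsto_zero_iff_norm_tendsto_zero.2 hosc).add h2
      simpa using h3
    rw [hN, ← D.map_stripEnd, tendsto_map'_iff]
    exact tendsto_subtype_rng.2 h1
  rw [← hc₀]
  exact (F.tendsto_smul hcN hσN).congr' ((eventually_of_mem hWN hc).mono fun z hz => hz.symm)

end IsModel

end CircleFibered

end BoundaryLifts

end

section

/-! ### Holomorphic maps to the cylinder -/

section Cylindrical

open Metric

variable {EY Y EZ Z : Type*}
  [NormedAddCommGroup EY] [NormedSpace ℝ EY] [FiniteDimensional ℝ EY]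
  [TopologicalSpace Y] [ChartedSpace EY Y] [IsManifold 𝓘(ℝ, EY) ∞ Y]
  [NormedAddCommGroup EZ] [NormedSpace ℝ EZ] [FiniteDimensional ℝ EZ]
  [TopologicalSpace Z] [ChartedSpace EZ Z] [IsManifold 𝓘(ℝ, EZ) ∞ Z] [MulAction Circle Z]
  (F : CircleFibered EY Y EZ Z)

namespace CircleFibered

variable {F} {J : ∀ x : ℝ × Z, TangentSpace (𝓘(ℝ, ℝ).prod 𝓘(ℝ, EZ)) x →L[ℝ]
  TangentSpace (𝓘(ℝ, ℝ).prod 𝓘(ℝ, EZ)) x}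

/-- The values of the cylindrical structure on `ds` and on the connection form. -/
lemma IsCylindrical.fst_and_a (hJ : F.IsCylindrical J) (x : ℝ × Z)
    {Jx : ℝ × EZ →L[ℝ] ℝ × EZ} (hx : Jx = J x) (v : ℝ × EZ) :
    (Jx v).1 = -F.a x.2 v.2 ∧ F.a x.2 (Jx v).2 = v.1 := by
  have hds : Jx (1, 0) = (0, F.gen x.2) := by rw [hx]; exact hJ.map_ds x
  have hgen : Jx (0, F.gen x.2) = -(1, 0) := by
    rw [← hds, hx]
    exact hJ.sq x (1, 0)
  set v₀ : EZ := v.2 - F.a x.2 v.2 • F.gen x.2 with hv₀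
  have hv₀a : F.a x.2 v₀ = 0 := by simp [hv₀, F.a_gen]
  have hplane : (Jx (0, v₀)).1 = 0 ∧ F.a x.2 (Jx (0, v₀)).2 = 0 := by
    rw [hx]; exact hJ.map_plane x v₀ hv₀a
  have hdec : v = v.1 • ((1, 0) : ℝ × EZ) + F.a x.2 v.2 • ((0, F.gen x.2) : ℝ × EZ) + (0, v₀) := by
    ext <;> simp [hv₀]
  have hJv : Jx v = v.1 • (0, F.gen x.2) + F.a x.2 v.2 • (-(1, 0)) + Jx (0, v₀) := by
    conv_lhs => rw [hdec]
    rw [map_add, map_add, map_smul, map_smul, hds, hgen]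
  rw [hJv]
  constructor
  · simp [hplane.1]
  · simp [hplane.2, F.a_gen]

lemma eq_imForm_of_apply_I {σ μ : ℂ →L[ℝ] ℝ} (h₁ : ∀ v, σ (Complex.I * v) = -μ v)
    (h₂ : ∀ v, μ (Complex.I * v) = σ v) : ∃ K : ℂ, σ = reForm K ∧ μ = imForm K := by
  have hdec : ∀ (v : ℂ), v = v.re • (1 : ℂ) + v.im • Complex.I := fun v => by
    simp [Complex.re_add_im]
  have h3 := h₁ 1
  have h4 := h₂ 1
  rw [mul_one] at h3 h4
  refine ⟨⟨σ 1, μ 1⟩, ContinuousLinearMap.ext fun v => ?_, ContinuousLinearMap.ext fun v => ?_⟩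
  · conv_lhs => rw [hdec v]
    rw [map_add, map_smul, map_smul, h3]
    simp
    ring
  · conv_lhs => rw [hdec v]
    rw [map_add, map_smul, map_smul, h4]
    simp
    ring

/-- For a holomorphic map to the cylinder, `ds + i α` pulls back to a multiple of `dz`. -/
lemma IsCylindrical.exists_form (hJ : F.IsCylindrical J) {w : ℂ → ℝ × Z} {z : ℂ}
    (hw : ContMDiffAt 𝓘(ℝ, ℂ) (𝓘(ℝ, ℝ).prod 𝓘(ℝ, EZ)) ∞ w z)
    (hol : ∀ v : ℂ, mfderiv 𝓘(ℝ, ℂ) (𝓘(ℝ, ℝ).prod 𝓘(ℝ, EZ)) w z (Complex.I * v : ℂ) =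
      J (w z) (mfderiv 𝓘(ℝ, ℂ) (𝓘(ℝ, ℝ).prod 𝓘(ℝ, EZ)) w z v)) :
    ∃ K : ℂ, HasFDerivAt (fun y => (w y).1) (reForm K) z ∧
      F.HasForm univ (fun y => (w y).2) z (imForm K) := by
  obtain ⟨T, hT⟩ : ∃ T : ℂ →L[ℝ] ℝ × EZ, HasMFDerivAt 𝓘(ℝ, ℂ) (𝓘(ℝ, ℝ).prod 𝓘(ℝ, EZ)) w z T :=
    ⟨_, (hw.mdifferentiableAt (by simp)).hasMFDerivAt⟩
  obtain ⟨Jx, hJx⟩ : ∃ Jx : ℝ × EZ →L[ℝ] ℝ × EZ, Jx = J (w z) := ⟨_, rfl⟩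
  have hTJ : ∀ v : ℂ, T (Complex.I * v) = Jx (T v) := by
    intro v
    have h := hol v
    rw [hT.mfderiv, ← hJx] at h
    exact h
  have h1 : HasMFDerivAt 𝓘(ℝ, ℂ) 𝓘(ℝ, ℝ) (fun y => (w y).1) z
      ((ContinuousLinearMap.fst ℝ ℝ EZ).comp T) :=
    HasMFDerivAt.comp (g := Prod.fst) (I' := 𝓘(ℝ, ℝ).prod 𝓘(ℝ, EZ)) z (hasMFDerivAt_fst (w z)) hT
  have h2 : HasMFDerivAt 𝓘(ℝ, ℂ) 𝓘(ℝ, EZ) (fun y => (w y).2) z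
      ((ContinuousLinearMap.snd ℝ ℝ EZ).comp T) :=
    HasMFDerivAt.comp (g := Prod.snd) (I' := 𝓘(ℝ, ℝ).prod 𝓘(ℝ, EZ)) z (hasMFDerivAt_snd (w z)) hT
  obtain ⟨K, hK1, hK2⟩ := eq_imForm_of_apply_I (σ := (ContinuousLinearMap.fst ℝ ℝ EZ).comp T)
    (μ := (F.a (w z).2).comp ((ContinuousLinearMap.snd ℝ ℝ EZ).comp T))
    (fun v => by
      change (T (Complex.I * v)).1 = -F.a (w z).2 (T v).2
      rw [hTJ]; exact (hJ.fst_and_a (w z) hJx (T v)).1)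
    (fun v => by
      change F.a (w z).2 (T (Complex.I * v)).2 = (T v).1
      rw [hTJ]; exact (hJ.fst_and_a (w z) hJx (T v)).2)
  refine ⟨K, ?_, (ContinuousLinearMap.snd ℝ ℝ EZ).comp T, h2.hasMFDerivWithinAt, hK2⟩
  rw [← hK1]
  exact h1.hasFDerivAt

/-- A map to the cylinder over a holomorphic map is holomorphic if `ds + i α` pulls back to a multiple
of `dz`. -/
lemma IsCylindrical.holomorphic_of_form [T2Space Z] (hJ : F.IsCylindrical J) {u : ℂ → Y} {s : ℂ → ℝ}
    {ζ : ℂ → Z} {z K : ℂ} (hu : MDifferentiableAt 𝓘(ℝ, ℂ) 𝓘(ℝ, EY) u z)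
    (huJ : ∀ v : ℂ, mfderiv 𝓘(ℝ, ℂ) 𝓘(ℝ, EY) u z (Complex.I * v : ℂ) =
      F.JY (u z) (mfderiv 𝓘(ℝ, ℂ) 𝓘(ℝ, EY) u z v))
    (hp : ∀ᶠ y in 𝓝 z, F.p (ζ y) = u y) (hs : HasFDerivAt s (reForm K) z)
    (hζ : F.HasForm univ ζ z (imForm K)) (v : ℂ) :
    mfderiv 𝓘(ℝ, ℂ) (𝓘(ℝ, ℝ).prod 𝓘(ℝ, EZ)) (fun y => (s y, ζ y)) z (Complex.I * v : ℂ) =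
      J (s z, ζ z) (mfderiv 𝓘(ℝ, ℂ) (𝓘(ℝ, ℝ).prod 𝓘(ℝ, EZ)) (fun y => (s y, ζ y)) z v) := by
  obtain ⟨T, hT, hTa⟩ := hζ
  replace hT : HasMFDerivAt 𝓘(ℝ, ℂ) 𝓘(ℝ, EZ) ζ z T := hasMFDerivWithinAt_univ.1 hT
  have hT' : HasMFDerivAt 𝓘(ℝ, ℂ) (𝓘(ℝ, ℝ).prod 𝓘(ℝ, EZ)) (fun y => (s y, ζ y)) z
      ((reForm K).prod T) := hs.hasMFDerivAt.prodMk hT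
  obtain ⟨Jx, hJx⟩ : ∃ Jx : ℝ × EZ →L[ℝ] ℝ × EZ, Jx = J (s z, ζ z) := ⟨_, rfl⟩
  rw [hT'.mfderiv, ← hJx]
  change (((reForm K) (Complex.I * v), T (Complex.I * v)) : ℝ × EZ) = Jx ((reForm K) v, T v)
  obtain ⟨h1, h2⟩ := hJ.fst_and_a (s z, ζ z) hJx ((reForm K) v, T v)
  have hTa' : ∀ v, F.a (ζ z) (T v) = (K * v).im := fun v => DFunLike.congr_fun hTa v
  obtain ⟨U, hU⟩ : ∃ U : ℂ →L[ℝ] EY, HasMFDerivAt 𝓘(ℝ, ℂ) 𝓘(ℝ, EY) u z U := ⟨_, hu.hasMFDerivAt⟩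
  have hdp : ∀ v, F.dp (ζ z) (T v) = U v := by
    have h3 := HasMFDerivAt.comp (g := F.p) (I' := 𝓘(ℝ, EZ)) z (F.hasMFDerivAt_p (ζ z)) hT
    have h4 : HasMFDerivAt 𝓘(ℝ, ℂ) 𝓘(ℝ, EY) (F.p ∘ ζ) z U := hU.congr_of_eventuallyEq hp
    intro v
    exact DFunLike.congr_fun (hasMFDerivAt_unique h3 h4) v
  have hpz : F.p (ζ z) = u z := hp.self_of_nhds
  obtain ⟨JYz, hJYz⟩ : ∃ JYz : EY →L[ℝ] EY, JYz = F.JY (F.p (ζ z)) := ⟨_, rfl⟩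
  have huJ' : ∀ v, U (Complex.I * v) = JYz (U v) := by
    intro v
    have h5 := huJ v
    rw [hU.mfderiv, ← hpz, ← hJYz] at h5
    exact h5
  have h6 : F.dp (ζ z) (Jx ((reForm K) v, T v)).2 = JYz (F.dp (ζ z) (T v)) := by
    rw [hJx, hJYz]
    exact hJ.proj (s z, ζ z) ((reForm K) v, T v)
  refine Prod.ext ?_ ?_
  · rw [h1]
    change (K * (Complex.I * v)).re = -F.a (ζ z) (T v)
    rw [hTa']
    simp
    ring
  · rw [← sub_eq_zero]
    refine (F.eq_smul_gen_of_dp_eq_zero (z := ζ z) ?_).trans ?_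
    · rw [map_sub]
      simp only [h6, hdp, huJ', sub_self]
    · have h7 : F.a (ζ z) (Jx ((reForm K) v, T v)).2 = (K * v).re := h2
      rw [map_sub, h7]
      simp only [hTa']
      have h8 : (K * (Complex.I * v)).im - (K * v).re = 0 := by
        simp
      rw [h8, zero_smul]

lemma hasDerivAt_exp_mul_circle {ψ : ℂ → ℝ} {c : ℂ → Circle} {z k : ℂ}
    (hψ : HasFDerivAt ψ (reForm k) z)
    (hc : HasFDerivAt (fun y => (c y : ℂ)) ((imForm k).smulRight (Complex.I * (c z : ℂ))) z) :
    HasDerivAt (fun y => (Real.exp (ψ y) : ℂ) * c y) (k * ((Real.exp (ψ z) : ℂ) * c z)) z := by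
  have h1 : HasFDerivAt (fun y => (Real.exp (ψ y) : ℂ))
      (Complex.ofRealCLM.comp (Real.exp (ψ z) • reForm k)) z :=
    Complex.ofRealCLM.hasFDerivAt.comp z hψ.exp
  have h2 := h1.mul hc
  rw [hasDerivAt_iff_hasFDerivAt]
  refine hasFDerivAt_of_restrictScalars ℝ h2 ?_
  ext v
  have h3 : k * v = ((k * v).re : ℂ) + (k * v).im * Complex.I := (Complex.re_add_im _).symm
  rw [Complex.mul_re, Complex.mul_im] at h3
  push_cast at h3
  simp
  linear_combination (Complex.exp (ψ z) * (c z : ℂ)) * h3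

end CircleFibered

end Cylindrical

end

section

/-! ### The boundary condition -/

section LegendrianBoundary

open Metric

variable {EY Y EZ Z EL L P : Type*}
  [NormedAddCommGroup EY] [NormedSpace ℝ EY] [FiniteDimensional ℝ EY]
  [TopologicalSpace Y] [ChartedSpace EY Y] [IsManifold 𝓘(ℝ, EY) ∞ Y]
  [NormedAddCommGroup EZ] [NormedSpace ℝ EZ] [FiniteDimensional ℝ EZ]
  [TopologicalSpace Z] [ChartedSpace EZ Z] [IsManifold 𝓘(ℝ, EZ) ∞ Z] [MulAction Circle Z]
  [NormedAddCommGroup EL] [NormedSpace ℝ EL] [FiniteDimensional ℝ EL]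
  [TopologicalSpace L] [ChartedSpace EL L]
  [TopologicalSpace P] [ChartedSpace EL P]
variable [IsManifold 𝓘(ℝ, EL) ∞ L] [IsManifold 𝓘(ℝ, EL) ∞ P] [T2Space Y] [T2Space Z]
  {F : CircleFibered EY Y EZ Z} {Λ : LegendrianOver EL L P F}
  {E : Type*} {D : Punctures E} {u : ℂ → Y}

namespace LegendrianOver

lemma isEmbedding_j (Λ : LegendrianOver EL L P F) : IsEmbedding Λ.j := Λ.j_embedding.isEmbedding

/-- A boundary curve on the Legendrian has vanishing form. -/
lemma hasForm_curve (Λ : LegendrianOver EL L P F) (hu : CircleFibered.IsCornerMap EY D u)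
    {I : Set ℝ} {b : ℝ → ℂ} {l : ℝ → L} {x : ℝ} {b' : ℂ} (hx : x ∈ I)
    (hb : ∀ y ∈ I, b y ∈ D.surface) (hd : HasDerivAt b b' x) (hl : ContinuousWithinAt l I x)
    (hp : ∀ y ∈ I, F.p (Λ.j (l y)) = u (b y)) : F.HasForm I (fun y => Λ.j (l y)) x 0 := by
  obtain ⟨U, hU⟩ : ∃ U : ℂ →L[ℝ] EY, HasMFDerivWithinAt 𝓘(ℝ, ℂ) 𝓘(ℝ, EY) u D.surface (b x) U :=
    ⟨_, ((hu.smooth _ (hb x hx)).mdifferentiableWithinAt (by simp)).hasMFDerivWithinAt⟩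
  have h1 := hU.comp x hd.hasFDerivAt.hasFDerivWithinAt.hasMFDerivWithinAt
    (fun y hy => hb y hy)
  exact Λ.hasForm_j_comp hl (h1.congr_of_eventuallyEq
    (eventually_of_mem self_mem_nhdsWithin fun y hy => hp y hy) (hp x hx))

/-- Along a boundary arc a lift with vanishing boundary form is a constant rotation of a curve on the
Legendrian. -/
theorem exists_eq_smul_arc (Λ : LegendrianOver EL L P F) (hu : CircleFibered.IsCornerMap EY D u)
    {K : ℂ → ℂ} {ζ : ℂ → Z} (hζ : F.IsTwisted D u K ζ) (hK : ∀ z ∈ D.bdry, (z * K z).re = 0)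
    {I : Set ℝ} (hI : IsOpen I) (hIc : IsPreconnected I) {b : ℝ → ℂ} (hb : ∀ y ∈ I, b y ∈ D.bdry)
    (hd : ∀ y ∈ I, ∃ a : ℝ, HasDerivAt b (a * (Complex.I * b y)) y) {l : ℝ → L}
    (hl : ContinuousOn l I) (hp : ∀ y ∈ I, F.p (Λ.j (l y)) = u (b y)) :
    ∃ c : Circle, ∀ y ∈ I, ζ (b y) = c • Λ.j (l y) := by
  refine F.exists_eq_smul_of_hasForm hI hIc (μ := 0) (fun y hy => ?_) (fun y hy => ?_)
    fun y hy => ?_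
  · rw [hp y hy, hζ.p_eq _ (D.bdry_subset_surface (hb y hy))]
  · obtain ⟨a, ha⟩ := hd y hy
    have h := hζ.hasForm_curve hy (fun y hy => D.bdry_subset_surface (hb y hy)) ha
    rw [hK _ (hb y hy), mul_zero, ContinuousLinearMap.toSpanSingleton_zero] at h
    exact h
  · obtain ⟨a, ha⟩ := hd y hy
    exact Λ.hasForm_curve hu hy (fun y hy => D.bdry_subset_surface (hb y hy)) ha (hl y hy) hp

/-- The model lift converges at a puncture if the boundary lift converges on one side. -/
theorem exists_tendsto_pt [Finite E] (Λ : LegendrianOver EL L P F) (hu : CircleFibered.IsCornerMap EY D u)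
    {G : ℂ → ℂ} {s : ℂ → ℝ} {ζ : ℂ → Z} (h : F.IsModel D u G s ζ) (e : E) {l : ℝ → L} {T : ℝ}
    (hl : ContinuousOn l (Ioi T)) (hp : ∀ y ∈ Ioi T, F.p (Λ.j (l y)) = u (D.stripEnd e (y, 0)))
    {a : L} (ha : Tendsto l atTop (𝓝 a)) :
    ∃ d : Circle, Tendsto ζ (𝓝[closedBall 0 1 \ {D.pt e}] (D.pt e)) (𝓝 (d • Λ.j a)) := by
  set A : ℝ := F.area u / Real.pi with hA
  set g : ℂ → ℂ := fun z => -(A : ℂ) * D.cornerLog e z with hg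
  set g' : ℂ → ℂ := fun z => -(A : ℂ) *
    (-(starRingEnd ℂ) (D.pt e) / (1 - z * (starRingEnd ℂ) (D.pt e))) with hg'
  have hgd : ∀ z ∈ D.surface, HasDerivAt g (g' z) z := fun z hz =>
    (D.hasDerivAt_cornerLog e (D.mem_sdiff_of_mem_surface hz e)).const_mul _
  have htw := h.isTwisted.exp_smul hgd
  have hK : ∀ z ∈ D.bdry, (z * (G z + g' z)).re = 0 := by
    intro z hz
    have h1 := D.re_mul_deriv_cornerLog e hz.1
      (D.mem_sdiff_of_mem_surface (D.bdry_subset_surface hz) e).2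
    rw [mul_add, Complex.add_re, h.re_mul_G z hz, hg']
    simp only
    rw [mul_left_comm, ← Complex.ofReal_neg, Complex.re_ofReal_mul, h1, hA]
    field_simp
    ring
  obtain ⟨T', hT'⟩ := eventually_atTop.1 (D.eventually_stripEnd_mem_bdry e (Or.inl rfl : (0 : ℝ) = 0 ∨ _))
  obtain ⟨c, hc⟩ := Λ.exists_eq_smul_arc hu htw hK isOpen_Ioi (isPreconnected_Ioi (a := max T T'))
    (b := fun y => D.stripEnd e (y, 0)) (fun y hy => hT' y ((le_max_right _ _).trans hy.le))
    (fun y _ => D.exists_hasDerivAt_stripEnd e (Or.inl rfl) y)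
    (hl.mono fun y hy => (le_max_left T T').trans_lt hy)
    fun y hy => hp y ((le_max_left T T').trans_lt hy)
  have him : Tendsto (fun y : ℝ => (g (D.stripEnd e (y, 0))).im) atTop (𝓝 (-A * (Real.pi / 2))) := by
    have h1 := (D.tendsto_cornerLog_stripEnd_im e (t := 0) (by simp)).comp
      (tendsto_id.prodMk (tendsto_nhdsWithin_iff.2 ⟨tendsto_const_nhds (f := atTop),
        Eventually.of_forall fun _ => by simp⟩) : Tendsto (fun y : ℝ => (y, (0 : ℝ))) atTop _)
    rw [mul_zero, sub_zero] at h1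
    refine (h1.const_mul (-A)).congr fun y => ?_
    rw [hg]
    simp only [Function.comp_apply]
    rw [← Complex.ofReal_neg, Complex.im_ofReal_mul]
    rfl
  have h2 : Tendsto (fun y : ℝ => ζ (D.stripEnd e (y, 0))) atTop
      (𝓝 (Circle.exp (-(-A * (Real.pi / 2))) • (c • Λ.j a))) := by
    have h3 : Tendsto (fun y => c • Λ.j (l y)) atTop (𝓝 (c • Λ.j a)) :=
      (F.continuous_const_smul c).continuousAt.tendsto.comp
        ((Λ.isEmbedding_j.continuous.tendsto a).comp ha)
    have h4 := F.tendsto_smul ((Circle.exp.continuous.tendsto _).comp him.neg) h3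
    refine h4.congr' ?_
    filter_upwards [eventually_gt_atTop (max T T')] with y hy
    rw [← hc y hy, smul_smul, Function.comp_apply, ← Circle.exp_add, neg_add_cancel, Circle.exp_zero,
      one_smul]
  rw [smul_smul] at h2
  exact ⟨_, h.tendsto_pt_of_tendsto hu e h2⟩

/-- The limit of a lift at a puncture, in terms of the point of the Legendrian on the side before the
puncture. -/
lemma HasAngle.exists_tendsto {w : ℂ → ℝ × Z} {e : E} {θ : ℝ} (h : Λ.HasAngle D w e θ) :
    ∃ a : L, ∀ t ∈ Icc (0 : ℝ) 1, Tendsto (fun x => (w (D.stripEnd e x)).2)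
      (atTop ×ˢ 𝓝[Icc (0 : ℝ) 1] t) (𝓝 (Circle.exp (D.sign e * θ * t) • Λ.j a)) := by
  obtain ⟨-, a, b, hab, ht⟩ := h
  unfold Punctures.sign
  by_cases he : D.inc e
  · refine ⟨a, fun t htm => ?_⟩
    have := ht t htm
    simp only [he, if_true] at this ⊢
    rwa [one_mul]
  · refine ⟨b, fun t htm => ?_⟩
    have := ht t htm
    simp only [he] at this ⊢
    rw [← hab.2, smul_smul, ← Circle.exp_add]
    convert this using 4
    simp
    ring

lemma tendsto_prodMk_nhdsWithin {t : ℝ} (ht : t ∈ Icc (0 : ℝ) 1) :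
    Tendsto (fun τ : ℝ => (τ, t)) atTop (atTop ×ˢ 𝓝[Icc (0 : ℝ) 1] t) :=
  tendsto_id.prodMk (tendsto_nhdsWithin_iff.2 ⟨tendsto_const_nhds, Eventually.of_forall fun _ => ht⟩)

/-- The limit of a twisted model lift at a puncture. -/
lemma tendsto_exp_cornerSum_smul [Fintype E] {ζ : ℂ → Z} {e : E} {z₀ : Z}
    (h : Tendsto ζ (𝓝[closedBall 0 1 \ {D.pt e}] (D.pt e)) (𝓝 z₀)) (θ : E → ℝ) (F : CircleFibered EY Y EZ Z) :
    ∃ c : Circle, ∀ t ∈ Icc (0 : ℝ) 1,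
      Tendsto (fun x => Circle.exp (D.cornerSum θ (D.stripEnd e x)).im • ζ (D.stripEnd e x))
        (atTop ×ˢ 𝓝[Icc (0 : ℝ) 1] t) (𝓝 (Circle.exp (D.sign e * θ e * t) • c • z₀)) := by
  obtain ⟨κ, hκ⟩ := D.exists_tendsto_cornerSum_im θ e
  refine ⟨Circle.exp κ, fun t ht => ?_⟩
  have h1 := (h.comp (D.tendsto_stripEnd e)).mono_left
    (prod_mono_right atTop (inf_le_right : 𝓝[Icc (0 : ℝ) 1] t ≤ 𝓟 (Icc (0 : ℝ) 1)))
  have h2 := F.tendsto_smul ((Circle.exp.continuous.tendsto _).comp (hκ t ht)) h1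
  rwa [smul_smul, ← Circle.exp_add, add_comm]

lemma countable_preimage_exp [Finite E] : {x : ℝ | (Circle.exp x : ℂ) ∈ range D.pt}.Countable := by
  have h1 : {x : ℝ | (Circle.exp x : ℂ) ∈ range D.pt} ⊆
      ⋃ e, ⋃ m : ℤ, {Complex.arg (D.pt e) + m * (2 * Real.pi)} := by
    rintro x ⟨e, he⟩
    have h2 : Circle.exp x = Circle.exp (Complex.arg (D.pt e)) := by
      refine Circle.coe_injective ?_
      have h3 := Complex.norm_mul_exp_arg_mul_I (D.pt e)
      rw [D.norm_pt, Complex.ofReal_one, one_mul] at h3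
      rw [← he, Circle.coe_exp, h3]
    obtain ⟨m, hm⟩ := Circle.exp_eq_exp.1 h2
    simp only [mem_iUnion, mem_singleton_iff]
    exact ⟨e, m, hm⟩
  have := Finite.to_countable (α := E)
  exact (countable_iUnion fun e => countable_iUnion fun m => countable_singleton _).mono h1

lemma hasDerivAt_circle_exp (x : ℝ) :
    HasDerivAt (fun x : ℝ => (Circle.exp x : ℂ)) ((1 : ℝ) * (Complex.I * (Circle.exp x : ℂ))) x := by
  simp only [Circle.coe_exp]
  have h1 : HasDerivAt (fun x : ℝ => (x : ℂ) * Complex.I) (1 * Complex.I) x :=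
    (hasDerivAt_id x).ofReal_comp.mul_const _
  refine h1.cexp.congr_deriv ?_
  push_cast
  ring

end LegendrianOver

end LegendrianBoundary

end

section

/-! ### Lifts are twisted model lifts -/

section Uniqueness

open Metric

variable {EY Y EZ Z EL L P : Type*}
  [NormedAddCommGroup EY] [NormedSpace ℝ EY] [FiniteDimensional ℝ EY]
  [TopologicalSpace Y] [ChartedSpace EY Y] [IsManifold 𝓘(ℝ, EY) ∞ Y]
  [NormedAddCommGroup EZ] [NormedSpace ℝ EZ] [FiniteDimensional ℝ EZ]
  [TopologicalSpace Z] [ChartedSpace EZ Z] [IsManifold 𝓘(ℝ, EZ) ∞ Z] [MulAction Circle Z]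
  [NormedAddCommGroup EL] [NormedSpace ℝ EL] [FiniteDimensional ℝ EL]
  [TopologicalSpace L] [ChartedSpace EL L]
  [TopologicalSpace P] [ChartedSpace EL P]
variable [IsManifold 𝓘(ℝ, EL) ∞ L] [IsManifold 𝓘(ℝ, EL) ∞ P] [T2Space Y] [T2Space Z]
  {F : CircleFibered EY Y EZ Z} {Λ : LegendrianOver EL L P F}
  {E : Type*} [Fintype E] {D : Punctures E} {u : ℂ → Y}
  {J : ∀ x : ℝ × Z, TangentSpace (𝓘(ℝ, ℝ).prod 𝓘(ℝ, EZ)) x →L[ℝ]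
    TangentSpace (𝓘(ℝ, ℝ).prod 𝓘(ℝ, EZ)) x}

namespace LegendrianOver

/-- A choice of points of the Legendrian depends continuously on the points. -/
lemma exists_continuousOn_j_eq (Λ : LegendrianOver EL L P F) [Nonempty L] {X : Type*}
    [TopologicalSpace X] {I : Set X} {γ : X → Z} (hγ : ContinuousOn γ I) (hr : ∀ x ∈ I, γ x ∈ range Λ.j) :
    ∃ l : X → L, ContinuousOn l I ∧ ∀ x ∈ I, Λ.j (l x) = γ x := by
  have hex : ∀ x, ∃ a, x ∈ I → Λ.j a = γ x := fun x => by
    by_cases hx : x ∈ I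
    · obtain ⟨a, ha⟩ := hr x hx
      exact ⟨a, fun _ => ha⟩
    · exact ⟨Classical.arbitrary L, fun h => absurd h hx⟩
  choose l hl using hex
  refine ⟨l, fun x hx => ?_, hl⟩
  rw [Λ.isEmbedding_j.continuousWithinAt_iff]
  exact (hγ x hx).congr (fun y hy => hl y hy) (hl x hx)

lemma closedBall_subset_closure_surface : closedBall (0 : ℂ) 1 ⊆ closure D.surface := by
  rw [← closure_ball (0 : ℂ) one_ne_zero]
  exact closure_mono D.ball_subset_surface

/-- At a puncture the phase of a lift relative to the twisted model lift converges. -/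
lemma exists_tendsto_ratio [Nonempty L] (hu : CircleFibered.IsCornerMap EY D u) {G : ℂ → ℂ} {s : ℂ → ℝ} {ζ : ℂ → Z}
    (h : F.IsModel D u G s ζ) {w : ℂ → ℝ × Z} (hwc : ContinuousOn w D.surface)
    (hwp : ∀ z ∈ D.surface, F.p (w z).2 = u z) (hwb : ∀ z ∈ D.bdry, (w z).2 ∈ range Λ.j)
    {θ : E → ℝ} {e : E} (hθ : Λ.HasAngle D w e (θ e)) {c : ℂ → Circle}
    (hc : ∀ z ∈ D.surface, (w z).2 = c z • Circle.exp (D.cornerSum θ z).im • ζ z) :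
    ∃ C, Tendsto c (𝓝[closedBall 0 1 \ {D.pt e}] (D.pt e)) (𝓝 C) := by
  obtain ⟨a, ha⟩ := hθ.exists_tendsto
  have h01 : (0 : ℝ) ∈ Icc (0 : ℝ) 1 := by simp
  obtain ⟨T, hT⟩ := eventually_atTop.1 (D.eventually_stripEnd_mem_bdry e (Or.inl rfl : (0 : ℝ) = 0 ∨ _))
  have hTI : ∀ y ∈ Ioi T, D.stripEnd e (y, 0) ∈ D.bdry := fun y hy => hT y hy.le
  have hγ : ContinuousOn (fun y : ℝ => (w (D.stripEnd e (y, 0))).2) (Ioi T) := by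
    refine ContinuousOn.comp (g := fun z => (w z).2) (t := D.surface)
      (continuous_snd.comp_continuousOn hwc) (fun y _ => ?_)
      fun y hy => D.bdry_subset_surface (hTI y hy)
    exact (D.hasDerivAt_stripEnd_fst e h01).continuousAt.continuousWithinAt
  obtain ⟨l, hl, hlj⟩ := Λ.exists_continuousOn_j_eq hγ fun y hy => hwb _ (hTI y hy)
  have hla : Tendsto l atTop (𝓝 a) := by
    rw [Λ.isEmbedding_j.tendsto_nhds_iff]
    have h1 := (ha 0 h01).comp (tendsto_prodMk_nhdsWithin h01)
    rw [mul_zero, Circle.exp_zero, one_smul] at h1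
    refine h1.congr' ?_
    filter_upwards [eventually_gt_atTop T] with y hy
    exact (hlj y hy).symm
  obtain ⟨d, hd⟩ := Λ.exists_tendsto_pt hu h e hl
    (fun y hy => by rw [hlj y hy, hwp _ (D.bdry_subset_surface (hTI y hy))]) hla
  obtain ⟨c₁, hc₁⟩ := tendsto_exp_cornerSum_smul hd θ F
  refine ⟨(c₁ * d)⁻¹, ?_⟩
  rw [← D.map_stripEnd, tendsto_map'_iff]
  refine tendsto_prod_principal_of_forall isCompact_Icc fun t ht => ?_
  refine F.tendsto_ratio (ha t ht) (hc₁ t ht) ?_ ?_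
  · simp only [smul_smul]
    congr 1
    rw [mul_assoc, mul_comm _ (c₁ * d), inv_mul_cancel_left]
  · filter_upwards [(Filter.prod_mono_right atTop (inf_le_right : 𝓝[Icc (0 : ℝ) 1] t ≤ 𝓟 (Icc (0 : ℝ) 1)))
      (D.eventually_stripEnd_mem_surface e)] with x hx
    exact hc _ hx

/-- A lift with given angles satisfies the angle-change formula and is the twisted model lift up to
a constant scalar. -/
theorem IsLift.eq_twisted_model [Nonempty L] (hJ : F.IsCylindrical J) (hu : CircleFibered.IsCornerMap EY D u)
    {G : ℂ → ℂ} {s : ℂ → ℝ} {ζ : ℂ → Z} (h : F.IsModel D u G s ζ) {B : ℂ → Set Z}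
    (hB : ∀ z ∈ D.bdry, B z ⊆ range Λ.j) {w : ℂ → ℝ × Z} (hw : Λ.IsLift D J u B w) {θ : E → ℝ}
    (hθ : ∀ e, Λ.HasAngle D w e (θ e)) : F.AngleChange D u θ ∧ ∃ (r : ℝ) (c : Circle),
      ∀ z ∈ D.surface, w z = (s z + (D.cornerSum θ z).re + r,
        c • Circle.exp (D.cornerSum θ z).im • ζ z) := by
  have htw := h.isTwisted.exp_smul fun z hz => D.hasDerivAt_cornerSum θ hz
  set ζθ : ℂ → Z := fun z => Circle.exp (D.cornerSum θ z).im • ζ z with hζθ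
  have hwb : ∀ z ∈ D.bdry, (w z).2 ∈ range Λ.j := fun z hz => hB z hz (hw.boundary z hz)
  have hex : ∀ z, ∃ c : Circle, z ∈ D.surface → (w z).2 = c • ζθ z := by
    intro z
    by_cases hz : z ∈ D.surface
    · obtain ⟨c, hc⟩ := (F.p_fiber (ζθ z) (w z).2).1 ((htw.p_eq z hz).trans (hw.lifts z hz).symm)
      exact ⟨c, fun _ => hc.symm⟩
    · exact ⟨1, fun h => absurd h hz⟩
  choose c hc using hex
  have hw2 : ContinuousOn (fun z => (w z).2) D.surface :=
    continuous_snd.comp_continuousOn hw.continuous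
  have hcc : ContinuousOn c D.surface := fun z hz =>
    F.continuousWithinAt_ratio (hw2 z hz) (htw.continuousOn z hz) hc hz
  -- the extension of the phase to the closed disk
  obtain ⟨cbar, hcbar, hcbar_eq⟩ : ∃ cbar : ℂ → Circle, ContinuousOn cbar (closedBall 0 1) ∧
      ∀ z ∈ D.surface, cbar z = c z := by
    refine ⟨extendFrom D.surface c, continuousOn_extendFrom closedBall_subset_closure_surface
      fun z hz => ?_, extendFrom_extends hcc⟩
    rcases D.mem_surface_or_mem_range hz with hz | ⟨e, rfl⟩
    · exact ⟨_, hcc z hz⟩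
    · obtain ⟨C, hC⟩ := exists_tendsto_ratio hu h hw.continuous hw.lifts hwb (hθ e) hc
      exact ⟨C, hC.mono_left (nhdsWithin_mono _ fun z hz => D.mem_sdiff_of_mem_surface hz e)⟩
  -- the holomorphic quotient
  set ψ : ℂ → ℝ := fun z => (w z).1 - (s z + (D.cornerSum θ z).re) with hψ
  have hder : ∀ z ∈ ball (0 : ℂ) 1, ∃ k, HasDerivAt (fun y => (Real.exp (ψ y) : ℂ) * c y) k z := by
    intro z hz
    have hzs := D.ball_subset_surface hz
    obtain ⟨K, hK1, hK2⟩ := hJ.exists_form (hw.smooth.contMDiffAt (isOpen_ball.mem_nhds hz))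
      (hw.holomorphic z hz)
    refine ⟨_, CircleFibered.hasDerivAt_exp_mul_circle (k := K - (G z + D.cornerSumDeriv θ z)) ?_ ?_⟩
    · have h1 : HasFDerivAt (fun z => (D.cornerSum θ z).re) (reForm (D.cornerSumDeriv θ z)) z := by
        refine (Complex.reCLM.hasFDerivAt.comp z
          (D.hasDerivAt_cornerSum θ hzs).complexToReal_fderiv).congr_fderiv ?_
        ext v
        simp
      rw [map_sub, map_add]
      exact hK1.sub ((h.hasFDerivAt_s z hz).add h1)
    · rw [map_sub]
      exact (F.hasFDerivWithinAt_ratio (hK2.mono (subset_univ _)) (htw.hasForm z hzs) hc hzs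
        (uniqueDiffWithinAt_of_mem_nhds (D.surface_mem_nhds hz))).hasFDerivAt (D.surface_mem_nhds hz)
  obtain ⟨g, hg, hgH⟩ := exists_exp_eq_of_differentiableOn_ball
    (H := fun y => (Real.exp (ψ y) : ℂ) * c y)
    (fun z hz => by
      obtain ⟨k, hk⟩ := hder z hz
      exact hk.differentiableAt.differentiableWithinAt)
    (fun z _ => mul_ne_zero (by simp) (Circle.coe_ne_zero _))
  have hgψ : ∀ z ∈ ball (0 : ℂ) 1, (g z).re = ψ z := by
    intro z hz
    have h1 := congrArg norm (hgH z hz)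
    rw [norm_mul, Circle.norm_coe, mul_one, Complex.norm_exp, Complex.norm_real, Real.norm_eq_abs,
      Real.abs_exp] at h1
    exact (Real.exp_injective h1).symm
  have hgc : ∀ z ∈ ball (0 : ℂ) 1, c z = Circle.exp (g z).im := by
    intro z hz
    refine Circle.coe_injective ?_
    have h1 := hgH z hz
    rw [← hgψ z hz] at h1
    have h2 : Complex.exp (g z) = (Real.exp (g z).re : ℂ) * (Circle.exp (g z).im : ℂ) := by
      rw [Circle.coe_exp, Complex.ofReal_exp, ← Complex.exp_add, Complex.re_add_im]
    rw [h2] at h1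
    exact mul_left_cancel₀ (by simp) h1
  -- the phase on the boundary
  set κ : ℝ := (2 * Real.pi)⁻¹ * (∑ e, D.sign e * θ e - F.area u) with hκ
  have hbd : ∀ x ∉ {x : ℝ | (Circle.exp x : ℂ) ∈ range D.pt},
      HasDerivAt (fun x : ℝ => (cbar (Circle.exp x : ℂ) : ℂ))
        (κ * (Complex.I * (cbar (Circle.exp x : ℂ) : ℂ))) x := by
    intro x hx
    set I : Set ℝ := {x : ℝ | (Circle.exp x : ℂ) ∈ range D.pt}ᶜ with hI
    have hexpc : Continuous fun x : ℝ => (Circle.exp x : ℂ) :=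
      continuous_subtype_val.comp Circle.exp.continuous
    have hIo : IsOpen I := D.isOpen_compl_range.preimage hexpc
    have hIb : ∀ y ∈ I, (Circle.exp y : ℂ) ∈ D.bdry := fun y hy => ⟨by simp, hy⟩
    have hIs : ∀ y ∈ I, (Circle.exp y : ℂ) ∈ D.surface := fun y hy => D.bdry_subset_surface (hIb y hy)
    obtain ⟨l, hl, hlj⟩ := Λ.exists_continuousOn_j_eq (I := I)
      (γ := fun y : ℝ => (w (Circle.exp y : ℂ)).2)
      (hw2.comp hexpc.continuousOn hIs) fun y hy => hwb _ (hIb y hy)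
    have h1 : F.HasForm I (fun y : ℝ => (w (Circle.exp y : ℂ)).2) x 0 :=
      (Λ.hasForm_curve hu hx hIs (hasDerivAt_circle_exp x) (hl x hx)
        (fun y hy => by rw [hlj y hy, hw.lifts _ (hIs y hy)])).congr_of_eventuallyEq
        (eventually_of_mem self_mem_nhdsWithin fun y hy => (hlj y hy).symm) (hlj x hx).symm
    have h2 := htw.hasForm_curve hx hIs (hasDerivAt_circle_exp x)
    have h3 : (1 : ℝ) * ((Circle.exp x : ℂ) * (G (Circle.exp x) +
        D.cornerSumDeriv θ (Circle.exp x))).re = -κ := by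
      rw [one_mul, mul_add, Complex.add_re, h.re_mul_G _ (hIb x hx),
        D.re_mul_cornerSumDeriv θ (hIb x hx), hκ]
      ring
    rw [h3] at h2
    have h4 := (F.hasFDerivWithinAt_ratio h1 h2 (c := fun y => c (Circle.exp y : ℂ))
      (fun y hy => hc _ (hIs y hy)) hx (hIo.uniqueDiffWithinAt hx)).hasFDerivAt (hIo.mem_nhds hx)
    have h5 := h4.hasDerivAt
    have h6 : (0 - ContinuousLinearMap.toSpanSingleton ℝ (-κ) : ℝ →L[ℝ] ℝ).smulRight
        (Complex.I * (c (Circle.exp x : ℂ) : ℂ)) 1 =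
        κ * (Complex.I * (cbar (Circle.exp x : ℂ) : ℂ)) := by
      rw [hcbar_eq _ (hIs x hx)]
      simp
    rw [h6] at h5
    refine h5.congr_of_eventuallyEq (eventually_of_mem (hIo.mem_nhds hx) fun y hy => ?_)
    simp only [hcbar_eq _ (hIs y hy)]
  obtain ⟨hκ0, a, ha⟩ := exists_const_of_phase hg hcbar (fun z hz => by
    rw [hcbar_eq z (D.ball_subset_surface hz), hgc z hz]) countable_preimage_exp hbd
  refine ⟨?_, a.re, Circle.exp a.im, ?_⟩
  · have h1 : ∑ e, D.sign e * θ e - F.area u = 0 := by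
      have h2 : (2 * Real.pi)⁻¹ ≠ 0 := inv_ne_zero Real.two_pi_pos.ne'
      exact (mul_eq_zero.1 hκ0).resolve_left h2
    exact sub_eq_zero.1 h1
  · have hcl : D.surface ⊆ closure (ball (0 : ℂ) 1) := by
      rw [closure_ball _ one_ne_zero]; exact D.surface_subset
    have hcs : ContinuousOn (fun z => (s z + (D.cornerSum θ z).re + a.re,
        Circle.exp a.im • ζθ z)) D.surface := by
      refine ContinuousOn.prodMk ((h.continuousOn_s.add (Complex.continuous_re.comp_continuousOn
        fun z hz => (D.hasDerivAt_cornerSum θ hz).continuousAt.continuousWithinAt)).add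
          continuousOn_const) ?_
      exact (F.continuous_const_smul _).comp_continuousOn htw.continuousOn
    refine EqOn.of_subset_closure (s := ball (0 : ℂ) 1) ?_ hw.continuous hcs D.ball_subset_surface hcl
    intro z hz
    have h1 := hgψ z hz
    have h2 := hgc z hz
    rw [ha z hz] at h1 h2
    refine Prod.ext ?_ ?_
    · simp only [h1, hψ]
      ring
    · simp only [hc z (D.ball_subset_surface hz), h2]
      rfl

end LegendrianOver

end Uniqueness

end

section

/-! ### The boundary behavior of the twisted model lift -/

section Branches

open Metric

lemma norm_reForm_le (c : ℂ) : ‖reForm c‖ ≤ ‖c‖ := by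
  refine ContinuousLinearMap.opNorm_le_bound _ (norm_nonneg _) fun h => ?_
  rw [reForm_apply, Real.norm_eq_abs, ← norm_mul]
  exact Complex.abs_re_le_norm _

lemma eventually_sphere_of_exp {p : ℂ → Prop} {x : ℝ} (h : ∀ᶠ y in 𝓝 x, p (Circle.exp y : ℂ)) :
    ∀ᶠ z in 𝓝[sphere 0 1] (Circle.exp x : ℂ), p z := by
  have hne : (Circle.exp x : ℂ) ≠ 0 := Circle.coe_ne_zero _
  have h1 : Tendsto (fun z : ℂ => x + Complex.arg (z / (Circle.exp x : ℂ)))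
      (𝓝[sphere 0 1] (Circle.exp x : ℂ)) (𝓝 x) := by
    have h2 : Tendsto (fun z : ℂ => z / (Circle.exp x : ℂ)) (𝓝 (Circle.exp x : ℂ)) (𝓝 1) := by
      have h3 : Tendsto (fun z : ℂ => z / (Circle.exp x : ℂ)) (𝓝 (Circle.exp x : ℂ))
          (𝓝 ((Circle.exp x : ℂ) / (Circle.exp x : ℂ))) := tendsto_id.div_const _
      rwa [div_self hne] at h3
    have h4 := ((Complex.continuousAt_arg (x := 1) (by simp)).tendsto.comp h2).const_add x
    rw [Complex.arg_one, add_zero] at h4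
    exact h4.mono_left nhdsWithin_le_nhds
  filter_upwards [h1.eventually h, self_mem_nhdsWithin] with z hz hzs
  have h5 : (Circle.exp (x + Complex.arg (z / (Circle.exp x : ℂ))) : ℂ) = z := by
    have h6 := Complex.norm_mul_exp_arg_mul_I (z / (Circle.exp x : ℂ))
    rw [norm_div, mem_sphere_zero_iff_norm.1 hzs, Circle.norm_coe, div_one, Complex.ofReal_one,
      one_mul] at h6
    rw [Circle.exp_add, Circle.coe_mul, Circle.coe_exp (Complex.arg _), h6, mul_div_cancel₀ _ hne]
  rwa [h5] at hz

lemma exists_exp_eq {z : ℂ} (hz : z ∈ sphere (0 : ℂ) 1) : ∃ x : ℝ, (Circle.exp x : ℂ) = z := by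
  have h3 := Complex.norm_mul_exp_arg_mul_I z
  rw [mem_sphere_zero_iff_norm.1 hz, Complex.ofReal_one, one_mul] at h3
  exact ⟨Complex.arg z, by rw [Circle.coe_exp, h3]⟩

variable {EY Y EZ Z EL L P : Type*}
  [NormedAddCommGroup EY] [NormedSpace ℝ EY] [FiniteDimensional ℝ EY]
  [TopologicalSpace Y] [ChartedSpace EY Y] [IsManifold 𝓘(ℝ, EY) ∞ Y]
  [NormedAddCommGroup EZ] [NormedSpace ℝ EZ] [FiniteDimensional ℝ EZ]
  [TopologicalSpace Z] [ChartedSpace EZ Z] [IsManifold 𝓘(ℝ, EZ) ∞ Z] [MulAction Circle Z]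
  [NormedAddCommGroup EL] [NormedSpace ℝ EL] [FiniteDimensional ℝ EL]
  [TopologicalSpace L] [ChartedSpace EL L]
  [TopologicalSpace P] [ChartedSpace EL P]
variable [IsManifold 𝓘(ℝ, EL) ∞ L] [IsManifold 𝓘(ℝ, EL) ∞ P] [T2Space Y] [T2Space Z]
  {F : CircleFibered EY Y EZ Z} {Λ : LegendrianOver EL L P F}
  {E : Type*} {D : Punctures E} {u : ℂ → Y}

namespace Punctures

lemma bdry_neBot [Finite E] {z : ℂ} (hz : z ∈ sphere (0 : ℂ) 1) : (𝓝[D.bdry] z).NeBot := by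
  obtain ⟨x, rfl⟩ := exists_exp_eq hz
  have hd := (LegendrianOver.countable_preimage_exp (D := D)).dense_compl ℝ
  refine mem_closure_iff_nhdsWithin_neBot.1 ?_
  have hexpc : Continuous fun x : ℝ => (Circle.exp x : ℂ) :=
    continuous_subtype_val.comp Circle.exp.continuous
  exact map_mem_closure (f := fun x : ℝ => (Circle.exp x : ℂ)) hexpc (hd x) fun y hy => ⟨by simp, hy⟩

/-- A property of boundary points that is locally constant near every point of the circle. -/
lemma forall_bdry_of_eventually [Finite E] {p : ℂ → Prop}
    (h : ∀ z ∈ sphere (0 : ℂ) 1, (∀ᶠ z' in 𝓝[D.bdry] z, p z') ∨ ∀ᶠ z' in 𝓝[D.bdry] z, ¬p z')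
    {z₁ : ℂ} (hz₁ : z₁ ∈ D.bdry) (hp : p z₁) : ∀ z ∈ D.bdry, p z := by
  have hopen : ∀ q : ℂ → Prop, IsOpen {z | ∀ᶠ z' in 𝓝[D.bdry] z, q z'} := fun q =>
    isOpen_iff_mem_nhds.2 fun z hz => by
      simp only [mem_ofPred_eq, eventually_nhdsWithin_iff] at hz ⊢
      exact eventually_eventually_nhds.2 hz
  have hconn : IsPreconnected (sphere (0 : ℂ) 1) :=
    isPreconnected_sphere (by rw [Complex.rank_real_complex]; norm_num) 0 1
  have hdisj : ∀ z ∈ sphere (0 : ℂ) 1, (∀ᶠ z' in 𝓝[D.bdry] z, p z') →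
      (∀ᶠ z' in 𝓝[D.bdry] z, ¬p z') → False := by
    intro z hz h1 h2
    have := D.bdry_neBot hz
    obtain ⟨z', h3, h4⟩ := (h1.and h2).exists
    exact h4 h3
  have h1 : ∀ᶠ z' in 𝓝[D.bdry] z₁, p z' := (h z₁ hz₁.1).resolve_right fun h2 =>
    h2.self_of_nhdsWithin hz₁ hp
  have hsub : sphere (0 : ℂ) 1 ⊆ {z | ∀ᶠ z' in 𝓝[D.bdry] z, p z'} := by
    intro z hz
    by_contra hcon
    obtain ⟨w, hw, hw1, hw2⟩ := hconn _ _ (hopen p) (hopen fun z => ¬p z) (fun z hz => h z hz)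
      ⟨z₁, hz₁.1, h1⟩ ⟨z, hz, (h z hz).resolve_left hcon⟩
    exact hdisj w hw hw1 hw2
  exact fun z hz => (hsub hz.1).self_of_nhdsWithin hz

end Punctures

namespace CircleFibered

/-- The `ℝ`-coordinate of the model lift grows slowly along the ends. -/
lemma IsModel.exists_abs_s_le [Finite E] {G : ℂ → ℂ} {s : ℂ → ℝ} {ζ : ℂ → Z}
    (h : F.IsModel D u G s ζ) (e : E) {ε : ℝ} (hε : 0 < ε) : ∃ C : ℝ,
    ∀ᶠ x in atTop ×ˢ 𝓟 (Icc (0 : ℝ) 1), |s (D.stripEnd e x)| ≤ ε * x.1 + C := by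
  have h1 : ∀ᶠ z in 𝓝[closedBall 0 1 \ {D.pt e}] (D.pt e), ‖(z - D.pt e) * G z‖ < ε / Real.pi :=
    (tendsto_zero_iff_norm_tendsto_zero.1 (h.tendsto_G e)).eventually
      (gt_mem_nhds (div_pos hε Real.pi_pos))
  have h2 := (D.tendsto_stripEnd e).eventually (h1.and (D.surface_mem_nhdsWithin_pt e))
  rw [eventually_prod_principal_iff] at h2
  obtain ⟨T, hT⟩ := eventually_atTop.1 h2
  have hcont : ∀ τ, T ≤ τ → ContinuousOn (fun t => s (D.stripEnd e (τ, t))) (Icc 0 1) := fun τ hτ =>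
    ContinuousOn.comp (g := s) (t := D.surface) h.continuousOn_s
      (fun t ht => (D.hasDerivAt_stripEnd_snd e ht).continuousAt.continuousWithinAt)
      fun t ht => (hT τ hτ t ht).2
  obtain ⟨C, hC⟩ := isCompact_Icc.exists_bound_of_continuousOn (hcont T le_rfl)
  refine ⟨C - ε * T, ?_⟩
  rw [eventually_prod_principal_iff]
  filter_upwards [eventually_ge_atTop T] with τ hτ t ht
  have hcl : closure (Ioo (0 : ℝ) 1) = Icc 0 1 := closure_Ioo zero_ne_one
  refine le_on_closure (s := Ioo (0 : ℝ) 1) (f := fun t => |s (D.stripEnd e (τ, t))|)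
    (g := fun _ => ε * τ + (C - ε * T)) (fun t ht => ?_) ?_ continuousOn_const (by rwa [hcl])
  · have ht' := Ioo_subset_Icc_self ht
    have hder : ∀ τ ∈ Ici T, HasDerivWithinAt (fun τ => s (D.stripEnd e (τ, t)))
        (reForm (G (D.stripEnd e (τ, t))) (D.pt e * (2 * Complex.I * Real.pi * 1 *
          Punctures.stripExp (τ, t) / (Punctures.stripExp (τ, t) + Complex.I) ^ 2))) (Ici T) τ := by
      intro τ hτ
      have hb : D.stripEnd e (τ, t) ∈ ball (0 : ℂ) 1 := by
        simpa using D.norm_stripEnd_lt e (x := (τ, t)) ht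
      exact ((h.hasFDerivAt_s _ hb).comp_hasDerivAt τ (D.hasDerivAt_stripEnd_fst e ht')).hasDerivWithinAt
    have hbd := (convex_Ici T).norm_image_sub_le_of_norm_hasDerivWithin_le hder (C := ε)
      (fun τ hτ => ?_) self_mem_Ici hτ
    · rw [Real.norm_eq_abs, Real.norm_eq_abs, abs_of_nonneg (sub_nonneg.2 hτ)] at hbd
      have h3 := hC t ht'
      rw [Real.norm_eq_abs] at h3
      have h4 := abs_sub_abs_le_abs_sub (s (D.stripEnd e (τ, t))) (s (D.stripEnd e (T, t)))
      linarith
    · refine (ContinuousLinearMap.le_opNorm _ _).trans ?_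
      have h3 := D.norm_deriv_stripEnd_le e (x := (τ, t)) ht' norm_one
      have h4 := (hT τ hτ t ht').1
      rw [norm_mul, lt_div_iff₀ Real.pi_pos] at h4
      calc _ ≤ ‖G (D.stripEnd e (τ, t))‖ * (Real.pi * ‖D.stripEnd e (τ, t) - D.pt e‖) :=
            mul_le_mul (norm_reForm_le _) h3 (norm_nonneg _) (norm_nonneg _)
        _ ≤ ε := by linarith
  · rw [hcl]
    exact (hcont τ hτ).abs

lemma IsModel.tendsto_add_cornerSum [Fintype E] {G : ℂ → ℂ} {s : ℂ → ℝ} {ζ : ℂ → Z}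
    (h : F.IsModel D u G s ζ) {θ : E → ℝ} {e : E} (hθ : 0 < θ e) :
    Tendsto (fun x => D.sign e * (s (D.stripEnd e x) + (D.cornerSum θ (D.stripEnd e x)).re))
      (atTop ×ˢ 𝓟 (Icc (0 : ℝ) 1)) atTop := by
  obtain ⟨C, hC⟩ := h.exists_abs_s_le e (half_pos hθ)
  obtain ⟨C', hC'⟩ := D.exists_le_cornerSum_re hθ.le
  have h1 : Tendsto (fun x : ℝ × ℝ => θ e / 2 * x.1 - (C + C')) (atTop ×ˢ 𝓟 (Icc (0 : ℝ) 1)) atTop := by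
    have h2 : Tendsto (fun τ : ℝ => θ e / 2 * τ - (C + C')) atTop atTop :=
      tendsto_atTop_add_const_right _ _ (tendsto_id.const_mul_atTop (half_pos hθ))
    exact h2.comp tendsto_fst
  refine tendsto_atTop_mono' _ ?_ h1
  filter_upwards [hC, hC'] with x hx hx'
  have h4 : |D.sign e| = 1 := by unfold Punctures.sign; split_ifs <;> simp
  have h5 : |D.sign e * s (D.stripEnd e x)| ≤ θ e / 2 * x.1 + C := by rwa [abs_mul, h4, one_mul]
  have h6 := (abs_le.1 h5).1
  rw [mul_add]
  linarith

lemma IsModel.re_mul_add_cornerSumDeriv [Fintype E] {G : ℂ → ℂ} {s : ℂ → ℝ} {ζ : ℂ → Z}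
    (h : F.IsModel D u G s ζ) {θ : E → ℝ} (hA : F.AngleChange D u θ) :
    ∀ z ∈ D.bdry, (z * (G z + D.cornerSumDeriv θ z)).re = 0 := by
  intro z hz
  rw [mul_add, Complex.add_re, h.re_mul_G z hz, D.re_mul_cornerSumDeriv θ hz]
  unfold AngleChange at hA
  rw [hA]
  ring

end CircleFibered

namespace LegendrianOver

lemma IsCornerDisk.isCornerMap {β : ℂ → P} (h : Λ.IsCornerDisk D u β) :
    CircleFibered.IsCornerMap EY D u := ⟨h.continuous, h.smooth, h.decay⟩

/-- Near a boundary point of the punctured disk, a lift with vanishing boundary form is a constant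
rotation of points of the Legendrian over the boundary lift. -/
lemma IsCornerDisk.exists_smul_eq_bdry [Finite E] {β : ℂ → P} (hu : Λ.IsCornerDisk D u β) {K : ℂ → ℂ} {ζ : ℂ → Z}
    (hζ : F.IsTwisted D u K ζ) (hK : ∀ z ∈ D.bdry, (z * K z).re = 0) {z₁ : ℂ} (hz₁ : z₁ ∈ D.bdry) :
    ∃ d : Circle, ∀ᶠ z in 𝓝[D.bdry] z₁, ∃ a, Λ.q a = β z ∧ ζ z = d • Λ.j a := by
  obtain ⟨x₁, rfl⟩ := exists_exp_eq hz₁.1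
  obtain ⟨a, ha⟩ := Λ.q_surjective (β (Circle.exp x₁ : ℂ))
  obtain ⟨g, hga, hg⟩ := Λ.exists_section a
  have hexpc : Continuous fun x : ℝ => (Circle.exp x : ℂ) :=
    continuous_subtype_val.comp Circle.exp.continuous
  have hbo : ∀ x : ℝ, (Circle.exp x : ℂ) ∈ D.bdry → ∀ᶠ y in 𝓝 x, (Circle.exp y : ℂ) ∈ D.bdry := by
    intro x hx
    filter_upwards [hexpc.continuousAt.preimage_mem_nhds (D.isOpen_compl_range.mem_nhds hx.2)] with y hy
    exact ⟨by simp, hy⟩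
  have hβc : ∀ x : ℝ, (Circle.exp x : ℂ) ∈ D.bdry → ContinuousAt (fun y : ℝ => β (Circle.exp y : ℂ)) x :=
    fun x hx => (hu.boundary_continuous _ hx).tendsto.comp
      (tendsto_nhdsWithin_iff.2 ⟨hexpc.continuousAt, hbo x hx⟩)
  rw [ha] at hg
  obtain ⟨ε, hε, hI⟩ := Metric.eventually_nhds_iff_ball.1 ((hbo x₁ hz₁).and ((hβc x₁ hz₁).eventually hg))
  obtain ⟨d, hd⟩ := Λ.exists_eq_smul_arc hu.isCornerMap hζ hK isOpen_ball
    (convex_ball x₁ ε).isPreconnected (b := fun x => (Circle.exp x : ℂ)) (fun y hy => (hI y hy).1)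
    (fun y _ => ⟨1, by exact_mod_cast hasDerivAt_circle_exp y⟩) (l := fun x => g (β (Circle.exp x : ℂ)))
    (fun y hy => (ContinuousAt.comp (f := fun x : ℝ => β (Circle.exp x : ℂ)) (hI y hy).2.2
      (hβc y (hI y hy).1)).continuousWithinAt)
    (fun y hy => by rw [← Λ.proj_eq, (hI y hy).2.1, hu.boundary _ (hI y hy).1])
  refine ⟨d, Filter.Eventually.filter_mono (nhdsWithin_mono _ sdiff_subset) (eventually_sphere_of_exp ?_)⟩
  filter_upwards [ball_mem_nhds x₁ hε] with y hy
  exact ⟨_, (hI y hy).2.1, hd y hy⟩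

/-- A curve on the Legendrian over the boundary lift along one side of a strip-like end. -/
lemma IsCornerDisk.exists_side_curve [Finite E] {β : ℂ → P} (hu : Λ.IsCornerDisk D u β) (e : E) {t : ℝ}
    (ht : t = 0 ∨ t = 1) {a : L} (ha : Tendsto (fun τ : ℝ => β (D.stripEnd e (τ, t))) atTop (𝓝 (Λ.q a))) :
    ∃ (l : ℝ → L) (T : ℝ), ContinuousOn l (Ioi T) ∧ Tendsto l atTop (𝓝 a) ∧ ∀ y ∈ Ioi T,
      D.stripEnd e (y, t) ∈ D.bdry ∧ Λ.q (l y) = β (D.stripEnd e (y, t)) ∧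
        F.p (Λ.j (l y)) = u (D.stripEnd e (y, t)) := by
  have ht' : t ∈ Icc (0 : ℝ) 1 := by rcases ht with rfl | rfl <;> simp
  obtain ⟨g, hga, hg⟩ := Λ.exists_section a
  obtain ⟨T, hT⟩ := eventually_atTop.1 ((D.eventually_stripEnd_mem_bdry e ht).and (ha.eventually hg))
  refine ⟨fun y => g (β (D.stripEnd e (y, t))), T, fun y hy => ?_, ?_, fun y hy => ?_⟩
  · have h1 : ContinuousWithinAt (fun y => β (D.stripEnd e (y, t))) (Ioi T) y :=
      ContinuousWithinAt.comp (t := D.bdry) (hu.boundary_continuous _ (hT y (le_of_lt hy)).1)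
        (D.hasDerivAt_stripEnd_fst e ht').continuousAt.continuousWithinAt
        fun y hy => (hT y (le_of_lt hy)).1
    exact ContinuousAt.comp_continuousWithinAt (hT y (le_of_lt hy)).2.2 h1
  · have h1 := hg.self_of_nhds.2
    have h2 := h1.tendsto.comp ha
    rwa [hga] at h2
  · obtain ⟨h1, h2, -⟩ := hT y (le_of_lt hy)
    exact ⟨h1, h2, by rw [← Λ.proj_eq, h2, hu.boundary _ h1]⟩

/-- Near a puncture where the angle joins the branches of the boundary lift, the twisted model lift is
the same constant rotation of points of the Legendrian on both sides. -/
lemma IsCornerDisk.exists_smul_eq_pt [Fintype E] {β : ℂ → P} (hu : Λ.IsCornerDisk D u β) {G : ℂ → ℂ}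
    {s : ℂ → ℝ} {ζ : ℂ → Z} (h : F.IsModel D u G s ζ) {θ : E → ℝ} (hA : F.AngleChange D u θ) {e : E}
    {a₀ a₁ : L} (h₀ : Tendsto (fun τ : ℝ => β (D.stripEnd e (τ, 0))) atTop (𝓝 (Λ.q a₀)))
    (h₁ : Tendsto (fun τ : ℝ => β (D.stripEnd e (τ, 1))) atTop (𝓝 (Λ.q a₁)))
    (ha : Circle.exp (D.sign e * θ e) • Λ.j a₀ = Λ.j a₁) :
    ∃ d : Circle, (∀ᶠ z in 𝓝[D.bdry] (D.pt e), ∃ a, Λ.q a = β z ∧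
        Circle.exp (D.cornerSum θ z).im • ζ z = d • Λ.j a) ∧
      ∀ t ∈ Icc (0 : ℝ) 1,
        Tendsto (fun x => Circle.exp (D.cornerSum θ (D.stripEnd e x)).im • ζ (D.stripEnd e x))
          (atTop ×ˢ 𝓝[Icc (0 : ℝ) 1] t) (𝓝 (Circle.exp (D.sign e * θ e * t) • d • Λ.j a₀)) := by
  have htw := h.isTwisted.exp_smul fun z hz => D.hasDerivAt_cornerSum θ hz
  have hK := h.re_mul_add_cornerSumDeriv hA
  obtain ⟨l₀, T₀, hl₀, hl₀a, hl₀β⟩ := hu.exists_side_curve e (Or.inl rfl) h₀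
  obtain ⟨l₁, T₁, hl₁, hl₁a, hl₁β⟩ := hu.exists_side_curve e (Or.inr rfl) h₁
  obtain ⟨d, hd⟩ := Λ.exists_tendsto_pt hu.isCornerMap h e hl₀ (fun y hy => (hl₀β y hy).2.2) hl₀a
  obtain ⟨c, hc⟩ := tendsto_exp_cornerSum_smul hd θ F
  obtain ⟨d₀, hd₀⟩ := Λ.exists_eq_smul_arc hu.isCornerMap htw hK isOpen_Ioi isPreconnected_Ioi
    (fun y hy => (hl₀β y hy).1) (fun y _ => D.exists_hasDerivAt_stripEnd e (Or.inl rfl) y) hl₀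
    (fun y hy => (hl₀β y hy).2.2)
  obtain ⟨d₁, hd₁⟩ := Λ.exists_eq_smul_arc hu.isCornerMap htw hK isOpen_Ioi isPreconnected_Ioi
    (fun y hy => (hl₁β y hy).1) (fun y _ => D.exists_hasDerivAt_stripEnd e (Or.inr rfl) y) hl₁
    (fun y hy => (hl₁β y hy).2.2)
  have hside : ∀ {d' : Circle} {l : ℝ → L} {T t : ℝ} {a : L}, t ∈ Icc (0 : ℝ) 1 →
      Tendsto l atTop (𝓝 a) → (∀ y ∈ Ioi T, Circle.exp (D.cornerSum θ (D.stripEnd e (y, t))).im •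
        ζ (D.stripEnd e (y, t)) = d' • Λ.j (l y)) →
      d' • Λ.j a = Circle.exp (D.sign e * θ e * t) • c • d • Λ.j a₀ := by
    intro d' l T t a ht hla hl
    refine tendsto_nhds_unique ?_ ((hc t ht).comp (tendsto_prodMk_nhdsWithin ht))
    have h1 : Tendsto (fun y => d' • Λ.j (l y)) atTop (𝓝 (d' • Λ.j a)) :=
      (F.continuous_const_smul d').continuousAt.tendsto.comp
        ((Λ.isEmbedding_j.continuous.tendsto a).comp hla)
    refine h1.congr' ?_
    filter_upwards [eventually_gt_atTop T] with y hy
    exact (hl y hy).symm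
  have e₀ : d₀ = c * d := by
    have h1 := hside (by simp) hl₀a hd₀
    rw [mul_zero, Circle.exp_zero, one_smul, smul_smul] at h1
    exact F.smul_left_injective h1
  have e₁ : d₁ = c * d := by
    have h1 := hside (by simp) hl₁a hd₁
    rw [mul_one, smul_smul c d, smul_smul, mul_comm, mul_smul, ha] at h1
    exact F.smul_left_injective h1
  refine ⟨c * d, D.eventually_bdry_of_stripEnd e ?_ ?_, fun t ht => ?_⟩
  · filter_upwards [eventually_gt_atTop T₀] with y hy
    exact ⟨_, (hl₀β y hy).2.1, by rw [hd₀ y hy, e₀]⟩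
  · filter_upwards [eventually_gt_atTop T₁] with y hy
    exact ⟨_, (hl₁β y hy).2.1, by rw [hd₁ y hy, e₁]⟩
  · rw [mul_smul]
    exact hc t ht

end LegendrianOver

end Branches

end

section

/-! ### Existence of lifts -/

section Existence

open Metric

variable {EY Y EZ Z EL L P : Type*}
  [NormedAddCommGroup EY] [NormedSpace ℝ EY] [FiniteDimensional ℝ EY]
  [TopologicalSpace Y] [ChartedSpace EY Y] [IsManifold 𝓘(ℝ, EY) ∞ Y]
  [NormedAddCommGroup EZ] [NormedSpace ℝ EZ] [FiniteDimensional ℝ EZ]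
  [TopologicalSpace Z] [ChartedSpace EZ Z] [IsManifold 𝓘(ℝ, EZ) ∞ Z] [MulAction Circle Z]
  [NormedAddCommGroup EL] [NormedSpace ℝ EL] [FiniteDimensional ℝ EL]
  [TopologicalSpace L] [ChartedSpace EL L]
  [TopologicalSpace P] [ChartedSpace EL P]
variable [IsManifold 𝓘(ℝ, EL) ∞ L] [IsManifold 𝓘(ℝ, EL) ∞ P] [T2Space Y] [T2Space Z]
  {F : CircleFibered EY Y EZ Z} {Λ : LegendrianOver EL L P F}
  {E : Type*} [Fintype E] {D : Punctures E} {u : ℂ → Y}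
  {J : ∀ x : ℝ × Z, TangentSpace (𝓘(ℝ, ℝ).prod 𝓘(ℝ, EZ)) x →L[ℝ]
    TangentSpace (𝓘(ℝ, ℝ).prod 𝓘(ℝ, EZ)) x}

namespace Punctures

lemma bdry_nonempty : D.bdry.Nonempty := by
  have := D.bdry_neBot (z := 1) (by simp)
  exact Filter.nonempty_of_mem (self_mem_nhdsWithin : D.bdry ∈ 𝓝[D.bdry] (1 : ℂ))

lemma contDiffAt_cornerSum (θ : E → ℝ) {z : ℂ} (hz : z ∈ ball (0 : ℂ) 1) :
    ContDiffAt ℝ ∞ (D.cornerSum θ) z := by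
  have h1 : DifferentiableOn ℂ (D.cornerSum θ) (ball 0 1) := fun z hz =>
    (D.hasDerivAt_cornerSum θ (D.ball_subset_surface hz)).differentiableAt.differentiableWithinAt
  exact (h1.contDiffOn isOpen_ball).contDiffAt (isOpen_ball.mem_nhds hz) |>.restrict_scalars ℝ

lemma hasFDerivAt_cornerSum_re (θ : E → ℝ) {z : ℂ} (hz : z ∈ D.surface) :
    HasFDerivAt (fun z => (D.cornerSum θ z).re) (reForm (D.cornerSumDeriv θ z)) z := by
  refine (Complex.reCLM.hasFDerivAt.comp z
    (D.hasDerivAt_cornerSum θ hz).complexToReal_fderiv).congr_fderiv ?_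
  ext v
  simp

end Punctures

namespace CircleFibered

/-- The lift of `u` determined by a model lift, a collection of angles and a rotation. -/
def twistedLift (D : Punctures E) (s : ℂ → ℝ) (ζ : ℂ → Z) (θ : E → ℝ) (c : Circle) (z : ℂ) : ℝ × Z :=
  (s z + (D.cornerSum θ z).re, c • Circle.exp (D.cornerSum θ z).im • ζ z)

namespace IsModel

variable {G : ℂ → ℂ} {s : ℂ → ℝ} {ζ : ℂ → Z}

lemma continuousOn_twistedLift (h : F.IsModel D u G s ζ) (θ : E → ℝ) (c : Circle) :
    ContinuousOn (twistedLift D s ζ θ c) D.surface := by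
  refine ContinuousOn.prodMk (h.continuousOn_s.add (Complex.continuous_re.comp_continuousOn
    fun z hz => (D.hasDerivAt_cornerSum θ hz).continuousAt.continuousWithinAt)) ?_
  exact (F.continuous_const_smul _).comp_continuousOn
    (h.isTwisted.exp_smul fun z hz => D.hasDerivAt_cornerSum θ hz).continuousOn

lemma contMDiffOn_twistedLift (h : F.IsModel D u G s ζ) (θ : E → ℝ) (c : Circle) :
    ContMDiffOn 𝓘(ℝ, ℂ) (𝓘(ℝ, ℝ).prod 𝓘(ℝ, EZ)) ∞ (twistedLift D s ζ θ c) (ball 0 1) := by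
  intro z hz
  have hS := D.contDiffAt_cornerSum θ hz
  have hre : ContDiffAt ℝ ∞ (fun z => (D.cornerSum θ z).re) z := Complex.reCLM.contDiff.contDiffAt.comp z hS
  have him : ContDiffAt ℝ ∞ (fun z => (D.cornerSum θ z).im) z := Complex.imCLM.contDiff.contDiffAt.comp z hS
  have h1 : ContMDiffAt 𝓘(ℝ, ℂ) 𝓘(ℝ, ℝ) ∞ (fun z => s z + (D.cornerSum θ z).re) z :=
    ((h.contDiffAt_s z hz).add hre).contMDiffAt
  have h2 : ContMDiffAt 𝓘(ℝ, ℂ) 𝓘(ℝ, EZ) ∞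
      (fun z => Circle.exp (D.cornerSum θ z).im • ζ z) z :=
    (F.action_smooth.contMDiffAt (x := ((D.cornerSum θ z).im, ζ z))).comp z
      (him.contMDiffAt.prodMk (h.contMDiffAt_ζ z hz))
  have h3 : ContMDiffAt 𝓘(ℝ, ℂ) 𝓘(ℝ, EZ) ∞
      (fun z => c • Circle.exp (D.cornerSum θ z).im • ζ z) z :=
    ((F.contMDiff_smul c).contMDiffAt).comp z h2
  exact (h1.prodMk h3).contMDiffWithinAt

lemma holomorphic_twistedLift (h : F.IsModel D u G s ζ) (hJ : F.IsCylindrical J) (hu : IsCornerMap EY D u)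
    (huJ : F.IsBaseHolomorphic u) (θ : E → ℝ) (c : Circle) {z : ℂ} (hz : z ∈ ball (0 : ℂ) 1) (v : ℂ) :
    mfderiv 𝓘(ℝ, ℂ) (𝓘(ℝ, ℝ).prod 𝓘(ℝ, EZ)) (twistedLift D s ζ θ c) z (Complex.I * v : ℂ) =
      J (twistedLift D s ζ θ c z)
        (mfderiv 𝓘(ℝ, ℂ) (𝓘(ℝ, ℝ).prod 𝓘(ℝ, EZ)) (twistedLift D s ζ θ c) z v) := by
  have hzs := D.ball_subset_surface hz
  have htw := (h.isTwisted.exp_smul fun z hz => D.hasDerivAt_cornerSum θ hz).const_smul c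
  refine hJ.holomorphic_of_form (K := G z + D.cornerSumDeriv θ z)
    ((hu.contMDiffAt hz).mdifferentiableAt (by simp)) (huJ z hz) ?_ ?_ ?_ v
  · exact eventually_of_mem (D.surface_mem_nhds hz) htw.p_eq
  · rw [map_add]
    exact (h.hasFDerivAt_s z hz).add (D.hasFDerivAt_cornerSum_re θ hzs)
  · exact (htw.hasForm z hzs).mono_of_mem (by
      rw [nhdsWithin_univ]; exact D.surface_mem_nhds hz)

end IsModel

end CircleFibered

namespace LegendrianOver

/-- The angles join the branches of the boundary lift, in terms of the sides of the strip-like ends. -/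
lemma JoinsBranches.exists_sides {β : ℂ → P} {θ : E → ℝ} (h : Λ.JoinsBranches D β θ) (e : E) :
    0 < θ e ∧ ∃ a₀ a₁, Tendsto (fun τ : ℝ => β (D.stripEnd e (τ, 0))) atTop (𝓝 (Λ.q a₀)) ∧
      Tendsto (fun τ : ℝ => β (D.stripEnd e (τ, 1))) atTop (𝓝 (Λ.q a₁)) ∧
      Circle.exp (D.sign e * θ e) • Λ.j a₀ = Λ.j a₁ := by
  obtain ⟨a, b, ⟨h0, hab⟩, ha, hb⟩ := h e
  refine ⟨h0, ?_⟩
  unfold Punctures.sign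
  by_cases he : D.inc e
  · simp only [he, if_true] at ha hb ⊢
    exact ⟨a, b, ha, hb, by rw [one_mul, hab]⟩
  · simp only [he] at ha hb ⊢
    refine ⟨b, a, hb, ha, ?_⟩
    rw [← hab, smul_smul, ← Circle.exp_add]
    simp

lemma hasAngle_of_tendsto {w : ℂ → ℝ × Z} {e : E} {θ : ℝ} (hθ : 0 < θ)
    (hs : Tendsto (fun x => D.sign e * (w (D.stripEnd e x)).1) (atTop ×ˢ 𝓟 (Icc (0 : ℝ) 1)) atTop)
    {a₀ a₁ : L} (ha : Circle.exp (D.sign e * θ) • Λ.j a₀ = Λ.j a₁)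
    (hw : ∀ t ∈ Icc (0 : ℝ) 1, Tendsto (fun x => (w (D.stripEnd e x)).2)
      (atTop ×ˢ 𝓝[Icc (0 : ℝ) 1] t) (𝓝 (Circle.exp (D.sign e * θ * t) • Λ.j a₀))) :
    Λ.HasAngle D w e θ := by
  refine ⟨hs, ?_⟩
  unfold Punctures.sign at ha hw
  by_cases he : D.inc e
  · simp only [he, if_true, one_mul] at ha hw ⊢
    exact ⟨a₀, a₁, ⟨hθ, ha⟩, hw⟩
  · simp only [he] at ha hw ⊢
    refine ⟨a₁, a₀, ⟨hθ, ?_⟩, fun t ht => ?_⟩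
    · rw [← ha, smul_smul, ← Circle.exp_add]
      simp
    · rw [← ha, smul_smul, ← Circle.exp_add]
      convert hw t ht using 4
      simp
      ring

/-- Every collection of angles which joins the branches and satisfies the angle-change formula is
realized by a lift. -/
theorem IsCornerDisk.exists_isLift (hJ : F.IsCylindrical J) (hh : Λ.IsHomogeneous) {β : ℂ → P}
    (hu : Λ.IsCornerDisk D u β) {θ : E → ℝ} (hb : Λ.JoinsBranches D β θ) (hA : F.AngleChange D u θ) :
    ∃ w, Λ.IsLift D J u (fun z => Λ.j '' (Λ.q ⁻¹' {β z})) w ∧ ∀ e, Λ.HasAngle D w e (θ e) := by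
  obtain ⟨G, s, ζ, h⟩ := hu.isCornerMap.exists_isModel F
  have htw := h.isTwisted.exp_smul fun z hz => D.hasDerivAt_cornerSum θ hz
  have hK := h.re_mul_add_cornerSumDeriv hA
  set ζθ : ℂ → Z := fun z => Circle.exp (D.cornerSum θ z).im • ζ z with hζθ
  have hloc : ∀ z ∈ sphere (0 : ℂ) 1, ∃ d : Circle, ∀ᶠ z' in 𝓝[D.bdry] z,
      ∃ a, Λ.q a = β z' ∧ ζθ z' = d • Λ.j a := by
    intro z hz
    rcases D.mem_surface_or_mem_range (sphere_subset_closedBall hz) with hzs | ⟨e, rfl⟩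
    · exact hu.exists_smul_eq_bdry htw hK ⟨hz, hzs.2⟩
    · obtain ⟨-, a₀, a₁, h₀, h₁, ha⟩ := hb.exists_sides e
      obtain ⟨d, hd, -⟩ := hu.exists_smul_eq_pt h hA h₀ h₁ ha
      exact ⟨d, hd⟩
  obtain ⟨z₁, hz₁⟩ := D.bdry_nonempty
  obtain ⟨d₁, hd₁⟩ := hloc z₁ hz₁.1
  obtain ⟨b₁, hb₁, hζ₁⟩ := hd₁.self_of_nhdsWithin hz₁
  set c := d₁⁻¹ with hc
  have hdeck : ∀ {d : Circle} {z : ℂ}, (∃ a, Λ.q a = β z ∧ ζθ z = d • Λ.j a) →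
      (∃ a, Λ.q a = β z ∧ c • ζθ z = Λ.j a) → Λ.Deck (c * d) := by
    rintro d z ⟨a, ha, hda⟩ ⟨b, hb, hcb⟩
    exact hh.deck (ha.trans hb.symm) (by rw [mul_smul, ← hda, hcb])
  have hbd : ∀ z ∈ D.bdry, ∃ a, Λ.q a = β z ∧ c • ζθ z = Λ.j a := by
    refine D.forall_bdry_of_eventually (fun z hz => ?_) hz₁
      ⟨b₁, hb₁, by rw [hζ₁, hc, inv_smul_smul]⟩
    obtain ⟨d, hd⟩ := hloc z hz
    by_cases hcd : Λ.Deck (c * d)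
    · left
      filter_upwards [hd] with z' ⟨a, ha, hda⟩
      obtain ⟨b, hqb, hjb⟩ := hcd a
      exact ⟨b, hqb.symm.trans ha, by rw [hda, ← mul_smul, hjb]⟩
    · right
      filter_upwards [hd] with z' hz' hp
      exact hcd (hdeck hz' hp)
  have hang : ∀ e, Λ.HasAngle D (CircleFibered.twistedLift D s ζ θ c) e (θ e) := by
    intro e
    obtain ⟨hθ, a₀, a₁, h₀, h₁, ha⟩ := hb.exists_sides e
    obtain ⟨d, hd, hlim⟩ := hu.exists_smul_eq_pt h hA h₀ h₁ ha
    have hcd : Λ.Deck (c * d) := by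
      have := D.bdry_neBot (D.mem_sphere e)
      obtain ⟨z, hz, hzb⟩ := (hd.and self_mem_nhdsWithin).exists
      exact hdeck hz (hbd z hzb)
    obtain ⟨b₀, -, hb₀⟩ := hcd a₀
    obtain ⟨b₁, -, hb₁⟩ := hcd a₁
    refine hasAngle_of_tendsto hθ (h.tendsto_add_cornerSum hθ) (a₀ := b₀) (a₁ := b₁) ?_ fun t ht => ?_
    · rw [← hb₀, ← hb₁, ← ha, smul_comm]
    · have h1 := (F.continuous_const_smul c).continuousAt.tendsto.comp (hlim t ht)
      rw [smul_comm, smul_smul c d, hb₀] at h1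
      exact h1
  refine ⟨CircleFibered.twistedLift D s ζ θ c, ⟨h.continuousOn_twistedLift θ c,
    h.contMDiffOn_twistedLift θ c,
    fun z hz v => h.holomorphic_twistedLift hJ hu.isCornerMap hu.holomorphic θ c hz v, fun z hz => ?_,
    fun z hz => ?_, fun e => ⟨θ e, hang e⟩⟩, hang⟩
  · exact (htw.const_smul c).p_eq z hz
  · obtain ⟨a, ha, hca⟩ := hbd z hz
    exact ⟨a, ha, hca.symm⟩

end LegendrianOver

end Existence

end

section

/-! ### The classification of lifts by their angles -/

section Classification

open Metric

variable {EY Y EZ Z EL L P : Type*}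
  [NormedAddCommGroup EY] [NormedSpace ℝ EY] [FiniteDimensional ℝ EY]
  [TopologicalSpace Y] [ChartedSpace EY Y] [IsManifold 𝓘(ℝ, EY) ∞ Y]
  [NormedAddCommGroup EZ] [NormedSpace ℝ EZ] [FiniteDimensional ℝ EZ]
  [TopologicalSpace Z] [ChartedSpace EZ Z] [IsManifold 𝓘(ℝ, EZ) ∞ Z] [MulAction Circle Z]
  [NormedAddCommGroup EL] [NormedSpace ℝ EL] [FiniteDimensional ℝ EL]
  [TopologicalSpace L] [ChartedSpace EL L]
  [TopologicalSpace P] [ChartedSpace EL P]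
variable [IsManifold 𝓘(ℝ, EL) ∞ L] [IsManifold 𝓘(ℝ, EL) ∞ P] [T2Space Y] [T2Space Z]
  {F : CircleFibered EY Y EZ Z} {Λ : LegendrianOver EL L P F}
  {E : Type*} [Fintype E] {D : Punctures E} {u : ℂ → Y}
  {J : ∀ x : ℝ × Z, TangentSpace (𝓘(ℝ, ℝ).prod 𝓘(ℝ, EZ)) x →L[ℝ]
    TangentSpace (𝓘(ℝ, ℝ).prod 𝓘(ℝ, EZ)) x}

lemma eq_zero_of_circle_exp_mul {x : ℝ} (h : ∀ t ∈ Icc (0 : ℝ) 1, Circle.exp (x * t) = 1) : x = 0 := by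
  have hp : 0 < 1 + |x| := by positivity
  have h1 := h (1 + |x|)⁻¹ ⟨by positivity, inv_le_one_of_one_le₀ (by linarith [abs_nonneg x])⟩
  have h2 : |x * (1 + |x|)⁻¹| < 1 := by
    rw [abs_mul, abs_of_pos (inv_pos.2 hp), ← div_eq_mul_inv, div_lt_one hp]
    linarith
  have h3 := abs_lt.1 h2
  have hpi := Real.pi_gt_three
  have h4 : Complex.arg (Circle.exp (x * (1 + |x|)⁻¹)) = x * (1 + |x|)⁻¹ :=
    Circle.arg_exp (by linarith) (by linarith)
  rw [h1, Circle.coe_one, Complex.arg_one] at h4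
  exact (mul_eq_zero.1 h4.symm).resolve_right (inv_ne_zero hp.ne')

namespace Punctures

lemma sign_ne_zero (e : E) : D.sign e ≠ 0 := by
  unfold Punctures.sign
  split_ifs <;> norm_num

end Punctures

namespace LegendrianOver

lemma HasAngle.unique {w : ℂ → ℝ × Z} {e : E} {θ θ' : ℝ} (h : Λ.HasAngle D w e θ)
    (h' : Λ.HasAngle D w e θ') : θ = θ' := by
  obtain ⟨a, ha⟩ := h.exists_tendsto
  obtain ⟨a', ha'⟩ := h'.exists_tendsto
  have h1 : ∀ t ∈ Icc (0 : ℝ) 1,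
      Circle.exp (D.sign e * θ * t) • Λ.j a = Circle.exp (D.sign e * θ' * t) • Λ.j a' := fun t ht =>
    tendsto_nhds_unique ((ha t ht).comp (tendsto_prodMk_nhdsWithin ht))
      ((ha' t ht).comp (tendsto_prodMk_nhdsWithin ht))
  have h0 := h1 0 (by simp)
  rw [mul_zero, mul_zero, Circle.exp_zero, one_smul, one_smul] at h0
  have h2 : D.sign e * (θ - θ') = 0 := by
    refine eq_zero_of_circle_exp_mul fun t ht => ?_
    have h3 := h1 t ht
    rw [← h0] at h3
    rw [show D.sign e * (θ - θ') * t = D.sign e * θ * t - D.sign e * θ' * t by ring, Circle.exp_sub,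
      F.smul_left_injective h3, div_self']
  exact sub_eq_zero.1 ((mul_eq_zero.1 h2).resolve_left (D.sign_ne_zero e))

lemma HasAngle.of_scalar {w w' : ℂ → ℝ × Z} {e : E} {θ r : ℝ} {c : Circle} (h : Λ.HasAngle D w e θ)
    (hc : c • range Λ.j = range Λ.j) (hw : ∀ z ∈ D.surface, w' z = ((w z).1 + r, c • (w z).2)) :
    Λ.HasAngle D w' e θ := by
  have hj : ∀ a, ∃ a', c • Λ.j a = Λ.j a' := fun a => by
    have h1 : c • Λ.j a ∈ range Λ.j := hc ▸ Set.smul_mem_smul_set (mem_range_self a)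
    obtain ⟨a', ha'⟩ := h1
    exact ⟨a', ha'.symm⟩
  obtain ⟨hs, a, b, hab, ht⟩ := h
  obtain ⟨a', ha'⟩ := hj a
  obtain ⟨b', hb'⟩ := hj b
  refine ⟨?_, a', b', ⟨hab.1, by rw [← ha', ← hb', ← hab.2, smul_comm]⟩, fun t htm => ?_⟩
  · refine (tendsto_atTop_add_const_right _ (D.sign e * r) hs).congr' ?_
    filter_upwards [D.eventually_stripEnd_mem_surface e] with x hx
    rw [hw _ hx, mul_add]
  · have h1 := (F.continuous_const_smul c).continuousAt.tendsto.comp (ht t htm)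
    rw [smul_comm, ha'] at h1
    refine h1.congr' ?_
    filter_upwards [(Filter.prod_mono_right atTop (inf_le_right : 𝓝[Icc (0 : ℝ) 1] t ≤ 𝓟 (Icc (0 : ℝ) 1)))
      (D.eventually_stripEnd_mem_surface e)] with x hx
    rw [Function.comp_apply, hw _ hx]

/-- A criterion for the angle map to be well defined and bijective. -/
lemma angleMapBijective_of {B : ℂ → Set Z} {A : Set (E → ℝ)}
    (hA : ∀ (w : ℂ → ℝ × Z) (θ : E → ℝ), Λ.IsLift D J u B w → (∀ e, Λ.HasAngle D w e (θ e)) → θ ∈ A)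
    (hinj : ∀ (w w' : ℂ → ℝ × Z) (θ : E → ℝ), Λ.IsLift D J u B w → Λ.IsLift D J u B w' → (∀ e, Λ.HasAngle D w e (θ e)) →
      (∀ e, Λ.HasAngle D w' e (θ e)) → ∃ (r : ℝ) (c : Circle), c • range Λ.j = range Λ.j ∧
        ∀ z ∈ D.surface, w' z = ((w z).1 + r, c • (w z).2))
    (hsurj : ∀ θ ∈ A, ∃ w, Λ.IsLift D J u B w ∧ ∀ e, Λ.HasAngle D w e (θ e)) :
    Λ.AngleMapBijective D J u B A := by
  have hlift : ∀ w : Λ.Lifts D J u B, ∃ θ : E → ℝ, ∀ e, Λ.HasAngle D w.1 e (θ e) := fun w =>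
    ⟨_, fun e => (w.2.asymptotic e).choose_spec⟩
  choose θ hθ using hlift
  refine ⟨Quotient.lift θ ?_, fun w e θ' => ⟨fun h => (hθ w e).unique h, fun h => h ▸ hθ w e⟩,
    ?_, ?_, ?_⟩
  · rintro w w' ⟨r, c, hc, h⟩
    exact funext fun e => ((hθ w e).of_scalar hc h).unique (hθ w' e)
  · rintro x -
    induction x using Quotient.inductionOn with
    | h w => exact hA w.1 _ w.2 (hθ w)
  · rintro x - y - hxy
    induction x using Quotient.inductionOn with
    | h w =>
      induction y using Quotient.inductionOn with
      | h w' =>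
        have hxy' : θ w = θ w' := hxy
        exact Quotient.sound (hinj w.1 w'.1 _ w.2 w'.2 (hθ w) (hxy' ▸ hθ w'))
  · intro θ' hθ'
    obtain ⟨w, hw, hwθ⟩ := hsurj θ' hθ'
    exact ⟨Quotient.mk _ ⟨w, hw⟩, mem_univ _, funext fun e => (hθ ⟨w, hw⟩ e).unique (hwθ e)⟩

/-- Along a side of a strip-like end, convergence of a lift to a point of the Legendrian implies
convergence of the boundary lift. -/
lemma IsLift.tendsto_boundary {β : ℂ → P} {w : ℂ → ℝ × Z}
    (hw : Λ.IsLift D J u (fun z => Λ.j '' (Λ.q ⁻¹' {β z})) w) {e : E} {t : ℝ} (ht : t = 0 ∨ t = 1) {a : L}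
    (ha : Tendsto (fun x => (w (D.stripEnd e x)).2) (atTop ×ˢ 𝓝[Icc (0 : ℝ) 1] t) (𝓝 (Λ.j a))) :
    Tendsto (fun τ : ℝ => β (D.stripEnd e (τ, t))) atTop (𝓝 (Λ.q a)) := by
  have hex : ∀ τ : ℝ, ∃ b, D.stripEnd e (τ, t) ∈ D.bdry →
      Λ.q b = β (D.stripEnd e (τ, t)) ∧ Λ.j b = (w (D.stripEnd e (τ, t))).2 := by
    intro τ
    by_cases h : D.stripEnd e (τ, t) ∈ D.bdry
    · obtain ⟨b, hb, hj⟩ := hw.boundary _ h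
      exact ⟨b, fun _ => ⟨hb, hj⟩⟩
    · exact ⟨a, fun h' => absurd h' h⟩
  choose b hb using hex
  have ht' : t ∈ Icc (0 : ℝ) 1 := by rcases ht with rfl | rfl <;> simp
  have hbd := D.eventually_stripEnd_mem_bdry e ht
  have h1 : Tendsto b atTop (𝓝 a) := by
    rw [Λ.isEmbedding_j.tendsto_nhds_iff]
    refine (ha.comp (tendsto_prodMk_nhdsWithin ht')).congr' ?_
    filter_upwards [hbd] with τ hτ
    exact (hb τ hτ).2.symm
  refine ((Λ.q_smooth.continuous.tendsto a).comp h1).congr' ?_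
  filter_upwards [hbd] with τ hτ
  exact (hb τ hτ).1

lemma IsLift.joinsBranches {β : ℂ → P} {w : ℂ → ℝ × Z}
    (hw : Λ.IsLift D J u (fun z => Λ.j '' (Λ.q ⁻¹' {β z})) w) {θ : E → ℝ}
    (hθ : ∀ e, Λ.HasAngle D w e (θ e)) : Λ.JoinsBranches D β θ := by
  intro e
  obtain ⟨-, a, b, hab, ht⟩ := hθ e
  refine ⟨a, b, hab, ?_, ?_⟩
  · refine hw.tendsto_boundary (by split_ifs <;> simp) ?_
    convert ht (if D.inc e then 0 else 1) (by split_ifs <;> simp) using 2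
    split_ifs <;> simp
  · refine hw.tendsto_boundary (by split_ifs <;> simp) ?_
    convert ht (if D.inc e then 1 else 0) (by split_ifs <;> simp) using 2
    rw [← hab.2]
    split_ifs <;> simp

/-- Two lifts with the same angles and the same boundary lift are equivalent. -/
theorem IsCornerDisk.exists_scalar (hJ : F.IsCylindrical J) (hh : Λ.IsHomogeneous) {β : ℂ → P}
    (hu : Λ.IsCornerDisk D u β) {w w' : ℂ → ℝ × Z}
    (hw : Λ.IsLift D J u (fun z => Λ.j '' (Λ.q ⁻¹' {β z})) w)
    (hw' : Λ.IsLift D J u (fun z => Λ.j '' (Λ.q ⁻¹' {β z})) w') {θ : E → ℝ}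
    (hθ : ∀ e, Λ.HasAngle D w e (θ e)) (hθ' : ∀ e, Λ.HasAngle D w' e (θ e)) :
    ∃ (r : ℝ) (c : Circle), c • range Λ.j = range Λ.j ∧
      ∀ z ∈ D.surface, w' z = ((w z).1 + r, c • (w z).2) := by
  obtain ⟨z₁, hz₁⟩ := D.bdry_nonempty
  obtain ⟨a, ha, hja⟩ := hw.boundary z₁ hz₁
  obtain ⟨a', ha', hja'⟩ := hw'.boundary z₁ hz₁
  have : Nonempty L := ⟨a⟩
  obtain ⟨G, s, ζ, h⟩ := hu.isCornerMap.exists_isModel F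
  obtain ⟨-, r, c, hc⟩ := hw.eq_twisted_model hJ hu.isCornerMap h (fun z _ => image_subset_range _ _) hθ
  obtain ⟨-, r', c', hc'⟩ :=
    hw'.eq_twisted_model hJ hu.isCornerMap h (fun z _ => image_subset_range _ _) hθ'
  have hww : ∀ z ∈ D.surface, w' z = ((w z).1 + (r' - r), (c' * c⁻¹) • (w z).2) := by
    intro z hz
    rw [hc z hz, hc' z hz]
    refine Prod.ext ?_ ?_
    · simp only
      ring
    · simp only [mul_smul, inv_smul_smul]
  refine ⟨r' - r, c' * c⁻¹, hh.smul_range (hh.deck (ha.trans ha'.symm) ?_), hww⟩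
  rw [hja, hja', hww z₁ (D.bdry_subset_surface hz₁)]

lemma IsCornerDisk.angleChange (hJ : F.IsCylindrical J) {β : ℂ → P}
    (hu : Λ.IsCornerDisk D u β) {w : ℂ → ℝ × Z}
    (hw : Λ.IsLift D J u (fun z => Λ.j '' (Λ.q ⁻¹' {β z})) w) {θ : E → ℝ}
    (hθ : ∀ e, Λ.HasAngle D w e (θ e)) : F.AngleChange D u θ := by
  obtain ⟨z₁, hz₁⟩ := D.bdry_nonempty
  obtain ⟨a, -⟩ := hw.boundary z₁ hz₁
  have : Nonempty L := ⟨a⟩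
  obtain ⟨G, s, ζ, h⟩ := hu.isCornerMap.exists_isModel F
  exact (hw.eq_twisted_model hJ hu.isCornerMap h (fun z _ => image_subset_range _ _) hθ).1

/-- The classification of lifts of a disk with corners, for any description of the boundary condition
and of the angles. -/
theorem IsCornerDisk.angleMapBijective (hJ : F.IsCylindrical J) (hh : Λ.IsHomogeneous) {β : ℂ → P}
    (hu : Λ.IsCornerDisk D u β) {B : ℂ → Set Z} {A : Set (E → ℝ)}
    (hB : ∀ z ∈ D.bdry, ∀ x, F.p x = u z → (x ∈ B z ↔ x ∈ Λ.j '' (Λ.q ⁻¹' {β z})))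
    (hA : ∀ θ, F.AngleChange D u θ → (θ ∈ A ↔ Λ.JoinsBranches D β θ))
    (hA' : ∀ θ ∈ A, F.AngleChange D u θ) : Λ.AngleMapBijective D J u B A := by
  have hlift : ∀ w, Λ.IsLift D J u B w ↔ Λ.IsLift D J u (fun z => Λ.j '' (Λ.q ⁻¹' {β z})) w := fun w =>
    ⟨fun h => ⟨h.continuous, h.smooth, h.holomorphic, h.lifts, fun z hz =>
      (hB z hz _ (h.lifts z (D.bdry_subset_surface hz))).1 (h.boundary z hz), h.asymptotic⟩,
    fun h => ⟨h.continuous, h.smooth, h.holomorphic, h.lifts, fun z hz =>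
      (hB z hz _ (h.lifts z (D.bdry_subset_surface hz))).2 (h.boundary z hz), h.asymptotic⟩⟩
  refine angleMapBijective_of (fun w θ hw hθ => ?_) (fun w w' θ hw hw' hθ hθ' => ?_) fun θ hθ => ?_
  · rw [hlift] at hw
    exact (hA θ (hu.angleChange hJ hw hθ)).2 (hw.joinsBranches hθ)
  · rw [hlift] at hw hw'
    exact hu.exists_scalar hJ hh hw hw' hθ hθ'
  · obtain ⟨w, hw, hwθ⟩ := hu.exists_isLift hJ hh ((hA θ (hA' θ hθ)).1 hθ) (hA' θ hθ)
    exact ⟨w, (hlift w).2 hw, hwθ⟩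

/-! ### Embedded projections -/

/-- If the fibers of an embedded projection have as many points as there are rotations between them,
every such rotation preserves the Legendrian. -/
lemma deck_of_pow_eq_one {k : ℕ} (hk : 0 < k)
    (hchord : ∀ (a b : L) (θ : ℝ), Λ.IsReebChord a b θ → ∃ m : ℕ, θ = m * (2 * Real.pi / k))
    (hφ : Function.Injective Λ.φ)
    (hcard : ∀ y ∈ range Λ.φ, (F.p ⁻¹' {y} ∩ range Λ.j).ncard = k) {c : Circle} (hc : c ^ k = 1) :
    Λ.Deck c := by
  intro b
  have hroots : ((fun d : Circle => (d : ℂ)) '' {d : Circle | d ^ k = 1}) ⊆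
      ((Polynomial.nthRoots k (1 : ℂ)).toFinset : Set ℂ) := by
    rintro _ ⟨d, hd, rfl⟩
    have hd' : (d : ℂ) ^ k = 1 := by
      have := congrArg (fun d : Circle => (d : ℂ)) (show d ^ k = 1 from hd)
      simpa using this
    simpa [Polynomial.mem_nthRoots hk] using hd'
  have hfin : {d : Circle | d ^ k = 1}.Finite :=
    Set.Finite.of_finite_image ((Finset.finite_toSet _).subset hroots) Circle.coe_injective.injOn
  have hle : {d : Circle | d ^ k = 1}.ncard ≤ k := by
    rw [← Set.ncard_image_of_injective {d : Circle | d ^ k = 1} Circle.coe_injective]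
    refine (Set.ncard_le_ncard hroots (Finset.finite_toSet _)).trans ?_
    rw [Set.ncard_coe_finset]
    exact (Multiset.toFinset_card_le _).trans (Polynomial.card_nthRoots k 1)
  have hsub : F.p ⁻¹' {Λ.φ (Λ.q b)} ∩ range Λ.j ⊆ (fun d : Circle => d • Λ.j b) '' {d | d ^ k = 1} := by
    rintro _ ⟨hp, b', rfl⟩
    obtain ⟨d, hd⟩ := (F.p_fiber (Λ.j b) (Λ.j b')).1 ((Λ.proj_eq b).symm.trans (Eq.symm hp))
    exact ⟨d, Λ.pow_eq_one_of_smul_eq hk hchord hd, hd⟩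
  have heq := Set.eq_of_subset_of_ncard_le hsub
    (by rw [hcard _ (mem_range_self _)]; exact (Set.ncard_image_le hfin).trans hle) (hfin.image _)
  have hmem : c • Λ.j b ∈ F.p ⁻¹' {Λ.φ (Λ.q b)} ∩ range Λ.j := heq ▸ ⟨c, hc, rfl⟩
  obtain ⟨b', hb'⟩ := hmem.2
  refine ⟨b', hφ ?_, hb'.symm⟩
  rw [Λ.proj_eq b', hb', F.p_smul, Λ.proj_eq b]

/-- A disk which is smooth up to the boundary has bounded derivative near the punctures. -/
lemma IsDisk.exists_decay (hu : Λ.IsDisk u) (e : E) : ∃ C δ r : ℝ, 0 < δ ∧ 0 < r ∧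
    ∀ z ∈ Metric.ball (0 : ℂ) 1, ‖z - D.pt e‖ < r →
      ‖fderiv ℝ (fun w : ℂ => extChartAt 𝓘(ℝ, EY) (u (D.pt e)) (u w)) z‖
        ≤ C * ‖z - D.pt e‖ ^ (δ - 1) := by
  let D₀ : Punctures Empty := ⟨Empty.elim, fun e => e.elim, fun e => e.elim, Empty.elim⟩
  have hD₀ : D₀.surface = closedBall 0 1 := by
    rw [Punctures.surface, range_eq_empty, sdiff_empty]
  have hu₀ : CircleFibered.IsCornerMap EY D₀ u :=
    ⟨hu.smooth.continuousOn, hD₀ ▸ hu.smooth, fun e => e.elim⟩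
  obtain ⟨C, ρ, hρ, hC⟩ := hu₀.exists_norm_fderiv_le (z₀ := D.pt e)
    (hD₀ ▸ sphere_subset_closedBall (D.mem_sphere e))
  refine ⟨C, 1, ρ, one_pos, hρ, fun z hz hzr => ?_⟩
  rw [sub_self, Real.rpow_zero, mul_one]
  exact hC z ⟨hz, by rwa [mem_ball, dist_eq_norm]⟩

/-- A disk with boundary on an embedded projection has a boundary lift, which is continuous also at
the punctures. -/
lemma IsDisk.exists_isCornerDisk [CompactSpace L] (hu : Λ.IsDisk u) (hφ : Function.Injective Λ.φ)
    (D : Punctures E) : ∃ β : ℂ → P, Λ.IsCornerDisk D u β ∧ ContinuousOn β (sphere 0 1) ∧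
      ∀ z ∈ sphere (0 : ℂ) 1, Λ.φ (β z) = u z := by
  have : CompactSpace P := Λ.q_surjective.compactSpace Λ.q_smooth.continuous
  have hemb : IsEmbedding Λ.φ :=
    (Λ.φ_immersion.contMDiff.continuous.isClosedEmbedding hφ).isEmbedding
  have : Nonempty P := by
    obtain ⟨x, -⟩ := hu.boundary 1 (by simp)
    exact ⟨x⟩
  have hb : ∀ z ∈ sphere (0 : ℂ) 1, Λ.φ (Function.invFun Λ.φ (u z)) = u z := fun z hz =>
    Function.invFun_eq (hu.boundary z hz)
  have hc : ContinuousOn (fun z => Function.invFun Λ.φ (u z)) (sphere 0 1) := by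
    rw [hemb.continuousOn_iff]
    exact (hu.smooth.continuousOn.mono sphere_subset_closedBall).congr hb
  exact ⟨_, ⟨hu.smooth.continuousOn, hu.smooth.mono sdiff_subset, hu.holomorphic,
    hc.mono sdiff_subset, fun z hz => hb z hz.1, fun e => hu.exists_decay e⟩, hc, hb⟩

/-- The classification of lifts of a disk with boundary on an embedded projection. -/
theorem IsDisk.angleMapBijective [CompactSpace L] (hJ : F.IsCylindrical J) {k : ℕ} (hk : 0 < k)
    (hchord : ∀ (a b : L) (θ : ℝ), Λ.IsReebChord a b θ → ∃ m : ℕ, θ = m * (2 * Real.pi / k))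
    (hφ : Function.Injective Λ.φ)
    (hcard : ∀ y ∈ range Λ.φ, (F.p ⁻¹' {y} ∩ range Λ.j).ncard = k) (hu : Λ.IsDisk u) :
    Λ.AngleMapBijective D J u (fun _ => range Λ.j)
      {θ | (∀ e, ∃ m : ℕ, 0 < m ∧ θ e = m * (2 * Real.pi / k)) ∧ F.AngleChange D u θ} := by
  have hdeck : ∀ {c : Circle}, c ^ k = 1 → Λ.Deck c := fun hc => deck_of_pow_eq_one hk hchord hφ hcard hc
  obtain ⟨β, hβ, hβc, hβu⟩ := hu.exists_isCornerDisk hφ D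
  refine hβ.angleMapBijective hJ
    (fun c a a' _ hc => hdeck (Λ.pow_eq_one_of_smul_eq hk hchord hc))
    (fun z hz x hx => ⟨?_, fun h => image_subset_range _ _ h⟩) (fun θ hA => ⟨fun h e => ?_, fun h => ?_⟩)
    fun θ h => h.2
  · rintro ⟨a, rfl⟩
    refine ⟨a, hφ ?_, rfl⟩
    rw [Λ.proj_eq, hx, hβu z hz.1]
  · obtain ⟨m, hm, hθ⟩ := h.1 e
    have hk' : (0 : ℝ) < k := Nat.cast_pos.2 hk
    have hm' : (0 : ℝ) < m := Nat.cast_pos.2 hm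
    obtain ⟨a, ha⟩ := Λ.q_surjective (β (D.pt e))
    have hpow : Circle.exp (θ e) ^ k = 1 := by
      rw [← Circle.exp_nsmul, nsmul_eq_mul, hθ, ← Circle.exp_zero, Circle.exp_eq_exp]
      exact ⟨m, by rw [Int.cast_natCast, zero_add]; field_simp⟩
    obtain ⟨b, hqb, hb⟩ := hdeck hpow a
    have hlim : ∀ t : ℝ, t = 0 ∨ t = 1 →
        Tendsto (fun τ : ℝ => β (D.stripEnd e (τ, t))) atTop (𝓝 (Λ.q a)) := by
      intro t ht
      rw [ha]
      have ht' : t ∈ Icc (0 : ℝ) 1 := by rcases ht with rfl | rfl <;> simp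
      refine (hβc _ (D.mem_sphere e)).tendsto.comp (tendsto_nhdsWithin_iff.2
        ⟨(D.tendsto_stripEnd_nhds e).comp (Punctures.tendsto_prodMk_const ht'), ?_⟩)
      filter_upwards [D.eventually_stripEnd_mem_bdry e ht] with τ hτ
      exact hτ.1
    refine ⟨a, b, ⟨by rw [hθ]; positivity, hb⟩, hlim _ (by split_ifs <;> simp), ?_⟩
    rw [← hqb]
    exact hlim _ (by split_ifs <;> simp)
  · refine ⟨fun e => ?_, hA⟩
    obtain ⟨a, b, hab, -⟩ := h e
    obtain ⟨m, hm⟩ := hchord a b _ hab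
    refine ⟨m, Nat.pos_of_ne_zero fun h0 => ?_, hm⟩
    have := hab.1
    rw [hm, h0, Nat.cast_zero, zero_mul] at this
    exact lt_irrefl _ this

end LegendrianOver

end Classification

end

end CircleLift

end

theorem mainTheorem4 {EY Y EZ Z EL L P E : Type*}
    [NormedAddCommGroup EY] [NormedSpace ℝ EY] [FiniteDimensional ℝ EY]
    [TopologicalSpace Y] [T2Space Y] [ChartedSpace EY Y] [IsManifold 𝓘(ℝ, EY) ∞ Y]
    [NormedAddCommGroup EZ] [NormedSpace ℝ EZ] [FiniteDimensional ℝ EZ]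
    [TopologicalSpace Z] [T2Space Z] [ChartedSpace EZ Z] [IsManifold 𝓘(ℝ, EZ) ∞ Z]
    [MulAction Circle Z]
    [NormedAddCommGroup EL] [NormedSpace ℝ EL] [FiniteDimensional ℝ EL]
    [TopologicalSpace L] [CompactSpace L] [ChartedSpace EL L] [IsManifold 𝓘(ℝ, EL) ∞ L]
    [TopologicalSpace P] [T2Space P] [ChartedSpace EL P] [IsManifold 𝓘(ℝ, EL) ∞ P]
    [Fintype E]
    (F : CircleLift.CircleFibered EY Y EZ Z)
    (J : ∀ x : ℝ × Z, TangentSpace (𝓘(ℝ, ℝ).prod 𝓘(ℝ, EZ)) x →L[ℝ]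
      TangentSpace (𝓘(ℝ, ℝ).prod 𝓘(ℝ, EZ)) x)
    (hJ : F.IsCylindrical J)
    (Λ : CircleLift.LegendrianOver EL L P F)
    (k : ℕ) (hk : 0 < k)
    (hchord : ∀ (a b : L) (θ : ℝ), Λ.IsReebChord a b θ → ∃ m : ℕ, θ = m * (2 * Real.pi / k))
    (D : CircleLift.Punctures E) :
    (Function.Injective Λ.φ →
      (∀ y ∈ range Λ.φ, (F.p ⁻¹' {y} ∩ range Λ.j).ncard = k) →
      ∀ uY : ℂ → Y, Λ.IsDisk uY →
        Λ.AngleMapBijective D J uY (fun _ => range Λ.j)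
          {θ | (∀ e, ∃ m : ℕ, 0 < m ∧ θ e = m * (2 * Real.pi / k)) ∧ F.AngleChange D uY θ}) ∧
    (Λ.IsHomogeneous →
      ∀ (uY : ℂ → Y) (β : ℂ → P), Λ.IsCornerDisk D uY β →
        Λ.AngleMapBijective D J uY (fun z => Λ.j '' (Λ.q ⁻¹' {β z}))
          {θ | Λ.JoinsBranches D β θ ∧ F.AngleChange D uY θ}) := by
  refine ⟨fun hφ hcard uY hu => hu.angleMapBijective hJ hk hchord hφ hcard,
    fun hh uY β hu => hu.angleMapBijective hJ hh (fun _ _ _ _ => Iff.rfl)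
      (fun θ hA => ⟨fun h => h.1, fun h => ⟨h, hA⟩⟩) fun θ h => h.2⟩
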